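/- **Proposition 4.1.** Let $\lambda\in\mathbb R\setminus\{0\}$, $N(u)=\lambda|u|u$, $\square=\partial_t^2-\Delta$ on $\mathbb R\times\mathbb R^2$, $\langle\mu\rangle=(1+|\mu|^2)^{1/2}$, and $\hat\phi(\xi)=(2\pi)^{-1}\int_{\mathbb R^2}e^{-ix\cdot\xi}\phi(x)\,dx$. Let $Y$ be the space of pairs $(\phi_0,\phi_1)\in\mathcal S'(\mathbb R^2)\times\mathcal S'(\mathbb R^2)$ of complex-valued tempered distributions with $$\|(\phi_0,\phi_1)\|_Y:=\|\phi_0\|_{H^2}+\|x\phi_0\|_{H^3}+\||x|^2\phi_0\|_{H^4}+\|\phi_1\|_{H^1}+\|x\phi_1\|_{H^2}+\||x|^2\phi_1\|_{H^3}<\infty ,$$ where $\|x\phi\|_{H^s}=\|x_1\phi\|_{H^s}+\|x_2\phi\|_{H^s}$. For $(\phi_0,\phi_1)\in Y$ put $$P_1(\mu)=-\langle\mu\rangle^2\operatorname{Im}\hat\phi_0(\mu)-\langle\mu\rangle\operatorname{Re}\hat\phi_1(\mu),\qquad Q_1(\mu)=\langle\mu\rangle^2\operatorname{Re}\hat\phi_0(\mu)-\langle\mu\rangle\operatorname{Im}\hat\phi_1(\mu),$$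 $$\Psi(\mu)=-\frac{4\lambda}{3\pi}\langle\mu\rangle\left|\hat\phi_0(\mu)+i\langle\mu\rangle^{-1}\hat\phi_1(\mu)\right| ,$$ and let $\beta(\mu)\in(0,2\pi]$ satisfy $P_1=\sqrt{P_1^2+Q_1^2}\cos\beta$, $Q_1=\sqrt{P_1^2+Q_1^2}\sin\beta$. For odd $n\ge3$ put $$P_n=\frac{8\sin(\frac n2\pi)}{\pi n(n^2-1)(n^2-4)}\lambda(P_1^2+Q_1^2)\cos(n\beta),\qquad Q_n=\frac{8\sin(\frac n2\pi)}{\pi n(n^2-1)(n^2-4)}\lambda(P_1^2+Q_1^2)\sin(n\beta),$$ and $P_n=Q_n=0$ for even $n\ge2$. For $t>0$ and $|x|<t$ let $\mu=x/\sqrt{t^2-|x|^2}$, $\alpha=\langle\mu\rangle^{-1}t+\Psi(\mu)\log t$ and $$u_{\rm ap}(t,x)=t^{-1}\bigl(P_1(\mu)\cos\alpha+Q_1(\mu)\sin\alpha\bigr),\qquad v_{\rm ap}(t,x)=t^{-2}\sum_{n=2}^\infty\bigl(P_n(\mu)\cos(n\alpha)+Q_n(\mu)\sin(n\alpha)\bigr),$$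 and let $u_{\rm ap}=v_{\rm ap}=0$ for $|x|\ge t$. Let $A=u_{\rm ap}+v_{\rm ap}$. Then there is a constant $C>0$, depending only on $\lambda$, such that for all $(\phi_0,\phi_1)\in Y$ and all $t\ge e$ $$\|A(t)\|_{L^\infty_x}\le Ct^{-1}\|(\phi_0,\phi_1)\|_Y\bigl(1+\|(\phi_0,\phi_1)\|_Y\bigr),$$ $$\|(\square+1)A(t)-N(A(t))\|_{L^2_x}\le Ct^{-2}(\log t)^2\|(\phi_0,\phi_1)\|_Y\bigl(1+\|(\phi_0,\phi_1)\|_Y^3\bigr).$$ Here $(\square+1)A(t)$ is taken in the sense of distributions: for every $\psi\in C_c^\infty(\mathbb R^2)$ the function $s\mapsto\int A(s,x)\psi(x)\,dx$ is twice differentiable at $t$, $(\square+1)A(t)$ is the distribution $\psi\mapsto\frac{d^2}{dt^2}\int A(t)\psi\,dx-\int A(t)\Delta\psi\,dx+\int A(t)\psi\,dx$, and it is part of the claim that this distribution is a locally integrable function. -/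

import Mathlib

open MeasureTheory Filter Topology
open scoped ENNReal SchwartzMap FourierTransform ContDiff Laplacian

noncomputable section

namespace NLKG

/-- The plane `ℝ²` with its Euclidean norm. -/
abbrev Plane : Type := EuclideanSpace ℝ (Fin 2)

/-! ### Sobolev norms and the space of final states -/

/-- The norm `‖u‖_{H^s} = ‖(1 - Δ)^{s/2} u‖_{L²}` of a tempered distribution; it is `∞` when
`(1 - Δ)^{s/2} u` is not in `L²`. (Mathlib's frequency variable is `ξ` with `e^{-2πi x·ξ}`, so the
symbol of `1 - Δ` is `1 + (2π|ξ|)²`. At most one `g` competes in the infimum.) -/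
def sobolevNorm (s : ℝ) (u : 𝓢'(Plane, ℂ)) : ℝ≥0∞ :=
  ⨅ (g : Lp ℂ 2 (volume : Measure Plane))
    (_ : TemperedDistribution.fourierMultiplierCLM ℂ
      (fun ξ : Plane ↦ (((1 + (2 * Real.pi * ‖ξ‖) ^ 2) ^ (s / 2) : ℝ) : ℂ)) u = g), ‖g‖ₑ

/-- The product `x_j u`. -/
def mulCoord (j : Fin 2) (u : 𝓢'(Plane, ℂ)) : 𝓢'(Plane, ℂ) :=
  TemperedDistribution.smulLeftCLM ℂ (fun x : Plane ↦ ((x j : ℝ) : ℂ)) u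

/-- The product `|x|² u`. -/
def mulNormSq (u : 𝓢'(Plane, ℂ)) : 𝓢'(Plane, ℂ) :=
  TemperedDistribution.smulLeftCLM ℂ (fun x : Plane ↦ ((‖x‖ ^ 2 : ℝ) : ℂ)) u

/-- The (extended) norm of the space `Y` of final states. The norm of the vector `x u` is the sum
of the norms of its two components. -/
def normY (φ₀ φ₁ : 𝓢'(Plane, ℂ)) : ℝ≥0∞ :=
  sobolevNorm 2 φ₀ + ∑ j, sobolevNorm 3 (mulCoord j φ₀) + sobolevNorm 4 (mulNormSq φ₀)
    + (sobolevNorm 1 φ₁ + ∑ j, sobolevNorm 2 (mulCoord j φ₁) + sobolevNorm 3 (mulNormSq φ₁))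

/-- Membership in `Y`. -/
def MemY (φ₀ φ₁ : 𝓢'(Plane, ℂ)) : Prop := normY φ₀ φ₁ < (⊤ : ℝ≥0∞)

/-! ### The Fourier transform as a function -/

open Classical in
/-- The `L²` function (unique almost everywhere) that represents `T`, if there is one. -/
def toFunction (T : 𝓢'(Plane, ℂ)) : Plane → ℂ :=
  if h : ∃ g : Lp ℂ 2 (volume : Measure Plane), T = g then h.choose else 0

/-- `φ̂(ξ) = (2π)⁻¹ ∫ e^{-i x·ξ} φ(x) dx`, as a function. -/
def hat (φ : 𝓢'(Plane, ℂ)) (ξ : Plane) : ℂ :=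
  ((2 * Real.pi : ℝ) : ℂ)⁻¹ * toFunction (𝓕 φ) ((2 * Real.pi)⁻¹ • ξ)

/-! ### The approximate solution -/

/-- The bracket `⟨μ⟩ = (1 + |μ|²)^{1/2}`. -/
def bracket (μ : Plane) : ℝ := Real.sqrt (1 + ‖μ‖ ^ 2)

/-- `μ = x / √(t² - |x|²)`, used for `|x| < t` only. -/
def mu (t : ℝ) (x : Plane) : Plane := (Real.sqrt (t ^ 2 - ‖x‖ ^ 2))⁻¹ • x

/-- `P₁ = -⟨μ⟩² Im φ̂₀ - ⟨μ⟩ Re φ̂₁`. -/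
def P₁ (φ₀ φ₁ : 𝓢'(Plane, ℂ)) (μ : Plane) : ℝ :=
  -(bracket μ ^ 2 * (hat φ₀ μ).im) - bracket μ * (hat φ₁ μ).re

/-- `Q₁ = ⟨μ⟩² Re φ̂₀ - ⟨μ⟩ Im φ̂₁`. -/
def Q₁ (φ₀ φ₁ : 𝓢'(Plane, ℂ)) (μ : Plane) : ℝ :=
  bracket μ ^ 2 * (hat φ₀ μ).re - bracket μ * (hat φ₁ μ).im

/-- The phase correction `Ψ = -(4λ/(3π)) ⟨μ⟩ |φ̂₀ + i⟨μ⟩⁻¹ φ̂₁|`. -/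
def Psi (lam : ℝ) (φ₀ φ₁ : 𝓢'(Plane, ℂ)) (μ : Plane) : ℝ :=
  -(4 * lam / (3 * Real.pi)) * bracket μ *
    ‖hat φ₀ μ + Complex.I * ((bracket μ : ℝ) : ℂ)⁻¹ * hat φ₁ μ‖

/-- The phase `α = ⟨μ⟩⁻¹ t + Ψ(μ) log t`. -/
def alpha (lam : ℝ) (φ₀ φ₁ : 𝓢'(Plane, ℂ)) (t : ℝ) (μ : Plane) : ℝ :=
  (bracket μ)⁻¹ * t + Psi lam φ₀ φ₁ μ * Real.log t

/-- The angle `β ∈ (0, 2π]` with `√(P₁² + Q₁²) (cos β, sin β) = (P₁, Q₁)`. Its value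
where `P₁ = Q₁ = 0` is never used. -/
def beta (φ₀ φ₁ : 𝓢'(Plane, ℂ)) (μ : Plane) : ℝ :=
  toIocMod Real.two_pi_pos 0 (Complex.arg ⟨P₁ φ₀ φ₁ μ, Q₁ φ₀ φ₁ μ⟩)

/-- The number `8 sin(nπ/2) / (π n (n² - 1)(n² - 4))` for odd `n`, and `0` for even `n`
(it is used for `n ≥ 2` only). -/
def coeff (n : ℕ) : ℝ :=
  if Odd n then
    8 * Real.sin (n / 2 * Real.pi) /
      (Real.pi * n * ((n : ℝ) ^ 2 - 1) * ((n : ℝ) ^ 2 - 4))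
  else 0

/-- The amplitudes `P_n`, for `n ≥ 2`. -/
def P (lam : ℝ) (φ₀ φ₁ : 𝓢'(Plane, ℂ)) (n : ℕ) (μ : Plane) : ℝ :=
  coeff n * lam * (P₁ φ₀ φ₁ μ ^ 2 + Q₁ φ₀ φ₁ μ ^ 2) * Real.cos (n * beta φ₀ φ₁ μ)

/-- The amplitudes `Q_n`, for `n ≥ 2`. -/
def Q (lam : ℝ) (φ₀ φ₁ : 𝓢'(Plane, ℂ)) (n : ℕ) (μ : Plane) : ℝ :=
  coeff n * lam * (P₁ φ₀ φ₁ μ ^ 2 + Q₁ φ₀ φ₁ μ ^ 2) * Real.sin (n * beta φ₀ φ₁ μ)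

/-- The first approximation `u_ap`. -/
def uap (lam : ℝ) (φ₀ φ₁ : 𝓢'(Plane, ℂ)) (t : ℝ) : Plane → ℝ :=
  (Metric.ball 0 t).indicator fun x ↦
    t⁻¹ * P₁ φ₀ φ₁ (mu t x) * Real.cos (alpha lam φ₀ φ₁ t (mu t x))
      + t⁻¹ * Q₁ φ₀ φ₁ (mu t x) * Real.sin (alpha lam φ₀ φ₁ t (mu t x))

/-- The second approximation `v_ap`; the sums run over all integers `k + 2 ≥ 2`. -/
def vap (lam : ℝ) (φ₀ φ₁ : 𝓢'(Plane, ℂ)) (t : ℝ) : Plane → ℝ :=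
  (Metric.ball 0 t).indicator fun x ↦
    (t ^ 2)⁻¹ * (∑' k : ℕ, P lam φ₀ φ₁ (k + 2) (mu t x) *
        Real.cos ((k + 2 : ℕ) * alpha lam φ₀ φ₁ t (mu t x)))
      + (t ^ 2)⁻¹ * (∑' k : ℕ, Q lam φ₀ φ₁ (k + 2) (mu t x) *
        Real.sin ((k + 2 : ℕ) * alpha lam φ₀ φ₁ t (mu t x)))

/-- The approximate solution `A = u_ap + v_ap`. -/
def approx (lam : ℝ) (φ₀ φ₁ : 𝓢'(Plane, ℂ)) (t : ℝ) (x : Plane) : ℝ :=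
  uap lam φ₀ φ₁ t x + vap lam φ₀ φ₁ t x

/-! ### The equation -/

/-- The nonlinearity `N(u) = λ|u|u`. -/
def nonlin (lam u : ℝ) : ℝ := lam * |u| * u

/-- The locally integrable function `G` on `ℝ²` is `(□ + 1)A` at time `t`, where
`□ = ∂_t² - Δ`, in the sense of distributions: `s ↦ A(s)` is twice differentiable at `t` as a map
with values in the distributions on `ℝ²` (tested on each `ψ ∈ C_c^∞(ℝ²)`), and
`∂_t² A(t) - ΔA(t) + A(t) = G`. -/
def IsKleinGordonAt (A : ℝ → Plane → ℝ) (t : ℝ) (G : Plane → ℝ) : Prop :=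
  (∀ᶠ s in 𝓝 t, LocallyIntegrable (A s) volume) ∧ LocallyIntegrable G volume ∧
    ∀ ψ : Plane → ℝ, ContDiff ℝ (∞ : ℕ∞ω) ψ → HasCompactSupport ψ →
      ∃ D : ℝ → ℝ, ∃ D₂ : ℝ,
        (∀ᶠ s in 𝓝 t, HasDerivAt (fun τ ↦ ∫ x, A τ x * ψ x) (D s) s) ∧
        HasDerivAt D D₂ t ∧
        D₂ - (∫ x, A t x * (Δ ψ) x) + (∫ x, A t x * ψ x) = ∫ x, G x * ψ x

end NLKG

end

open MeasureTheory Filter Topology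
open scoped ENNReal SchwartzMap FourierTransform ContDiff Laplacian

noncomputable section

namespace NLKG


/-! Write `Z = P₁ + iQ₁` (`amp`), `m = ⟨μ⟩` and `c = -4λ/(3π)`. Since `|Z| = m² |φ̂₀ + i m⁻¹ φ̂₁|`,
the phase is `α = t/m + c (|Z|/m) log t`, and `A` is the real part of `t⁻¹ Z e^{-iα} + λ t⁻² |Z|²
k(Z e^{-iα}/|Z|)` with `k(z) = ∑ c_n zⁿ`, where `c_n` is `coeff n` (`approx_eq`).

In the coordinates `ρ = √(t² - |x|²)`, `μ = x/ρ`, where `t = ρm`, the wave operator is `∂_ρ² +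
(2/ρ)∂_ρ - ρ⁻² Δ_H`, with `Δ_H` the Laplacian of the hyperbolic plane (`box_comp_hyp`). In the
radial part plus the identity, all terms of order `t⁻¹` cancel. At order `t⁻²` the logarithmic
correction of the phase leaves `-2c |Z| Z e^{-iα}`, and the second approximation leaves its `n`-th
harmonic multiplied by `1 - n²` (`radial_identity`). The coefficients are made so that the sum is
the Fourier series of `|cos| cos`: the harmonic `n = 1`, with coefficient `8/(3π)`, cannot come from
a term with the factor `1 - n²` and is produced by the phase; the others are produced by `c_n`
(`two_mul_absCosCoeff`, `re_kk_sub_kk`). Hence the terms of order `t⁻²` give exactly `N(u_ap)`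
(`re_lead`). Passing from `N(u_ap)` to `N(A)` costs `O(t⁻³)` pointwise on a disc of area `πt²`,
which is `O(t⁻²)` in `L²` (`l2Bd_nonlin_sub`).

The remaining error is `m² t⁻³ (log t)²` times a polynomial in `|Z|`, `m|∇Z|`, `m²|D²Z|`: the factor
`m² t⁻²` is `ρ⁻²`, and each of the two derivatives in `Δ_H` can bring down one logarithm from the
phase (`norm_box_prof_sub_lead_le`). The map `μ ↦ x = tμ/m` has Jacobian `t² m⁻⁴`, so the `L²` norm
in `x` is `t⁻² (log t)²` times the unweighted `L²` norm of that polynomial in `μ`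
(`l2Bd_spread_errFun`). The norm of `Y` turns into weighted second order bounds for `Z`, and in
dimension two these give `Z ∈ L^∞`, `m∇Z ∈ L⁴` and `m²D²Z ∈ L²` (`exists_amp_approx`,
`WBd.exists_bounds`), which is what the polynomial requires.

The difficulty is regularity: `|Z|` need not be differentiable at zeros of `Z`, the argument of `k`
lies on the boundary of its disc of convergence, and `Z` has only two weak derivatives. The
pointwise calculus is therefore done for smooth compactly supported approximations of `Z` and for
the modulus `√(|Z|² + ε²)`, which keeps the argument of `k` in the open disc; the bounds contain no
negative power of `ε`. The limit is taken in the weak formulation. The substitution `x = sy` freezes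
`μ`, so the time derivatives of `∫ A ψ` exist and converge without any smoothness of `Z`
(`hasDerivAt_pairing`, `tendsto_weakBox`). The limiting error is a functional bounded in `L²`, hence
a function by the Riesz theorem (`exists_density`, `exists_error_density`). -/

/-! ### Square integrable functions on the plane with a bound for their norm -/

/-- `f` is square integrable with `‖f‖_{L²} ≤ M`. -/
def L2Bd {F : Type*} [NormedAddCommGroup F] (f : Plane → F) (M : ℝ) : Prop :=
  0 ≤ M ∧ AEStronglyMeasurable f volume ∧ eLpNorm f 2 volume ≤ ENNReal.ofReal M

namespace L2Bd

variable {F G : Type*} [NormedAddCommGroup F] [NormedAddCommGroup G]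

theorem memLp {f : Plane → F} {M : ℝ} (h : L2Bd f M) : MemLp f 2 volume :=
  ⟨h.2.1, h.2.2.trans_lt ENNReal.ofReal_lt_top⟩

theorem add {f g : Plane → F} {M N : ℝ} (hf : L2Bd f M) (hg : L2Bd g N) :
    L2Bd (fun x ↦ f x + g x) (M + N) := by
  refine ⟨add_nonneg hf.1 hg.1, hf.2.1.add hg.2.1, ?_⟩
  rw [ENNReal.ofReal_add hf.1 hg.1]
  exact (eLpNorm_add_le hf.2.1 hg.2.1 (by norm_num)).trans (add_le_add hf.2.2 hg.2.2)

theorem mono_ae {f : Plane → F} {g : Plane → G} {M : ℝ} (hg : L2Bd g M)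
    (hf : AEStronglyMeasurable f volume) (h : ∀ᵐ x, ‖f x‖ ≤ ‖g x‖) : L2Bd f M :=
  ⟨hg.1, hf, (eLpNorm_mono_ae h).trans hg.2.2⟩

theorem mono {f : Plane → F} {g : Plane → ℝ} {M : ℝ} (hg : L2Bd g M)
    (hf : AEStronglyMeasurable f volume) (h : ∀ x, ‖f x‖ ≤ g x) : L2Bd f M :=
  hg.mono_ae hf (ae_of_all _ fun x ↦ (h x).trans (le_abs_self _))

theorem le {f : Plane → F} {M N : ℝ} (hf : L2Bd f M) (h : M ≤ N) : L2Bd f N :=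
  ⟨hf.1.trans h, hf.2.1, hf.2.2.trans (ENNReal.ofReal_le_ofReal h)⟩

theorem norm {f : Plane → F} {M : ℝ} (hf : L2Bd f M) : L2Bd (fun x ↦ ‖f x‖) M :=
  ⟨hf.1, hf.2.1.norm, by rw [eLpNorm_norm]; exact hf.2.2⟩

theorem const_mul {f : Plane → ℝ} {M : ℝ} (hf : L2Bd f M) {c : ℝ} (hc : 0 ≤ c) :
    L2Bd (fun x ↦ c * f x) (c * M) := by
  refine ⟨mul_nonneg hc hf.1, hf.2.1.const_mul c, ?_⟩
  have := eLpNorm_const_smul (μ := (volume : Measure Plane)) c f 2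
  rw [ENNReal.ofReal_mul hc]
  calc eLpNorm (fun x ↦ c * f x) 2 volume = ‖c‖ₑ * eLpNorm f 2 volume := this
    _ ≤ _ := by
        gcongr
        · rw [Real.enorm_eq_ofReal hc]
        · exact hf.2.2

theorem congr_norm {f : Plane → F} {g : Plane → G} {M : ℝ} (hg : L2Bd g M)
    (hf : AEStronglyMeasurable f volume) (h : ∀ x, ‖f x‖ = ‖g x‖) : L2Bd f M :=
  hg.mono_ae hf (ae_of_all _ fun x ↦ (h x).le)

theorem of_sq_le {f : Plane → F} {M : ℝ} (hM : 0 ≤ M) (hf : AEStronglyMeasurable f volume)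
    (h : ∫⁻ x, ‖f x‖ₑ ^ 2 ≤ ENNReal.ofReal (M ^ 2)) : L2Bd f M := by
  refine ⟨hM, hf, ?_⟩
  have h2 : eLpNorm f 2 volume ^ 2 = ∫⁻ x, ‖f x‖ₑ ^ 2 := by
    have := eLpNorm_nnreal_pow_eq_lintegral (f := f) (μ := (volume : Measure Plane))
      (p := 2) (by norm_num)
    simpa using this
  rw [← h2, ENNReal.ofReal_pow hM] at h
  exact (ENNReal.pow_le_pow_left_iff (by norm_num)).1 h

theorem lintegral_sq_le {f : Plane → F} {M : ℝ} (h : L2Bd f M) :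
    ∫⁻ x, ‖f x‖ₑ ^ 2 ≤ ENNReal.ofReal (M ^ 2) := by
  have h2 : eLpNorm f 2 volume ^ 2 = ∫⁻ x, ‖f x‖ₑ ^ 2 := by
    have := eLpNorm_nnreal_pow_eq_lintegral (f := f) (μ := (volume : Measure Plane))
      (p := 2) (by norm_num)
    simpa using this
  rw [← h2, ENNReal.ofReal_pow h.1]
  exact pow_le_pow_left₀ (by positivity) h.2.2 2

end L2Bd

/-! ### Inequalities for Schwartz functions, by the Fourier transform -/

theorem eLpNorm_fourier (f : 𝓢(Plane, ℂ)) :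
    eLpNorm (𝓕 f : 𝓢(Plane, ℂ)) 2 volume = eLpNorm f 2 volume := by
  have h1 := SchwartzMap.norm_fourier_toL2_eq f
  have h2 : eLpNorm (𝓕 f : 𝓢(Plane, ℂ)) 2 volume ≠ ⊤ :=
    (SchwartzMap.eLpNorm_lt_top (𝓕 f) 2 volume).ne
  have h3 : eLpNorm f 2 volume ≠ ⊤ := (SchwartzMap.eLpNorm_lt_top f 2 volume).ne
  rw [SchwartzMap.norm_toLp, SchwartzMap.norm_toLp] at h1
  rw [← ENNReal.ofReal_toReal h2, ← ENNReal.ofReal_toReal h3, h1]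

theorem L2Bd.fourier {f : 𝓢(Plane, ℂ)} {M : ℝ} (h : L2Bd f M) :
    L2Bd (𝓕 f : 𝓢(Plane, ℂ)) M :=
  ⟨h.1, (𝓕 f : 𝓢(Plane, ℂ)).continuous.aestronglyMeasurable, (eLpNorm_fourier f).trans_le h.2.2⟩

theorem L2Bd.of_fourier {f : 𝓢(Plane, ℂ)} {M : ℝ} (h : L2Bd (𝓕 f : 𝓢(Plane, ℂ)) M) :
    L2Bd f M :=
  ⟨h.1, f.continuous.aestronglyMeasurable, (eLpNorm_fourier f).symm.trans_le h.2.2⟩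

open LineDeriv in
theorem fourier_lineDeriv_apply (f : 𝓢(Plane, ℂ)) (v ξ : Plane) :
    𝓕 (∂_{v} f) ξ = (2 * Real.pi * Complex.I) * ((inner ℝ ξ v : ℝ) : ℂ) * 𝓕 f ξ := by
  rw [SchwartzMap.fourier_lineDerivOp_eq]
  rw [smul_apply, SchwartzMap.smulLeftCLM_apply_apply (by fun_prop)]
  simp [mul_assoc]

theorem fourier_laplacian_apply (f : 𝓢(Plane, ℂ)) (ξ : Plane) :
    𝓕 (Δ f) ξ = -(2 * Real.pi * ‖ξ‖) ^ 2 * 𝓕 f ξ := by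
  rw [SchwartzMap.laplacian_eq_sum (EuclideanSpace.basisFun (Fin 2) ℝ)]
  simp only [Fin.sum_univ_two, FourierTransform.fourier_add, add_apply,
    fourier_lineDeriv_apply]
  have h := EuclideanSpace.real_norm_sq_eq ξ
  have h' : ((‖ξ‖ : ℝ) : ℂ) ^ 2 = (ξ 0 : ℂ) ^ 2 + (ξ 1 : ℂ) ^ 2 := by
    rw [← Complex.ofReal_pow, h]; simp [Fin.sum_univ_two]
  rw [mul_pow, h']
  simp only [EuclideanSpace.basisFun_apply,
    EuclideanSpace.inner_single_right]
  simp
  ring_nf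
  simp
  ring

-- By Plancherel it suffices to compare symbols: `(2π)² |ξ·v| |ξ·w| ≤ (2π|ξ|)²`. This is how the
-- full Hessian is recovered from the Laplacian in `L²`.
open LineDeriv in
theorem L2Bd.lineDeriv_lineDeriv {f : 𝓢(Plane, ℂ)} {M : ℝ} (h : L2Bd (Δ f : 𝓢(Plane, ℂ)) M) {v w : Plane}
    (hv : ‖v‖ ≤ 1) (hw : ‖w‖ ≤ 1) : L2Bd (∂_{v} (∂_{w} f) : 𝓢(Plane, ℂ)) M := by
  apply L2Bd.of_fourier
  refine h.fourier.mono_ae (SchwartzMap.continuous _).aestronglyMeasurable (ae_of_all _ fun ξ ↦ ?_)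
  rw [fourier_laplacian_apply, fourier_lineDeriv_apply, fourier_lineDeriv_apply]
  have h1 : |inner ℝ ξ v| ≤ ‖ξ‖ := (abs_real_inner_le_norm _ _).trans
    (mul_le_of_le_one_right (norm_nonneg _) hv)
  have h2 : |inner ℝ ξ w| ≤ ‖ξ‖ := (abs_real_inner_le_norm _ _).trans
    (mul_le_of_le_one_right (norm_nonneg _) hw)
  simp only [norm_mul, norm_neg, norm_pow, Complex.norm_real, Complex.norm_I, Real.norm_eq_abs,
    abs_norm, Complex.norm_ofNat, abs_of_pos Real.pi_pos]
  have : |inner ℝ ξ v| * |inner ℝ ξ w| ≤ ‖ξ‖ * ‖ξ‖ := by gcongr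
  calc _ = (2 * Real.pi) ^ 2 * (|inner ℝ ξ v| * |inner ℝ ξ w|) * ‖𝓕 f ξ‖ := by ring
    _ ≤ (2 * Real.pi) ^ 2 * (‖ξ‖ * ‖ξ‖) * ‖𝓕 f ξ‖ := by gcongr
    _ = _ := by ring

/-- The embedding of `H²` into `L^∞` in dimension two: Fourier inversion bounds `|f|` by the `L¹`
norm of the transform, and Cauchy-Schwarz applies because `(1 + |ξ|²)⁻¹` is square integrable on the
plane. -/
theorem exists_sup_bound : ∃ C : ℝ, 0 ≤ C ∧ ∀ (f : 𝓢(Plane, ℂ)) (M N : ℝ), L2Bd f M →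
    L2Bd (Δ f : 𝓢(Plane, ℂ)) N → ∀ x, ‖f x‖ ≤ C * (M + N) := by
  have hk : MemLp (fun x : Plane ↦ (1 + ‖x‖ ^ 2)⁻¹) 2 volume := by
    have hc : Continuous (fun x : Plane ↦ (1 + ‖x‖ ^ 2)⁻¹) :=
      Continuous.inv₀ (by fun_prop) (fun x ↦ by positivity)
    rw [memLp_two_iff_integrable_sq hc.aestronglyMeasurable]
    have := integrable_rpow_neg_one_add_norm_sq (E := Plane) (μ := volume) (r := 4)
      (by simp; norm_num)
    refine this.congr (ae_of_all _ fun x ↦ ?_)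
    have h0 : (0 : ℝ) < 1 + ‖x‖ ^ 2 := by positivity
    simp only
    rw [show (-4 / 2 : ℝ) = -((2 : ℕ) : ℝ) by norm_num, Real.rpow_neg h0.le, Real.rpow_natCast,
      inv_pow]
  refine ⟨(eLpNorm (fun x : Plane ↦ (1 + ‖x‖ ^ 2)⁻¹) 2 volume).toReal, ENNReal.toReal_nonneg,
    fun f M N hM hN x ↦ ?_⟩
  have h1 : L2Bd (fun ξ ↦ ‖𝓕 f ξ‖ + ‖𝓕 (Δ f) ξ‖) (M + N) := hM.fourier.norm.add hN.fourier.norm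
  have h2 : ‖f x‖ ≤ ∫ ξ, ‖𝓕 f ξ‖ := by
    have : f x = 𝓕⁻ (𝓕 f) x := by rw [FourierTransform.fourierInv_fourier_eq]
    rw [this, SchwartzMap.fourierInv_coe, Real.fourierInv_eq]
    refine (norm_integral_le_integral_norm _).trans ?_
    simp
  have h3 : ∀ ξ : Plane, ‖𝓕 f ξ‖ ≤ ‖(1 + ‖ξ‖ ^ 2)⁻¹ • (‖𝓕 f ξ‖ + ‖𝓕 (Δ f) ξ‖)‖ := by
    intro ξ
    rw [fourier_laplacian_apply]
    have h0 : (0 : ℝ) < 1 + ‖ξ‖ ^ 2 := by positivity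
    rw [Real.norm_eq_abs, abs_of_nonneg (by positivity), smul_eq_mul, inv_mul_eq_div,
      le_div_iff₀ h0]
    simp only [norm_mul, norm_neg, norm_pow, Complex.norm_real, Real.norm_eq_abs,
      abs_norm, Complex.norm_ofNat, abs_of_pos Real.pi_pos]
    have : ‖ξ‖ ^ 2 ≤ (2 * Real.pi * ‖ξ‖) ^ 2 := by
      gcongr
      nlinarith [Real.pi_gt_three, norm_nonneg ξ]
    nlinarith [norm_nonneg (𝓕 f ξ)]
  have h4 : eLpNorm (𝓕 f : 𝓢(Plane, ℂ)) 1 volume ≤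
      eLpNorm (fun x : Plane ↦ (1 + ‖x‖ ^ 2)⁻¹) 2 volume * ENNReal.ofReal (M + N) := by
    refine (eLpNorm_mono h3).trans ?_
    refine (eLpNorm_smul_le_mul_eLpNorm (p := 2) (q := 2) h1.2.1 hk.1).trans ?_
    gcongr
    exact h1.2.2
  rw [eLpNorm_one_eq_lintegral_enorm] at h4
  refine h2.trans ?_
  rw [integral_norm_eq_lintegral_enorm (SchwartzMap.continuous _).aestronglyMeasurable]
  refine (ENNReal.toReal_mono (ENNReal.mul_ne_top hk.2.ne ENNReal.ofReal_ne_top) h4).trans ?_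
  rw [ENNReal.toReal_mul, ENNReal.toReal_ofReal h1.1]

/-! ### Derivatives in coordinates -/

/-- The standard unit vectors of the plane. -/
abbrev unitVec (j : Fin 2) : Plane := EuclideanSpace.single j (1 : ℝ)

theorem norm_unitVec (j : Fin 2) : ‖unitVec j‖ = 1 := by simp [unitVec]

/-- The Laplacian as a trace of the second derivative. -/
def lapl {F : Type*} [NormedAddCommGroup F] [NormedSpace ℝ F] (f : Plane → F) (x : Plane) : F :=
  ∑ j, fderiv ℝ (fderiv ℝ f) x (unitVec j) (unitVec j)

section

variable {F : Type*} [NormedAddCommGroup F] [NormedSpace ℝ F]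

/-- The operator norm of the first derivative. -/
def norm1 (f : Plane → F) (x : Plane) : ℝ := ‖fderiv ℝ f x‖

/-- The operator norm of the second derivative. -/
def norm2 (f : Plane → F) (x : Plane) : ℝ := ‖fderiv ℝ (fderiv ℝ f) x‖

theorem norm1_nonneg (f : Plane → F) (x : Plane) : 0 ≤ norm1 f x := norm_nonneg _

theorem norm2_nonneg (f : Plane → F) (x : Plane) : 0 ≤ norm2 f x :=
  norm_nonneg (fderiv ℝ (fderiv ℝ f) x)

theorem norm_fderiv_apply_le (f : Plane → F) (x v : Plane) :
    ‖fderiv ℝ f x v‖ ≤ norm1 f x * ‖v‖ := (fderiv ℝ f x).le_opNorm v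

theorem norm_fderiv_fderiv_apply_le (f : Plane → F) (x v w : Plane) :
    ‖fderiv ℝ (fderiv ℝ f) x v w‖ ≤ norm2 f x * ‖v‖ * ‖w‖ := (fderiv ℝ (fderiv ℝ f) x).le_opNorm₂ v w

theorem norm1_le {f : Plane → F} {x : Plane} {C : ℝ} (hC : 0 ≤ C)
    (h : ∀ v, ‖fderiv ℝ f x v‖ ≤ C * ‖v‖) : norm1 f x ≤ C :=
  ContinuousLinearMap.opNorm_le_bound _ hC h

theorem norm2_le {f : Plane → F} {x : Plane} {C : ℝ} (hC : 0 ≤ C)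
    (h : ∀ v w, ‖fderiv ℝ (fderiv ℝ f) x v w‖ ≤ C * ‖v‖ * ‖w‖) : norm2 f x ≤ C :=
  ContinuousLinearMap.opNorm_le_bound₂ _ hC h

theorem continuous_norm1 {f : Plane → F} (hf : ContDiff ℝ 1 f) : Continuous (norm1 f) :=
  (hf.continuous_fderiv (by simp)).norm

theorem continuous_norm2 {f : Plane → F} (hf : ContDiff ℝ 2 f) : Continuous (norm2 f) := by
  have h1 : ContDiff ℝ 1 (fderiv ℝ f) := hf.fderiv_right (by norm_num)
  exact (h1.continuous_fderiv (by simp)).norm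

end

theorem plane_eq_sum (v : Plane) : v = v 0 • unitVec 0 + v 1 • unitVec 1 := by
  ext i; fin_cases i <;> simp [unitVec]

theorem abs_apply_le_norm (v : Plane) (j : Fin 2) : |v j| ≤ ‖v‖ := by
  have := PiLp.norm_apply_le v j
  simpa using this

theorem opNorm_le_sum {F : Type*} [NormedAddCommGroup F] [NormedSpace ℝ F] (T : Plane →L[ℝ] F) :
    ‖T‖ ≤ ‖T (unitVec 0)‖ + ‖T (unitVec 1)‖ := by
  refine T.opNorm_le_bound (by positivity) fun v ↦ ?_
  conv_lhs => rw [plane_eq_sum v]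
  rw [map_add, map_smul, map_smul, add_mul]
  refine (norm_add_le _ _).trans ?_
  rw [norm_smul, norm_smul, mul_comm, mul_comm ‖v 1‖]
  gcongr <;> exact abs_apply_le_norm _ _

theorem lapl_eq_laplacian {F : Type*} [NormedAddCommGroup F] [NormedSpace ℝ F] (f : Plane → F) :
    lapl f = Δ f := by
  rw [InnerProductSpace.laplacian_eq_iteratedFDeriv_orthonormalBasis f
    (EuclideanSpace.basisFun (Fin 2) ℝ)]
  ext x
  simp [lapl, iteratedFDeriv_two_apply, unitVec]

theorem two_le_infty : (2 : ℕ∞ω) ≤ (∞ : ℕ∞ω) := by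
  exact WithTop.coe_le_coe.2 (le_top : (2 : ℕ∞) ≤ ⊤)

theorem fderiv_fderiv_apply {E F : Type*} [NormedAddCommGroup E] [NormedSpace ℝ E]
    [NormedAddCommGroup F] [NormedSpace ℝ F] {f : E → F} {x : E}
    (hf : ContDiffAt ℝ 2 f x) (w : E) :
    HasFDerivAt (fun y ↦ fderiv ℝ f y w) ((fderiv ℝ (fderiv ℝ f) x).flip w) x := by
  have h : DifferentiableAt ℝ (fderiv ℝ f) x :=
    (hf.fderiv_right (m := 1) (by norm_num)).differentiableAt (by norm_num)
  have h1 := h.hasFDerivAt.clm_apply (hasFDerivAt_const w x)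
  convert h1 using 1
  ext z
  simp

theorem fderiv_smul_apply {g : Plane → ℝ} {f : Plane → ℂ} (hg : ContDiff ℝ ∞ g)
    (hf : ContDiff ℝ ∞ f) (x v : Plane) :
    fderiv ℝ (fun y ↦ g y • f y) x v = g x • fderiv ℝ f x v + fderiv ℝ g x v • f x := by
  rw [fderiv_fun_smul (hg.differentiable (by simp) x) (hf.differentiable (by simp) x)]
  simp

theorem fderiv_fderiv_smul_apply {g : Plane → ℝ} {f : Plane → ℂ} (hg : ContDiff ℝ ∞ g)
    (hf : ContDiff ℝ ∞ f) (x v w : Plane) :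
    fderiv ℝ (fderiv ℝ (fun y ↦ g y • f y)) x v w =
      g x • fderiv ℝ (fderiv ℝ f) x v w + fderiv ℝ g x v • fderiv ℝ f x w
        + fderiv ℝ g x w • fderiv ℝ f x v + fderiv ℝ (fderiv ℝ g) x v w • f x := by
  have hg2 : ContDiffAt ℝ 2 g x := (hg.of_le two_le_infty).contDiffAt
  have hf2 : ContDiffAt ℝ 2 f x := (hf.of_le two_le_infty).contDiffAt
  have hgf2 : ContDiffAt ℝ 2 (fun y ↦ g y • f y) x := hg2.smul hf2
  have h1 := (fderiv_fderiv_apply hgf2 w).fderiv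
  have h2 := ((hg.differentiable (by simp) x).hasFDerivAt.smul (fderiv_fderiv_apply hf2 w)).add
    ((fderiv_fderiv_apply hg2 w).smul (hf.differentiable (by simp) x).hasFDerivAt)
  have h3 : (fun y ↦ fderiv ℝ (fun y ↦ g y • f y) y w) =
      (fun y ↦ g y • fderiv ℝ f y w) + fun y ↦ fderiv ℝ g y w • f y := by
    funext y; exact fderiv_smul_apply hg hf y w
  have h4 := congrArg (fun T : Plane →L[ℝ] ℂ ↦ T v) (h1.symm.trans (h3 ▸ h2.fderiv))
  simp only [ContinuousLinearMap.flip_apply, add_apply, smul_apply,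
    ContinuousLinearMap.smulRight_apply] at h4
  rw [h4]
  abel

/-- Leibniz rule `Δ(gf) = gΔf + 2∇g·∇f + fΔg`. The 4 is the factor 2 of the cross term times the two
coordinate directions; the 2 bounds the trace of the Hessian of `g` by its operator norm. -/
theorem norm_lapl_smul_le {g : Plane → ℝ} {f : Plane → ℂ} (hg : ContDiff ℝ ∞ g)
    (hf : ContDiff ℝ ∞ f) (x : Plane) :
    ‖lapl (fun y ↦ g y • f y) x‖ ≤ |g x| * ‖lapl f x‖ + 4 * (norm1 g x * norm1 f x)
      + 2 * (norm2 g x * ‖f x‖) := by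
  have h : lapl (fun y ↦ g y • f y) x = g x • lapl f x +
      ∑ j, (2 • (fderiv ℝ g x (unitVec j) • fderiv ℝ f x (unitVec j))) + lapl g x • f x := by
    simp only [lapl, fderiv_fderiv_smul_apply hg hf, Fin.sum_univ_two, smul_add, add_smul, two_smul]
    abel
  have h1 : ∀ j, ‖(2 • (fderiv ℝ g x (unitVec j) • fderiv ℝ f x (unitVec j)) : ℂ)‖ ≤
      2 * (norm1 g x * norm1 f x) := by
    intro j
    refine (norm_nsmul_le).trans ?_
    rw [norm_smul]
    push_cast
    gcongr
    · exact norm1_nonneg _ _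
    · simpa [norm_unitVec] using norm_fderiv_apply_le g x (unitVec j)
    · simpa [norm_unitVec] using norm_fderiv_apply_le f x (unitVec j)
  have h2 : ‖lapl g x‖ ≤ 2 * norm2 g x := by
    refine (norm_sum_le _ _).trans ?_
    rw [Fin.sum_univ_two, two_mul]
    gcongr
    · simpa [norm_unitVec] using norm_fderiv_fderiv_apply_le g x (unitVec 0) (unitVec 0)
    · simpa [norm_unitVec] using norm_fderiv_fderiv_apply_le g x (unitVec 1) (unitVec 1)
  rw [h]
  refine (norm_add_le _ _).trans (add_le_add ((norm_add_le _ _).trans (add_le_add ?_ ?_)) ?_)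
  · rw [norm_smul, Real.norm_eq_abs]
  · refine (norm_sum_le _ _).trans ?_
    rw [Fin.sum_univ_two]
    linarith [h1 0, h1 1]
  · rw [norm_smul, ← mul_assoc]
    gcongr

/-! ### Weighted inequalities for test functions -/

theorem continuous_lapl {F : Type*} [NormedAddCommGroup F] [NormedSpace ℝ F] {f : Plane → F}
    (hf : ContDiff ℝ ∞ f) : Continuous (lapl f) := by
  have h1 : ContDiff ℝ 1 (fderiv ℝ f) := hf.fderiv_right (by norm_cast)
  have h2 : Continuous (fderiv ℝ (fderiv ℝ f)) := h1.continuous_fderiv (by simp)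
  unfold lapl
  fun_prop

theorem coe_laplacian_toSchwartzMap {f : Plane → ℂ} (hf : ContDiff ℝ ∞ f)
    (hs : HasCompactSupport f) : ⇑(Δ (hs.toSchwartzMap hf) : 𝓢(Plane, ℂ)) = lapl f := by
  ext x
  rw [SchwartzMap.laplacian_apply, lapl_eq_laplacian]
  rfl

-- The operator norm of the Hessian is at most the sum of its four entries, each of which is
-- controlled by the Laplacian in `L²`.
open LineDeriv in
theorem L2Bd.fderiv_fderiv {f : Plane → ℂ} (hf : ContDiff ℝ ∞ f) (hs : HasCompactSupport f)
    {M : ℝ} (h : L2Bd (lapl f) M) : L2Bd (norm2 f) (4 * M) := by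
  have h0 : ∀ i j, L2Bd (fun x ↦ ‖fderiv ℝ (fderiv ℝ f) x (unitVec i) (unitVec j)‖) M := by
    intro i j
    rw [← coe_laplacian_toSchwartzMap hf hs] at h
    have h1 := h.lineDeriv_lineDeriv (v := unitVec i) (w := unitVec j) (norm_unitVec i).le
      (norm_unitVec j).le
    have h2 : (⇑(∂_{unitVec j} (hs.toSchwartzMap hf) : 𝓢(Plane, ℂ)) : Plane → ℂ) =
        fun y ↦ fderiv ℝ f y (unitVec j) := by
      ext y; rw [SchwartzMap.lineDerivOp_apply_eq_fderiv]; rfl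
    have h3 : (⇑(∂_{unitVec i} (∂_{unitVec j} (hs.toSchwartzMap hf)) : 𝓢(Plane, ℂ)) : Plane → ℂ) =
        fun x ↦ fderiv ℝ (fderiv ℝ f) x (unitVec i) (unitVec j) := by
      ext x
      rw [SchwartzMap.lineDerivOp_apply_eq_fderiv, h2, (fderiv_fderiv_apply
        (hf.of_le two_le_infty).contDiffAt (unitVec j)).fderiv]
      rfl
    rw [h3] at h1
    exact h1.norm
  refine ((((h0 0 0).add (h0 0 1)).add (h0 1 0)).add (h0 1 1)).le (by linarith) |>.mono
    (continuous_norm2 (hf.of_le two_le_infty)).aestronglyMeasurable fun x ↦ ?_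
  rw [Real.norm_eq_abs, abs_of_nonneg (norm2_nonneg _ _)]
  refine (opNorm_le_sum _).trans ?_
  linarith [opNorm_le_sum (fderiv ℝ (fderiv ℝ f) x (unitVec 0)),
    opNorm_le_sum (fderiv ℝ (fderiv ℝ f) x (unitVec 1))]

/-- Ladyzhenskaya's inequality. The Sobolev inequality from `W^{1,1}` to `L²` in the plane is
applied to `|f|²`, whose gradient is at most `2|f||∇f|` and hence in `L¹` by Cauchy-Schwarz. -/
theorem exists_L2Bd_sq : ∃ C : ℝ, 0 ≤ C ∧ ∀ (f : Plane → ℂ) (M N : ℝ), ContDiff ℝ 1 f →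
    HasCompactSupport f → L2Bd f M → L2Bd (fderiv ℝ f) N →
      L2Bd (fun x ↦ ‖f x‖ ^ 2) (C * (M * N)) := by
  have hp : NNReal.HolderConjugate (Module.finrank ℝ Plane) 2 := by
    rw [finrank_euclideanSpace_fin]
    exact_mod_cast NNReal.HolderConjugate.two_two
  refine ⟨2 * eLpNormLESNormFDerivOneConst (volume : Measure Plane) ((2 : NNReal) : ℝ),
    by positivity, fun f M N hf hs hM hN ↦ ⟨?_, ?_, ?_⟩⟩
  · have := hM.1; have := hN.1; positivity
  · exact (hf.continuous.norm.pow 2).aestronglyMeasurable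
  · have h1 := eLpNorm_le_eLpNorm_fderiv_one (μ := (volume : Measure Plane))
      (u := fun x ↦ ‖f x‖ ^ 2) (hf.norm_sq ℝ) (by
        have := hs.norm.comp_left (g := fun y : ℝ ↦ y ^ 2) (by simp)
        exact this) hp
    have h2 : ∀ x, ‖fderiv ℝ (fun x ↦ ‖f x‖ ^ 2) x‖ ≤ ‖(2 * ‖f x‖) • fderiv ℝ f x‖ := by
      intro x
      have hd := ((hf.differentiable (by simp) x).hasFDerivAt.norm_sq).fderiv
      rw [hd, norm_smul (2 * ‖f x‖)]
      refine ContinuousLinearMap.opNorm_le_bound _ (by positivity) fun v ↦ ?_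
      simp only [smul_apply, ContinuousLinearMap.comp_apply, innerSL_apply_apply, nsmul_eq_mul,
        norm_mul, Real.norm_eq_abs]
      have h3 : |inner ℝ (f x) (fderiv ℝ f x v)| ≤ ‖f x‖ * (‖fderiv ℝ f x‖ * ‖v‖) :=
        (abs_real_inner_le_norm _ _).trans (by gcongr; exact (fderiv ℝ f x).le_opNorm v)
      simp only [abs_norm, Nat.cast_ofNat, Nat.abs_ofNat]
      nlinarith
    have h4 : eLpNorm (fun x ↦ (2 * ‖f x‖) • fderiv ℝ f x) 1 volume ≤
        ENNReal.ofReal (2 * M) * ENNReal.ofReal N := by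
      have hM2 := hM.norm.const_mul (c := 2) (by norm_num)
      refine (eLpNorm_smul_le_mul_eLpNorm (p := 2) (q := 2) hN.2.1 hM2.2.1).trans ?_
      exact mul_le_mul' hM2.2.2 hN.2.2
    refine h1.trans ((mul_le_mul_right ((eLpNorm_mono h2).trans h4) _).trans ?_)
    rw [← ENNReal.ofReal_mul (by linarith [hM.1]), ENNReal.ofReal, ENNReal.ofReal,
      ← ENNReal.coe_mul, ENNReal.coe_le_coe, ← NNReal.coe_le_coe]
    have := hM.1; have := hN.1
    rw [NNReal.coe_mul, Real.coe_toNNReal _ (by positivity), Real.coe_toNNReal _ (by positivity)]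
    apply le_of_eq; ring

/-! ### The weight `⟨x⟩` -/

theorem one_le_bracket (x : Plane) : 1 ≤ bracket x := by
  rw [bracket, Real.one_le_sqrt]; nlinarith [norm_nonneg x]

theorem bracket_pos (x : Plane) : 0 < bracket x := one_pos.trans_le (one_le_bracket x)

theorem bracket_sq (x : Plane) : bracket x ^ 2 = 1 + ‖x‖ ^ 2 := Real.sq_sqrt (by positivity)

theorem norm_le_bracket (x : Plane) : ‖x‖ ≤ bracket x := by
  apply Real.le_sqrt_of_sq_le; linarith

theorem contDiff_bracket : ContDiff ℝ ∞ bracket := by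
  unfold bracket
  exact (contDiff_const.add (contDiff_norm_sq ℝ)).sqrt (fun x ↦ by positivity)

/-- The inner product of the plane as a bilinear map. -/
def innerL : Plane →L[ℝ] Plane →L[ℝ] ℝ := innerSL ℝ

theorem innerL_apply (v w : Plane) : innerL v w = inner ℝ v w := rfl

theorem norm_innerL_apply (v : Plane) : ‖innerL v‖ = ‖v‖ := innerSL_apply_norm ℝ v

theorem norm_innerL_le : ‖innerL‖ ≤ 1 :=
  ContinuousLinearMap.opNorm_le_bound _ zero_le_one fun v ↦ by rw [norm_innerL_apply, one_mul]

theorem norm_smul_clm {E F : Type*} [NormedAddCommGroup E] [NormedSpace ℝ E]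
    [NormedAddCommGroup F] [NormedSpace ℝ F] (c : ℝ) (T : E →L[ℝ] F) : ‖c • T‖ = |c| * ‖T‖ :=
  norm_smul c T

theorem hasFDerivAt_bracket (x : Plane) :
    HasFDerivAt bracket ((bracket x)⁻¹ • innerL x) x := by
  have h := ((hasStrictFDerivAt_norm_sq x).hasFDerivAt.const_add 1).sqrt
    (by positivity : (1 : ℝ) + ‖x‖ ^ 2 ≠ 0)
  have e : (1 / (2 * √(1 + ‖x‖ ^ 2))) • (2 • innerSL ℝ x) = (bracket x)⁻¹ • innerL x := by
    ext v
    simp [bracket, innerL_apply]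
    ring_nf
  rw [← e]
  exact h

theorem fderiv_bracket : fderiv ℝ bracket = fun x ↦ (bracket x)⁻¹ • innerL x :=
  funext fun x ↦ (hasFDerivAt_bracket x).fderiv

theorem norm1_bracket_le (x : Plane) : norm1 bracket x ≤ 1 := by
  refine norm1_le zero_le_one fun v ↦ ?_
  rw [fderiv_bracket, smul_apply, innerL_apply, norm_smul, norm_inv, Real.norm_eq_abs,
    abs_of_pos (bracket_pos x), inv_mul_le_iff₀ (bracket_pos x), one_mul]
  exact (norm_inner_le_norm _ _).trans (by gcongr; exact norm_le_bracket x)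

theorem fderiv_fderiv_bracket_apply (x v w : Plane) : fderiv ℝ (fderiv ℝ bracket) x v w =
    (bracket x)⁻¹ * inner ℝ v w - (bracket x ^ 3)⁻¹ * inner ℝ x v * inner ℝ x w := by
  have hb := bracket_pos x
  have h1 : HasFDerivAt (fun y ↦ (bracket y)⁻¹)
      (-(bracket x ^ 2)⁻¹ • ((bracket x)⁻¹ • innerL x)) x :=
    (hasDerivAt_inv hb.ne').comp_hasFDerivAt x (hasFDerivAt_bracket x)
  have h2 : HasFDerivAt (fun y : Plane ↦ innerL y w) (innerL.flip w) x := by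
    have := (innerL.flip w).hasFDerivAt (x := x)
    exact this
  have h3 := fderiv_fderiv_apply (contDiff_bracket.of_le two_le_infty).contDiffAt w (x := x)
  have h4 := h1.mul h2
  have h5 : (fun y ↦ fderiv ℝ bracket y w) = (fun y ↦ (bracket y)⁻¹) * fun y ↦ innerL y w := by
    funext y; rw [fderiv_bracket]; rfl
  rw [h5] at h3
  have h6 := congrArg (fun T : Plane →L[ℝ] ℝ ↦ T v) (h3.unique h4)
  simp only [ContinuousLinearMap.flip_apply, add_apply, smul_apply, innerL_apply,
    smul_eq_mul] at h6
  rw [h6]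
  field_simp
  ring

theorem norm2_bracket_le (x : Plane) : bracket x * norm2 bracket x ≤ 2 := by
  have hb := bracket_pos x
  rw [← le_div_iff₀' hb]
  refine norm2_le (by positivity) fun v w ↦ ?_
  rw [fderiv_fderiv_bracket_apply]
  have h1 : |inner ℝ v w| ≤ ‖v‖ * ‖w‖ := abs_real_inner_le_norm _ _
  have h2 : |inner ℝ x v| ≤ bracket x * ‖v‖ :=
    (abs_real_inner_le_norm _ _).trans (by gcongr; exact norm_le_bracket x)
  have h3 : |inner ℝ x w| ≤ bracket x * ‖w‖ :=
    (abs_real_inner_le_norm _ _).trans (by gcongr; exact norm_le_bracket x)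
  refine (abs_sub _ _).trans ?_
  rw [abs_mul, abs_mul, abs_mul, abs_of_pos (inv_pos.2 hb), abs_of_pos (inv_pos.2 (pow_pos hb 3))]
  calc _ ≤ (bracket x)⁻¹ * (‖v‖ * ‖w‖)
        + (bracket x ^ 3)⁻¹ * (bracket x * ‖v‖) * (bracket x * ‖w‖) := by gcongr
    _ = 2 / bracket x * ‖v‖ * ‖w‖ := by field_simp; norm_num

/-! ### Weighted second order bounds -/

/-- The weighted second order Sobolev norms of the Fourier variables. -/
structure WBd (q : ℕ) (f : Plane → ℂ) (M : ℝ) : Prop where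
  zero : L2Bd (fun x ↦ bracket x ^ q * ‖f x‖) M
  one : L2Bd (fun x ↦ bracket x ^ (q + 1) * norm1 f x) M
  two : L2Bd (fun x ↦ bracket x ^ (q + 2) * ‖lapl f x‖) M

theorem WBd.le {q : ℕ} {f : Plane → ℂ} {M N : ℝ} (h : WBd q f M) (hMN : M ≤ N) : WBd q f N :=
  ⟨h.zero.le hMN, h.one.le hMN, h.two.le hMN⟩

/-- `g` and its first two derivatives are bounded by `A ⟨x⟩^p`, `A ⟨x⟩^{p-1}`, `A ⟨x⟩^{p-2}`. -/
structure IsWeight (p : ℕ) (g : Plane → ℝ) (A : ℝ) : Prop where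
  contDiff : ContDiff ℝ ∞ g
  zero : ∀ x, |g x| ≤ A * bracket x ^ p
  one : ∀ x, bracket x * norm1 g x ≤ A * bracket x ^ p
  two : ∀ x, bracket x ^ 2 * norm2 g x ≤ A * bracket x ^ p

theorem norm1_smul_le {g : Plane → ℝ} {f : Plane → ℂ} (hg : ContDiff ℝ ∞ g)
    (hf : ContDiff ℝ ∞ f) (x : Plane) :
    norm1 (fun y ↦ g y • f y) x ≤ |g x| * norm1 f x + norm1 g x * ‖f x‖ := by
  have h1 := norm1_nonneg f x
  have h2 := norm1_nonneg g x
  refine norm1_le (by positivity) fun v ↦ ?_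
  rw [fderiv_smul_apply hg hf]
  refine (norm_add_le _ _).trans ?_
  rw [norm_smul, norm_smul, Real.norm_eq_abs]
  have h3 := mul_le_mul_of_nonneg_left (norm_fderiv_apply_le f x v) (abs_nonneg (g x))
  have h4 := mul_le_mul_of_nonneg_right (norm_fderiv_apply_le g x v) (norm_nonneg (f x))
  linarith

/-- A derivative that falls on the weight lowers its order by one, which matches the one extra power
of `⟨x⟩` that `WBd` attaches to each derivative. So every term of the Leibniz rule loses exactly `p`
powers. The 7 is `1 + 4 + 2`, from the rule for the Laplacian. -/
theorem WBd.smul {p q : ℕ} {f : Plane → ℂ} {g : Plane → ℝ} {M A : ℝ} (h : WBd (p + q) f M)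
    (hf : ContDiff ℝ ∞ f) (hA : 0 ≤ A) (hg : IsWeight p g A) :
    WBd q (fun x ↦ g x • f x) (7 * A * M) := by
  have hM := h.zero.1
  have hAM : 0 ≤ A * M := mul_nonneg hA hM
  have hgf : ContDiff ℝ ∞ (fun x ↦ g x • f x) := hg.contDiff.smul hf
  have hb := contDiff_bracket.continuous
  refine ⟨?_, ?_, ?_⟩
  · refine ((h.zero.const_mul hA).le (N := 7 * A * M) (by linarith)).mono
      ((hb.pow _).mul hgf.continuous.norm).aestronglyMeasurable fun x ↦ ?_
    have hx := bracket_pos x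
    rw [Real.norm_eq_abs, abs_of_nonneg (by positivity), norm_smul, Real.norm_eq_abs, pow_add]
    calc bracket x ^ q * (|g x| * ‖f x‖) ≤ bracket x ^ q * (A * bracket x ^ p * ‖f x‖) := by
          gcongr; exact hg.zero x
      _ = _ := by ring
  · refine (((h.one.const_mul hA).add (h.zero.const_mul hA)).le (N := 7 * A * M)
      (by linarith)).mono ((hb.pow _).mul (continuous_norm1 (hgf.of_le (by norm_cast)))).aestronglyMeasurable
      fun x ↦ ?_
    have hx := bracket_pos x
    have hn := norm1_nonneg f x
    rw [Real.norm_eq_abs, abs_of_nonneg (mul_nonneg (by positivity) (norm1_nonneg _ _))]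
    calc bracket x ^ (q + 1) * norm1 (fun x ↦ g x • f x) x
        ≤ bracket x ^ (q + 1) * (|g x| * norm1 f x + norm1 g x * ‖f x‖) := by
          gcongr; exact norm1_smul_le hg.contDiff hf x
      _ = bracket x ^ (q + 1) * |g x| * norm1 f x
          + bracket x ^ q * (bracket x * norm1 g x) * ‖f x‖ := by ring
      _ ≤ bracket x ^ (q + 1) * (A * bracket x ^ p) * norm1 f x
          + bracket x ^ q * (A * bracket x ^ p) * ‖f x‖ := by
          gcongr bracket x ^ (q + 1) * ?_ * _ + bracket x ^ q * ?_ * _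
          · exact hg.zero x
          · exact hg.one x
      _ = _ := by ring
  · refine ((((h.two.const_mul hA).add ((h.one.const_mul hA).const_mul (c := 4) (by norm_num))).add
      ((h.zero.const_mul hA).const_mul (c := 2) (by norm_num))).le (N := 7 * A * M)
      (by linarith)).mono ((hb.pow _).mul (continuous_lapl hgf).norm).aestronglyMeasurable
      fun x ↦ ?_
    have hx := bracket_pos x
    rw [Real.norm_eq_abs, abs_of_nonneg (by positivity)]
    have hn := norm1_nonneg f x
    calc bracket x ^ (q + 2) * ‖lapl (fun x ↦ g x • f x) x‖
        ≤ bracket x ^ (q + 2) * (|g x| * ‖lapl f x‖ + 4 * (norm1 g x * norm1 f x)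
          + 2 * (norm2 g x * ‖f x‖)) := by
          gcongr; exact norm_lapl_smul_le hg.contDiff hf x
      _ = bracket x ^ (q + 2) * |g x| * ‖lapl f x‖
          + 4 * (bracket x ^ (q + 1) * (bracket x * norm1 g x) * norm1 f x)
          + 2 * (bracket x ^ q * (bracket x ^ 2 * norm2 g x) * ‖f x‖) := by ring
      _ ≤ bracket x ^ (q + 2) * (A * bracket x ^ p) * ‖lapl f x‖
          + 4 * (bracket x ^ (q + 1) * (A * bracket x ^ p) * norm1 f x)
          + 2 * (bracket x ^ q * (A * bracket x ^ p) * ‖f x‖) := by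
          gcongr bracket x ^ (q + 2) * ?_ * _ + 4 * (bracket x ^ (q + 1) * ?_ * _)
            + 2 * (bracket x ^ q * ?_ * _)
          · exact hg.zero x
          · exact hg.one x
          · exact hg.two x
      _ = _ := by ring

theorem WBd.add {q : ℕ} {f g : Plane → ℂ} {M N : ℝ} (hf : WBd q f M) (hg : WBd q g N)
    (hfs : ContDiff ℝ ∞ f) (hgs : ContDiff ℝ ∞ g) : WBd q (fun x ↦ f x + g x) (M + N) := by
  have hb := contDiff_bracket.continuous
  have hs : ContDiff ℝ ∞ (fun x ↦ f x + g x) := hfs.add hgs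
  have h1 : fderiv ℝ (fun x ↦ f x + g x) = fun x ↦ fderiv ℝ f x + fderiv ℝ g x :=
    funext fun x ↦ fderiv_fun_add (hfs.differentiable (by simp) x) (hgs.differentiable (by simp) x)
  have hf1 : ContDiff ℝ 1 (fderiv ℝ f) := hfs.fderiv_right (by norm_cast)
  have hg1 : ContDiff ℝ 1 (fderiv ℝ g) := hgs.fderiv_right (by norm_cast)
  have h2 : lapl (fun x ↦ f x + g x) = fun x ↦ lapl f x + lapl g x := by
    funext x
    simp only [lapl, h1]
    rw [fderiv_fun_add (hf1.differentiable (by simp) x) (hg1.differentiable (by simp) x)]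
    simp [Fin.sum_univ_two]
    ring
  refine ⟨?_, ?_, ?_⟩
  · refine (hf.zero.add hg.zero).mono ((hb.pow _).mul hs.continuous.norm).aestronglyMeasurable
      fun x ↦ ?_
    have hx := bracket_pos x
    rw [Real.norm_eq_abs, abs_of_nonneg (by positivity), ← mul_add]
    gcongr; exact norm_add_le _ _
  · refine (hf.one.add hg.one).mono
      ((hb.pow _).mul (continuous_norm1 (hs.of_le (by norm_cast)))).aestronglyMeasurable fun x ↦ ?_
    have hx := bracket_pos x
    rw [Real.norm_eq_abs, abs_of_nonneg (mul_nonneg (by positivity) (norm1_nonneg _ _)), ← mul_add]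
    gcongr
    simp only [norm1, h1]
    exact norm_add_le _ _
  · refine (hf.two.add hg.two).mono
      ((hb.pow _).mul (continuous_lapl hs).norm).aestronglyMeasurable fun x ↦ ?_
    have hx := bracket_pos x
    rw [Real.norm_eq_abs, abs_of_nonneg (by positivity), ← mul_add, h2]
    gcongr; exact norm_add_le _ _

theorem WBd.const_mul {q : ℕ} {f : Plane → ℂ} {M : ℝ} (hf : WBd q f M) (hfs : ContDiff ℝ ∞ f)
    (c : ℂ) : WBd q (fun x ↦ c * f x) (‖c‖ * M) := by
  have hb := contDiff_bracket.continuous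
  have hs : ContDiff ℝ ∞ (fun x ↦ c * f x) := contDiff_const.mul hfs
  have h1 : fderiv ℝ (fun x ↦ c * f x) = fun x ↦ c • fderiv ℝ f x :=
    funext fun x ↦ fderiv_const_mul (hfs.differentiable (by simp) x) c
  have hf1 : ContDiff ℝ 1 (fderiv ℝ f) := hfs.fderiv_right (by norm_cast)
  have h2 : lapl (fun x ↦ c * f x) = fun x ↦ c * lapl f x := by
    funext x
    simp only [lapl, h1]
    rw [fderiv_fun_const_smul (hf1.differentiable (by simp) x)]
    simp [Fin.sum_univ_two]
    ring
  refine ⟨?_, ?_, ?_⟩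
  · refine (hf.zero.const_mul (norm_nonneg c)).congr_norm
      ((hb.pow _).mul hs.continuous.norm).aestronglyMeasurable fun x ↦ ?_
    simp only [norm_mul, norm_norm]; ring
  · refine (hf.one.const_mul (norm_nonneg c)).congr_norm
      ((hb.pow _).mul (continuous_norm1 (hs.of_le (by norm_cast)))).aestronglyMeasurable fun x ↦ ?_
    simp only [norm1, h1, norm_mul, norm_norm, norm_smul]; ring
  · refine (hf.two.const_mul (norm_nonneg c)).congr_norm
      ((hb.pow _).mul (continuous_lapl hs).norm).aestronglyMeasurable fun x ↦ ?_
    rw [h2]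
    simp only [norm_mul, norm_norm]; ring

theorem isWeight_bracket : IsWeight 1 bracket 2 where
  contDiff := contDiff_bracket
  zero x := by rw [abs_of_pos (bracket_pos x)]; linarith [bracket_pos x]
  one x := by nlinarith [bracket_pos x, norm1_bracket_le x, norm1_nonneg bracket x]
  two x := by
    have := mul_le_mul_of_nonneg_left (norm2_bracket_le x) (bracket_pos x).le
    linarith

theorem fderiv_bracket_sq :
    fderiv ℝ (fun x ↦ bracket x ^ 2) = fun x ↦ ((2 : ℝ) • innerL) x := by
  funext x
  have h : (fun x ↦ bracket x ^ 2) = fun x : Plane ↦ 1 + ‖x‖ ^ 2 := funext bracket_sq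
  rw [h, ((hasStrictFDerivAt_norm_sq x).hasFDerivAt.const_add 1).fderiv]
  ext v
  simp [innerL_apply]

theorem isWeight_bracket_sq : IsWeight 2 (fun x ↦ bracket x ^ 2) 2 where
  contDiff := contDiff_bracket.pow 2
  zero x := by
    rw [abs_of_nonneg (by positivity)]; nlinarith [bracket_pos x]
  one x := by
    have h : ‖((2 : ℝ) • innerL) x‖ = 2 * ‖x‖ := by
      rw [smul_apply, norm_smul, norm_innerL_apply]; simp
    rw [norm1, fderiv_bracket_sq, h]
    nlinarith [bracket_pos x, norm_le_bracket x]
  two x := by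
    rw [norm2, fderiv_bracket_sq, ContinuousLinearMap.fderiv, mul_comm]
    gcongr
    rw [norm_smul_clm, Nat.abs_ofNat]
    linarith [norm_innerL_le]

/-- The Leibniz rule solved for `g D²f`. It is used for `g = ⟨x⟩²`: the Hessian of the product is
controlled through its Laplacian, and the weight is then commuted out. -/
theorem norm_smul_fderiv_fderiv_le {g : Plane → ℝ} {f : Plane → ℂ} (hg : ContDiff ℝ ∞ g)
    (hf : ContDiff ℝ ∞ f) (x : Plane) :
    |g x| * norm2 f x ≤ norm2 (fun y ↦ g y • f y) x
      + 2 * (norm1 g x * norm1 f x) + norm2 g x * ‖f x‖ := by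
  rw [norm2, ← norm_smul_clm]
  have n0 := norm1_nonneg f x
  have n1 := norm1_nonneg g x
  have n2 := norm2_nonneg g x
  have n3 := norm2_nonneg (fun y ↦ g y • f y) x
  refine ContinuousLinearMap.opNorm_le_bound₂ _ (by positivity) fun v w ↦ ?_
  have e := fderiv_fderiv_smul_apply hg hf x v w
  have e' : (g x • fderiv ℝ (fderiv ℝ f) x) v w =
      fderiv ℝ (fderiv ℝ (fun y ↦ g y • f y)) x v w - fderiv ℝ g x v • fderiv ℝ f x w
      - fderiv ℝ g x w • fderiv ℝ f x v - fderiv ℝ (fderiv ℝ g) x v w • f x := by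
    rw [e, smul_apply, smul_apply]; abel
  have a1 := norm_fderiv_fderiv_apply_le (fun y ↦ g y • f y) x v w
  have a2 : ∀ v w, ‖fderiv ℝ g x v • fderiv ℝ f x w‖ ≤
      norm1 g x * ‖v‖ * (norm1 f x * ‖w‖) := by
    intro v w
    rw [norm_smul]
    exact mul_le_mul (norm_fderiv_apply_le _ _ _) (norm_fderiv_apply_le _ _ _) (norm_nonneg _)
      (by positivity)
  have a4 : ‖fderiv ℝ (fderiv ℝ g) x v w • f x‖ ≤ norm2 g x * ‖v‖ * ‖w‖ * ‖f x‖ := by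
    rw [norm_smul]
    exact mul_le_mul_of_nonneg_right (norm_fderiv_fderiv_apply_le _ _ _ _) (norm_nonneg _)
  rw [e']
  refine ((norm_sub_le _ _).trans (add_le_add ((norm_sub_le _ _).trans
    (add_le_add ((norm_sub_le _ _).trans (add_le_add a1 (a2 v w))) (a2 w v))) a4)).trans ?_
  apply le_of_eq; ring

theorem norm1_bracket_sq_le (x : Plane) :
    norm1 (fun x ↦ bracket x ^ 2) x ≤ 2 * bracket x := by
  have h1 := isWeight_bracket_sq.one x
  rw [pow_two, ← mul_assoc, mul_comm] at h1
  exact le_of_mul_le_mul_right h1 (bracket_pos x)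

theorem norm2_bracket_sq_le (x : Plane) :
    norm2 (fun x ↦ bracket x ^ 2) x ≤ 2 := by
  have h2 := isWeight_bracket_sq.two x
  rw [mul_comm] at h2
  exact le_of_mul_le_mul_right h2 (pow_pos (bracket_pos x) 2)

/-! ### Consequences of the weighted bounds for test functions -/

section

variable {f : Plane → ℂ} {M : ℝ}

theorem hasCompactSupport_smul {g : Plane → ℝ} (hs : HasCompactSupport f) :
    HasCompactSupport (fun x ↦ g x • f x) :=
  hs.mono fun x hx h0 ↦ hx (by simp only [h0, smul_zero])

theorem WBd.l2Bd (h : WBd 0 f M) (hf : ContDiff ℝ ∞ f) : L2Bd f M :=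
  h.zero.mono hf.continuous.aestronglyMeasurable fun x ↦ by simp

theorem WBd.l2Bd_lapl (h : WBd 0 f M) (hf : ContDiff ℝ ∞ f) : L2Bd (lapl f) M :=
  h.two.mono (continuous_lapl hf).aestronglyMeasurable fun x ↦ by
    simp only [zero_add]
    exact le_mul_of_one_le_left (norm_nonneg _) (one_le_pow₀ (one_le_bracket x))

theorem WBd.l2Bd_fderiv (h : WBd 0 f M) (hf : ContDiff ℝ ∞ f) : L2Bd (fderiv ℝ f) M :=
  h.one.mono (hf.continuous_fderiv (by simp)).aestronglyMeasurable fun x ↦ by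
    simp only [zero_add]
    exact le_mul_of_one_le_left (norm_nonneg _) (one_le_pow₀ (one_le_bracket x))

/-- The derivatives of `⟨x⟩²` of order 0, 1, 2 are at most `2⟨x⟩²`, `2⟨x⟩`, `2`, so each term of the
Leibniz rule meets its own weight in `WBd`; `14 = 2 + 4·2 + 2·2`. -/
theorem WBd.l2Bd_lapl_bracket_sq (h : WBd 0 f M) (hf : ContDiff ℝ ∞ f) :
    L2Bd (lapl (fun x ↦ bracket x ^ 2 • f x)) (14 * M) := by
  have hg := isWeight_bracket_sq
  have hgf : ContDiff ℝ ∞ (fun x ↦ bracket x ^ 2 • f x) := hg.contDiff.smul hf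
  have hM := h.zero.1
  refine ((((h.two.const_mul zero_le_two).add ((h.one.const_mul zero_le_two).const_mul (c := 4)
    (by norm_num))).add ((h.zero.const_mul zero_le_two).const_mul (c := 2) (by norm_num))).le
    (N := 14 * M) (by linarith)).mono (continuous_lapl hgf).aestronglyMeasurable fun x ↦ ?_
  refine (norm_lapl_smul_le hg.contDiff hf x).trans ?_
  calc _ ≤ (2 * bracket x ^ 2) * ‖lapl f x‖ + 4 * ((2 * bracket x) * norm1 f x)
        + 2 * (2 * ‖f x‖) := by
        have n0 := norm1_nonneg f x
        gcongr ?_ * _ + 4 * (?_ * _) + 2 * (?_ * _)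
        · exact hg.zero x
        · exact norm1_bracket_sq_le x
        · exact norm2_bracket_sq_le x
    _ = _ := by ring

/-- `WBd` controls only the Laplacian with weight. The unweighted comparison of Hessian and
Laplacian is applied to `⟨x⟩²f`, and the lower order terms are subtracted: `62 = 4·14 + 4 + 2`. -/
theorem WBd.l2Bd_fderiv_fderiv (h : WBd 0 f M) (hf : ContDiff ℝ ∞ f) (hs : HasCompactSupport f) :
    L2Bd (fun x ↦ bracket x ^ 2 * norm2 f x) (62 * M) := by
  have hg := isWeight_bracket_sq
  have hgf : ContDiff ℝ ∞ (fun x ↦ bracket x ^ 2 • f x) := hg.contDiff.smul hf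
  have hgs : HasCompactSupport (fun x ↦ bracket x ^ 2 • f x) := hasCompactSupport_smul hs
  have hM := h.zero.1
  have d2 : L2Bd (norm2 fun x ↦ bracket x ^ 2 • f x) (4 * (14 * M)) :=
    (h.l2Bd_lapl_bracket_sq hf).fderiv_fderiv hgf hgs
  have d3 : L2Bd (fun x ↦ 4 * (bracket x ^ (0 + 1) * norm1 f x)) (4 * M) :=
    h.one.const_mul (by norm_num)
  have d4 : L2Bd (fun x ↦ 2 * (bracket x ^ 0 * ‖f x‖)) (2 * M) := h.zero.const_mul (by norm_num)
  have d5 := ((d2.add d3).add d4).le (N := 62 * M) (by linarith)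
  refine d5.mono ((contDiff_bracket.continuous.pow 2).mul
    (continuous_norm2 (hf.of_le two_le_infty))).aestronglyMeasurable fun x ↦ ?_
  have hx := bracket_pos x
  have key := norm_smul_fderiv_fderiv_le hg.contDiff hf x
  have h1 := norm1_bracket_sq_le x
  have h2 := norm2_bracket_sq_le x
  rw [abs_of_nonneg (by positivity)] at key
  rw [Real.norm_eq_abs, abs_of_nonneg (mul_nonneg (by positivity) (norm2_nonneg _ _)), pow_zero,
    one_mul, zero_add, pow_one]
  refine key.trans ?_
  have h3 := mul_le_mul_of_nonneg_right h1 (norm1_nonneg f x)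
  have h4 := mul_le_mul_of_nonneg_right h2 (norm_nonneg (f x))
  linarith

/-- This is the `L⁴` bound for `⟨x⟩∇f`: Ladyzhenskaya's inequality for `⟨x⟩∂_j f`, whose gradient is
at most `⟨x⟩²|D²f| + |∇f|`, with `L²` norm at most `(62 + 1)M`. Adding the two components and
squaring gives `252 = 2·2·63`. -/
theorem WBd.exists_l2Bd_sq : ∃ C : ℝ, 0 ≤ C ∧ ∀ (f : Plane → ℂ) (M : ℝ), ContDiff ℝ ∞ f →
    HasCompactSupport f → WBd 0 f M → L2Bd (fun x ↦ (bracket x * norm1 f x) ^ 2)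
      (C * M ^ 2) := by
  obtain ⟨C, hC, H⟩ := exists_L2Bd_sq
  refine ⟨252 * C, by linarith, fun f M hf hs h ↦ ?_⟩
  have hM := h.zero.1
  have hb := contDiff_bracket.continuous
  have hf1 : ContDiff ℝ ∞ (fderiv ℝ f) := hf.fderiv_right (by simp)
  have hj : ∀ j, L2Bd (fun x ↦ ‖bracket x • fderiv ℝ f x (unitVec j)‖ ^ 2)
      (C * (M * (63 * M))) := by
    intro j
    have hcj : ContDiff ℝ ∞ (fun x ↦ fderiv ℝ f x (unitVec j)) := hf1.clm_apply contDiff_const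
    have hpj : ContDiff ℝ ∞ (fun x ↦ bracket x • fderiv ℝ f x (unitVec j)) :=
      contDiff_bracket.smul hcj
    refine H _ _ _ (hpj.of_le (by norm_cast)) ?_ ?_ ?_
    · exact hasCompactSupport_smul
        ((hs.fderiv (𝕜 := ℝ)).comp_left (g := fun T : Plane →L[ℝ] ℂ ↦ T (unitVec j)) (by simp))
    · refine h.one.mono hpj.continuous.aestronglyMeasurable fun x ↦ ?_
      rw [norm_smul, Real.norm_eq_abs, abs_of_pos (bracket_pos x), zero_add, pow_one]
      have := norm_fderiv_apply_le f x (unitVec j)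
      rw [norm_unitVec, mul_one] at this
      exact mul_le_mul_of_nonneg_left this (bracket_pos x).le
    · have d1 : L2Bd (fun x ↦ norm1 f x) M := (h.l2Bd_fderiv hf).norm
      have d2 := ((h.l2Bd_fderiv_fderiv hf hs).add d1).le (N := 63 * M) (by linarith)
      refine d2.mono (hpj.continuous_fderiv (by simp)).aestronglyMeasurable fun x ↦ ?_
      refine (norm1_smul_le contDiff_bracket hcj x).trans ?_
      rw [abs_of_pos (bracket_pos x)]
      have a1 : norm1 (fun y ↦ fderiv ℝ f y (unitVec j)) x ≤ norm2 f x := by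
        refine norm1_le (norm2_nonneg _ _) fun v ↦ ?_
        rw [(fderiv_fderiv_apply (hf.of_le two_le_infty).contDiffAt (unitVec j)).fderiv]
        have := norm_fderiv_fderiv_apply_le f x v (unitVec j)
        rwa [norm_unitVec, mul_one] at this
      have a2 := norm_fderiv_apply_le f x (unitVec j)
      rw [norm_unitVec, mul_one] at a2
      have hx := one_le_bracket x
      refine add_le_add ?_ ?_
      · refine (mul_le_mul_of_nonneg_left a1 (bracket_pos x).le).trans ?_
        exact mul_le_mul_of_nonneg_right (by nlinarith) (norm2_nonneg _ _)
      · refine (mul_le_mul (norm1_bracket_le x) a2 (norm_nonneg _) zero_le_one).trans ?_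
        rw [one_mul]
  have d := (((hj 0).add (hj 1)).const_mul zero_le_two).le (N := 252 * C * M ^ 2) (by linarith)
  refine d.mono ((hb.mul (continuous_norm1 (hf.of_le (by norm_cast)))).pow 2).aestronglyMeasurable
    fun x ↦ ?_
  rw [Real.norm_eq_abs, abs_of_nonneg (sq_nonneg _)]
  simp only [norm_smul, Real.norm_eq_abs, abs_of_pos (bracket_pos x), mul_pow]
  have h2 := pow_le_pow_left₀ (norm1_nonneg f x) (opNorm_le_sum (fderiv ℝ f x)) 2
  have h3 : norm1 f x ^ 2 ≤ 2 * (‖fderiv ℝ f x (unitVec 0)‖ ^ 2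
      + ‖fderiv ℝ f x (unitVec 1)‖ ^ 2) := by
    linarith [sq_nonneg (‖fderiv ℝ f x (unitVec 0)‖ - ‖fderiv ℝ f x (unitVec 1)‖)]
  linarith [mul_le_mul_of_nonneg_left h3 (sq_nonneg (bracket x))]

end

/-- The error estimate is nonlinear in the amplitude; these are the norms it consumes beyond `WBd`
itself: `L^∞` for the value, `L⁴` for the gradient, `L²` for the Hessian. -/
theorem WBd.exists_bounds : ∃ C : ℝ, 1 ≤ C ∧ ∀ (f : Plane → ℂ) (M : ℝ), ContDiff ℝ ∞ f →
    HasCompactSupport f → WBd 0 f M → (∀ x, ‖f x‖ ≤ C * M) ∧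
      L2Bd (fun x ↦ bracket x ^ 2 * norm2 f x) (C * M) ∧
      L2Bd (fun x ↦ (bracket x * norm1 f x) ^ 2) (C * M ^ 2) := by
  obtain ⟨C₁, hC₁, H₁⟩ := exists_sup_bound
  obtain ⟨C₂, hC₂, H₂⟩ := WBd.exists_l2Bd_sq
  refine ⟨2 * C₁ + 62 + C₂, by linarith, fun f M hf hs h ↦ ⟨fun x ↦ ?_, ?_, ?_⟩⟩
  · have hM := h.zero.1
    have := H₁ (hs.toSchwartzMap hf) M M (h.l2Bd hf)
      (by rw [coe_laplacian_toSchwartzMap hf hs]; exact h.l2Bd_lapl hf) x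
    rw [HasCompactSupport.toSchwartzMap_toFun] at this
    linarith [mul_nonneg hC₂ hM]
  · have hM := h.zero.1
    exact (h.l2Bd_fderiv_fderiv hf hs).le
      (by linarith [mul_nonneg hC₁ hM, mul_nonneg hC₂ hM])
  · exact (H₂ f M hf hs h).le
      (by linarith [mul_nonneg hC₁ (sq_nonneg M), mul_nonneg hC₂ (sq_nonneg M), sq_nonneg M])

/-! ### Mollification and cutoff -/

/-- The convolution of a real kernel with a complex function. -/
def conv (η : Plane → ℝ) (f : Plane → ℂ) (x : Plane) : ℂ := ∫ y, η (x - y) • f y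

theorem conv_eq_convolution (η : Plane → ℝ) (f : Plane → ℂ) :
    conv η f = convolution η f (ContinuousLinearMap.lsmul ℝ ℝ) volume := by
  funext x
  rw [convolution_eq_swap]
  rfl

section

variable {η : Plane → ℝ} {f : Plane → ℂ}

theorem contDiff_conv (hη : ContDiff ℝ ∞ η) (hs : HasCompactSupport η)
    (hf : LocallyIntegrable f volume) : ContDiff ℝ ∞ (conv η f) := by
  rw [conv_eq_convolution]
  exact hs.contDiff_convolution_left _ hη hf

theorem fderiv_conv_apply (hη : ContDiff ℝ ∞ η) (hs : HasCompactSupport η)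
    (hf : LocallyIntegrable f volume) (x v : Plane) :
    fderiv ℝ (conv η f) x v = conv (fun y ↦ fderiv ℝ η y v) f x := by
  rw [conv_eq_convolution, (hs.hasFDerivAt_convolution_left _ (hη.of_le (by norm_cast)) hf x).fderiv,
    convolution_eq_swap, ContinuousLinearMap.integral_apply]
  · rfl
  · have h := (hs.fderiv (𝕜 := ℝ)).convolutionExists_left
      ((ContinuousLinearMap.lsmul ℝ ℝ).precompL Plane : _ →L[ℝ] ℂ →L[ℝ] (Plane →L[ℝ] ℂ))
      (hη.continuous_fderiv (by simp)) hf x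
    exact h.integrable_swap

theorem contDiff_fderiv_apply {F : Type*} [NormedAddCommGroup F] [NormedSpace ℝ F]
    {g : Plane → F} (hg : ContDiff ℝ ∞ g) (v : Plane) :
    ContDiff ℝ ∞ (fun y ↦ fderiv ℝ g y v) :=
  ContDiff.clm_apply (hg.fderiv_right (by simp)) contDiff_const

theorem hasCompactSupport_fderiv_apply {F : Type*} [NormedAddCommGroup F] [NormedSpace ℝ F]
    {g : Plane → F} (hg : HasCompactSupport g) (v : Plane) :
    HasCompactSupport (fun y ↦ fderiv ℝ g y v) :=
  (hg.fderiv (𝕜 := ℝ)).mono fun y hy h0 ↦ hy (by simp only [h0, zero_apply])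

theorem lapl_conv (hη : ContDiff ℝ ∞ η) (hs : HasCompactSupport η)
    (hf : LocallyIntegrable f volume) (x : Plane) :
    lapl (conv η f) x = conv (lapl η) f x := by
  have key : ∀ v, fderiv ℝ (fderiv ℝ (conv η f)) x v v =
      conv (fun y ↦ fderiv ℝ (fderiv ℝ η) y v v) f x := by
    intro v
    have h1 := (fderiv_fderiv_apply ((contDiff_conv hη hs hf).of_le two_le_infty).contDiffAt
      v (x := x)).fderiv
    have h2 : (fun y ↦ fderiv ℝ (conv η f) y v) = conv (fun y ↦ fderiv ℝ η y v) f :=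
      funext fun y ↦ fderiv_conv_apply hη hs hf y v
    have h3 := congrArg (fun T : Plane →L[ℝ] ℂ ↦ T v) h1
    simp only [ContinuousLinearMap.flip_apply] at h3
    rw [← h3, h2, fderiv_conv_apply (contDiff_fderiv_apply hη v)
      (hasCompactSupport_fderiv_apply hs v) hf]
    congr 1
    funext y
    rw [(fderiv_fderiv_apply (hη.of_le two_le_infty).contDiffAt v (x := y)).fderiv]
    rfl
  have hint : ∀ v, Integrable (fun y ↦ fderiv ℝ (fderiv ℝ η) (x - y) v v • f y) := by
    intro v
    have e : (fun y ↦ fderiv ℝ (fderiv ℝ η) y v v) =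
        fun y ↦ fderiv ℝ (fun z ↦ fderiv ℝ η z v) y v := by
      funext y
      rw [(fderiv_fderiv_apply (hη.of_le two_le_infty).contDiffAt v (x := y)).fderiv]
      rfl
    have hc := contDiff_fderiv_apply (contDiff_fderiv_apply hη v) v
    have hcs := hasCompactSupport_fderiv_apply (hasCompactSupport_fderiv_apply hs v) v
    have h := (hcs.convolutionExists_left (ContinuousLinearMap.lsmul ℝ ℝ)
      hc.continuous hf x).integrable_swap
    have h' : Integrable fun y ↦ (fun y ↦ fderiv ℝ (fderiv ℝ η) y v v) (x - y) • f y := by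
      rw [e]; exact h
    exact h'
  simp only [lapl, key, Fin.sum_univ_two, conv, add_smul]
  rw [integral_add (hint _) (hint _)]

end

/-- Since `a(x - ·)` is a probability density, Cauchy-Schwarz puts the square inside the integral;
exchanging the integrals then removes the kernel. -/
theorem lintegral_conv_sq_le {a : Plane → ℝ} (ha : Continuous a) (h0 : ∀ x, 0 ≤ a x)
    (hi : Integrable a volume) (h1 : ∫ x, a x = 1) {H : Plane → ℝ≥0∞} (hH : AEMeasurable H volume) :
    ∫⁻ x, (∫⁻ y, ENNReal.ofReal (a (x - y)) * H y) ^ 2 ≤ ∫⁻ x, H x ^ 2 := by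
  have h1' : ∫⁻ x, ENNReal.ofReal (a x) = 1 := by
    rw [← ofReal_integral_eq_lintegral_ofReal hi (ae_of_all _ h0), h1, ENNReal.ofReal_one]
  have hm : ∀ x, Measurable fun y ↦ ENNReal.ofReal (a (x - y)) := fun x ↦
    (ha.comp (by fun_prop)).measurable.ennreal_ofReal
  have hsq : ∀ x, (∫⁻ y, ENNReal.ofReal (a (x - y)) * H y) ^ 2 ≤
      ∫⁻ y, ENNReal.ofReal (a (x - y)) * H y ^ 2 := by
    intro x
    have hs : ∀ y, ENNReal.ofReal (a (x - y)) =
        ENNReal.ofReal (√(a (x - y))) * ENNReal.ofReal (√(a (x - y))) := fun y ↦ by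
      rw [← ENNReal.ofReal_mul (Real.sqrt_nonneg _), Real.mul_self_sqrt (h0 _)]
    have hms : Measurable fun y ↦ ENNReal.ofReal (√(a (x - y))) :=
      (ha.comp (by fun_prop)).sqrt.measurable.ennreal_ofReal
    have hcs := ENNReal.lintegral_mul_le_Lp_mul_Lq volume
      (Real.HolderConjugate.two_two) hms.aemeasurable (hms.aemeasurable.mul hH)
    have e1 : ∫⁻ y, ENNReal.ofReal (√(a (x - y))) ^ (2 : ℝ) = 1 := by
      rw [← h1', ← lintegral_sub_left_eq_self (fun z ↦ ENNReal.ofReal (a z)) x]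
      refine lintegral_congr fun y ↦ ?_
      rw [hs y, ENNReal.rpow_two, pow_two]
    have e2 : ∫⁻ y, ((fun y ↦ ENNReal.ofReal (√(a (x - y)))) * H) y ^ (2 : ℝ) =
        ∫⁻ y, ENNReal.ofReal (a (x - y)) * H y ^ 2 := by
      refine lintegral_congr fun y ↦ ?_
      rw [hs y, ENNReal.rpow_two, Pi.mul_apply, mul_pow, pow_two]
    have e3 : ∫⁻ y, ((fun y ↦ ENNReal.ofReal (√(a (x - y)))) *
        ((fun y ↦ ENNReal.ofReal (√(a (x - y)))) * H)) y =
        ∫⁻ y, ENNReal.ofReal (a (x - y)) * H y := by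
      refine lintegral_congr fun y ↦ ?_
      rw [hs y, Pi.mul_apply, Pi.mul_apply, mul_assoc]
    rw [e3, e1, e2, ENNReal.one_rpow, one_mul] at hcs
    refine (pow_le_pow_left₀ (zero_le) hcs 2).trans (le_of_eq ?_)
    rw [← ENNReal.rpow_two, ← ENNReal.rpow_mul]
    norm_num
  refine (lintegral_mono hsq).trans ?_
  rw [lintegral_lintegral_swap]
  · refine le_of_eq (lintegral_congr fun y ↦ ?_)
    rw [lintegral_mul_const, lintegral_sub_right_eq_self (fun x ↦ ENNReal.ofReal (a x)) y, h1',
      one_mul]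
    exact (ha.comp (by fun_prop)).measurable.ennreal_ofReal
  · have : Measurable fun p : Plane × Plane ↦ ENNReal.ofReal (a (p.1 - p.2)) :=
      (ha.comp (by fun_prop)).measurable.ennreal_ofReal
    exact this.aemeasurable.mul ((hH.pow_const 2).comp_quasiMeasurePreserving
      Measure.quasiMeasurePreserving_snd)

theorem bracket_le_two_mul {x y : Plane} (h : ‖x - y‖ ≤ 1) : bracket x ≤ 2 * bracket y := by
  have h1 : ‖x‖ ≤ ‖y‖ + 1 := by
    have := norm_add_le (x - y) y
    rw [sub_add_cancel] at this; linarith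
  refine Real.sqrt_le_iff.2 ⟨by linarith [bracket_pos y], ?_⟩
  rw [mul_pow, bracket_sq]
  nlinarith [norm_nonneg x, norm_nonneg y, sq_nonneg (‖y‖ - 1)]

/-- The kernel is supported in the unit ball, over which `⟨·⟩` changes by a factor of at most 2. So
the weight passes through the convolution at the price `2^n`, and convolution with a probability
density contracts `L²`. -/
theorem L2Bd.conv {a : Plane → ℝ} (ha : Continuous a) (h0 : ∀ x, 0 ≤ a x)
    (hi : Integrable a volume) (h1 : ∫ x, a x = 1) (hs : ∀ x, 1 < ‖x‖ → a x = 0) {n : ℕ}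
    {d : Plane → ℂ} {M : ℝ} (hd : L2Bd (fun x ↦ bracket x ^ n * ‖d x‖) M)
    (hm : AEStronglyMeasurable (NLKG.conv a d) volume) :
    L2Bd (fun x ↦ bracket x ^ n * ‖NLKG.conv a d x‖) (2 ^ n * M) := by
  have hb := contDiff_bracket.continuous
  have hM := hd.1
  refine L2Bd.of_sq_le (by positivity)
    ((hb.pow n).aestronglyMeasurable.mul hm.norm) ?_
  have hH : AEMeasurable (fun x ↦ ‖bracket x ^ n * ‖d x‖‖ₑ) volume := hd.2.1.enorm
  have key : ∀ x, ‖bracket x ^ n * ‖NLKG.conv a d x‖‖ₑ ≤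
      ENNReal.ofReal (2 ^ n) * ∫⁻ y, ENNReal.ofReal (a (x - y)) * ‖bracket y ^ n * ‖d y‖‖ₑ := by
    intro x
    rw [enorm_mul, enorm_norm]
    have hle : ‖NLKG.conv a d x‖ₑ ≤ ∫⁻ y, ‖a (x - y) • d y‖ₑ := enorm_integral_le_lintegral_enorm _
    refine (mul_le_mul_right hle _).trans ?_
    rw [← lintegral_const_mul' _ _ (by simp), ← lintegral_const_mul' _ _ (by simp)]
    refine lintegral_mono fun y ↦ ?_
    rw [enorm_mul, enorm_norm, enorm_smul]
    by_cases hxy : 1 < ‖x - y‖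
    · simp [hs _ hxy]
    · have h2 := pow_le_pow_left₀ (bracket_pos x).le (bracket_le_two_mul (not_lt.1 hxy)) n
      rw [mul_pow] at h2
      rw [Real.enorm_of_nonneg (by have := bracket_pos x; positivity), Real.enorm_of_nonneg (h0 _),
        Real.enorm_of_nonneg (by have := bracket_pos y; positivity)]
      calc _ ≤ ENNReal.ofReal (2 ^ n * bracket y ^ n) * (ENNReal.ofReal (a (x - y)) * ‖d y‖ₑ) := by
            gcongr
        _ = _ := by rw [ENNReal.ofReal_mul (by positivity)]; ring
  calc _ ≤ ∫⁻ x, (ENNReal.ofReal (2 ^ n) *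
        ∫⁻ y, ENNReal.ofReal (a (x - y)) * ‖bracket y ^ n * ‖d y‖‖ₑ) ^ 2 :=
        lintegral_mono fun x ↦ pow_le_pow_left₀ zero_le (key x) 2
    _ = ENNReal.ofReal (2 ^ n) ^ 2 *
        ∫⁻ x, (∫⁻ y, ENNReal.ofReal (a (x - y)) * ‖bracket y ^ n * ‖d y‖‖ₑ) ^ 2 := by
        simp_rw [mul_pow]
        rw [lintegral_const_mul' _ _ (by simp)]
    _ ≤ ENNReal.ofReal (2 ^ n) ^ 2 * ENNReal.ofReal (M ^ 2) := by
        gcongr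
        exact (lintegral_conv_sq_le ha h0 hi h1 hH).trans hd.lintegral_sq_le
    _ = _ := by
        rw [← ENNReal.ofReal_pow (by positivity), ← ENNReal.ofReal_mul (by positivity), mul_pow]

/-! ### Weak derivatives and their approximation by test functions -/

/-- A function with weak gradient and weak Laplacian in weighted `L²` spaces. -/
structure WeakBd (q : ℕ) (f : Plane → ℂ) (M : ℝ) : Prop where
  meas : AEStronglyMeasurable f volume
  zero : L2Bd (fun x ↦ bracket x ^ q * ‖f x‖) M
  one : ∀ j, ∃ d : Plane → ℂ, L2Bd (fun x ↦ bracket x ^ (q + 1) * ‖d x‖) M ∧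
    ∀ ψ : Plane → ℝ, ContDiff ℝ ∞ ψ → HasCompactSupport ψ →
      ∫ x, fderiv ℝ ψ x (unitVec j) • f x = - ∫ x, ψ x • d x
  two : ∃ l : Plane → ℂ, L2Bd (fun x ↦ bracket x ^ (q + 2) * ‖l x‖) M ∧
    ∀ ψ : Plane → ℝ, ContDiff ℝ ∞ ψ → HasCompactSupport ψ →
      ∫ x, lapl ψ x • f x = ∫ x, ψ x • l x

theorem WeakBd.locallyIntegrable {q : ℕ} {f : Plane → ℂ} {M : ℝ} (h : WeakBd q f M) :
    LocallyIntegrable f volume := by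
  have : L2Bd f M := h.zero.mono h.meas fun x ↦
    le_mul_of_one_le_left (norm_nonneg _) (one_le_pow₀ (one_le_bracket x))
  exact this.memLp.locallyIntegrable (by norm_num)

theorem fderiv_comp_sub_left {F : Type*} [NormedAddCommGroup F] [NormedSpace ℝ F] {a : Plane → F}
    (ha : Differentiable ℝ a) (x y : Plane) :
    fderiv ℝ (fun y ↦ a (x - y)) y = -fderiv ℝ a (x - y) := by
  have h := (ha (x - y)).hasFDerivAt.comp y ((hasFDerivAt_id y).const_sub x)
  refine h.fderiv.trans ?_
  ext v
  simp

theorem lapl_comp_sub_left {a : Plane → ℝ} (ha : ContDiff ℝ ∞ a) (x y : Plane) :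
    lapl (fun y ↦ a (x - y)) y = lapl a (x - y) := by
  have h1 : fderiv ℝ (fun y ↦ a (x - y)) = fun y ↦ -fderiv ℝ a (x - y) :=
    funext fun y ↦ fderiv_comp_sub_left (ha.differentiable (by simp)) x y
  have ha1 : ContDiff ℝ 1 (fderiv ℝ a) := ha.fderiv_right (by norm_cast)
  have h : fderiv ℝ (fun y ↦ -fderiv ℝ a (x - y)) y = fderiv ℝ (fderiv ℝ a) (x - y) := by
    rw [fderiv_fun_neg, fderiv_comp_sub_left (ha1.differentiable (by simp)), neg_neg]
  simp only [lapl, h1, h]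

theorem hasCompactSupport_comp_sub_left {a : Plane → ℝ} (h : HasCompactSupport a) (x : Plane) :
    HasCompactSupport fun y ↦ a (x - y) :=
  h.comp_homeomorph (Homeomorph.subLeft x)

/-- Testing the weak derivatives against `y ↦ a(x - y)` shows that the derivatives of the
convolution are the convolutions of the weak derivatives; the sign from `∇_y a(x - y)` cancels the
sign of the weak gradient. -/
theorem WeakBd.conv {q : ℕ} {f : Plane → ℂ} {M : ℝ} (h : WeakBd q f M) {a : Plane → ℝ}
    (ha : ContDiff ℝ ∞ a) (hac : HasCompactSupport a) (h0 : ∀ x, 0 ≤ a x)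
    (h1 : ∫ x, a x = 1) (hs : ∀ x, 1 < ‖x‖ → a x = 0) :
    WBd q (NLKG.conv a f) (2 ^ (q + 3) * M) := by
  have hloc := h.locallyIntegrable
  have hi : Integrable a volume := ha.continuous.integrable_of_hasCompactSupport hac
  have hc := contDiff_conv ha hac hloc
  have hM := h.zero.1
  have hb := contDiff_bracket.continuous
  have hle : ∀ n ≤ q + 3, (2 : ℝ) ^ n * M ≤ 2 ^ (q + 3) * M := fun n hn ↦ by
    gcongr; norm_num
  have hxs : ∀ x, ContDiff ℝ ∞ fun y ↦ a (x - y) := fun x ↦ ha.comp (contDiff_const.sub contDiff_id)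
  refine ⟨(h.zero.conv ha.continuous h0 hi h1 hs hc.continuous.aestronglyMeasurable).le
    (hle _ (by omega)), ?_, ?_⟩
  · choose d hd hdw using h.one
    have e : ∀ j x, fderiv ℝ (NLKG.conv a f) x (unitVec j) = NLKG.conv a (d j) x := by
      intro j x
      have := hdw j (fun y ↦ a (x - y)) (hxs x) (hasCompactSupport_comp_sub_left hac x)
      rw [fderiv_conv_apply ha hac hloc]
      simp only [fderiv_comp_sub_left (ha.differentiable (by simp)), neg_apply, neg_smul, integral_neg, neg_inj] at this
      exact this
    have hj : ∀ j, L2Bd (fun x ↦ bracket x ^ (q + 1) * ‖fderiv ℝ (NLKG.conv a f) x (unitVec j)‖)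
        (2 ^ (q + 1) * M) := by
      intro j
      have hcd : Continuous fun x ↦ fderiv ℝ (NLKG.conv a f) x (unitVec j) :=
        (contDiff_fderiv_apply hc (unitVec j)).continuous
      simp only [e] at hcd ⊢
      exact (hd j).conv ha.continuous h0 hi h1 hs hcd.aestronglyMeasurable
    refine (((hj 0).add (hj 1)).le (N := 2 ^ (q + 3) * M) ?_).mono
      ((hb.pow _).mul (continuous_norm1 (hc.of_le (by norm_cast)))).aestronglyMeasurable fun x ↦ ?_
    -- The two components of the gradient contribute `2^(q+1) M` each, together `2^(q+2) M`.
    · have := hle (q + 2) (by omega)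
      rw [pow_succ] at this
      linarith
    · have hx := bracket_pos x
      rw [Real.norm_eq_abs, abs_of_nonneg (mul_nonneg (by positivity) (norm1_nonneg _ _)), ← mul_add]
      gcongr
      exact opNorm_le_sum _
  · obtain ⟨l, hl, hlw⟩ := h.two
    have e : ∀ x, lapl (NLKG.conv a f) x = NLKG.conv a l x := by
      intro x
      have := hlw (fun y ↦ a (x - y)) (hxs x) (hasCompactSupport_comp_sub_left hac x)
      rw [lapl_conv ha hac hloc]
      simp only [lapl_comp_sub_left ha] at this
      exact this
    have hcd := continuous_lapl hc
    have e' : lapl (NLKG.conv a f) = NLKG.conv a l := funext e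
    rw [e'] at hcd
    rw [e']
    exact (hl.conv ha.continuous h0 hi h1 hs hcd.aestronglyMeasurable).le (hle _ (by omega))

/-- Each derivative of `g(x/R)` gains `R⁻¹`, and `⟨x⟩/R ≤ ⟨x/R⟩` for `R ≥ 1`. So the weighted
derivatives are dominated by `⟨y⟩^j |D^j g(y)|` at `y = x/R`, which is bounded by compact support.
The uniformity in `R` lets cutoffs be removed without loss. -/
theorem exists_isWeight_dilation {g : Plane → ℝ} (hg : ContDiff ℝ ∞ g) (hs : HasCompactSupport g) :
    ∃ A : ℝ, 0 ≤ A ∧ ∀ R : ℝ, 1 ≤ R → IsWeight 0 (fun x ↦ g (R⁻¹ • x)) A := by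
  have hb := contDiff_bracket.continuous
  have hg1 : ContDiff ℝ ∞ (fderiv ℝ g) := hg.fderiv_right (by simp)
  have hs1 : HasCompactSupport (fderiv ℝ g) := hs.fderiv (𝕜 := ℝ)
  have hs2 : HasCompactSupport (fderiv ℝ (fderiv ℝ g)) := hs1.fderiv (𝕜 := ℝ)
  have hex : ∀ F : Plane → ℝ, Continuous F → HasCompactSupport F → ∃ C, ∀ x, ‖F x‖ ≤ C :=
    fun F hF hFs ↦ hFs.exists_bound_of_continuous hF
  obtain ⟨A₀, h₀⟩ := hex g hg.continuous hs
  obtain ⟨A₁, h₁⟩ := hex (fun x ↦ bracket x * norm1 g x)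
    (hb.mul (continuous_norm1 (hg.of_le (by norm_cast))))
    (hs1.mono fun y hy h0 ↦ hy (by simp only [norm1, h0, norm_zero, mul_zero]))
  obtain ⟨A₂, h₂⟩ := hex (fun x ↦ bracket x ^ 2 * norm2 g x)
    ((hb.pow 2).mul (continuous_norm2 (hg.of_le two_le_infty)))
    (hs2.mono fun y hy h0 ↦ hy (by
      have : norm2 g y = 0 := by rw [norm2, h0]; exact norm_zero (E := Plane →L[ℝ] Plane →L[ℝ] ℝ)
      simp only [this, mul_zero]))
  have hA₀ := (norm_nonneg _).trans (h₀ 0)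
  have hA₁ := (norm_nonneg _).trans (h₁ 0)
  have hA₂ := (norm_nonneg _).trans (h₂ 0)
  refine ⟨A₀ + A₁ + A₂, by positivity, fun R hR ↦ ?_⟩
  have hR0 : 0 < R := one_pos.trans_le hR
  have hbr : ∀ x, bracket x * R⁻¹ ≤ bracket (R⁻¹ • x) := by
    intro x
    rw [← div_eq_mul_inv, div_le_iff₀ hR0]
    refine Real.sqrt_le_iff.2 ⟨by have := bracket_pos (R⁻¹ • x); positivity, ?_⟩
    rw [mul_pow, bracket_sq, norm_smul, norm_inv, Real.norm_eq_abs, abs_of_pos hR0, mul_pow]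
    have : R ^ 2 * (R⁻¹ ^ 2 * ‖x‖ ^ 2) = ‖x‖ ^ 2 := by field_simp
    nlinarith [one_le_pow₀ hR (n := 2)]
  have d1 : fderiv ℝ (fun x ↦ g (R⁻¹ • x)) = fun x ↦ R⁻¹ • fderiv ℝ g (R⁻¹ • x) :=
    funext fun x ↦ fderiv_comp_smul _
  have n1 : ∀ x, norm1 (fun x ↦ g (R⁻¹ • x)) x = R⁻¹ * norm1 g (R⁻¹ • x) := fun x ↦ by
    rw [norm1, d1, norm1]
    simp only
    rw [norm_smul_clm, abs_of_pos (by positivity)]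
  have n2 : ∀ x, norm2 (fun x ↦ g (R⁻¹ • x)) x = R⁻¹ ^ 2 * norm2 g (R⁻¹ • x) := fun x ↦ by
    have hd : Differentiable ℝ (fun x ↦ fderiv ℝ g (R⁻¹ • x)) :=
      (hg1.comp (contDiff_const_smul (R⁻¹))).differentiable (by simp)
    rw [norm2, d1, fderiv_fun_const_smul (hd x),
      fderiv_comp_smul (f := fderiv ℝ g), norm2]
    rw [norm_smul_clm, norm_smul_clm, abs_of_pos (by positivity)]
    ring
  refine ⟨hg.comp (contDiff_const_smul (R⁻¹)), fun x ↦ ?_, fun x ↦ ?_, fun x ↦ ?_⟩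
  · rw [pow_zero, mul_one]
    exact (h₀ _).trans (by linarith)
  · rw [pow_zero, mul_one, n1, ← mul_assoc]
    refine (mul_le_mul_of_nonneg_right (hbr x) (norm1_nonneg _ _)).trans ?_
    exact ((le_abs_self _).trans (h₁ _)).trans (by linarith)
  · rw [pow_zero, mul_one, n2, ← mul_assoc, ← mul_pow]
    refine (mul_le_mul_of_nonneg_right (pow_le_pow_left₀ ?_ (hbr x) 2) (norm2_nonneg _ _)).trans ?_
    · have := bracket_pos x; positivity
    · exact ((le_abs_self _).trans (h₂ _)).trans (by linarith)

/-- The bump functions used for mollification and for the cutoff. -/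
def bump (k : ℕ) : ContDiffBump (0 : Plane) where
  rIn := (1 / 2) / ((k : ℝ) + 1)
  rOut := 1 / ((k : ℝ) + 1)
  rIn_pos := by positivity
  rIn_lt_rOut := by gcongr; norm_num

/-- Mollification at scale `1/(k+1)` followed by a cutoff at distance `k+1`. Both operations
preserve the weighted bounds uniformly in `k`, and the mollifications converge almost everywhere by
Lebesgue differentiation. -/
theorem exists_approx : ∃ C : ℕ → ℝ, (∀ q, 0 ≤ C q) ∧ ∀ (q : ℕ) (f : Plane → ℂ) (M : ℝ),
    WeakBd q f M → ∃ F : ℕ → Plane → ℂ, (∀ k, ContDiff ℝ ∞ (F k)) ∧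
      (∀ k, HasCompactSupport (F k)) ∧ (∀ k, WBd q (F k) (C q * M)) ∧
      ∀ᵐ x, Tendsto (fun k ↦ F k x) atTop (𝓝 (f x)) := by
  obtain ⟨A, hA, H⟩ := exists_isWeight_dilation (bump 0).contDiff (bump 0).hasCompactSupport
  refine ⟨fun q ↦ 7 * A * 2 ^ (q + 3), fun q ↦ by positivity, fun q f M h ↦ ?_⟩
  have hloc := h.locallyIntegrable
  have hR : ∀ k : ℕ, (1 : ℝ) ≤ (k : ℝ) + 1 := fun k ↦ by linarith [k.cast_nonneg (α := ℝ)]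
  have hout : ∀ k, (bump k).rOut ≤ 1 := fun k ↦ div_le_one_of_le₀ (hR k) (by positivity)
  have ha : ∀ k, ContDiff ℝ ∞ ((bump k).normed volume) := fun k ↦ (bump k).contDiff_normed
  have hac : ∀ k, HasCompactSupport ((bump k).normed volume) := fun k ↦
    (bump k).hasCompactSupport_normed
  have hcd := fun k ↦ contDiff_conv (ha k) (hac k) hloc
  refine ⟨fun k x ↦ bump 0 (((k : ℝ) + 1)⁻¹ • x) • conv ((bump k).normed volume) f x,
    fun k ↦ ?_, fun k ↦ ?_, fun k ↦ ?_, ?_⟩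
  · exact ((H _ (hR k)).contDiff).smul (hcd k)
  · have h1 : HasCompactSupport fun x : Plane ↦ bump 0 (((k : ℝ) + 1)⁻¹ • x) :=
      (bump 0).hasCompactSupport.comp_smul (by positivity)
    exact h1.mono fun y hy h0 ↦ hy (by simp only [h0, zero_smul])
  · have h1 : WBd (0 + q) (conv ((bump k).normed volume) f) (2 ^ (q + 3) * M) := by
      rw [zero_add]
      refine h.conv (ha k) (hac k) (bump k).nonneg_normed (bump k).integral_normed fun x hx ↦ ?_
      have : x ∉ Function.support ((bump k).normed volume) := by
        rw [(bump k).support_normed_eq, Metric.mem_ball, dist_zero_right, not_lt]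
        exact (hout k).trans hx.le
      simpa using this
    have := h1.smul (hcd k) hA (H _ (hR k))
    rwa [← mul_assoc] at this
  · have h0 : Tendsto (fun k ↦ (bump k).rOut) atTop (𝓝 0) :=
      tendsto_one_div_add_atTop_nhds_zero_nat
    -- The ratio of outer to inner radius is 2 for every `k`; this bounded ratio is what almost
    -- everywhere convergence asks of the kernels.
    have h2 : ∀ᶠ k in atTop, (bump k).rOut ≤ 2 * (bump k).rIn :=
      Eventually.of_forall fun k ↦ le_of_eq (by simp only [bump]; ring)
    filter_upwards [ContDiffBump.ae_convolution_tendsto_right_of_locallyIntegrable h0 h2 hloc]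
      with x hx
    refine hx.congr' ?_
    obtain ⟨N, hN⟩ := exists_nat_gt (2 * ‖x‖)
    filter_upwards [eventually_ge_atTop N] with k hk
    rw [conv_eq_convolution]
    -- The cutoff equals one on the ball of radius `1/2`, and `‖x‖/(k+1) ≤ 1/2` because `k ≥ N >
    -- 2‖x‖`.
    have : bump 0 (((k : ℝ) + 1)⁻¹ • x) = 1 := by
      apply (bump 0).one_of_mem_closedBall
      rw [Metric.mem_closedBall, dist_zero_right, norm_smul, norm_inv, Real.norm_eq_abs,
        abs_of_pos (by positivity : (0 : ℝ) < k + 1)]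
      have hk' : (N : ℝ) ≤ k := by exact_mod_cast hk
      have : (bump 0).rIn = 1 / 2 := by simp [bump]
      rw [this, inv_mul_le_iff₀ (by positivity)]
      linarith
    rw [this, one_smul]

/-! ### The Fourier transform of a final state -/

theorem quasiMeasurePreserving_const_smul {r : ℝ} (hr : r ≠ 0) :
    Measure.QuasiMeasurePreserving (fun x : Plane ↦ r • x) volume volume := by
  refine ⟨by fun_prop, ?_⟩
  have h := Measure.map_addHaar_smul (volume : Measure Plane) hr
  rw [h]
  exact Measure.smul_absolutelyContinuous

theorem lintegral_comp_const_smul {r : ℝ} (hr : 0 < r) {f : Plane → ℝ≥0∞}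
    (hf : AEMeasurable f volume) :
    ∫⁻ x, f (r • x) = ENNReal.ofReal ((r ^ 2)⁻¹) * ∫⁻ x, f x := by
  have h := Measure.map_addHaar_smul (volume : Measure Plane) hr.ne'
  rw [← lintegral_map' (f := f) (g := fun x : Plane ↦ r • x) _ (by fun_prop)]
  · change ∫⁻ x, f x ∂(Measure.map (r • ·) volume) = _
    rw [h, lintegral_smul_measure, finrank_euclideanSpace_fin, abs_of_pos (by positivity)]
    rfl
  · exact AEMeasurable.mono_ac hf (quasiMeasurePreserving_const_smul hr.ne').absolutelyContinuous

/-! ### Sobolev norms on the Fourier side -/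

open TemperedDistribution

/-- The Fourier symbol of `(1 - Δ)^{s/2}`. -/
def symbol (s : ℝ) (ξ : Plane) : ℂ := (((1 + (2 * Real.pi * ‖ξ‖) ^ 2) ^ (s / 2) : ℝ) : ℂ)

theorem symbol_eq (s : ℝ) (ξ : Plane) :
    symbol s ξ = ((1 + ‖((2 * Real.pi) • ContinuousLinearMap.id ℝ Plane) ξ‖ ^ 2) ^ (s / 2) : ℝ) := by
  rw [symbol, smul_apply, ContinuousLinearMap.id_apply, norm_smul, Real.norm_eq_abs,
    abs_of_pos Real.two_pi_pos]

theorem hasTemperateGrowth_symbol (s : ℝ) : (symbol s).HasTemperateGrowth := by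
  have h : symbol s = fun ξ : Plane ↦
      (((1 + ‖((2 * Real.pi) • ContinuousLinearMap.id ℝ Plane) ξ‖ ^ 2) ^ (s / 2) : ℝ) : ℂ) :=
    funext (symbol_eq s)
  rw [h]
  exact Complex.ofRealCLM.hasTemperateGrowth.comp
    ((Function.hasTemperateGrowth_one_add_norm_sq_rpow Plane (s / 2)).comp
    ((2 * Real.pi) • ContinuousLinearMap.id ℝ Plane).hasTemperateGrowth)

theorem symbol_mul_symbol_neg (s : ℝ) (ξ : Plane) : symbol s ξ * symbol (-s) ξ = 1 := by
  rw [symbol, symbol, ← Complex.ofReal_mul, ← Real.rpow_add (by positivity)]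
  simp [neg_div]

theorem symbol_natCast (s : ℕ) (ξ : Plane) :
    symbol s ξ = ((bracket ((2 * Real.pi) • ξ) ^ s : ℝ) : ℂ) := by
  rw [symbol, bracket, norm_smul, Real.norm_eq_abs, abs_of_pos Real.two_pi_pos,
    Real.sqrt_eq_rpow, ← Real.rpow_mul_natCast (by positivity)]
  congr 2
  ring

theorem norm_symbol_neg_le {s : ℝ} (hs : 0 ≤ s) (ξ : Plane) : ‖symbol (-s) ξ‖ ≤ 1 := by
  rw [symbol, Complex.norm_real, Real.norm_eq_abs, abs_of_nonneg (by positivity)]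
  exact Real.rpow_le_one_of_one_le_of_nonpos (by nlinarith [sq_nonneg (2 * Real.pi * ‖ξ‖)])
    (by linarith)

theorem toTemperedDistribution_injective {f g : Lp ℂ 2 (volume : Measure Plane)}
    (h : (f : 𝓢'(Plane, ℂ)) = g) : f = g := by
  have hk := Lp.ker_toTemperedDistributionCLM_eq_bot (E := Plane) (F := ℂ) (p := 2)
    (μ := (volume : Measure Plane))
  exact LinearMap.ker_eq_bot.1 hk h

/-- A finite infimum has a competitor, and injectivity of the map from `L²` to tempered
distributions leaves only one, so its norm is the infimum. Plancherel carries it to the frequency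
side. -/
theorem exists_sobolev_repr {s : ℝ} (u : 𝓢'(Plane, ℂ)) (h : sobolevNorm s u < ⊤) :
    ∃ g : Lp ℂ 2 (volume : Measure Plane),
      smulLeftCLM ℂ (symbol s) (𝓕 u) = (g : 𝓢'(Plane, ℂ)) ∧ ‖g‖ₑ = sobolevNorm s u := by
  have hex : ∃ g : Lp ℂ 2 (volume : Measure Plane), fourierMultiplierCLM ℂ (symbol s) u = g := by
    by_contra hne
    push Not at hne
    refine h.ne ?_
    simp only [sobolevNorm, iInf_eq_top]
    exact fun g hg ↦ absurd hg (hne g)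
  obtain ⟨g, hg⟩ := hex
  refine ⟨𝓕 g, ?_, ?_⟩
  · apply_fun 𝓕 at hg
    rw [fourierMultiplierCLM_apply] at hg
    rw [← Lp.fourier_toTemperedDistribution_eq g, ← hg]
    simp
  · have e : ‖𝓕 g‖ₑ = ‖g‖ₑ := by
      rw [← ofReal_norm, ← ofReal_norm, Lp.norm_fourier_eq]
    rw [e]
    apply le_antisymm
    · refine le_iInf₂ fun g' hg' ↦ ?_
      rw [toTemperedDistribution_injective (hg.symm.trans hg')]
    · exact iInf₂_le g hg

/-- For `s ≥ 0` the inverse symbol is bounded, so multiplying the representative by it exhibits `𝓕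
u` itself as an `L²` function. -/
theorem exists_toFunction_repr {s : ℝ} (hs : 0 ≤ s) (u : 𝓢'(Plane, ℂ)) (h : sobolevNorm s u < ⊤) :
    AEStronglyMeasurable (toFunction (𝓕 u)) volume ∧
      eLpNorm (fun ξ ↦ symbol s ξ * toFunction (𝓕 u) ξ) 2 volume = sobolevNorm s u ∧
      ∀ ψ : 𝓢(Plane, ℂ), 𝓕 u ψ = ∫ ξ, ψ ξ * toFunction (𝓕 u) ξ := by
  obtain ⟨g, hg, hgn⟩ := exists_sobolev_repr u h
  have hm : MemLp (symbol (-s)) ⊤ (volume : Measure Plane) :=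
    memLp_top_of_bound (hasTemperateGrowth_symbol _).1.continuous.aestronglyMeasurable 1
      (ae_of_all _ (norm_symbol_neg_le hs))
  set F : Lp ℂ 2 (volume : Measure Plane) := hm.toLp _ • g with hF
  have hFd : 𝓕 u = (F : 𝓢'(Plane, ℂ)) := by
    rw [hF, Lp.toTemperedDistribution_smul_eq (p := ⊤) (q := 2) (r := 2) (hasTemperateGrowth_symbol _), ← hg,
      smulLeftCLM_smulLeftCLM_apply (hasTemperateGrowth_symbol _) (hasTemperateGrowth_symbol _)]
    convert! (smulLeftCLM_const 1 (𝓕 u)).symm using 1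
    · simp
    · congr
      ext ξ
      rw [Pi.mul_apply, symbol_mul_symbol_neg]
  have hex : ∃ g : Lp ℂ 2 (volume : Measure Plane), 𝓕 u = g := ⟨F, hFd⟩
  -- `toFunction` is defined by choice; injectivity shows that the chosen class is `F`.
  have hto : toFunction (𝓕 u) = F := by
    rw [toFunction, dif_pos hex]
    congr 1
    exact congrArg _ (toTemperedDistribution_injective (hex.choose_spec.symm.trans hFd))
  rw [hto]
  refine ⟨Lp.aestronglyMeasurable F, ?_, fun ψ ↦ ?_⟩
  · rw [← hgn, Lp.enorm_def]
    refine eLpNorm_congr_ae ?_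
    filter_upwards [Lp.coeFn_lpSMul (r := 2) (hm.toLp (symbol (-s))) g, hm.coeFn_toLp] with ξ h1 h2
    rw [hF, h1, Pi.smul_apply', h2, smul_eq_mul, ← mul_assoc, symbol_mul_symbol_neg, one_mul]
  · rw [hFd, Lp.toTemperedDistribution_apply]
    rfl

/-- The dilation by `(2π)⁻¹` turns the symbol into a power of `⟨ξ⟩`. In dimension two it multiplies
the square of the `L²` norm by `(2π)²`, which the factor `(2π)⁻¹` in `hat` compensates exactly. -/
theorem hat_repr {s : ℕ} (u : 𝓢'(Plane, ℂ)) (h : sobolevNorm s u < ⊤) :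
    AEStronglyMeasurable (hat u) volume ∧
      L2Bd (fun ξ ↦ bracket ξ ^ s * ‖hat u ξ‖) (sobolevNorm s u).toReal ∧
      ∀ ψ : 𝓢(Plane, ℂ), 𝓕 u ψ =
        (2 * Real.pi : ℂ)⁻¹ * ∫ ξ, ψ ((2 * Real.pi)⁻¹ • ξ) * hat u ξ := by
  obtain ⟨h1, h2, h3⟩ := exists_toFunction_repr s.cast_nonneg u h
  have hp := Real.two_pi_pos
  have hp' : (0 : ℝ) < (2 * Real.pi)⁻¹ := by positivity
  have hq := quasiMeasurePreserving_const_smul hp'.ne'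
  have hmeas : AEStronglyMeasurable (hat u) volume :=
    (h1.comp_quasiMeasurePreserving hq).const_mul _
  have hb := contDiff_bracket.continuous
  refine ⟨hmeas, ?_, fun ψ ↦ ?_⟩
  · refine L2Bd.of_sq_le ENNReal.toReal_nonneg ((hb.pow s).aestronglyMeasurable.mul hmeas.norm) ?_
    have hl : L2Bd (fun ξ ↦ symbol s ξ * toFunction (𝓕 u) ξ) (sobolevNorm s u).toReal :=
      ⟨ENNReal.toReal_nonneg,
        (hasTemperateGrowth_symbol _).1.continuous.aestronglyMeasurable.mul h1,
        by rw [h2, ENNReal.ofReal_toReal h.ne]⟩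
    have e : ∀ ξ, ‖bracket ξ ^ s * ‖hat u ξ‖‖ₑ ^ 2 = ENNReal.ofReal ((2 * Real.pi)⁻¹ ^ 2) *
        (fun η ↦ ‖symbol s η * toFunction (𝓕 u) η‖ₑ ^ 2) ((2 * Real.pi)⁻¹ • ξ) := by
      intro ξ
      have r : bracket ξ ^ s * ‖hat u ξ‖ = (2 * Real.pi)⁻¹ *
          ‖symbol s ((2 * Real.pi)⁻¹ • ξ) * toFunction (𝓕 u) ((2 * Real.pi)⁻¹ • ξ)‖ := by
        rw [hat, symbol_natCast, smul_smul, mul_inv_cancel₀ hp.ne', one_smul, norm_mul, norm_mul,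
          norm_inv, Complex.norm_real, Complex.norm_real, Real.norm_eq_abs, Real.norm_eq_abs,
          abs_of_pos hp, abs_of_pos (pow_pos (bracket_pos ξ) s)]
        ring
      rw [r, enorm_mul, enorm_norm, mul_pow, Real.enorm_of_nonneg hp'.le,
        ENNReal.ofReal_pow hp'.le]
    simp_rw [e]
    rw [lintegral_const_mul' _ _ (by simp), lintegral_comp_const_smul hp' (hl.2.1.enorm.pow_const 2),
      ← mul_assoc, ← ENNReal.ofReal_mul (by positivity), mul_inv_cancel₀ (by positivity),
      ENNReal.ofReal_one, one_mul]
    exact hl.lintegral_sq_le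
  · rw [h3]
    have := Measure.integral_comp_smul (volume : Measure Plane)
      (fun ξ ↦ ψ ξ * toFunction (𝓕 u) ξ) (2 * Real.pi)⁻¹
    have e : ∫ ξ, ψ ((2 * Real.pi)⁻¹ • ξ) * hat u ξ =
        (2 * Real.pi : ℂ)⁻¹ * ∫ ξ, (fun ξ ↦ ψ ξ * toFunction (𝓕 u) ξ) ((2 * Real.pi)⁻¹ • ξ) := by
      rw [← integral_const_mul]
      refine integral_congr_ae (ae_of_all _ fun ξ ↦ ?_)
      simp only [hat]
      push_cast
      ring
    rw [e, this, finrank_euclideanSpace_fin, abs_of_pos (by positivity), Complex.real_smul,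
      ← mul_assoc, ← mul_assoc]
    push_cast
    have : (Real.pi : ℂ) ≠ 0 := by exact_mod_cast Real.pi_ne_zero
    field_simp

/-! ### Multiplication by coordinates as differentiation in frequency -/

section

open LineDeriv

variable (u : 𝓢'(Plane, ℂ))

theorem fourier_mulCoord_apply (j : Fin 2) (ψ : 𝓢(Plane, ℂ)) :
    𝓕 u (∂_{unitVec j} ψ) = (2 * Real.pi * Complex.I) * 𝓕 (mulCoord j u) ψ := by
  rw [TemperedDistribution.fourier_apply, TemperedDistribution.fourier_apply, mulCoord, smulLeftCLM_apply_apply, ← smul_eq_mul, ← map_smul]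
  congr 1
  ext ξ
  have hg : (fun x : Plane ↦ ((x j : ℝ) : ℂ)).HasTemperateGrowth :=
    (Complex.ofRealCLM ∘L (EuclideanSpace.proj j : Plane →L[ℝ] ℝ)).hasTemperateGrowth
  rw [fourier_lineDeriv_apply, smul_apply, SchwartzMap.smulLeftCLM_apply_apply hg]
  simp [unitVec, mul_assoc, EuclideanSpace.inner_single_right]

theorem fourier_mulNormSq_apply (ψ : 𝓢(Plane, ℂ)) :
    𝓕 u (Δ ψ : 𝓢(Plane, ℂ)) = -(2 * Real.pi) ^ 2 * 𝓕 (mulNormSq u) ψ := by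
  rw [TemperedDistribution.fourier_apply, TemperedDistribution.fourier_apply, mulNormSq, smulLeftCLM_apply_apply, ← smul_eq_mul, ← map_smul]
  congr 1
  ext ξ
  rw [fourier_laplacian_apply, smul_apply, SchwartzMap.smulLeftCLM_apply_apply (by fun_prop)]
  push_cast
  rw [smul_eq_mul, smul_eq_mul]
  ring

/-- The dilated test function `η ↦ ψ(2πη)` as a complex Schwartz function. -/
theorem exists_dilated (ψ : Plane → ℝ) (hψ : ContDiff ℝ ∞ ψ) (hs : HasCompactSupport ψ) :
    ∃ χ : 𝓢(Plane, ℂ), (∀ ξ, χ ((2 * Real.pi)⁻¹ • ξ) = ψ ξ) ∧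
      (∀ j ξ, (∂_{unitVec j} χ : 𝓢(Plane, ℂ)) ((2 * Real.pi)⁻¹ • ξ) =
        2 * Real.pi * (fderiv ℝ ψ ξ (unitVec j) : ℝ)) ∧
      ∀ ξ, (Δ χ : 𝓢(Plane, ℂ)) ((2 * Real.pi)⁻¹ • ξ) = (2 * Real.pi) ^ 2 * (lapl ψ ξ : ℝ) := by
  have hp := Real.two_pi_pos
  set r := 2 * Real.pi with hr
  have hc : ContDiff ℝ ∞ fun η : Plane ↦ ((ψ (r • η) : ℝ) : ℂ) :=
    Complex.ofRealCLM.contDiff.comp (hψ.comp (contDiff_const_smul r))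
  have hcs : HasCompactSupport fun η : Plane ↦ ((ψ (r • η) : ℝ) : ℂ) :=
    (hs.comp_smul hp.ne').mono fun y hy h0 ↦ hy (by simp only [h0, Complex.ofReal_zero])
  have hrr : ∀ ξ : Plane, r • r⁻¹ • ξ = ξ := fun ξ ↦ by
    rw [smul_smul, mul_inv_cancel₀ hp.ne', one_smul]
  have d : ∀ (g : Plane → ℝ), ContDiff ℝ 1 g → ∀ (c : ℝ) (η v : Plane),
      fderiv ℝ (fun η : Plane ↦ ((c * g (r • η) : ℝ) : ℂ)) η v =
        ((c * (r * fderiv ℝ g (r • η) v) : ℝ) : ℂ) := by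
    intro g hg c η v
    have h1 : HasFDerivAt (fun η : Plane ↦ g (r • η)) (r • fderiv ℝ g (r • η)) η := by
      have h2 : DifferentiableAt ℝ (fun η : Plane ↦ g (r • η)) η :=
        (hg.comp (contDiff_const_smul r)).differentiable (by simp) η
      have h3 := h2.hasFDerivAt
      rwa [fderiv_comp_smul (f := g)] at h3
    have h4 := Complex.ofRealCLM.hasFDerivAt.comp η (h1.const_mul c)
    rw [show (fun η : Plane ↦ ((c * g (r • η) : ℝ) : ℂ)) = Complex.ofRealCLM ∘
      fun η : Plane ↦ c * g (r • η) from rfl, h4.fderiv]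
    simp
  have d0 : ∀ η v, fderiv ℝ (fun η : Plane ↦ ((ψ (r • η) : ℝ) : ℂ)) η v =
      ((r * fderiv ℝ ψ (r • η) v : ℝ) : ℂ) := by
    intro η v
    simpa only [one_mul] using d ψ (hψ.of_le (by norm_cast)) 1 η v
  refine ⟨hcs.toSchwartzMap hc, fun ξ ↦ ?_, fun j ξ ↦ ?_, fun ξ ↦ ?_⟩
  · change ((ψ (r • r⁻¹ • ξ) : ℝ) : ℂ) = _
    rw [hrr]
  · rw [SchwartzMap.lineDerivOp_apply_eq_fderiv]
    change fderiv ℝ (fun η : Plane ↦ ((ψ (r • η) : ℝ) : ℂ)) _ _ = _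
    rw [d0, hrr]
    push_cast [hr]
    rfl
  · rw [coe_laplacian_toSchwartzMap hc hcs]
    simp only [lapl]
    push_cast
    rw [Finset.mul_sum]
    refine Finset.sum_congr rfl fun j _ ↦ ?_
    have h1 := congrArg (fun T : Plane →L[ℝ] ℂ ↦ T (unitVec j))
      (fderiv_fderiv_apply (hc.of_le two_le_infty).contDiffAt (unitVec j) (x := r⁻¹ • ξ)).fderiv
    have h2 := congrArg (fun T : Plane →L[ℝ] ℝ ↦ T (unitVec j))
      (fderiv_fderiv_apply (hψ.of_le two_le_infty).contDiffAt (unitVec j) (x := ξ)).fderiv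
    simp only [ContinuousLinearMap.flip_apply, d0] at h1 h2
    rw [← h1, ← h2, d _ ((contDiff_fderiv_apply hψ _).of_le (by norm_cast)), hrr]
    push_cast [hr]
    ring

/-- The weak gradient of `hat u` has the components `-i · hat (x_j u)` and its weak Laplacian is
`-hat (|x|² u)`. The norm of `Y` contains `|x|²φ` but not the products `x_i x_j φ`, which is why
only the Laplacian, and not the Hessian, is recorded at second order. The dilated test functions
absorb the factors `2π`. -/
theorem weakBd_hat {q : ℕ} {M : ℝ} (h0 : sobolevNorm q u < ⊤)
    (h1 : ∀ j, sobolevNorm (q + 1 : ℕ) (mulCoord j u) < ⊤)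
    (h2 : sobolevNorm (q + 2 : ℕ) (mulNormSq u) < ⊤)
    (hM0 : (sobolevNorm q u).toReal ≤ M)
    (hM1 : ∀ j, (sobolevNorm (q + 1 : ℕ) (mulCoord j u)).toReal ≤ M)
    (hM2 : (sobolevNorm (q + 2 : ℕ) (mulNormSq u)).toReal ≤ M) : WeakBd q (hat u) M := by
  obtain ⟨m0, l0, r0⟩ := hat_repr u h0
  have hpi : (Real.pi : ℂ) ≠ 0 := by exact_mod_cast Real.pi_ne_zero
  refine ⟨m0, l0.le hM0, fun j ↦ ?_, ?_⟩
  · obtain ⟨m1, l1, r1⟩ := hat_repr _ (h1 j)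
    refine ⟨fun ξ ↦ -Complex.I * hat (mulCoord j u) ξ, ?_, fun ψ hψ hs ↦ ?_⟩
    · simpa using l1.le (hM1 j)
    · obtain ⟨χ, e0, e1, -⟩ := exists_dilated ψ hψ hs
      have h := fourier_mulCoord_apply u j χ
      rw [r0, r1] at h
      simp only [e0, e1] at h
      have a1 : ∫ ξ, 2 * Real.pi * (fderiv ℝ ψ ξ (unitVec j) : ℝ) * hat u ξ =
          2 * Real.pi * ∫ ξ, fderiv ℝ ψ ξ (unitVec j) • hat u ξ := by
        rw [← integral_const_mul]
        refine integral_congr_ae (ae_of_all _ fun ξ ↦ ?_)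
        simp only [Complex.real_smul]; ring
      have a2 : ∫ ξ, ψ ξ • (-Complex.I * hat (mulCoord j u) ξ) =
          -Complex.I * ∫ ξ, (ψ ξ : ℂ) * hat (mulCoord j u) ξ := by
        rw [← integral_const_mul]
        refine integral_congr_ae (ae_of_all _ fun ξ ↦ ?_)
        simp only [Complex.real_smul]; ring
      rw [a1] at h
      rw [a2]
      field_simp at h
      rw [h]
      ring
  · obtain ⟨m2, l2, r2⟩ := hat_repr _ h2
    refine ⟨fun ξ ↦ -hat (mulNormSq u) ξ, ?_, fun ψ hψ hs ↦ ?_⟩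
    · simpa using l2.le hM2
    · obtain ⟨χ, e0, -, e2⟩ := exists_dilated ψ hψ hs
      have h := fourier_mulNormSq_apply u χ
      rw [r0, r2] at h
      simp only [e0, e2] at h
      have a1 : ∫ ξ, (2 * Real.pi : ℂ) ^ 2 * (lapl ψ ξ : ℝ) * hat u ξ =
          (2 * Real.pi) ^ 2 * ∫ ξ, lapl ψ ξ • hat u ξ := by
        rw [← integral_const_mul]
        refine integral_congr_ae (ae_of_all _ fun ξ ↦ ?_)
        simp only [Complex.real_smul]; ring
      have a2 : ∫ ξ, ψ ξ • (-hat (mulNormSq u) ξ) =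
          -∫ ξ, (ψ ξ : ℂ) * hat (mulNormSq u) ξ := by
        rw [← integral_neg]
        refine integral_congr_ae (ae_of_all _ fun ξ ↦ ?_)
        simp only [Complex.real_smul]; ring
      rw [a1] at h
      rw [a2]
      field_simp at h
      rw [h]

end

/-! ### The amplitude and its smooth approximations -/

/-- The complex amplitude `P₁ + i Q₁`. -/
def amp (φ₀ φ₁ : 𝓢'(Plane, ℂ)) (μ : Plane) : ℂ := ⟨P₁ φ₀ φ₁ μ, Q₁ φ₀ φ₁ μ⟩

/-- This form is complex linear in the data: `amp = i⟨μ⟩² φ̂₀ - ⟨μ⟩ φ̂₁`, so the weighted bounds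
transfer term by term. -/
theorem amp_eq (φ₀ φ₁ : 𝓢'(Plane, ℂ)) (μ : Plane) : amp φ₀ φ₁ μ =
    bracket μ ^ 2 • (Complex.I * hat φ₀ μ) + bracket μ • (-1 * hat φ₁ μ) := by
  apply Complex.ext
  · rw [Complex.add_re, Complex.smul_re, Complex.smul_re]
    simp [amp, P₁]
    ring
  · rw [Complex.add_im, Complex.smul_im, Complex.smul_im]
    simp [amp, Q₁]
    ring

/-- The regularities 2, 3, 4 of `φ₀` and 1, 2, 3 of `φ₁` are the weights `q, q+1, q+2` with `q = 2`
and `q = 1`. The factors `⟨μ⟩²` and `⟨μ⟩` in the amplitude use them up and leave `q = 0` for both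
terms. The 14 is the constant 7 of the product rule times the constant 2 of the weights. -/
theorem exists_amp_approx : ∃ C : ℝ, 0 ≤ C ∧ ∀ φ₀ φ₁ : 𝓢'(Plane, ℂ), MemY φ₀ φ₁ →
    AEStronglyMeasurable (amp φ₀ φ₁) volume ∧ ∃ F : ℕ → Plane → ℂ,
      (∀ k, ContDiff ℝ ∞ (F k)) ∧ (∀ k, HasCompactSupport (F k)) ∧
      (∀ k, WBd 0 (F k) (C * (normY φ₀ φ₁).toReal)) ∧
      ∀ᵐ x, Tendsto (fun k ↦ F k x) atTop (𝓝 (amp φ₀ φ₁ x)) := by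
  obtain ⟨C, hC, H⟩ := exists_approx
  refine ⟨14 * C 2 + 14 * C 1, by linarith [hC 1, hC 2], fun φ₀ φ₁ hY ↦ ?_⟩
  have hle : ∀ a : ℝ≥0∞, a ≤ normY φ₀ φ₁ → a < ⊤ ∧ a.toReal ≤ (normY φ₀ φ₁).toReal :=
    fun a ha ↦ ⟨ha.trans_lt hY, ENNReal.toReal_mono hY.ne ha⟩
  have t0 := hle (sobolevNorm 2 φ₀) (by unfold normY; rw [add_assoc, add_assoc]; exact le_self_add)
  have t1 : ∀ j, _ := fun j ↦ hle (sobolevNorm 3 (mulCoord j φ₀)) (by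
    unfold normY
    refine (Finset.single_le_sum (f := fun j ↦ sobolevNorm 3 (mulCoord j φ₀))
      (fun _ _ ↦ zero_le) (Finset.mem_univ j)).trans ?_
    exact le_add_self.trans (le_self_add.trans le_self_add))
  have t2 := hle (sobolevNorm 4 (mulNormSq φ₀)) (le_add_self.trans le_self_add)
  have s0 := hle (sobolevNorm 1 φ₁) ((le_self_add.trans le_self_add).trans le_add_self)
  have s1 : ∀ j, _ := fun j ↦ hle (sobolevNorm 2 (mulCoord j φ₁)) (by
    unfold normY
    refine (Finset.single_le_sum (f := fun j ↦ sobolevNorm 2 (mulCoord j φ₁))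
      (fun _ _ ↦ zero_le) (Finset.mem_univ j)).trans ?_
    exact (le_add_self.trans le_self_add).trans le_add_self)
  have s2 := hle (sobolevNorm 3 (mulNormSq φ₁)) (le_add_self.trans le_add_self)
  set Y := (normY φ₀ φ₁).toReal
  have w0 : WeakBd 2 (hat φ₀) Y := by
    refine weakBd_hat φ₀ ?_ (fun j ↦ ?_) ?_ ?_ (fun j ↦ ?_) ?_ <;> norm_num
    exacts [t0.1, (t1 j).1, t2.1, t0.2, (t1 j).2, t2.2]
  have w1 : WeakBd 1 (hat φ₁) Y := by
    refine weakBd_hat φ₁ ?_ (fun j ↦ ?_) ?_ ?_ (fun j ↦ ?_) ?_ <;> norm_num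
    exacts [s0.1, (s1 j).1, s2.1, s0.2, (s1 j).2, s2.2]
  have hb := contDiff_bracket.continuous
  obtain ⟨F, F1, F2, F3, F4⟩ := H 2 _ _ w0
  obtain ⟨G, G1, G2, G3, G4⟩ := H 1 _ _ w1
  refine ⟨?_, fun k x ↦ bracket x ^ 2 • (Complex.I * F k x) + bracket x • (-1 * G k x),
    fun k ↦ ?_, fun k ↦ ?_, fun k ↦ ?_, ?_⟩
  · rw [show amp φ₀ φ₁ = _ from funext (amp_eq φ₀ φ₁)]
    exact ((hb.pow 2).aestronglyMeasurable.smul (w0.meas.const_mul _)).add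
      (hb.aestronglyMeasurable.smul (w1.meas.const_mul _))
  · exact ((contDiff_bracket.pow 2).smul (contDiff_const.mul (F1 k))).add
      (contDiff_bracket.smul (contDiff_const.mul (G1 k)))
  · have h1 : HasCompactSupport fun x ↦ bracket x ^ 2 • (Complex.I * F k x) :=
      (F2 k).mono fun y hy h0 ↦ hy (by simp only [h0, mul_zero, smul_zero])
    have h2 : HasCompactSupport fun x ↦ bracket x • (-1 * G k x) :=
      (G2 k).mono fun y hy h0 ↦ hy (by simp only [h0, mul_zero, smul_zero])
    exact h1.add h2
  · have a1 := WBd.smul (q := 0) (F3 k |>.const_mul (F1 k) Complex.I)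
      (contDiff_const.mul (F1 k)) zero_le_two isWeight_bracket_sq
    have a2 := WBd.smul (q := 0) (G3 k |>.const_mul (G1 k) (-1))
      (contDiff_const.mul (G1 k)) zero_le_two isWeight_bracket
    refine (a1.add a2 (isWeight_bracket_sq.contDiff.smul (contDiff_const.mul (F1 k)))
      (contDiff_bracket.smul (contDiff_const.mul (G1 k)))).le (le_of_eq ?_)
    simp only [Complex.norm_I, norm_neg, norm_one]
    ring
  · filter_upwards [F4, G4] with x h1 h2
    rw [amp_eq]
    exact ((h1.const_mul _).const_smul _).add ((h2.const_mul _).const_smul _)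

/-! ### The power series of the second approximation -/

theorem coeff_zero : coeff 0 = 0 := by simp [coeff]

theorem coeff_one : coeff 1 = 0 := by simp [coeff]

/-- The coefficient decays like `n⁻⁵`; the cruder `n⁻⁴` already makes `∑ n² |c_n|` finite, as two
derivatives of the series require. -/
theorem abs_coeff_le {n : ℕ} (hn : 3 ≤ n) : (n : ℝ) ^ 2 * |coeff n| ≤ 8 / (n : ℝ) ^ 2 := by
  have hn' : (3 : ℝ) ≤ n := by exact_mod_cast hn
  by_cases ho : Odd n
  · rw [coeff, if_pos ho, abs_div, abs_mul, abs_of_pos (by norm_num : (0 : ℝ) < 8)]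
    have hpi := Real.pi_gt_three
    have h1 : (n : ℝ) ^ 2 / 2 ≤ (n : ℝ) ^ 2 - 4 := by nlinarith
    have h2 : (n : ℝ) ^ 2 / 2 ≤ (n : ℝ) ^ 2 - 1 := by nlinarith
    have h4 : (n : ℝ) ^ 4 ≤ Real.pi * n * ((n : ℝ) ^ 2 - 1) * ((n : ℝ) ^ 2 - 4) := by
      -- The factor 9 outweighs the factor 4 lost by replacing `n² - 1` and `n² - 4` with `n²/2`.
      have h3 : 9 ≤ Real.pi * n := by nlinarith
      calc (n : ℝ) ^ 4 ≤ 9 * ((n : ℝ) ^ 2 / 2) * ((n : ℝ) ^ 2 / 2) := by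
            nlinarith [pow_nonneg (by linarith : (0 : ℝ) ≤ n) 4]
        _ ≤ Real.pi * n * ((n : ℝ) ^ 2 - 1) * ((n : ℝ) ^ 2 - 4) := by
            have : 0 ≤ (n : ℝ) ^ 2 / 2 := by positivity
            exact mul_le_mul (mul_le_mul h3 h2 this (by positivity)) h1 this
              (mul_nonneg (by positivity) (this.trans h2))
    have h5 : (0 : ℝ) < (n : ℝ) ^ 4 := by positivity
    rw [abs_of_pos (h5.trans_le h4)]
    calc _ ≤ (n : ℝ) ^ 2 * (8 * 1 / (n : ℝ) ^ 4) := by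
          gcongr; exact Real.abs_sin_le_one _
      _ = _ := by field_simp
  · rw [coeff, if_neg ho, abs_zero, mul_zero]
    positivity

theorem summable_sq_mul_coeff : Summable fun n : ℕ ↦ (n : ℝ) ^ 2 * |coeff n| := by
  have h : Summable fun n : ℕ ↦ 8 / (n : ℝ) ^ 2 := by
    simpa [div_eq_mul_inv] using (Real.summable_nat_pow_inv.2 one_lt_two).mul_left 8
  refine Summable.of_norm_bounded_eventually_nat h ?_
  filter_upwards [eventually_ge_atTop 3] with n hn
  rw [Real.norm_of_nonneg (by positivity)]
  exact abs_coeff_le hn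

/-- The sum of the absolute values of the coefficients, with two powers of `n`. -/
def coeffSum : ℝ := ∑' n : ℕ, (n : ℝ) ^ 2 * |coeff n|

theorem coeffSum_nonneg : 0 ≤ coeffSum := tsum_nonneg fun n ↦ by positivity

theorem pow_mul_coeff_le {j : ℕ} (hj : j ≤ 2) (n : ℕ) :
    (n : ℝ) ^ j * |coeff n| ≤ (n : ℝ) ^ 2 * |coeff n| := by
  rcases Nat.eq_zero_or_pos n with rfl | hn
  · simp [coeff_zero]
  · have : (1 : ℝ) ≤ n := by exact_mod_cast hn
    gcongr

/-- The power series `∑ n^j c_n z^n`. -/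
def kk (j : ℕ) (z : ℂ) : ℂ := ∑' n : ℕ, (((n : ℝ) ^ j * coeff n : ℝ) : ℂ) * z ^ n

/-- The coefficients of `1` and `z` vanish, so every term carries at least `z²`. -/
theorem norm_kk_term_le {j : ℕ} (hj : j ≤ 2) {z : ℂ} (hz : ‖z‖ ≤ 1) (n : ℕ) :
    ‖(((n : ℝ) ^ j * coeff n : ℝ) : ℂ) * z ^ n‖ ≤ (n : ℝ) ^ 2 * |coeff n| * ‖z‖ ^ 2 := by
  rw [norm_mul, norm_pow, Complex.norm_real, norm_mul, Real.norm_eq_abs, Real.norm_eq_abs,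
    abs_of_nonneg (by positivity)]
  rcases n with _ | _ | n
  · simp [coeff_zero]
  · simp [coeff_one]
  · exact mul_le_mul (pow_mul_coeff_le hj _)
      (pow_le_pow_of_le_one (norm_nonneg _) hz (by omega)) (by positivity) (by positivity)

theorem norm_kk_term_le' {j : ℕ} (hj : j ≤ 2) {z : ℂ} (hz : ‖z‖ ≤ 1) (n : ℕ) :
    ‖(((n : ℝ) ^ j * coeff n : ℝ) : ℂ) * z ^ n‖ ≤ (n : ℝ) ^ 2 * |coeff n| :=
  (norm_kk_term_le hj hz n).trans (mul_le_of_le_one_right (by positivity)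
    (pow_le_one₀ (norm_nonneg _) hz))

theorem summable_kk {j : ℕ} (hj : j ≤ 2) {z : ℂ} (hz : ‖z‖ ≤ 1) :
    Summable fun n : ℕ ↦ (((n : ℝ) ^ j * coeff n : ℝ) : ℂ) * z ^ n :=
  Summable.of_norm_bounded summable_sq_mul_coeff (norm_kk_term_le' hj hz)

theorem norm_kk_le {j : ℕ} (hj : j ≤ 2) {z : ℂ} (hz : ‖z‖ ≤ 1) : ‖kk j z‖ ≤ coeffSum * ‖z‖ ^ 2 :=
  tsum_of_norm_bounded (summable_sq_mul_coeff.hasSum.mul_right _) (norm_kk_term_le hj hz)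

theorem continuousOn_kk {j : ℕ} (hj : j ≤ 2) : ContinuousOn (kk j) (Metric.closedBall 0 1) :=
  continuousOn_tsum (fun n ↦ by fun_prop) summable_sq_mul_coeff fun n z hz ↦
    norm_kk_term_le' hj (by simpa using hz) n

theorem norm_exp_neg_I_mul (θ : ℝ) : ‖Complex.exp (-Complex.I * θ)‖ = 1 := by
  rw [Complex.norm_exp]; simp

theorem hasDerivAt_exp_neg_I (θ : ℝ) :
    HasDerivAt (fun θ : ℝ ↦ Complex.exp (-Complex.I * θ))
      (-Complex.I * Complex.exp (-Complex.I * θ)) θ := by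
  have h1 : HasDerivAt (fun θ : ℝ ↦ -Complex.I * (θ : ℂ)) (-Complex.I * 1) θ :=
    Complex.ofRealCLM.hasDerivAt.const_mul (-Complex.I)
  convert! h1.cexp using 1
  ring

/-- Rotating `z` multiplies the `n`-th term by `e^{-inθ}`, and summability of `n² |c_n|` permits
termwise differentiation on the whole closed disc. Complex differentiability will be used in the
open disc only; the amplitude of the solution sits on the circle, and rotation is all that time
derivatives need. -/
theorem hasDerivAt_kk_rotate {j : ℕ} (hj : j ≤ 1) {z : ℂ} (hz : ‖z‖ ≤ 1) (θ : ℝ) :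
    HasDerivAt (fun θ : ℝ ↦ kk j (z * Complex.exp (-Complex.I * θ)))
      (-Complex.I * kk (j + 1) (z * Complex.exp (-Complex.I * θ))) θ := by
  have hn : ∀ θ : ℝ, ‖z * Complex.exp (-Complex.I * θ)‖ ≤ 1 := fun θ ↦ by
    rw [norm_mul, norm_exp_neg_I_mul, mul_one]; exact hz
  have h := hasDerivAt_tsum (u := fun n : ℕ ↦ (n : ℝ) ^ 2 * |coeff n|)
    (g := fun (n : ℕ) (θ : ℝ) ↦
      (((n : ℝ) ^ j * coeff n : ℝ) : ℂ) * (z * Complex.exp (-Complex.I * θ)) ^ n)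
    (g' := fun (n : ℕ) (θ : ℝ) ↦ -Complex.I *
      ((((n : ℝ) ^ (j + 1) * coeff n : ℝ) : ℂ) * (z * Complex.exp (-Complex.I * θ)) ^ n))
    summable_sq_mul_coeff (fun n θ ↦ ?_) (fun n θ ↦ ?_)
    (summable_kk (by omega) (hn 0)) θ
  · rw [tsum_mul_left] at h
    exact h
  · have h1 := (((hasDerivAt_exp_neg_I θ).const_mul z).pow n).const_mul
      (((n : ℝ) ^ j * coeff n : ℝ) : ℂ)
    convert! h1 using 1
    rcases n with _ | n
    · simp
    · push_cast
      ring
  · rw [norm_mul, norm_neg, Complex.norm_I, one_mul]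
    exact norm_kk_term_le' (by omega) (hn θ) n

/-- The first and second derivatives of the power series `∑ c_n z^n`. -/
def kd (i : ℕ) (z : ℂ) : ℂ := ∑' n : ℕ, ((n.descFactorial i * coeff n : ℝ) : ℂ) * z ^ (n - i)

theorem norm_kd_term_le {i : ℕ} (hi : i ≤ 2) {z : ℂ} (hz : ‖z‖ ≤ 1) (n : ℕ) :
    ‖((n.descFactorial i * coeff n : ℝ) : ℂ) * z ^ (n - i)‖ ≤ (n : ℝ) ^ 2 * |coeff n| := by
  rw [norm_mul, norm_pow, Complex.norm_real, norm_mul, Real.norm_eq_abs, Real.norm_eq_abs,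
    abs_of_nonneg (by positivity)]
  refine (mul_le_of_le_one_right (by positivity) (pow_le_one₀ (norm_nonneg _) hz)).trans ?_
  refine le_trans ?_ (pow_mul_coeff_le hi n)
  gcongr
  exact_mod_cast Nat.descFactorial_le_pow n i

theorem norm_kd_le {i : ℕ} (hi : i ≤ 2) {z : ℂ} (hz : ‖z‖ ≤ 1) : ‖kd i z‖ ≤ coeffSum :=
  tsum_of_norm_bounded summable_sq_mul_coeff.hasSum (norm_kd_term_le hi hz)

theorem kd_zero : kd 0 = kk 0 := by
  funext z
  simp [kd, kk]

theorem hasDerivAt_kd {i : ℕ} (hi : i ≤ 1) {z : ℂ} (hz : ‖z‖ < 1) :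
    HasDerivAt (kd i) (kd (i + 1) z) z := by
  refine hasDerivAt_tsum_of_isPreconnected (𝕜 := ℂ) (F := ℂ) (t := Metric.ball (0 : ℂ) 1) (y₀ := 0)
    (g := fun (n : ℕ) (z : ℂ) ↦ ((n.descFactorial i * coeff n : ℝ) : ℂ) * z ^ (n - i))
    (g' := fun (n : ℕ) (z : ℂ) ↦ ((n.descFactorial (i + 1) * coeff n : ℝ) : ℂ) * z ^ (n - (i + 1)))
    summable_sq_mul_coeff Metric.isOpen_ball (convex_ball (0 : ℂ) 1).isPreconnected
    (fun n y _ ↦ ?_) (fun n y hy ↦ ?_) (by simp) ?_ (by simpa using hz)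
  · have h := (hasDerivAt_pow (n - i) y).const_mul ((n.descFactorial i * coeff n : ℝ) : ℂ)
    convert! h using 1
    rw [Nat.descFactorial_succ, Nat.sub_sub]
    push_cast
    ring
  · exact norm_kd_term_le (by omega) (by simpa using (Metric.mem_ball.1 hy).le) n
  · exact Summable.of_norm_bounded summable_sq_mul_coeff
      (norm_kd_term_le (by omega) (by simp))

/-! ### The Fourier series of `|cos| cos` -/

theorem intervalIntegral_cexp {c : ℤ} (hc : c ≠ 0) :
    ∫ x in (-(Real.pi / 2))..(Real.pi / 2), Complex.exp (Complex.I * c * x) =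
      ((2 * Real.sin (c * (Real.pi / 2)) / c : ℝ) : ℂ) := by
  have hc' : Complex.I * (c : ℂ) ≠ 0 := mul_ne_zero Complex.I_ne_zero (by exact_mod_cast hc)
  rw [integral_exp_mul_complex hc']
  push_cast
  rw [Complex.sin]
  have hI : (c : ℂ) ≠ 0 := by exact_mod_cast hc
  have e1 : Complex.I * c * (Real.pi / 2) = c * (Real.pi / 2) * Complex.I := by ring
  have e2 : Complex.I * c * (-(Real.pi / 2)) = -(c * (Real.pi / 2)) * Complex.I := by ring
  rw [e1, e2]
  field_simp
  rw [Complex.I_sq]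
  ring

/-- The Fourier coefficients of `|cos| cos`. -/
def absCosCoeff (n : ℤ) : ℝ :=
  if Odd n then -4 * Real.sin (n / 2 * Real.pi) / (Real.pi * n * ((n : ℝ) ^ 2 - 4)) else 0

/-- Expand `cos² x = 1/2 + (e^{2ix} + e^{-2ix})/4`. For odd `n` none of the frequencies `-n`, `2 -
n`, `-n - 2` is zero, so three elementary integrals remain. -/
theorem integral_cos_sq_mul_cexp {n : ℤ} (hn : Odd n) :
    ∫ x in (-(Real.pi / 2))..(Real.pi / 2),
      (Real.cos x : ℂ) ^ 2 * Complex.exp (Complex.I * (-n : ℤ) * x) =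
      ((Real.pi * absCosCoeff n : ℝ) : ℂ) := by
  have h0 : (-n) ≠ 0 := by rintro h; rw [neg_eq_zero] at h; subst h; simp at hn
  have h1 : (2 - n) ≠ 0 := by
    intro h; obtain rfl : n = 2 := by omega
    exact absurd hn (by decide)
  have h2 : (-n - 2) ≠ 0 := by
    intro h; obtain rfl : n = -2 := by omega
    exact absurd hn (by decide)
  have e : ∀ x : ℝ, (Real.cos x : ℂ) ^ 2 * Complex.exp (Complex.I * (-n : ℤ) * x) =
      (1 / 2) * Complex.exp (Complex.I * (-n : ℤ) * x)
      + (1 / 4) * Complex.exp (Complex.I * (2 - n : ℤ) * x)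
      + (1 / 4) * Complex.exp (Complex.I * (-n - 2 : ℤ) * x) := by
    intro x
    rw [Complex.ofReal_cos, Complex.cos]
    have a1 : Complex.exp (Complex.I * (2 - n : ℤ) * x) =
        Complex.exp (x * Complex.I) ^ 2 * Complex.exp (Complex.I * (-n : ℤ) * x) := by
      rw [← Complex.exp_nat_mul, ← Complex.exp_add]; congr 1; push_cast; ring
    have a2 : Complex.exp (Complex.I * (-n - 2 : ℤ) * x) =
        Complex.exp (-x * Complex.I) ^ 2 * Complex.exp (Complex.I * (-n : ℤ) * x) := by
      rw [← Complex.exp_nat_mul, ← Complex.exp_add]; congr 1; push_cast; ring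
    have a3 : Complex.exp (x * Complex.I) * Complex.exp (-x * Complex.I) = 1 := by
      rw [← Complex.exp_add]; simp
    rw [a1, a2]
    linear_combination (1 / 2) * Complex.exp (Complex.I * (-n : ℤ) * x) * a3
  have hi : ∀ (c : ℂ) (k : ℤ), IntervalIntegrable
      (fun x : ℝ ↦ c * Complex.exp (Complex.I * k * x)) volume (-(Real.pi / 2)) (Real.pi / 2) :=
    fun c k ↦ Continuous.intervalIntegrable (by fun_prop) _ _
  simp_rw [e]
  rw [intervalIntegral.integral_add ((hi _ _).add (hi _ _)) (hi _ _),
    intervalIntegral.integral_add (hi _ _) (hi _ _), intervalIntegral.integral_const_mul,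
    intervalIntegral.integral_const_mul, intervalIntegral.integral_const_mul,
    intervalIntegral_cexp h0, intervalIntegral_cexp h1, intervalIntegral_cexp h2,
    absCosCoeff, if_pos hn]
  have s1 : Real.sin (((-n : ℤ) : ℝ) * (Real.pi / 2)) = -Real.sin (n / 2 * Real.pi) := by
    rw [← Real.sin_neg]; congr 1; push_cast; ring
  have s2 : Real.sin (((2 - n : ℤ) : ℝ) * (Real.pi / 2)) = Real.sin (n / 2 * Real.pi) := by
    rw [← Real.sin_pi_sub]; congr 1; push_cast; ring
  have s3 : Real.sin (((-n - 2 : ℤ) : ℝ) * (Real.pi / 2)) = Real.sin (n / 2 * Real.pi) := by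
    rw [show ((-n - 2 : ℤ) : ℝ) * (Real.pi / 2) = -(n / 2 * Real.pi + Real.pi) by push_cast; ring,
      Real.sin_neg, Real.sin_add_pi, neg_neg]
  rw [s1, s2, s3]
  have r0 : (n : ℝ) ≠ 0 := by exact_mod_cast neg_ne_zero.1 h0
  have r1 : (2 - n : ℝ) ≠ 0 := by exact_mod_cast h1
  have r2 : (-n - 2 : ℝ) ≠ 0 := by exact_mod_cast h2
  have r3 : ((n : ℝ) ^ 2 - 4) = (2 - n) * (-n - 2) := by ring
  have hpi := Real.pi_ne_zero
  have e4 : (1 / 2 : ℂ) = ((1 / 2 : ℝ) : ℂ) := by push_cast; rfl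
  have e5 : (1 / 4 : ℂ) = ((1 / 4 : ℝ) : ℂ) := by push_cast; rfl
  rw [e4, e5, ← Complex.ofReal_mul, ← Complex.ofReal_mul, ← Complex.ofReal_mul,
    ← Complex.ofReal_add, ← Complex.ofReal_add]
  congr 1
  push_cast
  rw [r3]
  field_simp
  ring

/-- `|cos| cos` on the circle. -/
def absCos : C(AddCircle (2 * Real.pi), ℂ) where
  toFun θ := ((|Real.Angle.cos θ| * Real.Angle.cos θ : ℝ) : ℂ)
  continuous_toFun := Complex.continuous_ofReal.comp
    (Real.Angle.continuous_cos.abs.mul Real.Angle.continuous_cos)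

theorem absCos_coe (x : ℝ) :
    absCos (x : AddCircle (2 * Real.pi)) = ((|Real.cos x| * Real.cos x : ℝ) : ℂ) := rfl

local instance factTwoPiPos : Fact (0 < 2 * Real.pi) := ⟨Real.two_pi_pos⟩

theorem fourier_two_pi (n : ℤ) (x : ℝ) :
    fourier n (x : AddCircle (2 * Real.pi)) = Complex.exp (Complex.I * n * x) := by
  rw [fourier_coe_apply]
  congr 1
  have : (Real.pi : ℂ) ≠ 0 := by exact_mod_cast Real.pi_ne_zero
  push_cast
  field_simp

/-- On `[-π/2, π/2]` the function is `cos²`, and a shift by `π` changes its sign while multiplying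
the exponential by `(-1)^n`. The two half periods thus add up for odd `n` and cancel for even `n`.
-/
theorem fourierCoeff_absCos (n : ℤ) : fourierCoeff absCos n = (absCosCoeff n : ℂ) := by
  have hpi := Real.pi_pos
  rw [fourierCoeff_eq_intervalIntegral _ _ (-(Real.pi / 2))]
  simp only [fourier_two_pi, absCos_coe, smul_eq_mul]
  set F : ℝ → ℂ := fun x ↦
    Complex.exp (Complex.I * (-n : ℤ) * x) * ((|Real.cos x| * Real.cos x : ℝ) : ℂ) with hF
  have hc : Continuous F := by fun_prop
  have hI1 : ∫ x in (-(Real.pi / 2))..(Real.pi / 2), F x =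
      ∫ x in (-(Real.pi / 2))..(Real.pi / 2),
        (Real.cos x : ℂ) ^ 2 * Complex.exp (Complex.I * (-n : ℤ) * x) := by
    refine intervalIntegral.integral_congr fun x hx ↦ ?_
    rw [Set.uIcc_of_le (by linarith)] at hx
    simp only [hF]
    rw [abs_of_nonneg (Real.cos_nonneg_of_mem_Icc hx)]
    push_cast; ring
  have hshift : ∀ x : ℝ, F (x + Real.pi) = -(-1) ^ n * F x := by
    intro x
    simp only [hF]
    rw [Real.cos_add_pi, abs_neg]
    have : Complex.exp (Complex.I * (-n : ℤ) * ((x + Real.pi : ℝ) : ℂ)) =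
        (-1) ^ n * Complex.exp (Complex.I * (-n : ℤ) * x) := by
      rw [← Complex.exp_pi_mul_I, ← Complex.exp_int_mul, ← Complex.exp_add,
        show Complex.I * ((-n : ℤ) : ℂ) * ((x + Real.pi : ℝ) : ℂ) =
          n * (Real.pi * Complex.I) + Complex.I * (-n : ℤ) * x
            + ((-n : ℤ) : ℂ) * (2 * Real.pi * Complex.I) by push_cast; ring,
        Complex.exp_add, Complex.exp_int_mul_two_pi_mul_I, mul_one]
    rw [this]
    push_cast; ring
  have hI2 : ∫ x in (Real.pi / 2)..(-(Real.pi / 2) + 2 * Real.pi), F x =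
      -(-1) ^ n * ∫ x in (-(Real.pi / 2))..(Real.pi / 2), F x := by
    rw [← intervalIntegral.integral_const_mul]
    simp_rw [← hshift]
    rw [intervalIntegral.integral_comp_add_right]
    congr 1 <;> ring
  rw [← intervalIntegral.integral_add_adjacent_intervals (hc.intervalIntegrable _ (Real.pi / 2))
    (hc.intervalIntegrable _ _), hI2, hI1]
  rcases Int.even_or_odd n with he | ho
  · rw [he.neg_one_zpow, absCosCoeff, if_neg (by simpa using he)]
    simp
  · rw [ho.neg_one_zpow, integral_cos_sq_mul_cexp ho]
    rw [Complex.real_smul]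
    have : (Real.pi : ℂ) ≠ 0 := by exact_mod_cast Real.pi_ne_zero
    push_cast
    field_simp
    ring

theorem abs_absCosCoeff_le (n : ℤ) : |absCosCoeff n| ≤ 4 * (1 / |(n : ℝ)| ^ (2 : ℝ)) := by
  rw [absCosCoeff]
  split_ifs with h
  · have hpi := Real.pi_gt_three
    have h1 : 1 ≤ |(n : ℝ)| := by
      have : n ≠ 0 := by rintro rfl; simp at h
      exact_mod_cast Int.one_le_abs this
    -- The factor 3 is absorbed by `π > 3`. The value `|n| = 1`, where `n² - 4` is negative, is
    -- checked separately.
    have h2 : |(n : ℝ)| ≤ 3 * |(n : ℝ) ^ 2 - 4| := by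
      have hsq := sq_abs (n : ℝ)
      by_cases h3 : 3 ≤ |(n : ℝ)|
      · have := le_abs_self ((n : ℝ) ^ 2 - 4)
        nlinarith
      · have : |n| < 3 := by exact_mod_cast not_le.1 h3
        have h5 := abs_lt.1 this
        have h6 : |n| = 1 := by
          obtain ⟨k, rfl⟩ := h
          have : k = 0 ∨ k = -1 := by omega
          rcases this with rfl | rfl <;> rfl
        have h7 : |(n : ℝ)| = 1 := by exact_mod_cast h6
        rw [← hsq, h7]; norm_num
    have h8 : |(n : ℝ)| ^ 2 ≤ Real.pi * |(n : ℝ)| * |(n : ℝ) ^ 2 - 4| := by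
      have := mul_le_mul_of_nonneg_left h2 (abs_nonneg (n : ℝ))
      nlinarith [mul_nonneg (abs_nonneg (n : ℝ)) (abs_nonneg ((n : ℝ) ^ 2 - 4))]
    have h9 : (0 : ℝ) < |(n : ℝ)| ^ 2 := by positivity
    rw [abs_div, abs_mul, abs_mul, abs_mul, abs_of_pos Real.pi_pos, Real.rpow_two,
      mul_one_div]
    have h10 : |(-4 : ℝ)| * |Real.sin (n / 2 * Real.pi)| ≤ 4 := by
      rw [abs_neg, Nat.abs_ofNat]
      exact mul_le_of_le_one_right (by norm_num) (Real.abs_sin_le_one _)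
    exact div_le_div₀ (by norm_num) h10 h9 h8
  · rw [abs_zero]; positivity

theorem hasSum_absCos (x : ℝ) : HasSum (fun n : ℤ ↦ (absCosCoeff n : ℂ) *
    Complex.exp (Complex.I * n * x)) ((|Real.cos x| * Real.cos x : ℝ) : ℂ) := by
  have hs : Summable (fourierCoeff absCos) := by
    refine Summable.of_norm_bounded
      ((Real.summable_one_div_int_add_rpow 0 2).2 one_lt_two |>.mul_left 4) fun n ↦ ?_
    rw [fourierCoeff_absCos, Complex.norm_real, Real.norm_eq_abs, add_zero]
    exact abs_absCosCoeff_le n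
  have h := has_pointwise_sum_fourier_series_of_summable hs (x : AddCircle (2 * Real.pi))
  simpa only [fourierCoeff_absCos, fourier_two_pi, absCos_coe, smul_eq_mul] using h

theorem absCosCoeff_neg (n : ℤ) : absCosCoeff (-n) = absCosCoeff n := by
  unfold absCosCoeff
  by_cases h : Odd n
  · rw [if_pos h, if_pos h.neg]
    push_cast
    rw [show -(n : ℝ) / 2 * Real.pi = -(n / 2 * Real.pi) by ring, Real.sin_neg, neg_sq]
    rw [show Real.pi * -(n : ℝ) * ((n : ℝ) ^ 2 - 4) = -(Real.pi * n * ((n : ℝ) ^ 2 - 4)) by ring,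
      show -4 * -Real.sin (n / 2 * Real.pi) = -(-4 * Real.sin (n / 2 * Real.pi)) by ring,
      neg_div_neg_eq]
  · rw [if_neg h, if_neg fun h' ↦ h (by simpa using h'.neg)]

/-- The reason for the choice of `coeff`: multiplied by `1 - n²`, the value of `∂² + 1` on the
`n`-th harmonic, it is the `n`-th cosine coefficient of `|cos| cos`. At `n = 1` this factor
vanishes, and the resonant coefficient `8/(3π)` is left over for the phase correction. -/
theorem two_mul_absCosCoeff (n : ℕ) : 2 * absCosCoeff n =
    (1 - (n : ℝ) ^ 2) * coeff n + if n = 1 then 8 / (3 * Real.pi) else 0 := by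
  by_cases h1 : n = 1
  · subst h1
    rw [coeff_one, if_pos rfl, absCosCoeff, if_pos (by decide)]
    push_cast
    rw [show (1 / 2 * Real.pi : ℝ) = Real.pi / 2 by ring, Real.sin_pi_div_two]
    have := Real.pi_ne_zero
    field_simp
    norm_num
  · rw [if_neg h1, add_zero, absCosCoeff, coeff]
    simp only [Int.odd_coe_nat, Int.cast_natCast]
    split_ifs with ho
    · have h0 : (n : ℝ) ^ 2 - 1 ≠ 0 := by
        have : 2 ≤ n := by
          rcases n with _ | _ | n
          · simp at ho
          · simp at h1
          · omega
        have : (2 : ℝ) ≤ n := by exact_mod_cast this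
        nlinarith
      have : (1 - (n : ℝ) ^ 2) = -((n : ℝ) ^ 2 - 1) := by ring
      rw [this]
      field_simp
      ring
    · simp

/-- Pairing the frequencies `n` and `-n` turns the Fourier series into a cosine series, whose
coefficients are those of `kk 0 - kk 2` except at the resonance `n = 1`. -/
theorem re_kk_sub_kk (θ : ℝ) : (8 / (3 * Real.pi)) * Real.cos θ
    + (kk 0 (Complex.exp (-Complex.I * θ)) - kk 2 (Complex.exp (-Complex.I * θ))).re =
      |Real.cos θ| * Real.cos θ := by
  have h := (hasSum_absCos θ).nat_add_neg
  have hn : ‖Complex.exp (-Complex.I * θ)‖ ≤ 1 := (norm_exp_neg_I_mul θ).le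
  have h2 := (summable_kk (j := 0) (by norm_num) hn).hasSum.sub
    (summable_kk (j := 2) le_rfl hn).hasSum
  have h3 := Complex.hasSum_re h2
  have h4 := Complex.hasSum_re h
  have h5 : HasSum (fun n : ℕ ↦ if n = 1 then 8 / (3 * Real.pi) * Real.cos θ else 0)
      (8 / (3 * Real.pi) * Real.cos θ) := hasSum_ite_eq 1 _
  have h6 := h5.add h3
  have e : ∀ n : ℕ, ((absCosCoeff (n : ℤ) : ℂ) * Complex.exp (Complex.I * (n : ℤ) * θ) +
      (absCosCoeff (-(n : ℤ)) : ℂ) * Complex.exp (Complex.I * (-(n : ℤ) : ℤ) * θ)).re =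
      (if n = 1 then 8 / (3 * Real.pi) * Real.cos θ else 0) +
      ((((n : ℝ) ^ 0 * coeff n : ℝ) : ℂ) * Complex.exp (-Complex.I * θ) ^ n -
        (((n : ℝ) ^ 2 * coeff n : ℝ) : ℂ) * Complex.exp (-Complex.I * θ) ^ n).re := by
    intro n
    have e1 : ∀ y : ℝ, (Complex.exp (Complex.I * y)).re = Real.cos y := fun y ↦ by
      rw [mul_comm, Complex.exp_ofReal_mul_I_re]
    have e2 : Complex.I * (n : ℤ) * θ = Complex.I * ((n * θ : ℝ) : ℂ) := by push_cast; ring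
    have e3 : Complex.I * (-(n : ℤ) : ℤ) * θ = Complex.I * ((-(n * θ) : ℝ) : ℂ) := by
      push_cast; ring
    have e4 : Complex.exp (-Complex.I * θ) ^ n = Complex.exp (Complex.I * ((-(n * θ) : ℝ) : ℂ)) := by
      rw [← Complex.exp_nat_mul]; congr 1; push_cast; ring
    rw [absCosCoeff_neg, e2, e3, e4, Complex.add_re, Complex.sub_re, Complex.re_ofReal_mul,
      Complex.re_ofReal_mul, Complex.re_ofReal_mul, Complex.re_ofReal_mul, e1, e1, Real.cos_neg]
    have h7 := two_mul_absCosCoeff n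
    split_ifs at h7 ⊢ with hn1
    · subst hn1
      push_cast at h7 ⊢
      rw [one_mul]
      linear_combination Real.cos θ * h7
    · linear_combination Real.cos (n * θ) * h7
  simp only [e] at h4
  have h8 := h4.unique h6
  -- The pairing counts the frequency zero twice, which is harmless because its coefficient
  -- vanishes.
  have h9 : (absCosCoeff 0 : ℂ) = 0 := by simp [absCosCoeff]
  rw [h9, zero_mul, add_zero, Complex.ofReal_re] at h8
  exact h8.symm

/-! ### Second order Taylor data of curves -/

/-- The value and the first two derivatives of `f` at `0`. -/
structure Jet {F : Type*} [NormedAddCommGroup F] [NormedSpace ℝ F] (f : ℝ → F) (d₀ d₁ d₂ : F) :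
    Prop where
  val : f 0 = d₀
  ex : ∃ f₁ : ℝ → F, (∀ᶠ h in 𝓝 0, HasDerivAt f (f₁ h) h) ∧ f₁ 0 = d₁ ∧ HasDerivAt f₁ d₂ 0

namespace Jet

section

variable {F : Type*} [NormedAddCommGroup F] [NormedSpace ℝ F] {f g : ℝ → F}
  {d₀ d₁ d₂ e₀ e₁ e₂ : F}

/-- Used to extract second derivatives: a curve is differentiated once by the abstract chain rule
and once explicitly, and the two answers must coincide. -/
theorem unique (hf : Jet f d₀ d₁ d₂) (hg : Jet f e₀ e₁ e₂) : d₁ = e₁ ∧ d₂ = e₂ := by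
  obtain ⟨f₁, h1, rfl, h2⟩ := hf.ex
  obtain ⟨g₁, k1, rfl, k2⟩ := hg.ex
  have e : f₁ =ᶠ[𝓝 0] g₁ := by
    filter_upwards [h1, k1] with h a b using a.unique b
  exact ⟨e.eq_of_nhds, (h2.congr_of_eventuallyEq e.symm).unique k2⟩

theorem hasDerivAt (hf : Jet f d₀ d₁ d₂) : HasDerivAt f d₁ 0 := by
  obtain ⟨f₁, h1, rfl, -⟩ := hf.ex
  exact h1.self_of_nhds

theorem congr (hf : Jet f d₀ d₁ d₂) (h : g =ᶠ[𝓝 0] f) : Jet g d₀ d₁ d₂ := by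
  obtain ⟨f₁, h1, h0, h2⟩ := hf.ex
  refine ⟨h.eq_of_nhds.trans hf.val, f₁, ?_, h0, h2⟩
  filter_upwards [h1, h.eventuallyEq_nhds] with x a b using a.congr_of_eventuallyEq b

theorem const (c : F) : Jet (fun _ ↦ c) c 0 0 :=
  ⟨rfl, fun _ ↦ 0, Eventually.of_forall fun h ↦ hasDerivAt_const h c, rfl, hasDerivAt_const 0 0⟩

theorem add (hf : Jet f d₀ d₁ d₂) (hg : Jet g e₀ e₁ e₂) :
    Jet (fun h ↦ f h + g h) (d₀ + e₀) (d₁ + e₁) (d₂ + e₂) := by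
  obtain ⟨f₁, h1, rfl, h2⟩ := hf.ex
  obtain ⟨g₁, k1, rfl, k2⟩ := hg.ex
  refine ⟨by rw [hf.val, hg.val], fun h ↦ f₁ h + g₁ h, ?_, rfl, h2.add k2⟩
  filter_upwards [h1, k1] with h a b using a.add b

end

section

variable {F : Type*} [NormedRing F] [NormedAlgebra ℝ F] {f g : ℝ → F} {d₀ d₁ d₂ e₀ e₁ e₂ : F}

theorem mul (hf : Jet f d₀ d₁ d₂) (hg : Jet g e₀ e₁ e₂) :
    Jet (fun h ↦ f h * g h) (d₀ * e₀) (d₁ * e₀ + d₀ * e₁)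
      (d₂ * e₀ + d₁ * e₁ + (d₁ * e₁ + d₀ * e₂)) := by
  have hfd := hf.hasDerivAt
  have hgd := hg.hasDerivAt
  have hf0 := hf.val
  have hg0 := hg.val
  obtain ⟨f₁, h1, rfl, h2⟩ := hf.ex
  obtain ⟨g₁, k1, rfl, k2⟩ := hg.ex
  refine ⟨by rw [hf0, hg0], fun h ↦ f₁ h * g h + f h * g₁ h, ?_, by simp only [hf0, hg0], ?_⟩
  · filter_upwards [h1, k1] with h a b using a.mul b
  · rw [← hf0, ← hg0]
    exact (h2.mul hgd).add (hfd.mul k2)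

end

section

variable {F : Type*} [NontriviallyNormedField F] [NormedAlgebra ℝ F] {f : ℝ → F} {d₀ d₁ d₂ : F}

theorem comp (hf : Jet f d₀ d₁ d₂) {G G₁ : F → F} {g₂ : F}
    (hG : ∀ᶠ y in 𝓝 d₀, HasDerivAt G (G₁ y) y) (hG₁ : HasDerivAt G₁ g₂ d₀) :
    Jet (fun h ↦ G (f h)) (G d₀) (d₁ * G₁ d₀) (d₂ * G₁ d₀ + d₁ * (d₁ * g₂)) := by
  have hfd := hf.hasDerivAt
  have hf0 := hf.val
  have hfc : Tendsto f (𝓝 0) (𝓝 d₀) := by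
    rw [← hf0]; exact hfd.continuousAt
  obtain ⟨f₁, h1, rfl, h2⟩ := hf.ex
  refine ⟨by rw [hf0], fun h ↦ f₁ h * G₁ (f h), ?_, by simp only [hf0], ?_⟩
  · filter_upwards [h1, hfc.eventually hG] with h a b
    have := HasDerivAt.scomp h b a
    rwa [smul_eq_mul] at this
  · have h3 : HasDerivAt (fun h ↦ G₁ (f h)) (f₁ 0 * g₂) 0 := by
      rw [← hf0] at hG₁
      have := HasDerivAt.scomp (0 : ℝ) hG₁ hfd
      rwa [smul_eq_mul] at this
    have h4 := h2.mul h3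
    rwa [hf0] at h4

end

theorem ofReal {f : ℝ → ℝ} {d₀ d₁ d₂ : ℝ} (hf : Jet f d₀ d₁ d₂) :
    Jet (fun h ↦ (f h : ℂ)) d₀ d₁ d₂ := by
  obtain ⟨f₁, h1, rfl, h2⟩ := hf.ex
  refine ⟨by rw [hf.val], fun h ↦ (f₁ h : ℂ), ?_, rfl, h2.ofReal_comp⟩
  filter_upwards [h1] with h a using a.ofReal_comp

theorem of_contDiffAt {E F : Type*} [NormedAddCommGroup E] [NormedSpace ℝ E]
    [NormedAddCommGroup F] [NormedSpace ℝ F] {f : E → F} {γ : ℝ → E} {c₀ c₁ c₂ : E}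
    (hf : ContDiffAt ℝ 2 f c₀) (hγ : Jet γ c₀ c₁ c₂) :
    Jet (fun h ↦ f (γ h)) (f c₀) (fderiv ℝ f c₀ c₁)
      (fderiv ℝ (fderiv ℝ f) c₀ c₁ c₁ + fderiv ℝ f c₀ c₂) := by
  have hγd := hγ.hasDerivAt
  have h0 := hγ.val
  have hγc : Tendsto γ (𝓝 0) (𝓝 c₀) := by
    rw [← h0]; exact hγd.continuousAt
  obtain ⟨γ₁, h1, rfl, h2⟩ := hγ.ex
  have hf1 : ∀ᶠ y in 𝓝 c₀, DifferentiableAt ℝ f y := by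
    filter_upwards [hf.eventually (by simp)] with y hy using hy.differentiableAt (by simp)
  have hf2 : DifferentiableAt ℝ (fderiv ℝ f) c₀ :=
    (hf.fderiv_right (m := 1) (by norm_num)).differentiableAt (by simp)
  refine ⟨by rw [h0], fun h ↦ fderiv ℝ f (γ h) (γ₁ h), ?_, by simp only [h0], ?_⟩
  · filter_upwards [h1, hγc.eventually hf1] with h a b
    exact b.hasFDerivAt.comp_hasDerivAt h a
  · have h3 : HasDerivAt (fun h ↦ fderiv ℝ f (γ h)) (fderiv ℝ (fderiv ℝ f) c₀ (γ₁ 0)) 0 := by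
      rw [← h0] at hf2 ⊢
      exact hf2.hasFDerivAt.comp_hasDerivAt 0 hγd
    have h4 := h3.clm_apply h2
    rwa [h0] at h4

theorem line {E : Type*} [NormedAddCommGroup E] [NormedSpace ℝ E] (p v : E) :
    Jet (fun h : ℝ ↦ p + h • v) p v 0 := by
  refine ⟨by simp, fun _ ↦ v, Eventually.of_forall fun h ↦ ?_, rfl, hasDerivAt_const _ _⟩
  simpa using ((hasDerivAt_id h).smul_const v).const_add p

theorem prodMk {E F : Type*} [NormedAddCommGroup E] [NormedSpace ℝ E]
    [NormedAddCommGroup F] [NormedSpace ℝ F] {f : ℝ → E} {g : ℝ → F} {d₀ d₁ d₂ : E}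
    {e₀ e₁ e₂ : F} (hf : Jet f d₀ d₁ d₂) (hg : Jet g e₀ e₁ e₂) :
    Jet (fun h ↦ (f h, g h)) (d₀, e₀) (d₁, e₁) (d₂, e₂) := by
  obtain ⟨f₁, h1, rfl, h2⟩ := hf.ex
  obtain ⟨g₁, k1, rfl, k2⟩ := hg.ex
  refine ⟨by rw [hf.val, hg.val], fun h ↦ (f₁ h, g₁ h), ?_, rfl, h2.prodMk k2⟩
  filter_upwards [h1, k1] with h a b using a.prodMk b

theorem smul {E : Type*} [NormedAddCommGroup E] [NormedSpace ℝ E] {f : ℝ → ℝ} {g : ℝ → E}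
    {d₀ d₁ d₂ : ℝ} {e₀ e₁ e₂ : E} (hf : Jet f d₀ d₁ d₂) (hg : Jet g e₀ e₁ e₂) :
    Jet (fun h ↦ f h • g h) (d₀ • e₀) (d₀ • e₁ + d₁ • e₀)
      (d₀ • e₂ + d₁ • e₁ + (d₁ • e₁ + d₂ • e₀)) := by
  have hfd := hf.hasDerivAt
  have hgd := hg.hasDerivAt
  have hf0 := hf.val
  have hg0 := hg.val
  obtain ⟨f₁, h1, rfl, h2⟩ := hf.ex
  obtain ⟨g₁, k1, rfl, k2⟩ := hg.ex
  refine ⟨by rw [hf0, hg0], fun h ↦ f h • g₁ h + f₁ h • g h, ?_, by simp only [hf0, hg0], ?_⟩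
  · filter_upwards [h1, k1] with h a b using a.smul b
  · rw [← hf0, ← hg0]
    exact (hfd.smul k2).add (h2.smul hgd)

theorem inv {f : ℝ → ℝ} {d₀ d₁ d₂ : ℝ} (hf : Jet f d₀ d₁ d₂) (h0 : d₀ ≠ 0) :
    Jet (fun h ↦ (f h)⁻¹) d₀⁻¹ (d₁ * -(d₀ ^ 2)⁻¹)
      (d₂ * -(d₀ ^ 2)⁻¹ + d₁ * (d₁ * (2 * (d₀ ^ 3)⁻¹))) := by
  refine hf.comp (G := fun y ↦ y⁻¹) (G₁ := fun y ↦ -(y ^ 2)⁻¹) ?_ ?_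
  · filter_upwards [isOpen_ne.mem_nhds h0] with y hy using hasDerivAt_inv hy
  · have := ((hasDerivAt_pow 2 d₀).inv (by positivity)).neg
    convert! this using 1
    field_simp
    norm_num

theorem log {f : ℝ → ℝ} {d₀ d₁ d₂ : ℝ} (hf : Jet f d₀ d₁ d₂) (h0 : d₀ ≠ 0) :
    Jet (fun h ↦ Real.log (f h)) (Real.log d₀) (d₁ * d₀⁻¹)
      (d₂ * d₀⁻¹ + d₁ * (d₁ * -(d₀ ^ 2)⁻¹)) := by
  refine hf.comp (G := Real.log) (G₁ := fun y ↦ y⁻¹) ?_ (hasDerivAt_inv h0)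
  filter_upwards [isOpen_ne.mem_nhds h0] with y hy using Real.hasDerivAt_log hy

theorem sqrt {f : ℝ → ℝ} {d₀ d₁ d₂ : ℝ} (hf : Jet f (d₀ ^ 2) d₁ d₂) (h0 : 0 < d₀) :
    Jet (fun h ↦ √(f h)) d₀ (d₁ * (2 * d₀)⁻¹)
      (d₂ * (2 * d₀)⁻¹ + d₁ * (d₁ * -(4 * d₀ ^ 3)⁻¹)) := by
  have hs : √(d₀ ^ 2) = d₀ := Real.sqrt_sq h0.le
  have h := hf.comp (G := Real.sqrt) (G₁ := fun y ↦ (2 * √y)⁻¹) (g₂ := -(4 * d₀ ^ 3)⁻¹) ?_ ?_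
  · rwa [hs] at h
  · filter_upwards [isOpen_ne.mem_nhds (pow_pos h0 2).ne'] with y hy
    simpa using Real.hasDerivAt_sqrt hy
  · have h1 := (Real.hasDerivAt_sqrt (pow_pos h0 2).ne').const_mul 2
    have h2 := h1.inv (by rw [hs]; positivity)
    convert! h2 using 1
    rw [hs]
    field_simp
    ring

theorem cexp {f : ℝ → ℂ} {d₀ d₁ d₂ : ℂ} (hf : Jet f d₀ d₁ d₂) :
    Jet (fun h ↦ Complex.exp (f h)) (Complex.exp d₀) (d₁ * Complex.exp d₀)
      (d₂ * Complex.exp d₀ + d₁ * (d₁ * Complex.exp d₀)) :=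
  hf.comp (Eventually.of_forall fun y ↦ Complex.hasDerivAt_exp y) (Complex.hasDerivAt_exp d₀)

end Jet

/-! ### The wave operator in hyperbolic coordinates -/

/-- Hyperbolic coordinates `(ρ, μ)` of the point `(t, x)`. -/
def hyp (p : ℝ × Plane) : ℝ × Plane := (√(p.1 ^ 2 - ‖p.2‖ ^ 2), mu p.1 p.2)

/-- The wave operator applied to a function on spacetime. -/
def box (A : ℝ × Plane → ℂ) (p : ℝ × Plane) : ℂ :=
  fderiv ℝ (fderiv ℝ A) p (1, 0) (1, 0) -
    ∑ j, fderiv ℝ (fderiv ℝ A) p (0, unitVec j) (0, unitVec j)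

theorem sqrt_hyp (ρ : ℝ) (μ : Plane) :
    (ρ * bracket μ) ^ 2 - ‖ρ • μ‖ ^ 2 = ρ ^ 2 := by
  rw [mul_pow, bracket_sq, norm_smul, Real.norm_eq_abs, mul_pow, sq_abs]
  ring

theorem hyp_apply {ρ : ℝ} (hρ : 0 < ρ) (μ : Plane) : hyp (ρ * bracket μ, ρ • μ) = (ρ, μ) := by
  rw [hyp, mu, sqrt_hyp ρ, Real.sqrt_sq hρ.le, smul_smul, inv_mul_cancel₀ hρ.ne', one_smul]

theorem norm_sq_add_smul (x v : Plane) (h : ℝ) :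
    ‖x + h • v‖ ^ 2 = ‖x‖ ^ 2 + h * (2 * inner ℝ x v) + h * h * ‖v‖ ^ 2 := by
  rw [norm_add_sq_real, inner_smul_right, norm_smul, Real.norm_eq_abs, mul_pow, sq_abs]
  ring

theorem jet_hyp_time {ρ : ℝ} (hρ : 0 < ρ) (μ : Plane) :
    Jet (fun h : ℝ ↦ hyp ((ρ * bracket μ, ρ • μ) + h • (1, 0))) (ρ, μ)
      (bracket μ, -(bracket μ / ρ) • μ)
      (-‖μ‖ ^ 2 / ρ, ((2 + 3 * ‖μ‖ ^ 2) / ρ ^ 2) • μ) := by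
  have hb := bracket_sq μ
  have j1 := (Jet.line (ρ * bracket μ) (1 : ℝ))
  have j2 := (j1.mul j1).add (Jet.const (-‖ρ • μ‖ ^ 2))
  have e0 : ρ * bracket μ * (ρ * bracket μ) + -‖ρ • μ‖ ^ 2 = ρ ^ 2 := by
    rw [← sqrt_hyp ρ μ]; ring
  rw [e0] at j2
  have j3 := j2.sqrt hρ
  have j4 := (j3.inv hρ.ne').smul (Jet.const (ρ • μ))
  have j5 := j3.prodMk j4
  convert! j5 using 1
  · funext h
    simp only [hyp, mu, Prod.fst_add, Prod.snd_add, Prod.smul_fst, Prod.smul_snd, smul_zero,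
      add_zero]
    rw [sub_eq_add_neg, pow_two]
  · simp [smul_smul, hρ.ne']
  · refine Prod.ext ?_ ?_
    · simp only; field_simp; ring
    · simp only [smul_zero, zero_add, smul_smul]
      congr 1; field_simp; ring
  · refine Prod.ext ?_ ?_
    · simp only; field_simp
      linear_combination (8 * ρ ^ 2) * hb
    · simp only [smul_zero, zero_add, smul_smul]
      congr 1; field_simp
      linear_combination (-24 * ρ ^ 2) * hb

theorem inner_unitVec (μ : Plane) (j : Fin 2) : inner ℝ μ (unitVec j) = μ j := by
  simp [unitVec, EuclideanSpace.inner_single_right]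

theorem jet_hyp_space {ρ : ℝ} (hρ : 0 < ρ) (μ : Plane) (j : Fin 2) :
    Jet (fun h : ℝ ↦ hyp ((ρ * bracket μ, ρ • μ) + h • (0, unitVec j))) (ρ, μ)
      (-μ j, ρ⁻¹ • unitVec j + (μ j / ρ) • μ)
      (-(1 + μ j ^ 2) / ρ, (2 * μ j / ρ ^ 2) • unitVec j + ((1 + 3 * μ j ^ 2) / ρ ^ 2) • μ) := by
  have hb := bracket_sq μ
  have j1 := (Jet.line (0 : ℝ) (1 : ℝ))
  have j2 := ((Jet.const (ρ ^ 2)).add (j1.mul (Jet.const (-(2 * (ρ * μ j)))))).add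
    ((j1.mul j1).mul (Jet.const (-1)))
  have e0 : ρ ^ 2 + 0 * -(2 * (ρ * μ j)) + 0 * 0 * -1 = ρ ^ 2 := by ring
  rw [e0] at j2
  have j3 := j2.sqrt hρ
  have j4 := (j3.inv hρ.ne').smul (Jet.line (ρ • μ) (unitVec j))
  have j5 := j3.prodMk j4
  convert! j5 using 1
  · funext h
    simp only [hyp, mu, Prod.fst_add, Prod.snd_add, Prod.smul_fst, Prod.smul_snd, smul_zero,
      add_zero]
    rw [norm_sq_add_smul, inner_smul_left, inner_unitVec, norm_unitVec]
    have e : (ρ * bracket μ) ^ 2 - (‖ρ • μ‖ ^ 2 + h * (2 * ((starRingEnd ℝ) ρ * μ j))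
        + h * h * 1 ^ 2) = ρ ^ 2 + (0 + h • (1 : ℝ)) * -(2 * (ρ * μ j)) +
          (0 + h • (1 : ℝ)) * (0 + h • (1 : ℝ)) * -1 := by
      rw [← sqrt_hyp ρ μ]
      simp only [smul_eq_mul, conj_trivial]
      ring
    rw [e]
  · simp [smul_smul, hρ.ne']
  · refine Prod.ext ?_ ?_
    · simp only; field_simp; ring
    · simp only [smul_smul]
      congr 2; field_simp; ring
  · refine Prod.ext ?_ ?_
    · simp only; field_simp; ring
    · simp only [smul_zero, zero_add, smul_smul]
      rw [← add_assoc, ← add_smul]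
      congr 2 <;> · field_simp; ring

theorem contDiffAt_hyp {n : WithTop ℕ∞} {p : ℝ × Plane} (hp : ‖p.2‖ < |p.1|) : ContDiffAt ℝ n hyp p := by
  have h1 : ContDiffAt ℝ n (fun p : ℝ × Plane ↦ p.1 ^ 2 - ‖p.2‖ ^ 2) p :=
    (contDiff_fst.pow 2).contDiffAt.sub ((contDiff_norm_sq ℝ).comp contDiff_snd).contDiffAt
  have h0 : 0 < p.1 ^ 2 - ‖p.2‖ ^ 2 := by
    rw [← sq_abs p.1]; nlinarith [norm_nonneg p.2]
  have h2 := h1.sqrt h0.ne'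
  exact h2.prodMk ((h2.inv (Real.sqrt_pos.2 h0).ne').smul contDiff_snd.contDiffAt)

theorem norm_lt_of_hyp {ρ : ℝ} (hρ : 0 < ρ) (μ : Plane) : ‖ρ • μ‖ < |ρ * bracket μ| := by
  have hb := bracket_pos μ
  rw [norm_smul, Real.norm_eq_abs, abs_mul, abs_of_pos hb]
  have : ‖μ‖ < bracket μ := by
    rw [bracket]; exact Real.lt_sqrt_of_sq_lt (by linarith)
  gcongr

/-- Second order chain rule along the three coordinate lines of spacetime, expanded in the `ρ` and
`μ` directions. The combination `Δ + D²[μ, μ] + 2 μ·∇` is the Laplacian of the hyperbolic plane in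
the coordinate `μ`. -/
theorem box_comp_hyp {a : ℝ × Plane → ℂ} {ρ : ℝ} (hρ : 0 < ρ) {μ : Plane}
    (ha : ContDiffAt ℝ 2 a (ρ, μ)) {r₀ r₁ r₂ : ℂ} {l₀ l₁ l₂ : Plane → ℂ}
    (hr : Jet (fun h : ℝ ↦ a (ρ + h, μ)) r₀ r₁ r₂)
    (hl : ∀ v, Jet (fun h : ℝ ↦ a (ρ, μ + h • v)) (l₀ v) (l₁ v) (l₂ v)) :
    box (fun p ↦ a (hyp p)) (ρ * bracket μ, ρ • μ) = r₂ + (2 / ρ : ℝ) * r₁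
      - ((ρ ^ 2)⁻¹ : ℝ) * (l₂ (unitVec 0) + l₂ (unitVec 1) + l₂ μ + 2 * l₁ μ) := by
  set p : ℝ × Plane := (ρ * bracket μ, ρ • μ) with hp
  have hhyp : hyp p = (ρ, μ) := hyp_apply hρ μ
  have hA : ContDiffAt ℝ 2 (fun p ↦ a (hyp p)) p := by
    refine ContDiffAt.comp p (g := a) ?_ (contDiffAt_hyp (norm_lt_of_hyp hρ μ))
    rw [hhyp]; exact ha
  set B := fderiv ℝ (fderiv ℝ a) (ρ, μ) with hB
  set D := fderiv ℝ a (ρ, μ) with hD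
  have key : ∀ {v : ℝ × Plane} {c₁ c₂ : ℝ × Plane},
      Jet (fun h : ℝ ↦ hyp (p + h • v)) (ρ, μ) c₁ c₂ →
      fderiv ℝ (fderiv ℝ fun p ↦ a (hyp p)) p v v = B c₁ c₁ + D c₂ := by
    intro v c₁ c₂ hv
    have h1 := Jet.of_contDiffAt hA (Jet.line p v)
    have h2 := Jet.of_contDiffAt ha hv
    have h3 := (h1.unique h2).2
    rwa [map_zero, add_zero] at h3
  have hR := Jet.of_contDiffAt ha (Jet.line (ρ, μ) ((1 : ℝ), (0 : Plane)))
  have hR' : Jet (fun h : ℝ ↦ a ((ρ, μ) + h • ((1 : ℝ), (0 : Plane)))) r₀ r₁ r₂ := by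
    simpa using hr
  obtain ⟨R1, R2⟩ := hR.unique hR'
  have hV : ∀ v, D (0, v) = l₁ v ∧ B (0, v) (0, v) = l₂ v := by
    intro v
    have h1 := Jet.of_contDiffAt ha (Jet.line (ρ, μ) ((0 : ℝ), v))
    have h2 : Jet (fun h : ℝ ↦ a ((ρ, μ) + h • ((0 : ℝ), v))) (l₀ v) (l₁ v) (l₂ v) := by
      simpa using hl v
    have h3 := h1.unique h2
    rwa [map_zero, add_zero] at h3
  rw [map_zero, add_zero] at R2
  have hsymm : ∀ u v, B u v = B v u := fun u v ↦
    (ha.isSymmSndFDerivAt (by simp)).eq u v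
  rw [box, key (jet_hyp_time hρ μ), Fin.sum_univ_two, key (jet_hyp_space hρ μ 0),
    key (jet_hyp_space hρ μ 1)]
  rw [← R1, ← R2, ← (hV _).2, ← (hV _).2, ← (hV _).2, ← (hV _).1]
  have dec : ∀ (c : ℝ) (v : Plane), ((c, v) : ℝ × Plane) = c • (1, 0) + (0, v) := fun c v ↦ by
    ext <;> simp
  have dadd : ∀ (v w : Plane), ((0, v + w) : ℝ × Plane) = (0, v) + (0, w) := fun v w ↦ by
    ext <;> simp
  have dsmul : ∀ (c : ℝ) (v : Plane), ((0, c • v) : ℝ × Plane) = c • (0, v) := fun c v ↦ by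
    ext <;> simp
  have hMM : ((0, μ) : ℝ × Plane) = μ 0 • (0, unitVec 0) + μ 1 • (0, unitVec 1) := by
    rw [← dsmul, ← dsmul, ← dadd, ← plane_eq_sum]
  have hb := bracket_sq μ
  have hn : ‖μ‖ ^ 2 = μ 0 ^ 2 + μ 1 ^ 2 := by
    rw [EuclideanSpace.norm_sq_eq, Fin.sum_univ_two]; simp
  rw [hn] at hb
  have hbC : (bracket μ : ℂ) ^ 2 = 1 + ((μ 0 : ℝ) : ℂ) ^ 2 + ((μ 1 : ℝ) : ℂ) ^ 2 := by
    rw [← Complex.ofReal_pow, hb]; push_cast; ring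
  have hρC : (ρ : ℂ) ≠ 0 := by exact_mod_cast hρ.ne'
  rw [hn, dec (bracket μ), dec (-μ 0), dec (-μ 1), dec (-(μ 0 ^ 2 + μ 1 ^ 2) / ρ),
    dec (-(1 + μ 0 ^ 2) / ρ), dec (-(1 + μ 1 ^ 2) / ρ)]
  simp only [dadd, dsmul, hMM, map_add, map_smul, add_apply, smul_apply, Complex.real_smul]
  rw [hsymm (0, unitVec 0) (1, 0), hsymm (0, unitVec 1) (1, 0),
    hsymm (0, unitVec 1) (0, unitVec 0)]
  push_cast
  generalize B (1, 0) (1, 0) = b1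
  generalize B (1, 0) (0, unitVec 0) = b2
  generalize B (1, 0) (0, unitVec 1) = b3
  generalize B (0, unitVec 0) (0, unitVec 0) = b4
  generalize B (0, unitVec 0) (0, unitVec 1) = b5
  generalize B (0, unitVec 1) (0, unitVec 1) = b6
  generalize D (1, 0) = b7
  generalize D (0, unitVec 0) = b8
  generalize D (0, unitVec 1) = b9
  -- With the derivatives of `a` treated as free symbols, the identity holds modulo `⟨μ⟩² = 1 +
  -- |μ|²`. The multiplier is the Hessian of `a` in the direction `(1, -μ/ρ)`, which the time line
  -- contributes with the factor `⟨μ⟩²`.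
  linear_combination (b1 - 2 * (ρ : ℂ)⁻¹ * ((μ 0 : ℝ) * b2 + (μ 1 : ℝ) * b3) + (ρ : ℂ)⁻¹ ^ 2 *
    ((μ 0 : ℝ) ^ 2 * b4 + 2 * (μ 0 : ℝ) * (μ 1 : ℝ) * b5 + (μ 1 : ℝ) ^ 2 * b6)) * hbC

/-! ### Curves with bounds -/

/-- The first two derivatives of `f` at `0` are bounded by `A P` and `A P²`. -/
def BJet {F : Type*} [NormedAddCommGroup F] [NormedSpace ℝ F] (f : ℝ → F) (A P : ℝ) : Prop :=
  ∃ d₀ d₁ d₂, Jet f d₀ d₁ d₂ ∧ ‖d₀‖ ≤ A ∧ ‖d₁‖ ≤ A * P ∧ ‖d₂‖ ≤ A * P ^ 2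

theorem BJet.nonneg {F : Type*} [NormedAddCommGroup F] [NormedSpace ℝ F] {f : ℝ → F} {A P : ℝ}
    (h : BJet f A P) : 0 ≤ A := by
  obtain ⟨d₀, d₁, d₂, -, h0, -⟩ := h
  exact (norm_nonneg _).trans h0

theorem BJet.mono {F : Type*} [NormedAddCommGroup F] [NormedSpace ℝ F] {f : ℝ → F}
    {A P B Q : ℝ} (h : BJet f A P) (hAB : A ≤ B) (hP : 0 ≤ P) (hPQ : P ≤ Q) : BJet f B Q := by
  have hA := h.nonneg
  obtain ⟨d₀, d₁, d₂, hj, h0, h1, h2⟩ := h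
  exact ⟨d₀, d₁, d₂, hj, h0.trans hAB, h1.trans (mul_le_mul hAB hPQ hP (hA.trans hAB)),
    h2.trans (mul_le_mul hAB (pow_le_pow_left₀ hP hPQ 2) (sq_nonneg P) (hA.trans hAB))⟩

/-- The bounds `A`, `AP`, `AP²` are the derivatives of the majorant `A e^{Ph}`; for a product the
amplitudes multiply and the rates add. -/
theorem BJet.mul {F : Type*} [NormedRing F] [NormedAlgebra ℝ F] {f g : ℝ → F} {A P B Q : ℝ}
    (hf : BJet f A P) (hg : BJet g B Q) (hP : 0 ≤ P) :
    BJet (fun h ↦ f h * g h) (A * B) (P + Q) := by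
  have hA := hf.nonneg
  have hB := hg.nonneg
  obtain ⟨d₀, d₁, d₂, hj, h0, h1, h2⟩ := hf
  obtain ⟨e₀, e₁, e₂, kj, k0, k1, k2⟩ := hg
  have hm : ∀ (x y : F) (a b : ℝ), ‖x‖ ≤ a → ‖y‖ ≤ b → 0 ≤ a → ‖x * y‖ ≤ a * b :=
    fun x y a b hx hy ha ↦ (norm_mul_le x y).trans (mul_le_mul hx hy (norm_nonneg _) ha)
  refine ⟨_, _, _, hj.mul kj, hm _ _ _ _ h0 k0 hA, ?_, ?_⟩
  · refine (norm_add_le _ _).trans ((add_le_add (hm _ _ _ _ h1 k0 (by positivity))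
      (hm _ _ _ _ h0 k1 hA)).trans (le_of_eq (by ring)))
  · refine (norm_add_le _ _).trans ((add_le_add ((norm_add_le _ _).trans
      (add_le_add (hm _ _ _ _ h2 k0 (by positivity)) (hm _ _ _ _ h1 k1 (by positivity))))
      ((norm_add_le _ _).trans
      (add_le_add (hm _ _ _ _ h1 k1 (by positivity)) (hm _ _ _ _ h0 k2 hA)))).trans
      (le_of_eq (by ring)))

theorem BJet.const {F : Type*} [NormedAddCommGroup F] [NormedSpace ℝ F] (c : F) {A P : ℝ}
    (h : ‖c‖ ≤ A) (hP : 0 ≤ P) : BJet (fun _ : ℝ ↦ c) A P := by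
  have hA := (norm_nonneg _).trans h
  exact ⟨_, _, _, Jet.const c, h, by simp; positivity, by simp; positivity⟩

theorem BJet.ofReal {f : ℝ → ℝ} {A P : ℝ} (h : BJet f A P) :
    BJet (fun h ↦ (f h : ℂ)) A P := by
  obtain ⟨d₀, d₁, d₂, hj, h0, h1, h2⟩ := h
  exact ⟨_, _, _, hj.ofReal, by simpa using h0, by simpa using h1, by simpa using h2⟩

/-- The second derivative of `1/f` is `-f''/f² + 2f'²/f³`. Each term contributes `2P²`, and the sum
`4P²` is the square of the rate `2P`. -/
theorem BJet.inv {f : ℝ → ℝ} {d₀ d₁ d₂ P : ℝ} (h : Jet f d₀ d₁ d₂) (h0 : 0 < d₀) (hP : 0 ≤ P)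
    (h1 : |d₁| ≤ d₀ * P) (h2 : |d₂| ≤ d₀ * (2 * P ^ 2)) :
    BJet (fun h ↦ (f h)⁻¹) d₀⁻¹ (2 * P) := by
  refine ⟨_, _, _, h.inv h0.ne', ?_, ?_, ?_⟩
  · rw [Real.norm_eq_abs, abs_of_pos (inv_pos.2 h0)]
  · rw [Real.norm_eq_abs, abs_mul, abs_neg, abs_of_pos (inv_pos.2 (pow_pos h0 2))]
    calc |d₁| * (d₀ ^ 2)⁻¹ ≤ d₀ * P * (d₀ ^ 2)⁻¹ := by gcongr
      _ = d₀⁻¹ * P := by field_simp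
      _ ≤ d₀⁻¹ * (2 * P) := by gcongr; linarith
  · rw [Real.norm_eq_abs]
    have e : |d₁| * (|d₁| * (2 * (d₀ ^ 3)⁻¹)) ≤ d₀ * P * (d₀ * P * (2 * (d₀ ^ 3)⁻¹)) := by gcongr
    have e2 : |d₂| * (d₀ ^ 2)⁻¹ ≤ d₀ * (2 * P ^ 2) * (d₀ ^ 2)⁻¹ := by gcongr
    calc _ ≤ |d₂| * (d₀ ^ 2)⁻¹ + |d₁| * (|d₁| * (2 * (d₀ ^ 3)⁻¹)) := by
          refine (abs_add_le _ _).trans (le_of_eq ?_)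
          rw [abs_mul, abs_neg, abs_mul, abs_mul, abs_of_pos (inv_pos.2 (pow_pos h0 2)),
            abs_of_pos (by positivity : (0 : ℝ) < 2 * (d₀ ^ 3)⁻¹)]
      _ ≤ d₀ * (2 * P ^ 2) * (d₀ ^ 2)⁻¹ + d₀ * P * (d₀ * P * (2 * (d₀ ^ 3)⁻¹)) := add_le_add e2 e
      _ = d₀⁻¹ * (2 * P) ^ 2 := by field_simp; ring

theorem BJet.of_jet {F : Type*} [NormedAddCommGroup F] [NormedSpace ℝ F] {f : ℝ → F}
    {d₀ d₁ d₂ : F} (h : Jet f d₀ d₁ d₂) {A P : ℝ} (h0 : ‖d₀‖ ≤ A) (h1 : ‖d₁‖ ≤ A * P)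
    (h2 : ‖d₂‖ ≤ A * P ^ 2) : BJet f A P := ⟨_, _, _, h, h0, h1, h2⟩

/-! ### The profile in hyperbolic coordinates -/

/-- The coefficient `-4λ/(3π)` of the phase correction. -/
def phaseCoeff (lam : ℝ) : ℝ := -(4 * lam / (3 * Real.pi))

/-- The phase. -/
def phase (lam s r m : ℝ) : ℝ := s / m + phaseCoeff lam * r / m * Real.log s

/-- The oscillating factor. -/
def osc (lam s r m : ℝ) : ℂ := Complex.exp (-Complex.I * (phase lam s r m : ℝ))

theorem norm_osc (lam s r m : ℝ) : ‖osc lam s r m‖ = 1 := norm_exp_neg_I_mul _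

/-- The (complex) approximate solution as a function of time, amplitude `ζ`, regularized modulus
`r` of the amplitude, and weight `m`. -/
def pro (lam s : ℝ) (ζ : ℂ) (r m : ℝ) : ℂ :=
  ((s⁻¹ : ℝ) : ℂ) * (ζ * osc lam s r m)
    + ((lam * (s ^ 2)⁻¹ * r ^ 2 : ℝ) : ℂ) * kk 0 (ζ * osc lam s r m / r)

/-- The regularized modulus. -/
def rad (ε : ℝ) (Z : Plane → ℂ) (μ : Plane) : ℝ := √(‖Z μ‖ ^ 2 + ε ^ 2)

theorem norm_le_rad (ε : ℝ) (Z : Plane → ℂ) (μ : Plane) : ‖Z μ‖ ≤ rad ε Z μ :=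
  Real.le_sqrt_of_sq_le (by nlinarith [sq_nonneg ε])

theorem rad_nonneg (ε : ℝ) (Z : Plane → ℂ) (μ : Plane) : 0 ≤ rad ε Z μ := Real.sqrt_nonneg _

theorem rad_le {ε : ℝ} (hε : 0 ≤ ε) (Z : Plane → ℂ) (μ : Plane) : rad ε Z μ ≤ ‖Z μ‖ + ε :=
  Real.sqrt_le_iff.2 ⟨by positivity, by nlinarith [mul_nonneg (norm_nonneg (Z μ)) hε]⟩

theorem rad_sq (ε : ℝ) (Z : Plane → ℂ) (μ : Plane) : rad ε Z μ ^ 2 = ‖Z μ‖ ^ 2 + ε ^ 2 :=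
  Real.sq_sqrt (by positivity)

theorem norm_lt_rad {ε : ℝ} (hε : 0 < ε) (Z : Plane → ℂ) (μ : Plane) : ‖Z μ‖ < rad ε Z μ :=
  Real.lt_sqrt_of_sq_lt (by nlinarith [sq_pos_of_pos hε])

theorem rad_pos {ε : ℝ} (hε : 0 < ε) (Z : Plane → ℂ) (μ : Plane) : 0 < rad ε Z μ :=
  (norm_nonneg _).trans_lt (norm_lt_rad hε Z μ)

theorem jet_normSq {z : ℝ → ℂ} {d₀ d₁ d₂ : ℂ} (h : Jet z d₀ d₁ d₂) :
    Jet (fun h ↦ ‖z h‖ ^ 2) (‖d₀‖ ^ 2) (2 * inner ℝ d₀ d₁)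
      (2 * (‖d₁‖ ^ 2 + inner ℝ d₀ d₂)) := by
  have hd := h.hasDerivAt
  have h0 := h.val
  obtain ⟨z₁, h1, rfl, h2⟩ := h.ex
  refine ⟨by rw [h0], fun x ↦ 2 * inner ℝ (z x) (z₁ x), ?_, by simp only [h0], ?_⟩
  · filter_upwards [h1] with x hx using hx.norm_sq
  · have h3 := (hd.inner ℝ h2).const_mul 2
    rw [h0, real_inner_self_eq_norm_sq] at h3
    convert! h3 using 1
    ring

/-! ### Derivatives of the profile in the hyperbolic variable -/

section

variable {z : ℝ → ℂ} {m : ℝ → ℝ} {ζ ζ₁ ζ₂ : ℂ} {m₀ m₁ m₂ r ε : ℝ}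

/-- The scale of the derivatives of the regularized modulus. -/
def scale (r z₁ z₂ : ℝ) : ℝ := √(1 + 2 * (z₁ / r) ^ 2 + z₂ / r)

theorem scale_sq {r z₁ z₂ : ℝ} (hr : 0 < r) (h2 : 0 ≤ z₂) :
    scale r z₁ z₂ ^ 2 = 1 + 2 * (z₁ / r) ^ 2 + z₂ / r := Real.sq_sqrt (by positivity)

theorem one_le_scale {r z₁ z₂ : ℝ} (hr : 0 < r) (h2 : 0 ≤ z₂) : 1 ≤ scale r z₁ z₂ := by
  rw [scale, Real.one_le_sqrt]
  have : 0 ≤ z₂ / r := by positivity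
  nlinarith [sq_nonneg (z₁ / r)]

theorem le_mul_scale {r z₁ z₂ : ℝ} (hr : 0 < r) (h2 : 0 ≤ z₂) : z₁ ≤ r * scale r z₁ z₂ := by
  rw [← div_le_iff₀' hr]
  refine Real.le_sqrt_of_sq_le ?_
  have : 0 ≤ z₂ / r := by positivity
  nlinarith [sq_nonneg (z₁ / r)]

/-- `scale` is the smallest rate of its kind: `r · scale² = r + 2z₁²/r + z₂` covers the second
derivative of the regularized modulus. The term `z₁²/r` is not uniform as the regularization is
removed, but `r² · scale² = r² + 2z₁² + r z₂` is, so the rate may be squared only next to two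
factors `r`. -/
theorem le_mul_scale_sq {r z₁ z₂ : ℝ} (hr : 0 < r) (h2 : 0 ≤ z₂) :
    2 * (z₁ ^ 2 / r) + z₂ ≤ r * scale r z₁ z₂ ^ 2 := by
  rw [scale_sq hr h2]
  have : r * (1 + 2 * (z₁ / r) ^ 2 + z₂ / r) = r + (2 * (z₁ ^ 2 / r) + z₂) := by field_simp; ring
  linarith

theorem bjet_sqrt (hz : Jet z ζ ζ₁ ζ₂) (hr : 0 < r) (hrζ : ‖ζ‖ ^ 2 + ε ^ 2 = r ^ 2) {a b : ℝ}
    (h1 : ‖ζ₁‖ ≤ a) (h2 : ‖ζ₂‖ ≤ b) :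
    ∃ r₁ r₂, Jet (fun h ↦ √(‖z h‖ ^ 2 + ε ^ 2)) r r₁ r₂ ∧ |r₁| ≤ r * scale r a b ∧
      |r₂| ≤ r * scale r a b ^ 2 := by
  have hb := (norm_nonneg _).trans h2
  have ha := (norm_nonneg _).trans h1
  have j := (jet_normSq hz).add (Jet.const (ε ^ 2))
  rw [hrζ] at j
  have j2 := j.sqrt hr
  have hζr : ‖ζ‖ ≤ r := by
    apply le_of_sq_le_sq _ hr.le
    nlinarith [sq_nonneg ε]
  have i1 : |inner ℝ ζ ζ₁| ≤ r * a := (abs_real_inner_le_norm _ _).trans (by gcongr)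
  have i2 : |inner ℝ ζ ζ₂| ≤ r * b := (abs_real_inner_le_norm _ _).trans (by gcongr)
  refine ⟨_, _, j2, ?_, ?_⟩
  · rw [add_zero, abs_mul, abs_mul, Nat.abs_ofNat,
      abs_of_pos (by positivity : (0 : ℝ) < (2 * r)⁻¹)]
    refine le_trans ?_ (le_mul_scale hr hb)
    calc 2 * |inner ℝ ζ ζ₁| * (2 * r)⁻¹ ≤ 2 * (r * a) * (2 * r)⁻¹ := by gcongr
      _ = a := by field_simp
  · refine le_trans ?_ (le_mul_scale_sq hr hb)
    have i3 : |2 * (‖ζ₁‖ ^ 2 + inner ℝ ζ ζ₂) + 0| ≤ 2 * (a ^ 2 + r * b) := by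
      rw [add_zero, abs_mul, Nat.abs_ofNat]
      gcongr
      refine (abs_add_le _ _).trans (add_le_add ?_ i2)
      rw [abs_of_nonneg (sq_nonneg _)]
      gcongr
    have i4 : |2 * inner ℝ ζ ζ₁ + 0| ≤ 2 * (r * a) := by
      rw [add_zero, abs_mul, Nat.abs_ofNat]; gcongr
    refine (abs_add_le _ _).trans ?_
    rw [abs_mul, abs_mul, abs_mul, abs_neg, abs_of_pos (by positivity : (0 : ℝ) < (2 * r)⁻¹),
      abs_of_pos (by positivity : (0 : ℝ) < (4 * r ^ 3)⁻¹)]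
    -- The two terms are at most `a²/r + b` and `a²/r`, which explains the coefficient 2 in `scale`.
    calc _ ≤ 2 * (a ^ 2 + r * b) * (2 * r)⁻¹ + 2 * (r * a) * (2 * (r * a) * (4 * r ^ 3)⁻¹) := by
          gcongr
      _ = _ := by field_simp; ring

/-- The bound for the second order Taylor data of the profile. -/
def proBd (r z₁ z₂ : ℝ) : ℝ := r + z₁ + z₂ + (1 + r) ^ 2 * (r ^ 2 + z₁ ^ 2 + r * z₂)

theorem proBd_nonneg {r z₁ z₂ : ℝ} (hr : 0 ≤ r) (h1 : 0 ≤ z₁) (h2 : 0 ≤ z₂) :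
    0 ≤ proBd r z₁ z₂ := by
  rw [proBd]; positivity

theorem bjet_inv_weight (hm : Jet m m₀ m₁ m₂) (hm0 : 1 ≤ m₀) (hm1 : |m₁| ≤ m₀)
    (hm2 : |m₂| ≤ m₀ * 2) : BJet (fun h ↦ (m h)⁻¹) m₀⁻¹ 2 := by
  have := BJet.inv hm (one_pos.trans_le hm0) zero_le_one (by simpa using hm1) (by simpa using hm2)
  simpa using this

/-- The derivatives of the logarithm are at most 1 and 3. Since the logarithm is at least 1 when `t
≥ e`, they fit the amplitude `log` with rate 2. -/
theorem bjet_log (hm : Jet m m₀ m₁ m₂) (hm0 : 1 ≤ m₀) (hm1 : |m₁| ≤ m₀)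
    (hm2 : |m₂| ≤ m₀ * 2) {ρ : ℝ} (hρ : 0 < ρ) (ht : 1 ≤ Real.log (ρ * m₀)) :
    BJet (fun h ↦ Real.log (ρ * m h)) (Real.log (ρ * m₀)) 2 := by
  have hm0' := one_pos.trans_le hm0
  have j := ((Jet.const ρ).mul hm).log (by positivity)
  refine BJet.of_jet j (le_of_eq (by rw [Real.norm_eq_abs, abs_of_pos (by linarith)])) ?_ ?_
  · rw [zero_mul, zero_add, Real.norm_eq_abs, abs_mul, abs_mul, abs_of_pos hρ,
      abs_of_pos (by positivity : 0 < (ρ * m₀)⁻¹)]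
    calc ρ * |m₁| * (ρ * m₀)⁻¹ ≤ ρ * m₀ * (ρ * m₀)⁻¹ := by gcongr
      _ = 1 := by field_simp
      _ ≤ _ := by linarith
  · have e : ‖(0 * m₀ + 0 * m₁ + (0 * m₁ + ρ * m₂)) * (ρ * m₀)⁻¹
        + (0 * m₀ + ρ * m₁) * ((0 * m₀ + ρ * m₁) * -((ρ * m₀) ^ 2)⁻¹)‖ ≤
        ρ * |m₂| * (ρ * m₀)⁻¹ + ρ * |m₁| * (ρ * |m₁| * ((ρ * m₀) ^ 2)⁻¹) := by
      simp only [zero_mul, zero_add]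
      refine (norm_add_le _ _).trans (le_of_eq ?_)
      have p1 : 0 < (ρ * m₀)⁻¹ := by positivity
      have p2 : 0 < ((ρ * m₀) ^ 2)⁻¹ := by positivity
      generalize (ρ * m₀)⁻¹ = u at p1
      generalize ((ρ * m₀) ^ 2)⁻¹ = v at p2
      simp only [Real.norm_eq_abs, abs_mul, abs_neg, abs_of_pos hρ, abs_of_pos p1, abs_of_pos p2]
    refine e.trans ?_
    calc _ ≤ ρ * (m₀ * 2) * (ρ * m₀)⁻¹ + ρ * m₀ * (ρ * m₀ * ((ρ * m₀) ^ 2)⁻¹) := by gcongr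
      _ = 3 := by field_simp; norm_num
      _ ≤ _ := by linarith

/-- The part of the phase that depends on the amplitude. -/
theorem bjet_phase (lam : ℝ) {f l g : ℝ → ℝ} {R ℓ P : ℝ} (hf : BJet f R P) (hl : BJet l ℓ 2)
    (hg : BJet g m₀⁻¹ 2) (hm0 : 1 ≤ m₀) (hP : 1 ≤ P) :
    BJet (fun h ↦ phaseCoeff lam * f h * g h * l h) (|phaseCoeff lam| * R * ℓ) (5 * P) := by
  have hR := hf.nonneg
  have hℓ := hl.nonneg
  have hi : m₀⁻¹ ≤ 1 := inv_le_one_of_one_le₀ hm0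
  have hm0' : 0 ≤ m₀⁻¹ := by positivity
  -- The rates add up to `0 + P + 2 + 2 ≤ 5P`.
  refine ((((BJet.const (phaseCoeff lam) (le_refl _) (le_refl (0 : ℝ))).mul hf le_rfl).mul hg
    (by linarith)).mul hl (by linarith)).mono ?_ (by linarith) (by linarith)
  rw [Real.norm_eq_abs]
  exact mul_le_mul_of_nonneg_right (mul_le_of_le_one_right (by positivity) hi) hℓ

/-- At fixed `ρ` the large part `t/⟨μ⟩ = ρ` of the phase is constant, so differentiation brings down
only the logarithmic part `g`. This is the advantage of hyperbolic coordinates. -/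
theorem jet_osc {g : ℝ → ℝ} {L P : ℝ} (hg : BJet g L P) (ρ : ℝ) :
    ∃ e₀ e₁ e₂ : ℂ, Jet (fun h ↦ Complex.exp (-Complex.I * ((ρ + g h : ℝ) : ℂ))) e₀ e₁ e₂ ∧
      ‖e₀‖ = 1 ∧ ‖e₁‖ ≤ L * P ∧ ‖e₂‖ ≤ (L + L ^ 2) * P ^ 2 := by
  obtain ⟨g₀, g₁, g₂, hj, h0, h1, h2⟩ := hg
  have j := ((Jet.const (-Complex.I)).mul ((Jet.const ρ).add hj).ofReal).cexp
  have hn : ‖Complex.exp (-Complex.I * ((ρ + g₀ : ℝ) : ℂ))‖ = 1 := norm_exp_neg_I_mul _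
  refine ⟨_, _, _, j, hn, ?_, ?_⟩
  · rw [norm_mul, hn, mul_one, zero_mul, zero_add, norm_mul, norm_neg, Complex.norm_I, one_mul,
      zero_add, Complex.norm_real]
    exact h1
  · refine (norm_add_le _ _).trans ?_
    rw [norm_mul, norm_mul, norm_mul, hn]
    simp only [zero_mul, zero_add, mul_one, norm_mul, norm_neg, Complex.norm_I, one_mul,
      Complex.norm_real]
    calc ‖g₂‖ + ‖g₁‖ * ‖g₁‖ ≤ L * P ^ 2 + (L * P) * (L * P) := by
          have := (norm_nonneg _).trans h1
          gcongr
      _ = _ := by ring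

/-- Strict inequality keeps the point in the open disc, where the series is holomorphic. The two
terms of the second derivative contribute `coeffSum` each, whence the factor 2. -/
theorem bjet_kk {f : ℝ → ℂ} {P : ℝ} (hf : BJet f 1 P) (h0 : ‖f 0‖ < 1) (hP : 0 ≤ P) :
    BJet (fun h ↦ kk 0 (f h)) (2 * coeffSum) P := by
  have hC := coeffSum_nonneg
  obtain ⟨d₀, d₁, d₂, hj, k0, k1, k2⟩ := hf
  rw [hj.val] at h0
  have hev : ∀ᶠ y in 𝓝 d₀, HasDerivAt (kd 0) (kd 1 y) y := by
    have : Metric.ball (0 : ℂ) 1 ∈ 𝓝 d₀ := Metric.isOpen_ball.mem_nhds (by simpa using h0)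
    filter_upwards [this] with y hy using hasDerivAt_kd (by norm_num) (by simpa using hy)
  have j := hj.comp hev (hasDerivAt_kd (i := 1) le_rfl h0)
  rw [kd_zero] at j
  rw [one_mul] at k1 k2
  have n1 := norm_kd_le (i := 1) (by norm_num) h0.le
  have n2 := norm_kd_le (i := 2) (by norm_num) h0.le
  refine BJet.of_jet j ?_ ?_ ?_
  · have := norm_kk_le (j := 0) (by norm_num) h0.le
    refine this.trans ?_
    have : ‖d₀‖ ^ 2 ≤ 1 := pow_le_one₀ (norm_nonneg _) h0.le
    nlinarith
  · rw [norm_mul]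
    calc _ ≤ P * coeffSum := by gcongr
      _ ≤ _ := by nlinarith [mul_nonneg hP hC]
  · refine (norm_add_le _ _).trans ?_
    rw [norm_mul, norm_mul, norm_mul]
    calc _ ≤ P ^ 2 * coeffSum + P * (P * coeffSum) := by gcongr
      _ = _ := by ring

/-- The product rule for `BJet` would give `R P²` without any further small factor, which contains
`a²/r` and is not uniform in the regularization. So the terms in which the oscillation is not
differentiated are kept linear in `R + a + b`; wherever `P²` occurs it has the factor `L`, which in
the application is proportional to `r`. -/
theorem jet_amplitude {f g e : ℝ → ℂ} {R a b i L P ρ : ℝ} {f₀ f₁ f₂ e₀ e₁ e₂ : ℂ}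
    (hf : Jet f f₀ f₁ f₂) (h0 : ‖f₀‖ ≤ R) (h1 : ‖f₁‖ ≤ a) (h2 : ‖f₂‖ ≤ b) (haP : a ≤ R * P)
    (hg : BJet g i 2) (he : Jet e e₀ e₁ e₂) (k0 : ‖e₀‖ = 1) (k1 : ‖e₁‖ ≤ L * (5 * P))
    (k2 : ‖e₂‖ ≤ (L + L ^ 2) * (5 * P) ^ 2) (hP : 1 ≤ P) (hL : 0 ≤ L) (hρ : 0 < ρ) :
    ∃ d₀ d₁ d₂ : ℂ, Jet (fun h ↦ ((ρ⁻¹ : ℝ) : ℂ) * (g h * f h * e h)) d₀ d₁ d₂ ∧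
      ‖d₁‖ ≤ ρ⁻¹ * i * (4 * (R + a + b) + 55 * (L + L ^ 2) * (R * P ^ 2)) ∧
      ‖d₂‖ ≤ ρ⁻¹ * i * (4 * (R + a + b) + 55 * (L + L ^ 2) * (R * P ^ 2)) := by
  have hi := hg.nonneg
  have hR := (norm_nonneg _).trans h0
  have ha := (norm_nonneg _).trans h1
  have hb := (norm_nonneg _).trans h2
  obtain ⟨g₀, g₁, g₂, hj, l0, l1, l2⟩ := hg
  have j := (Jet.const ((ρ⁻¹ : ℝ) : ℂ)).mul ((hj.mul hf).mul he)
  have hm : ∀ (x y : ℂ) (a b : ℝ), ‖x‖ ≤ a → ‖y‖ ≤ b → 0 ≤ a → ‖x * y‖ ≤ a * b :=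
    fun x y a b hx hy ha ↦ (norm_mul_le x y).trans (mul_le_mul hx hy (norm_nonneg _) ha)
  have hy0 : ‖g₀ * f₀‖ ≤ i * R := hm _ _ _ _ l0 h0 hi
  have hy1 : ‖g₁ * f₀ + g₀ * f₁‖ ≤ i * (a + 2 * R) := (norm_add_le _ _).trans
    ((add_le_add (hm _ _ _ _ l1 h0 (by positivity)) (hm _ _ _ _ l0 h1 hi)).trans
      (le_of_eq (by ring)))
  have hy2 : ‖g₂ * f₀ + g₁ * f₁ + (g₁ * f₁ + g₀ * f₂)‖ ≤ i * (b + 4 * a + 4 * R) :=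
    (norm_add_le _ _).trans ((add_le_add
      ((norm_add_le _ _).trans (add_le_add (hm _ _ _ _ l2 h0 (by positivity))
        (hm _ _ _ _ l1 h1 (by positivity))))
      ((norm_add_le _ _).trans (add_le_add (hm _ _ _ _ l1 h1 (by positivity))
        (hm _ _ _ _ l0 h2 hi)))).trans (le_of_eq (by ring)))
  have hρn : ‖((ρ⁻¹ : ℝ) : ℂ)‖ = ρ⁻¹ := by
    rw [Complex.norm_real, Real.norm_eq_abs, abs_of_pos (inv_pos.2 hρ)]
  have hP0 : (0 : ℝ) ≤ P := by linarith
  have hPP : P ≤ P ^ 2 := by nlinarith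
  have hRP : R ≤ R * P := le_mul_of_one_le_right hR hP
  refine ⟨_, _, _, j, ?_, ?_⟩
  · rw [zero_mul, zero_add, norm_mul, hρn, mul_assoc ρ⁻¹ i]
    refine mul_le_mul_of_nonneg_left ?_ (inv_pos.2 hρ).le
    refine (norm_add_le _ _).trans ((add_le_add (hm _ _ _ _ hy1 k0.le (by positivity))
      (hm _ _ _ _ hy0 k1 (by positivity))).trans ?_)
    have e1 : R * L * (5 * P) ≤ 55 * (L + L ^ 2) * (R * P ^ 2) := by
      have : R * L * (5 * P) ≤ R * L * (5 * P ^ 2) := by gcongr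
      have h3 : 0 ≤ L ^ 2 * (R * P ^ 2) := by positivity
      have h4 : 0 ≤ L * (R * P ^ 2) := by positivity
      nlinarith
    have e2 : i * (a + 2 * R) * 1 + i * R * (L * (5 * P)) =
      i * (a + 2 * R + R * L * (5 * P)) := by ring
    rw [e2]
    gcongr
    linarith
  · simp only [zero_mul, zero_add]
    rw [norm_mul, hρn, mul_assoc ρ⁻¹ i]
    refine mul_le_mul_of_nonneg_left ?_ (inv_pos.2 hρ).le
    refine (norm_add_le _ _).trans ((add_le_add
      ((norm_add_le _ _).trans (add_le_add (hm _ _ _ _ hy2 k0.le (by positivity))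
        (hm _ _ _ _ hy1 k1 (by positivity))))
      ((norm_add_le _ _).trans (add_le_add (hm _ _ _ _ hy1 k1 (by positivity))
        (hm _ _ _ _ hy0 k2 (by positivity))))).trans ?_)
    have e2 : i * (b + 4 * a + 4 * R) * 1 + i * (a + 2 * R) * (L * (5 * P)) +
        (i * (a + 2 * R) * (L * (5 * P)) + i * R * ((L + L ^ 2) * (5 * P) ^ 2)) =
        i * (b + 4 * a + 4 * R + (a + 2 * R) * P * (10 * L) + 25 * ((L + L ^ 2) * (R * P ^ 2))) := by
      ring
    rw [e2]
    refine mul_le_mul_of_nonneg_left ?_ hi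
    have e3 : (a + 2 * R) * P * (10 * L) ≤ 3 * (R * P) * P * (10 * L) := by
      gcongr; linarith
    have e4 : 3 * (R * P) * P * (10 * L) = 30 * (L * (R * P ^ 2)) := by ring
    have e5 : 55 * (L + L ^ 2) * (R * P ^ 2) =
      30 * (L * (R * P ^ 2)) + 30 * (L ^ 2 * (R * P ^ 2)) + 25 * ((L + L ^ 2) * (R * P ^ 2)) := by
      ring
    have h3 : 0 ≤ L ^ 2 * (R * P ^ 2) := by positivity
    linarith

/-- Here the prefactor `R²` is already present and compensates the square of the rate, so the crude
product rule suffices. -/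
theorem bjet_second (lam : ℝ) {f e : ℝ → ℂ} {q g : ℝ → ℝ} {R i L P ρ : ℝ} {e₀ e₁ e₂ : ℂ}
    (hf : BJet f R P) (hq : BJet q R P) (hqi : BJet (fun h ↦ (q h)⁻¹) R⁻¹ (2 * P))
    (hf0 : ‖f 0‖ < q 0) (hR : 0 < R)
    (hg : BJet g i 2) (he : Jet e e₀ e₁ e₂) (k0 : ‖e₀‖ = 1) (k1 : ‖e₁‖ ≤ L * (5 * P))
    (k2 : ‖e₂‖ ≤ (L + L ^ 2) * (5 * P) ^ 2) (hP : 1 ≤ P) (hL : 0 ≤ L) :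
    BJet (fun h ↦ ((lam * (ρ⁻¹ * ρ⁻¹) * ((g h * g h) * (q h * q h)) : ℝ) : ℂ) *
      kk 0 (f h * e h * ((q h)⁻¹ : ℝ))) (|lam| * (ρ⁻¹ * ρ⁻¹) * (i * i * (R * R)) * (2 * coeffSum))
      (14 * (1 + L) * P) := by
  have hP0 : (0 : ℝ) ≤ P := by linarith
  have hLP : 0 ≤ L * P := by positivity
  have hE : BJet e 1 (5 * (1 + L) * P) := by
    refine BJet.of_jet he k0.le ?_ ?_
    · rw [one_mul]; linarith
    · rw [one_mul]
      refine k2.trans ?_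
      have : 0 ≤ (1 + L) * (P ^ 2) := by positivity
      nlinarith
  have hw : BJet (fun h ↦ f h * e h * ((q h)⁻¹ : ℝ)) 1 (8 * (1 + L) * P) := by
    -- The amplitudes multiply to `R · 1 · R⁻¹ = 1`, and the rates add up to `P + 5(1 + L)P + 2P ≤
    -- 8(1 + L)P`.
    refine ((hf.mul hE hP0).mul hqi.ofReal (by positivity)).mono (le_of_eq ?_) (by positivity) ?_
    · field_simp
    · nlinarith
  have hk := bjet_kk hw ?_ (by positivity)
  · have hr : BJet (fun h ↦ lam * (ρ⁻¹ * ρ⁻¹) * ((g h * g h) * (q h * q h)))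
        (|lam| * (ρ⁻¹ * ρ⁻¹) * (i * i * (R * R))) (0 + ((2 + 2) + (P + P))) := by
      refine (BJet.const (lam * (ρ⁻¹ * ρ⁻¹)) (le_of_eq ?_) le_rfl).mul
        ((hg.mul hg zero_le_two).mul (hq.mul hq hP0) (by norm_num)) le_rfl
      rw [Real.norm_eq_abs, abs_mul, abs_mul_self]
    -- `4 + 2P + 8(1 + L)P ≤ 14(1 + L)P`, because `P ≥ 1`.
    refine (hr.ofReal.mul hk (by positivity)).mono le_rfl (by positivity) ?_
    nlinarith
  · have hq0 : 0 < q 0 := (norm_nonneg _).trans_lt hf0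
    rw [norm_mul, norm_mul, he.val, k0, mul_one, Complex.norm_real, Real.norm_eq_abs,
      abs_of_pos (inv_pos.2 hq0), ← div_eq_mul_inv, div_lt_one hq0]
    exact hf0

/-- The constant in the bound for the profile. -/
def proConst (lam : ℝ) : ℝ :=
  (110 + 784 * (|lam| * coeffSum)) * (1 + |phaseCoeff lam|) ^ 2

theorem proConst_nonneg (lam : ℝ) : 0 ≤ proConst lam := by
  have := coeffSum_nonneg
  unfold proConst; positivity

/-- The hypothesis on `r² P²` trades the rate for quantities free of negative powers of `r`; `L = c
r ℓ` and the square `r²` supply the two factors `r`. The powers of `ℓ ≥ 1` are raised to `ℓ²`. The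
constants are `110 = 2·55` and `784 = 2·2·14²`. -/
theorem final_bound {c A C ℓ r a b P t : ℝ} (hc : 0 ≤ c) (hA : 0 ≤ A) (hC : 0 ≤ C) (hℓ : 1 ≤ ℓ)
    (hr : 0 < r) (ha : 0 ≤ a) (hb : 0 ≤ b) (ht : 1 ≤ t) (hP : 1 ≤ P)
    (hPe : r * (r * P ^ 2) ≤ 2 * (r ^ 2 + a ^ 2 + r * b)) :
    t⁻¹ * (4 * (r + a + b) + 55 * (c * r * ℓ + (c * r * ℓ) ^ 2) * (r * P ^ 2)) +
      A * (t⁻¹ * t⁻¹) * (r * r) * (2 * C) * (14 * (1 + c * r * ℓ) * P) ^ 2 ≤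
      (110 + 784 * (A * C)) * (1 + c) ^ 2 * ℓ ^ 2 * t⁻¹ * proBd r a b := by
  set X := r ^ 2 + a ^ 2 + r * b with hX
  have hX0 : 0 ≤ X := by positivity
  have hti : t⁻¹ ≤ 1 := inv_le_one_of_one_le₀ ht
  have ht0 : 0 < t⁻¹ := by positivity
  have hℓ2 : ℓ ≤ ℓ ^ 2 := by nlinarith
  have hcr : 0 ≤ c * r := by positivity
  have hD : 1 ≤ (1 + c) ^ 2 * ℓ ^ 2 := by
    have h1 : 1 ≤ (1 + c) ^ 2 := by nlinarith
    have h2 : 1 ≤ ℓ ^ 2 := by nlinarith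
    nlinarith
  have a1 : (c * r * ℓ + (c * r * ℓ) ^ 2) * (r * P ^ 2) ≤ (1 + c) ^ 2 * ℓ ^ 2 * ((1 + r) ^ 2 * (2 * X)) := by
    have e : (c * r * ℓ + (c * r * ℓ) ^ 2) * (r * P ^ 2) =
      (c * ℓ + c ^ 2 * ℓ ^ 2 * r) * (r * (r * P ^ 2)) := by ring
    rw [e]
    have : c * ℓ + c ^ 2 * ℓ ^ 2 * r ≤ (1 + c) ^ 2 * ℓ ^ 2 * (1 + r) ^ 2 := by
      have h1 : c * ℓ ≤ c * ℓ ^ 2 := by gcongr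
      have h2 : c + c ^ 2 * r ≤ (1 + c) ^ 2 * (1 + r) ^ 2 := by
        have : 0 ≤ c * r := by positivity
        have h3 : 0 ≤ c ^ 2 * r := by positivity
        have h4 : 0 ≤ c ^ 2 * r ^ 2 := by positivity
        have h5 : 0 ≤ c * r ^ 2 := by positivity
        nlinarith
      have h3 := mul_le_mul_of_nonneg_right h2 (sq_nonneg ℓ)
      linarith
    calc _ ≤ (1 + c) ^ 2 * ℓ ^ 2 * (1 + r) ^ 2 * (2 * X) := by gcongr
      _ = _ := by ring
  have a2 : A * (t⁻¹ * t⁻¹) * (r * r) * (2 * C) * (14 * (1 + c * r * ℓ) * P) ^ 2 ≤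
      t⁻¹ * (784 * (A * C) * ((1 + c) ^ 2 * ℓ ^ 2 * ((1 + r) ^ 2 * X))) := by
    have e : A * (t⁻¹ * t⁻¹) * (r * r) * (2 * C) * (14 * (1 + c * r * ℓ) * P) ^ 2 =
      t⁻¹ * (t⁻¹ * (392 * (A * C) * ((1 + c * r * ℓ) ^ 2 * (r * (r * P ^ 2))))) := by ring
    rw [e]
    have h1 : 1 + c * r * ℓ ≤ (1 + c) * ℓ * (1 + r) := by
      have : 0 ≤ r * ℓ := by positivity
      nlinarith [mul_nonneg hc (by linarith : 0 ≤ ℓ)]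
    have h2 : (1 + c * r * ℓ) ^ 2 * (r * (r * P ^ 2)) ≤
        ((1 + c) * ℓ * (1 + r)) ^ 2 * (2 * X) := by gcongr
    refine mul_le_mul_of_nonneg_left ?_ ht0.le
    calc _ ≤ 1 * (392 * (A * C) * ((1 + c * r * ℓ) ^ 2 * (r * (r * P ^ 2)))) := by gcongr
      _ ≤ 1 * (392 * (A * C) * (((1 + c) * ℓ * (1 + r)) ^ 2 * (2 * X))) := by gcongr
      _ = _ := by ring
  have a3 : 4 * (r + a + b) ≤ (110 + 784 * (A * C)) * ((1 + c) ^ 2 * ℓ ^ 2 * (r + a + b)) := by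
    have h1 : r + a + b ≤ (1 + c) ^ 2 * ℓ ^ 2 * (r + a + b) :=
      le_mul_of_one_le_left (by positivity) hD
    have h2 : 0 ≤ A * C * ((1 + c) ^ 2 * ℓ ^ 2 * (r + a + b)) := by positivity
    nlinarith
  have a4 : t⁻¹ * (4 * (r + a + b) + 55 * (c * r * ℓ + (c * r * ℓ) ^ 2) * (r * P ^ 2)) ≤
      t⁻¹ * ((110 + 784 * (A * C)) * ((1 + c) ^ 2 * ℓ ^ 2 * (r + a + b)) +
        110 * ((1 + c) ^ 2 * ℓ ^ 2 * ((1 + r) ^ 2 * X))) := by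
    refine mul_le_mul_of_nonneg_left ?_ ht0.le
    linarith
  refine (add_le_add a4 a2).trans (le_of_eq ?_)
  rw [proBd]
  ring

theorem pro_mul_eq (lam : ℝ) {ρ m : ℝ} (hm : m ≠ 0) (ζ : ℂ) (q : ℝ) :
    pro lam (ρ * m) ζ q m = ((ρ⁻¹ : ℝ) : ℂ) * (((m⁻¹ : ℝ) : ℂ) * ζ * Complex.exp (-Complex.I *
      ((ρ + phaseCoeff lam * q * m⁻¹ * Real.log (ρ * m) : ℝ) : ℂ))) +
      ((lam * (ρ⁻¹ * ρ⁻¹) * ((m⁻¹ * m⁻¹) * (q * q)) : ℝ) : ℂ) *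
      kk 0 (ζ * Complex.exp (-Complex.I *
      ((ρ + phaseCoeff lam * q * m⁻¹ * Real.log (ρ * m) : ℝ) : ℂ)) * (q⁻¹ : ℝ)) := by
  have hph : phase lam (ρ * m) q m = ρ + phaseCoeff lam * q * m⁻¹ * Real.log (ρ * m) := by
    rw [phase, mul_div_assoc, div_self hm, mul_one, div_eq_mul_inv]
  rw [pro, osc, hph]
  generalize Complex.exp (-Complex.I *
      ((ρ + phaseCoeff lam * q * m⁻¹ * Real.log (ρ * m) : ℝ) : ℂ)) = E
  rw [div_eq_mul_inv, ← Complex.ofReal_inv]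
  generalize kk 0 (ζ * E * ((q⁻¹ : ℝ) : ℂ)) = K
  push_cast
  rw [mul_inv]
  ring

theorem jet_pro (lam : ℝ) {a b ρ : ℝ} (hz : Jet z ζ ζ₁ ζ₂) (hε : 0 < ε) (hr : 0 < r)
    (hrζ : ‖ζ‖ ^ 2 + ε ^ 2 = r ^ 2) (h1 : ‖ζ₁‖ ≤ a) (h2 : ‖ζ₂‖ ≤ b)
    (hm : Jet m m₀ m₁ m₂) (hm0 : 1 ≤ m₀) (hm1 : |m₁| ≤ m₀) (hm2 : |m₂| ≤ m₀ * 2)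
    (hρ : 0 < ρ) (ht : 1 ≤ ρ * m₀) (hℓ : 1 ≤ Real.log (ρ * m₀)) :
    ∃ d₀ d₁ d₂ : ℂ, Jet (fun h ↦ pro lam (ρ * m h) (z h) √(‖z h‖ ^ 2 + ε ^ 2) (m h)) d₀ d₁ d₂ ∧
      ‖d₁‖ ≤ proConst lam * Real.log (ρ * m₀) ^ 2 * (ρ * m₀)⁻¹ * proBd r a b ∧
      ‖d₂‖ ≤ proConst lam * Real.log (ρ * m₀) ^ 2 * (ρ * m₀)⁻¹ * proBd r a b := by
  have hb := (norm_nonneg _).trans h2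
  have ha := (norm_nonneg _).trans h1
  obtain ⟨r₁, r₂, jr, hr1, hr2⟩ := bjet_sqrt hz hr hrζ h1 h2
  set P := scale r a b with hPdef
  have hP : 1 ≤ P := one_le_scale hr hb
  have hP0 : 0 ≤ P := by linarith
  have haP : a ≤ r * P := le_mul_scale hr hb
  have hbP : b ≤ r * P ^ 2 := by
    refine le_trans ?_ (le_mul_scale_sq hr hb)
    have : 0 ≤ 2 * (a ^ 2 / r) := by positivity
    linarith
  have hζr : ‖ζ‖ < r := by
    apply lt_of_pow_lt_pow_left₀ 2 hr.le
    nlinarith [sq_pos_of_pos hε]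
  set q : ℝ → ℝ := fun h ↦ √(‖z h‖ ^ 2 + ε ^ 2) with hq
  have bq : BJet q r P := BJet.of_jet jr (by rw [Real.norm_eq_abs, abs_of_pos hr]) hr1 hr2
  have bqi : BJet (fun h ↦ (q h)⁻¹) r⁻¹ (2 * P) := BJet.inv jr hr hP0 hr1 (hr2.trans (by
    gcongr; linarith [sq_nonneg P]))
  have bg := bjet_inv_weight hm hm0 hm1 hm2
  have bl := bjet_log hm hm0 hm1 hm2 hρ hℓ
  have bp := bjet_phase lam bq bl bg hm0 hP
  obtain ⟨e₀, e₁, e₂, je, k0, k1, k2⟩ := jet_osc bp ρ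
  obtain ⟨e, he⟩ : ∃ e : ℝ → ℂ, e = fun h ↦ Complex.exp (-Complex.I *
      ((ρ + phaseCoeff lam * q h * (m h)⁻¹ * Real.log (ρ * m h) : ℝ) : ℂ)) := ⟨_, rfl⟩
  rw [← he] at je
  set L := |phaseCoeff lam| * r * Real.log (ρ * m₀) with hLdef
  have hL : 0 ≤ L := by positivity
  obtain ⟨d₀, d₁, d₂, j1, n1, n2⟩ := jet_amplitude (f := z) (g := fun h ↦ ((m h)⁻¹ : ℝ))
    (e := e) (P := P) (L := L) (R := r) (ρ := ρ) hz hζr.le h1 h2 haP bg.ofReal je k0 k1 k2 hP hL hρ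
  have bz : BJet z r P := BJet.of_jet hz hζr.le (h1.trans haP) (h2.trans hbP)
  obtain ⟨f₀, f₁, f₂, j2, -, u1, u2⟩ := bjet_second lam (ρ := ρ)
    (f := z) (q := q) (g := fun h ↦ (m h)⁻¹) (e := e) bz bq bqi
    (by rw [hz.val, jr.val]; exact hζr) hr bg je k0 k1 k2 hP hL
  have hti : (ρ * m₀)⁻¹ = ρ⁻¹ * m₀⁻¹ := mul_inv _ _
  have hPe : r * (r * P ^ 2) ≤ 2 * (r ^ 2 + a ^ 2 + r * b) := by
    rw [scale_sq hr hb]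
    have : r * (r * (1 + 2 * (a / r) ^ 2 + b / r)) = r ^ 2 + 2 * a ^ 2 + r * b := by
      field_simp
    rw [this]
    nlinarith [mul_nonneg hr.le hb, sq_nonneg r]
  have fb := final_bound (abs_nonneg (phaseCoeff lam)) (abs_nonneg lam) coeffSum_nonneg hℓ hr ha hb ht
    hP hPe
  rw [hti] at fb
  have hQ : 1 ≤ 14 * (1 + L) * P := by
    have : 0 ≤ L * P := mul_nonneg hL hP0
    linarith
  have ea : |lam| * (ρ⁻¹ * ρ⁻¹) * (m₀⁻¹ * m₀⁻¹ * (r * r)) * (2 * coeffSum) =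
      |lam| * (ρ⁻¹ * m₀⁻¹ * (ρ⁻¹ * m₀⁻¹)) * (r * r) * (2 * coeffSum) := by ring
  rw [ea] at u1 u2
  have hA : 0 ≤ |lam| * (ρ⁻¹ * m₀⁻¹ * (ρ⁻¹ * m₀⁻¹)) * (r * r) * (2 * coeffSum) := by
    have := coeffSum_nonneg
    have : 0 < m₀ := by linarith
    positivity
  refine ⟨_, _, _, (j1.add j2).congr ?_, ?_, ?_⟩
  · have hne : ∀ᶠ h in 𝓝 (0 : ℝ), m h ≠ 0 := by
      have := hm.hasDerivAt.continuousAt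
      exact this.eventually_ne (by rw [hm.val]; linarith)
    filter_upwards [hne] with h hh
    rw [he]
    exact pro_mul_eq lam hh (z h) (q h)
  · rw [hti]
    refine (norm_add_le _ _).trans (le_trans ?_ fb)
    refine add_le_add n1 (u1.trans ?_)
    exact mul_le_mul_of_nonneg_left (le_self_pow₀ hQ two_ne_zero) hA
  · rw [hti]
    exact (norm_add_le _ _).trans (le_trans (add_le_add n2 u2) fb)

end

/-! ### Time derivatives of the profile -/

theorem Jet.scomp {F : Type*} [NormedAddCommGroup F] [NormedSpace ℝ F] {θ : ℝ → ℝ} {d₀ d₁ d₂ : ℝ}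
    (hθ : Jet θ d₀ d₁ d₂) {G G₁ : ℝ → F} {g₂ : F} (hG : ∀ y, HasDerivAt G (G₁ y) y)
    (hG₁ : HasDerivAt G₁ g₂ d₀) :
    Jet (fun h ↦ G (θ h)) (G d₀) (d₁ • G₁ d₀) (d₁ • d₁ • g₂ + d₂ • G₁ d₀) := by
  have hd := hθ.hasDerivAt
  have h0 := hθ.val
  obtain ⟨θ₁, h1, rfl, h2⟩ := hθ.ex
  refine ⟨by rw [h0], fun h ↦ θ₁ h • G₁ (θ h), ?_, by simp only [h0], ?_⟩
  · filter_upwards [h1] with h a using HasDerivAt.scomp h (hG (θ h)) a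
  · rw [← h0] at hG₁ ⊢
    exact h2.smul (HasDerivAt.scomp (0 : ℝ) hG₁ hd)

theorem Jet.comp_mul {F : Type*} [NormedAddCommGroup F] [NormedSpace ℝ F] {f : ℝ → F}
    {d₀ d₁ d₂ : F} (hf : Jet f d₀ d₁ d₂) (m : ℝ) :
    Jet (fun h ↦ f (m * h)) d₀ (m • d₁) (m • m • d₂) := by
  have h0 := hf.val
  obtain ⟨f₁, h1, rfl, h2⟩ := hf.ex
  have hm : ∀ h : ℝ, HasDerivAt (fun h ↦ m * h) m h := fun h ↦ by
    simpa using (hasDerivAt_id h).const_mul m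
  have ht : Tendsto (fun h : ℝ ↦ m * h) (𝓝 0) (𝓝 0) := by
    simpa using (hm 0).continuousAt.tendsto
  refine ⟨by simpa using h0, fun h ↦ m • f₁ (m * h), ?_, by simp, ?_⟩
  · filter_upwards [ht.eventually h1] with h a using HasDerivAt.scomp h a (hm h)
  · have h3 : HasDerivAt f₁ d₂ (m * 0) := by simpa using h2
    exact (HasDerivAt.scomp (0 : ℝ) h3 (hm 0)).const_smul m

/-- The first derivative of the phase in time. -/
def phase₁ (lam s r m : ℝ) : ℝ := 1 / m + phaseCoeff lam * r / m / s

/-- The second derivative of the phase in time. -/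
def phase₂ (lam s r m : ℝ) : ℝ := -(phaseCoeff lam * r / m / s ^ 2)

theorem jet_phase (lam : ℝ) {s : ℝ} (hs : 0 < s) (r m : ℝ) :
    Jet (fun h ↦ phase lam (s + h) r m) (phase lam s r m) (phase₁ lam s r m)
      (phase₂ lam s r m) := by
  have j1 : Jet (fun h : ℝ ↦ s + h) s 1 0 := by simpa using Jet.line s (1 : ℝ)
  have j := (j1.mul (Jet.const m⁻¹)).add ((Jet.const (phaseCoeff lam * r / m)).mul (j1.log hs.ne'))
  convert! j using 1
  · rw [phase₁]; field_simp; ring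
  · rw [phase₂]; field_simp; ring

/-- The harmonics of the second approximation. -/
def har (lam : ℝ) (j : ℕ) (s : ℝ) (ζ : ℂ) (r m : ℝ) : ℂ := kk j (ζ * osc lam s r m / r)

theorem norm_div_le_one {ζ : ℂ} {r : ℝ} (h : ‖ζ‖ ≤ r) : ‖ζ / r‖ ≤ 1 := by
  have hr := (norm_nonneg _).trans h
  rw [norm_div, Complex.norm_real, Real.norm_eq_abs, abs_of_nonneg hr]
  exact div_le_one_of_le₀ h hr

theorem norm_mul_osc_div_le_one (lam s m : ℝ) {ζ : ℂ} {r : ℝ} (h : ‖ζ‖ ≤ r) :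
    ‖ζ * osc lam s r m / r‖ ≤ 1 := by
  refine norm_div_le_one ?_
  rwa [norm_mul, norm_osc, mul_one]

theorem norm_har_le (lam : ℝ) {j : ℕ} (hj : j ≤ 2) (s m : ℝ) {ζ : ℂ} {r : ℝ} (h : ‖ζ‖ ≤ r) :
    ‖har lam j s ζ r m‖ ≤ coeffSum := by
  have h1 := norm_mul_osc_div_le_one lam s m h
  refine (norm_kk_le hj h1).trans (mul_le_of_le_one_right coeffSum_nonneg ?_)
  exact pow_le_one₀ (norm_nonneg _) h1

theorem jet_osc_time (lam : ℝ) {s : ℝ} (hs : 0 < s) (r m : ℝ) :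
    Jet (fun h ↦ osc lam (s + h) r m) (osc lam s r m)
      (phase₁ lam s r m • (-Complex.I * osc lam s r m))
      (phase₁ lam s r m • phase₁ lam s r m • (-Complex.I * (-Complex.I * osc lam s r m)) +
        phase₂ lam s r m • (-Complex.I * osc lam s r m)) :=
  (jet_phase lam hs r m).scomp (fun y ↦ hasDerivAt_exp_neg_I y)
    ((hasDerivAt_exp_neg_I _).const_mul _)

/-- Time acts on the harmonics by rotation only, so the equality `‖ζ‖ = r`, and even `r = 0`, are
allowed here, unlike for derivatives in `μ`. -/
theorem jet_har_time (lam : ℝ) {s : ℝ} (hs : 0 < s) {ζ : ℂ} {r : ℝ} (h : ‖ζ‖ ≤ r) (m : ℝ) :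
    Jet (fun h ↦ har lam 0 (s + h) ζ r m) (har lam 0 s ζ r m)
      (phase₁ lam s r m • (-Complex.I * har lam 1 s ζ r m))
      (phase₁ lam s r m • phase₁ lam s r m • (-Complex.I * (-Complex.I * har lam 2 s ζ r m)) +
        phase₂ lam s r m • (-Complex.I * har lam 1 s ζ r m)) := by
  have hz := norm_div_le_one h
  have e : ∀ (j : ℕ) (s : ℝ), har lam j s ζ r m =
      kk j (ζ / r * Complex.exp (-Complex.I * (phase lam s r m : ℝ))) := fun j s ↦ by
    rw [har, osc, div_mul_eq_mul_div]
  simp only [e]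
  exact (jet_phase lam hs r m).scomp (fun y ↦ hasDerivAt_kk_rotate (j := 0) (by norm_num) hz y)
    ((hasDerivAt_kk_rotate (j := 1) le_rfl hz _).const_mul _)

/-- The first time derivative of the profile. -/
def pro₁ (lam s : ℝ) (ζ : ℂ) (r m : ℝ) : ℂ :=
  -((s ^ 2)⁻¹ : ℝ) * (ζ * osc lam s r m)
    - Complex.I * phase₁ lam s r m * (s⁻¹ : ℝ) * (ζ * osc lam s r m)
    + (lam * r ^ 2 : ℝ) * (-2 * ((s ^ 3)⁻¹ : ℝ) * har lam 0 s ζ r m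
      - Complex.I * phase₁ lam s r m * ((s ^ 2)⁻¹ : ℝ) * har lam 1 s ζ r m)

/-- The second time derivative of the profile. -/
def pro₂ (lam s : ℝ) (ζ : ℂ) (r m : ℝ) : ℂ :=
  2 * ((s ^ 3)⁻¹ : ℝ) * (ζ * osc lam s r m)
    + 2 * Complex.I * phase₁ lam s r m * ((s ^ 2)⁻¹ : ℝ) * (ζ * osc lam s r m)
    - (Complex.I * phase₂ lam s r m + (phase₁ lam s r m : ℂ) ^ 2) * (s⁻¹ : ℝ)
      * (ζ * osc lam s r m)
    + (lam * r ^ 2 : ℝ) * (6 * ((s ^ 4)⁻¹ : ℝ) * har lam 0 s ζ r m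
      + 4 * Complex.I * phase₁ lam s r m * ((s ^ 3)⁻¹ : ℝ) * har lam 1 s ζ r m
      - Complex.I * phase₂ lam s r m * ((s ^ 2)⁻¹ : ℝ) * har lam 1 s ζ r m
      - (phase₁ lam s r m : ℂ) ^ 2 * ((s ^ 2)⁻¹ : ℝ) * har lam 2 s ζ r m)

theorem jet_pro_time (lam : ℝ) {s : ℝ} (hs : 0 < s) {ζ : ℂ} {r : ℝ} (h : ‖ζ‖ ≤ r) (m : ℝ) :
    Jet (fun h ↦ pro lam (s + h) ζ r m) (pro lam s ζ r m) (pro₁ lam s ζ r m)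
      (pro₂ lam s ζ r m) := by
  have j1 : Jet (fun h : ℝ ↦ s + h) s 1 0 := by simpa using Jet.line s (1 : ℝ)
  have ji := (j1.inv hs.ne').ofReal
  have j := (ji.mul ((Jet.const ζ).mul (jet_osc_time lam hs r m))).add
    ((Jet.const ((lam * r ^ 2 : ℝ) : ℂ)).mul ((ji.mul ji).mul (jet_har_time lam hs h m)))
  have hsc : (s : ℂ) ≠ 0 := by exact_mod_cast hs.ne'
  have hI : Complex.I ^ 2 = -1 := Complex.I_sq
  convert! j using 1
  · ext h
    rw [pro, har]
    push_cast
    rw [← inv_pow]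
    ring
  · rw [pro, har]
    push_cast
    rw [← inv_pow]
    ring
  · rw [pro₁]
    simp only [Complex.real_smul]
    generalize osc lam s r m = E
    generalize har lam 0 s ζ r m = K₀
    generalize har lam 1 s ζ r m = K₁
    push_cast
    field_simp
    ring
  · rw [pro₂]
    simp only [Complex.real_smul]
    generalize osc lam s r m = E
    generalize har lam 0 s ζ r m = K₀
    generalize har lam 1 s ζ r m = K₁
    generalize har lam 2 s ζ r m = K₂
    push_cast
    field_simp
    ring_nf
    simp only [hI]
    ring

/-- The resonant part of the wave operator applied to the profile. -/
def lead (lam s : ℝ) (ζ : ℂ) (r m : ℝ) : ℂ :=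
  ((lam * r ^ 2 * (s ^ 2)⁻¹ : ℝ) : ℂ) * ((8 / (3 * Real.pi) : ℝ) * (ζ * osc lam s r m / r)
    + har lam 0 s ζ r m - har lam 2 s ζ r m)

/-- With `B = phaseCoeff · r` one has `m · phase₁ = 1 + B/s`. In the first approximation the 1 in
`(1 + B/s)²` cancels the zeroth order term, `2B/s` yields the resonant term of `lead`, and the
contributions containing `phase₁` to the first power cancel thanks to the decay `s⁻¹`. In the second
approximation the leading part is the difference of `har 0` and `har 2`. What remains is of order
`s⁻³`. -/
theorem radial_identity (lam : ℝ) {s : ℝ} (hs : 0 < s) (ζ : ℂ) {r m : ℝ} (hr : 0 < r)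
    (hm : 0 < m) : (m ^ 2 : ℝ) * pro₂ lam s ζ r m + (2 * m ^ 2 / s : ℝ) * pro₁ lam s ζ r m
      + pro lam s ζ r m - lead lam s ζ r m =
    ((s ^ 3)⁻¹ : ℝ) * (ζ * osc lam s r m *
      (-(phaseCoeff lam * r : ℝ) ^ 2 + Complex.I * (m * (phaseCoeff lam * r) : ℝ))) +
    (lam * r ^ 2 * (s ^ 2)⁻¹ : ℝ) * ((2 * m ^ 2 / s ^ 2 : ℝ) * har lam 0 s ζ r m
      + Complex.I * (2 * m / s + 3 * m * (phaseCoeff lam * r) / s ^ 2 : ℝ) * har lam 1 s ζ r m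
      - (2 * (phaseCoeff lam * r) / s + (phaseCoeff lam * r) ^ 2 / s ^ 2 : ℝ) *
        har lam 2 s ζ r m) := by
  have hk : (8 / (3 * Real.pi) : ℝ) * lam = -2 * phaseCoeff lam := by
    rw [phaseCoeff]; field_simp; ring
  have hsc : (s : ℂ) ≠ 0 := by exact_mod_cast hs.ne'
  have hmc : (m : ℂ) ≠ 0 := by exact_mod_cast hm.ne'
  have hrc : (r : ℂ) ≠ 0 := by exact_mod_cast hr.ne'
  have e1 : pro lam s ζ r m = ((s⁻¹ : ℝ) : ℂ) * (ζ * osc lam s r m)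
    + ((lam * (s ^ 2)⁻¹ * r ^ 2 : ℝ) : ℂ) * har lam 0 s ζ r m := rfl
  have e2 : lead lam s ζ r m = ((s ^ 2)⁻¹ : ℝ) * ((-2 * phaseCoeff lam : ℝ) * r *
      (ζ * osc lam s r m)) + ((lam * r ^ 2 * (s ^ 2)⁻¹ : ℝ) : ℂ) *
      (har lam 0 s ζ r m - har lam 2 s ζ r m) := by
    rw [lead, ← hk]
    push_cast
    field_simp
    ring
  rw [e1, e2, pro₁, pro₂, phase₁, phase₂]
  generalize osc lam s r m = E
  generalize har lam 0 s ζ r m = K₀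
  generalize har lam 1 s ζ r m = K₁
  generalize har lam 2 s ζ r m = K₂
  generalize phaseCoeff lam = c
  push_cast
  field_simp
  ring

/-- The constant in the bound for the time derivatives of the profile. -/
def radConst (lam : ℝ) : ℝ := |phaseCoeff lam| ^ 2 + |phaseCoeff lam| +
  |lam| * coeffSum * (4 + 5 * |phaseCoeff lam| + |phaseCoeff lam| ^ 2)

theorem radConst_nonneg (lam : ℝ) : 0 ≤ radConst lam := by
  have := coeffSum_nonneg
  unfold radConst; positivity

theorem norm_radial_le (lam : ℝ) {s : ℝ} (hs : 1 ≤ s) {ζ : ℂ} {r m : ℝ} (hr : 0 < r)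
    (hζ : ‖ζ‖ ≤ r) (hm : 1 ≤ m) :
    ‖(m ^ 2 : ℝ) * pro₂ lam s ζ r m + (2 * m ^ 2 / s : ℝ) * pro₁ lam s ζ r m
      + pro lam s ζ r m - lead lam s ζ r m‖ ≤
    m ^ 2 * (s ^ 3)⁻¹ * (radConst lam * ((1 + r) ^ 2 * r ^ 2)) := by
  have hs0 : 0 < s := by linarith
  have hm0 : 0 < m := by linarith
  rw [radial_identity lam hs0 ζ hr hm0]
  have k0 := norm_har_le lam (j := 0) (by norm_num) s m hζ
  have k1 := norm_har_le lam (j := 1) (by norm_num) s m hζ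
  have k2 := norm_har_le lam (j := 2) (by norm_num) s m hζ
  have hE : ‖ζ * osc lam s r m‖ ≤ r := by rwa [norm_mul, norm_osc, mul_one]
  have hC := coeffSum_nonneg
  generalize ζ * osc lam s r m = X at hE
  generalize har lam 0 s ζ r m = K₀ at k0
  generalize har lam 1 s ζ r m = K₁ at k1
  generalize har lam 2 s ζ r m = K₂ at k2
  have hB : |phaseCoeff lam * r| = |phaseCoeff lam| * r := by rw [abs_mul, abs_of_pos hr]
  rw [radConst]
  generalize phaseCoeff lam = c at *
  obtain ⟨B, hBe⟩ : ∃ B, B = c * r := ⟨_, rfl⟩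
  rw [← hBe] at hB ⊢
  have hmm : m ≤ m ^ 2 := by nlinarith
  have h1m : 1 ≤ m ^ 2 := by nlinarith
  have t1 : ‖((s ^ 3)⁻¹ : ℝ) * (X * (-(B : ℂ) ^ 2 + Complex.I * (m * B : ℝ)))‖ ≤
      (s ^ 3)⁻¹ * (r * (m ^ 2 * (|B| ^ 2 + |B|))) := by
    rw [norm_mul, norm_mul, Complex.norm_real, Real.norm_eq_abs, abs_of_pos (by positivity)]
    have : ‖-(B : ℂ) ^ 2 + Complex.I * (m * B : ℝ)‖ ≤ m ^ 2 * (|B| ^ 2 + |B|) := by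
      refine (norm_add_le _ _).trans ?_
      rw [norm_neg, norm_pow, Complex.norm_real, norm_mul, Complex.norm_I, one_mul,
        Complex.norm_real, Real.norm_eq_abs, Real.norm_eq_abs, abs_mul, abs_of_pos hm0]
      have := mul_le_mul_of_nonneg_right hmm (abs_nonneg B)
      have := mul_le_mul_of_nonneg_right h1m (sq_nonneg |B|)
      linarith
    gcongr
  have hsi : s⁻¹ ≤ 1 := inv_le_one_of_one_le₀ hs
  have t2 : ‖(2 * m ^ 2 / s ^ 2 : ℝ) * K₀
      + Complex.I * (2 * m / s + 3 * m * B / s ^ 2 : ℝ) * K₁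
      - (2 * B / s + B ^ 2 / s ^ 2 : ℝ) * K₂‖ ≤
      s⁻¹ * (m ^ 2 * (coeffSum * (4 + 5 * |B| + |B| ^ 2))) := by
    have u0 : ‖((2 * m ^ 2 / s ^ 2 : ℝ) : ℂ)‖ ≤ s⁻¹ * (m ^ 2 * 2) := by
      rw [Complex.norm_real, Real.norm_eq_abs, abs_of_pos (by positivity)]
      calc 2 * m ^ 2 / s ^ 2 = s⁻¹ * (s⁻¹ * (m ^ 2 * 2)) := by field_simp
        _ ≤ s⁻¹ * (1 * (m ^ 2 * 2)) := by gcongr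
        _ = _ := by ring
    have u1 : ‖((2 * m / s + 3 * m * B / s ^ 2 : ℝ) : ℂ)‖ ≤ s⁻¹ * (m ^ 2 * (2 + 3 * |B|)) := by
      rw [Complex.norm_real, Real.norm_eq_abs]
      calc |2 * m / s + 3 * m * B / s ^ 2| ≤ |2 * m / s| + |3 * m * B / s ^ 2| := abs_add_le _ _
        _ = s⁻¹ * (2 * m + s⁻¹ * (3 * m * |B|)) := by
          rw [abs_of_pos (by positivity), abs_div, abs_mul, abs_of_pos (by positivity : 0 < 3 * m),
            abs_of_pos (by positivity : 0 < s ^ 2)]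
          field_simp
        _ ≤ s⁻¹ * (2 * m ^ 2 + 1 * (3 * m ^ 2 * |B|)) := by gcongr
        _ = _ := by ring
    have u2 : ‖((2 * B / s + B ^ 2 / s ^ 2 : ℝ) : ℂ)‖ ≤ s⁻¹ * (m ^ 2 * (2 * |B| + |B| ^ 2)) := by
      rw [Complex.norm_real, Real.norm_eq_abs]
      calc |2 * B / s + B ^ 2 / s ^ 2| ≤ |2 * B / s| + |B ^ 2 / s ^ 2| := abs_add_le _ _
        _ = s⁻¹ * (1 * (2 * |B| + s⁻¹ * |B| ^ 2)) := by
          rw [abs_div, abs_mul, abs_div, abs_pow, abs_of_pos (by positivity : 0 < s ^ 2),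
            abs_of_pos hs0, Nat.abs_ofNat]
          field_simp
        _ ≤ s⁻¹ * (m ^ 2 * (2 * |B| + 1 * |B| ^ 2)) := by gcongr
        _ = _ := by ring
    have hm3 : ∀ (x y : ℂ) (a b : ℝ), ‖x‖ ≤ a → ‖y‖ ≤ b → ‖x * y‖ ≤ a * b :=
      fun x y a b hx hy ↦ (norm_mul_le x y).trans
        (mul_le_mul hx hy (norm_nonneg _) ((norm_nonneg _).trans hx))
    have u1' : ‖Complex.I * (2 * m / s + 3 * m * B / s ^ 2 : ℝ)‖ ≤
        s⁻¹ * (m ^ 2 * (2 + 3 * |B|)) := by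
      rwa [norm_mul, Complex.norm_I, one_mul]
    refine (norm_sub_le _ _).trans ((add_le_add ((norm_add_le _ _).trans (add_le_add
      (hm3 _ _ _ _ u0 k0) (hm3 _ _ _ _ u1' k1))) (hm3 _ _ _ _ u2 k2)).trans (le_of_eq (by ring)))
  refine (norm_add_le _ _).trans ((add_le_add t1 ((norm_mul_le _ _).trans
    (mul_le_mul_of_nonneg_left t2 (norm_nonneg _)))).trans ?_)
  rw [Complex.norm_real, Real.norm_eq_abs, abs_mul, abs_mul, abs_of_pos (by positivity : 0 < r ^ 2),
    abs_of_pos (by positivity : 0 < (s ^ 2)⁻¹), hB]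
  have hc := abs_nonneg c
  have v1 : r * (( |c| * r) ^ 2 + |c| * r) ≤ ( |c| ^ 2 + |c|) * ((1 + r) ^ 2 * r ^ 2) := by
    have : ( |c| ^ 2 + |c|) * ((1 + r) ^ 2 * r ^ 2) - r * (( |c| * r) ^ 2 + |c| * r) =
      |c| ^ 2 * r ^ 2 * (1 + r + r ^ 2) + |c| * r ^ 2 * (2 * r + r ^ 2) := by ring
    have h2 : 0 ≤ |c| ^ 2 * r ^ 2 * (1 + r + r ^ 2) + |c| * r ^ 2 * (2 * r + r ^ 2) := by positivity
    linarith
  have v2 : r ^ 2 * (4 + 5 * ( |c| * r) + ( |c| * r) ^ 2) ≤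
      (4 + 5 * |c| + |c| ^ 2) * ((1 + r) ^ 2 * r ^ 2) := by
    have : (4 + 5 * |c| + |c| ^ 2) * ((1 + r) ^ 2 * r ^ 2) -
      r ^ 2 * (4 + 5 * ( |c| * r) + ( |c| * r) ^ 2) = r ^ 2 * (4 * (2 * r + r ^ 2) +
        5 * |c| * (1 + r + r ^ 2) + |c| ^ 2 * (1 + 2 * r)) := by ring
    have h2 : 0 ≤ r ^ 2 * (4 * (2 * r + r ^ 2) +
        5 * |c| * (1 + r + r ^ 2) + |c| ^ 2 * (1 + 2 * r)) := by positivity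
    linarith
  have e : (s ^ 3)⁻¹ * (r * (m ^ 2 * (( |c| * r) ^ 2 + |c| * r))) +
      |lam| * r ^ 2 * (s ^ 2)⁻¹ * (s⁻¹ * (m ^ 2 * (coeffSum *
        (4 + 5 * ( |c| * r) + ( |c| * r) ^ 2)))) =
      m ^ 2 * (s ^ 3)⁻¹ * (r * (( |c| * r) ^ 2 + |c| * r) +
        |lam| * coeffSum * (r ^ 2 * (4 + 5 * ( |c| * r) + ( |c| * r) ^ 2))) := by
    field_simp
  rw [e]
  refine mul_le_mul_of_nonneg_left ?_ (by positivity)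
  have := mul_le_mul_of_nonneg_left v2 (by positivity : 0 ≤ |lam| * coeffSum)
  linarith

/-! ### The wave operator applied to the regularized profile -/

/-- The regularized profile in hyperbolic coordinates. -/
def prof (lam ε : ℝ) (Z : Plane → ℂ) (p : ℝ × Plane) : ℂ :=
  pro lam (p.1 * bracket p.2) (Z p.2) (rad ε Z p.2) (bracket p.2)

theorem contDiffAt_kk_zero {z : ℂ} (hz : ‖z‖ < 1) : ContDiffAt ℝ 2 (kk 0) z := by
  have hd : DifferentiableOn ℂ (kk 0) (Metric.ball 0 1) := fun y hy ↦ by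
    rw [← kd_zero]
    exact (hasDerivAt_kd (i := 0) (by norm_num)
      (by simpa using hy)).differentiableAt.differentiableWithinAt
  have ha := hd.analyticAt (Metric.isOpen_ball.mem_nhds (by simpa using hz : z ∈ Metric.ball 0 1))
  exact (ha.contDiffAt (n := 2)).restrict_scalars ℝ

theorem contDiff_rad {ε : ℝ} (hε : 0 < ε) {Z : Plane → ℂ} (hZ : ContDiff ℝ ∞ Z) :
    ContDiff ℝ ∞ (rad ε Z) := by
  refine ((hZ.norm_sq ℝ).add contDiff_const).sqrt fun x ↦ ?_
  positivity

/-- The regularization `ε > 0` serves twice: it makes the modulus smooth and positive, and it keeps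
the argument of `kk` strictly inside the unit disc. -/
theorem contDiffAt_prof (lam : ℝ) {ε : ℝ} (hε : 0 < ε) {Z : Plane → ℂ} (hZ : ContDiff ℝ ∞ Z)
    {p : ℝ × Plane} (hp : 0 < p.1) : ContDiffAt ℝ 2 (prof lam ε Z) p := by
  have hb : ContDiffAt ℝ 2 (fun p : ℝ × Plane ↦ bracket p.2) p :=
    ((contDiff_bracket.of_le two_le_infty).comp contDiff_snd).contDiffAt
  have hr : ContDiffAt ℝ 2 (fun p : ℝ × Plane ↦ rad ε Z p.2) p :=
    (((contDiff_rad hε hZ).of_le two_le_infty).comp contDiff_snd).contDiffAt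
  have hz : ContDiffAt ℝ 2 (fun p : ℝ × Plane ↦ Z p.2) p :=
    ((hZ.of_le two_le_infty).comp contDiff_snd).contDiffAt
  have hb0 := bracket_pos p.2
  have hr0 := rad_pos hε Z p.2
  have hs : ContDiffAt ℝ 2 (fun p : ℝ × Plane ↦ p.1 * bracket p.2) p := contDiffAt_fst.mul hb
  have hs0 : p.1 * bracket p.2 ≠ 0 := by positivity
  have hph : ContDiffAt ℝ 2 (fun p : ℝ × Plane ↦
      phase lam (p.1 * bracket p.2) (rad ε Z p.2) (bracket p.2)) p := by
    unfold phase
    exact (hs.div hb hb0.ne').add (((contDiffAt_const.mul hr).div hb hb0.ne').mul (hs.log hs0))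
  have ho : ContDiffAt ℝ 2 (fun p : ℝ × Plane ↦
      osc lam (p.1 * bracket p.2) (rad ε Z p.2) (bracket p.2)) p := by
    unfold osc
    exact (contDiffAt_const.mul (Complex.ofRealCLM.contDiff.contDiffAt.comp p hph)).cexp
  have hw : ContDiffAt ℝ 2 (fun p : ℝ × Plane ↦
      Z p.2 * osc lam (p.1 * bracket p.2) (rad ε Z p.2) (bracket p.2) / (rad ε Z p.2 : ℂ)) p := by
    simp only [div_eq_mul_inv]
    have hrc : ContDiffAt ℝ 2 (fun p : ℝ × Plane ↦ (rad ε Z p.2 : ℂ)) p :=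
      Complex.ofRealCLM.contDiff.contDiffAt.comp p hr
    exact (hz.mul ho).mul (hrc.inv (by exact_mod_cast hr0.ne'))
  have hk := ContDiffAt.comp p (g := kk 0) (contDiffAt_kk_zero (z := _) ?_) hw
  · unfold prof pro
    exact ((Complex.ofRealCLM.contDiff.contDiffAt.comp p (hs.inv hs0)).mul (hz.mul ho)).add
      ((Complex.ofRealCLM.contDiff.contDiffAt.comp p
        ((contDiffAt_const.mul ((hs.pow 2).inv (pow_ne_zero 2 hs0))).mul (hr.pow 2))).mul hk)
  · rw [norm_div, norm_mul, norm_osc, mul_one, Complex.norm_real, Real.norm_eq_abs,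
      abs_of_pos hr0, div_lt_one hr0]
    exact norm_lt_rad hε Z p.2

theorem jet_along_line {F : Type*} [NormedAddCommGroup F] [NormedSpace ℝ F] {f : Plane → F}
    (hf : ContDiff ℝ ∞ f) (μ v : Plane) : Jet (fun h : ℝ ↦ f (μ + h • v)) (f μ) (fderiv ℝ f μ v)
      (fderiv ℝ (fderiv ℝ f) μ v v) := by
  simpa using Jet.of_contDiffAt ((hf.of_le two_le_infty).contDiffAt (x := μ)) (Jet.line μ v)

/-- The bound for the error on the support of `Z`. -/
def errBd (ε : ℝ) (Z : Plane → ℂ) (μ : Plane) : ℝ :=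
  proBd (rad ε Z μ) (bracket μ * norm1 Z μ) (bracket μ ^ 2 * norm2 Z μ)

theorem errBd_nonneg (ε : ℝ) (Z : Plane → ℂ) (μ : Plane) : 0 ≤ errBd ε Z μ :=
  proBd_nonneg (rad_nonneg _ _ _) (mul_nonneg (bracket_pos μ).le (norm1_nonneg _ _))
    (mul_nonneg (by positivity) (norm2_nonneg _ _))

/-- Directions as long as `⟨μ⟩` are admitted because the hyperbolic Laplacian differentiates in the
direction `μ`. Each derivative of `Z` then costs a factor `⟨μ⟩`, which is the weight in `errBd`. -/
theorem exists_jet_prof_line (lam : ℝ) {ε : ℝ} (hε : 0 < ε) {Z : Plane → ℂ} (hZ : ContDiff ℝ ∞ Z)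
    {ρ : ℝ} (hρ : 0 < ρ) {μ : Plane} (ht : Real.exp 1 ≤ ρ * bracket μ) {v : Plane}
    (hv : ‖v‖ ≤ bracket μ) :
    ∃ d₀ d₁ d₂ : ℂ, Jet (fun h : ℝ ↦ prof lam ε Z (ρ, μ + h • v)) d₀ d₁ d₂ ∧
      ‖d₁‖ ≤ proConst lam * Real.log (ρ * bracket μ) ^ 2 * (ρ * bracket μ)⁻¹ * errBd ε Z μ ∧
      ‖d₂‖ ≤ proConst lam * Real.log (ρ * bracket μ) ^ 2 * (ρ * bracket μ)⁻¹ * errBd ε Z μ := by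
  have hb := bracket_pos μ
  have n1 := norm1_nonneg Z μ
  have n2 := norm2_nonneg Z μ
  have h1 : (1 : ℝ) ≤ Real.exp 1 := by
    have := Real.add_one_le_exp (1 : ℝ); linarith
  have hl : 1 ≤ Real.log (ρ * bracket μ) := by
    rw [Real.le_log_iff_exp_le (by positivity)]; exact ht
  have b1 : |fderiv ℝ bracket μ v| ≤ bracket μ := by
    refine (norm_fderiv_apply_le bracket μ v).trans ?_
    calc _ ≤ 1 * bracket μ := mul_le_mul (norm1_bracket_le μ) hv (norm_nonneg _) zero_le_one
      _ = _ := one_mul _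
  have b2 : |fderiv ℝ (fderiv ℝ bracket) μ v v| ≤ bracket μ * 2 := by
    refine (norm_fderiv_fderiv_apply_le bracket μ v v).trans ?_
    have n3 := norm2_nonneg bracket μ
    calc _ ≤ norm2 bracket μ * bracket μ * bracket μ := by gcongr
      _ = bracket μ * (bracket μ * norm2 bracket μ) := by ring
      _ ≤ _ := mul_le_mul_of_nonneg_left (norm2_bracket_le μ) hb.le
  refine jet_pro lam (jet_along_line hZ μ v) hε (rad_pos hε Z μ) (rad_sq ε Z μ).symm
    (a := bracket μ * norm1 Z μ) (b := bracket μ ^ 2 * norm2 Z μ) ?_ ?_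
    (jet_along_line contDiff_bracket μ v) (one_le_bracket μ) b1 b2 hρ (h1.trans ht) hl
  · refine (norm_fderiv_apply_le Z μ v).trans ?_
    rw [mul_comm]
    gcongr
  · refine (norm_fderiv_fderiv_apply_le Z μ v v).trans ?_
    calc _ ≤ norm2 Z μ * bracket μ * bracket μ := by gcongr
      _ = _ := by ring

/-- The constant in the bound for the error. -/
def errConst (lam : ℝ) : ℝ := 5 * proConst lam + radConst lam

theorem errConst_nonneg (lam : ℝ) : 0 ≤ errConst lam := by
  have := proConst_nonneg lam
  have := radConst_nonneg lam
  unfold errConst; positivity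

/-- The radial part minus `lead` is bounded by `norm_radial_le`. The hyperbolic Laplacian consists
of three second derivatives and twice a first one, hence the 5, and has the factor `ρ⁻² = ⟨μ⟩² t⁻²`.
-/
theorem norm_box_prof_sub_lead_le (lam : ℝ) {ε : ℝ} (hε : 0 < ε) {Z : Plane → ℂ}
    (hZ : ContDiff ℝ ∞ Z) {ρ : ℝ} (hρ : 0 < ρ) {μ : Plane} (ht : Real.exp 1 ≤ ρ * bracket μ) :
    ‖box (fun p ↦ prof lam ε Z (hyp p)) (ρ * bracket μ, ρ • μ) + prof lam ε Z (ρ, μ)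
      - lead lam (ρ * bracket μ) (Z μ) (rad ε Z μ) (bracket μ)‖ ≤
    bracket μ ^ 2 * (errConst lam * Real.log (ρ * bracket μ) ^ 2 * ((ρ * bracket μ) ^ 3)⁻¹
      * errBd ε Z μ) := by
  have hb := bracket_pos μ
  obtain ⟨s, hs⟩ : ∃ s, s = ρ * bracket μ := ⟨_, rfl⟩
  have hs0 : 0 < s := by rw [hs]; positivity
  have h1 : (1 : ℝ) ≤ s := by
    rw [hs]; have := Real.add_one_le_exp (1 : ℝ); linarith
  have hl : 1 ≤ Real.log s := by
    rw [Real.le_log_iff_exp_le hs0, hs]; exact ht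
  have ha := contDiffAt_prof lam hε hZ (p := (ρ, μ)) hρ
  have hr : Jet (fun h : ℝ ↦ prof lam ε Z (ρ + h, μ)) (pro lam s (Z μ) (rad ε Z μ) (bracket μ))
      (bracket μ • pro₁ lam s (Z μ) (rad ε Z μ) (bracket μ))
      (bracket μ • bracket μ • pro₂ lam s (Z μ) (rad ε Z μ) (bracket μ)) := by
    have j := (jet_pro_time lam hs0 (norm_le_rad ε Z μ) (bracket μ)).comp_mul (bracket μ)
    refine j.congr (Eventually.of_forall fun h ↦ ?_)
    simp only [prof, hs]
    ring_nf
  have hl' : ∀ v, Jet (fun h : ℝ ↦ prof lam ε Z (ρ, μ + h • v)) (prof lam ε Z (ρ, μ))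
      (fderiv ℝ (prof lam ε Z) (ρ, μ) (0, v))
      (fderiv ℝ (fderiv ℝ (prof lam ε Z)) (ρ, μ) (0, v) (0, v) +
        fderiv ℝ (prof lam ε Z) (ρ, μ) (0, 0)) := fun v ↦
    Jet.of_contDiffAt ha ((Jet.const ρ).prodMk (Jet.line μ v))
  have hn : ∀ v : Plane, ‖v‖ ≤ bracket μ → ‖fderiv ℝ (prof lam ε Z) (ρ, μ) (0, v)‖ ≤
      proConst lam * Real.log (ρ * bracket μ) ^ 2 * (ρ * bracket μ)⁻¹ * errBd ε Z μ ∧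
      ‖fderiv ℝ (fderiv ℝ (prof lam ε Z)) (ρ, μ) (0, v) (0, v) +
        fderiv ℝ (prof lam ε Z) (ρ, μ) (0, 0)‖ ≤
      proConst lam * Real.log (ρ * bracket μ) ^ 2 * (ρ * bracket μ)⁻¹ * errBd ε Z μ := fun v hv ↦ by
    obtain ⟨d₀, d₁, d₂, jv, v1, v2⟩ := exists_jet_prof_line lam hε hZ hρ ht hv
    obtain ⟨e1, e2⟩ := (hl' v).unique jv
    rw [← e1] at v1
    rw [← e2] at v2
    exact And.intro v1 v2
  rw [box_comp_hyp hρ ha hr hl']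
  obtain ⟨-, w0⟩ := hn (unitVec 0) (by rw [norm_unitVec]; exact one_le_bracket μ)
  obtain ⟨-, w1⟩ := hn (unitVec 1) (by rw [norm_unitVec]; exact one_le_bracket μ)
  obtain ⟨w3, w2⟩ := hn μ (norm_le_bracket μ)
  have hrad := norm_radial_le lam h1 (rad_pos hε Z μ) (norm_le_rad ε Z μ) (one_le_bracket μ)
  rw [← hs] at w0 w1 w2 w3 ⊢
  have hB := errBd_nonneg ε Z μ
  set T := proConst lam * Real.log s ^ 2 * s⁻¹ * errBd ε Z μ with hT
  have hL : ‖fderiv ℝ (fderiv ℝ (prof lam ε Z)) (ρ, μ) (0, unitVec 0) (0, unitVec 0)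
      + fderiv ℝ (prof lam ε Z) (ρ, μ) (0, 0)
      + (fderiv ℝ (fderiv ℝ (prof lam ε Z)) (ρ, μ) (0, unitVec 1) (0, unitVec 1)
      + fderiv ℝ (prof lam ε Z) (ρ, μ) (0, 0))
      + (fderiv ℝ (fderiv ℝ (prof lam ε Z)) (ρ, μ) (0, μ) (0, μ)
      + fderiv ℝ (prof lam ε Z) (ρ, μ) (0, 0))
      + 2 * fderiv ℝ (prof lam ε Z) (ρ, μ) (0, μ)‖ ≤ 5 * T := by
    refine (norm_add_le _ _).trans ?_
    rw [norm_mul, Complex.norm_ofNat]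
    refine (add_le_add_left ((norm_add_le _ _).trans (add_le_add_left (norm_add_le _ _) _)) _).trans ?_
    linarith
  have hp : prof lam ε Z (ρ, μ) = pro lam s (Z μ) (rad ε Z μ) (bracket μ) := by rw [prof, hs]
  have hρs : ρ = s / bracket μ := by rw [hs]; field_simp
  have hscal : ‖(((ρ ^ 2)⁻¹ : ℝ) : ℂ)‖ = bracket μ ^ 2 * (s ^ 2)⁻¹ := by
    rw [Complex.norm_real, Real.norm_eq_abs, abs_of_pos (by positivity), hρs]
    field_simp
  have hbd : radConst lam * ((1 + rad ε Z μ) ^ 2 * rad ε Z μ ^ 2) ≤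
      radConst lam * (Real.log s ^ 2 * errBd ε Z μ) := by
    refine mul_le_mul_of_nonneg_left ?_ (radConst_nonneg lam)
    refine le_trans ?_ (le_mul_of_one_le_left hB (one_le_pow₀ hl))
    rw [errBd, proBd]
    have r0 := rad_nonneg ε Z μ
    have n1 := norm1_nonneg Z μ
    have n2 := norm2_nonneg Z μ
    have : 0 ≤ rad ε Z μ + bracket μ * norm1 Z μ + bracket μ ^ 2 * norm2 Z μ +
      (1 + rad ε Z μ) ^ 2 * ((bracket μ * norm1 Z μ) ^ 2 +
        rad ε Z μ * (bracket μ ^ 2 * norm2 Z μ)) := by positivity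
    linarith
  rw [hp]
  have hre : (bracket μ • bracket μ • pro₂ lam s (Z μ) (rad ε Z μ) (bracket μ) : ℂ) +
      (2 / ρ : ℝ) * (bracket μ • pro₁ lam s (Z μ) (rad ε Z μ) (bracket μ)) =
      (bracket μ ^ 2 : ℝ) * pro₂ lam s (Z μ) (rad ε Z μ) (bracket μ) +
      (2 * bracket μ ^ 2 / s : ℝ) * pro₁ lam s (Z μ) (rad ε Z μ) (bracket μ) := by
    have e : 2 / ρ * bracket μ = 2 * bracket μ ^ 2 / s := by rw [hρs]; field_simp
    rw [← e]
    simp only [Complex.real_smul]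
    push_cast
    ring
  rw [hre]
  have tri : ∀ {A B C D E S : ℂ} {x y : ℝ}, ‖A + B + C - D‖ ≤ x → ‖S‖ * ‖E‖ ≤ y →
      ‖A + B - S * E + C - D‖ ≤ x + y := fun {A B C D E S x y} hx hy ↦ by
    have e : A + B - S * E + C - D = A + B + C - D - S * E := by ring
    rw [e]
    exact (norm_sub_le _ _).trans (add_le_add hx ((norm_mul_le _ _).trans hy))
  refine (tri hrad (mul_le_mul_of_nonneg_left hL (norm_nonneg _))).trans ?_
  rw [hscal]
  have hb2 : 0 ≤ bracket μ ^ 2 * (s ^ 3)⁻¹ := by positivity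
  have h3 := mul_le_mul_of_nonneg_left hbd hb2
  have e : bracket μ ^ 2 * (s ^ 2)⁻¹ * (5 * T) =
        bracket μ ^ 2 * (s ^ 3)⁻¹ * (5 * proConst lam * (Real.log s ^ 2 * errBd ε Z μ)) := by
    rw [hT]; field_simp
  rw [e, errConst]
  linarith

/-! ### The change of variables `x = tμ/⟨μ⟩` -/

theorem mu_smul {t : ℝ} (ht : 0 < t) (μ : Plane) : mu t ((t / bracket μ) • μ) = μ := by
  have hb := bracket_pos μ
  have h := hyp_apply (ρ := t / bracket μ) (by positivity) μ
  rw [div_mul_cancel₀ _ hb.ne'] at h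
  exact (Prod.ext_iff.1 h).2

theorem norm_smul_lt {t : ℝ} (ht : 0 < t) (μ : Plane) : ‖(t / bracket μ) • μ‖ < t := by
  have hb := bracket_pos μ
  have h := norm_lt_of_hyp (ρ := t / bracket μ) (by positivity) μ
  rwa [div_mul_cancel₀ _ hb.ne', abs_of_pos ht] at h

theorem sqrt_mul_bracket_mu {t : ℝ} {x : Plane} (hx : ‖x‖ < t) :
    √(t ^ 2 - ‖x‖ ^ 2) * bracket (mu t x) = t := by
  have ht : 0 < t := (norm_nonneg x).trans_lt hx
  have h0 : 0 < t ^ 2 - ‖x‖ ^ 2 := by nlinarith [norm_nonneg x]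
  have hq : √(t ^ 2 - ‖x‖ ^ 2) ^ 2 = t ^ 2 - ‖x‖ ^ 2 := Real.sq_sqrt h0.le
  have hs := Real.sqrt_pos.2 h0
  have e : (√(t ^ 2 - ‖x‖ ^ 2) * bracket (mu t x)) ^ 2 = t ^ 2 := by
    rw [mul_pow, bracket_sq, mu, norm_smul, Real.norm_eq_abs, mul_pow, sq_abs, inv_pow, hq]
    field_simp
    ring
  exact (pow_left_inj₀ (mul_nonneg hs.le (bracket_pos _).le) ht.le two_ne_zero).1 e

theorem sqrt_smul_mu {t : ℝ} {x : Plane} (hx : ‖x‖ < t) : √(t ^ 2 - ‖x‖ ^ 2) • mu t x = x := by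
  have h0 : 0 < t ^ 2 - ‖x‖ ^ 2 := by nlinarith [norm_nonneg x]
  rw [mu, smul_smul, mul_inv_cancel₀ (Real.sqrt_pos.2 h0).ne', one_smul]

theorem image_smul_eq_ball {t : ℝ} (ht : 0 < t) :
    (fun μ : Plane ↦ (t / bracket μ) • μ) '' Set.univ = Metric.ball 0 t := by
  ext x
  simp only [Set.image_univ, Set.mem_range, mem_ball_zero_iff]
  constructor
  · rintro ⟨μ, rfl⟩
    exact norm_smul_lt ht μ
  · intro hx
    refine ⟨mu t x, ?_⟩
    have h := sqrt_mul_bracket_mu hx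
    have hb := bracket_pos (mu t x)
    rw [← eq_div_iff hb.ne'] at h
    rw [← h, sqrt_smul_mu hx]

theorem hasFDerivAt_smul_div_bracket (t : ℝ) (μ : Plane) :
    HasFDerivAt (fun μ : Plane ↦ (t / bracket μ) • μ)
      ((t / bracket μ) • ContinuousLinearMap.id ℝ Plane +
        (-(t / bracket μ ^ 3) • innerL μ).smulRight μ) μ := by
  have hb := bracket_pos μ
  have h1 : HasFDerivAt (fun μ : Plane ↦ t / bracket μ) (-(t / bracket μ ^ 3) • innerL μ) μ := by
    have h := ((hasDerivAt_inv hb.ne').comp_hasFDerivAt μ (hasFDerivAt_bracket μ)).const_mul t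
    simp only [div_eq_mul_inv]
    convert! h using 1
    ext v
    simp
    field_simp
  exact h1.smul (hasFDerivAt_id μ)

/-- The derivative is `t/⟨μ⟩` times a rank one perturbation of the identity, with determinant `1 -
|μ|²/⟨μ⟩² = ⟨μ⟩⁻²`. -/
theorem det_smul_div_bracket (t : ℝ) (μ : Plane) :
    ((t / bracket μ) • ContinuousLinearMap.id ℝ Plane +
        (-(t / bracket μ ^ 3) • innerL μ).smulRight μ).det = t ^ 2 / bracket μ ^ 4 := by
  have hb := bracket_pos μ
  have e : (((t / bracket μ) • ContinuousLinearMap.id ℝ Plane +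
        (-(t / bracket μ ^ 3) • innerL μ).smulRight μ : Plane →L[ℝ] Plane) : Plane →ₗ[ℝ] Plane) =
      (t / bracket μ) • LinearMap.transvection
        ((-((bracket μ ^ 2)⁻¹) • innerL μ : Plane →L[ℝ] ℝ) : Plane →ₗ[ℝ] ℝ) μ := by
    ext v : 1
    simp [LinearMap.transvection.apply, smul_smul]
    congr 1
    field_simp
  rw [ContinuousLinearMap.det, e, LinearMap.det_smul, LinearMap.transvection.det,
    finrank_euclideanSpace_fin]
  simp only [ContinuousLinearMap.coe_coe, smul_apply, innerL_apply, real_inner_self_eq_norm_sq,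
    smul_eq_mul]
  have := bracket_sq μ
  have h2 : ‖μ‖ ^ 2 = bracket μ ^ 2 - 1 := by linarith
  rw [h2]
  field_simp
  ring

theorem lintegral_ball_eq {t : ℝ} (ht : 0 < t) (g : Plane → ℝ≥0∞) :
    ∫⁻ x in Metric.ball (0 : Plane) t, g x =
      ∫⁻ μ, ENNReal.ofReal (t ^ 2 / bracket μ ^ 4) * g ((t / bracket μ) • μ) := by
  rw [← image_smul_eq_ball ht, lintegral_image_eq_lintegral_abs_det_fderiv_mul volume
    MeasurableSet.univ (fun μ _ ↦ (hasFDerivAt_smul_div_bracket t μ).hasFDerivWithinAt)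
    (fun μ _ ν _ h ↦ by
      have h' : (t / bracket μ) • μ = (t / bracket ν) • ν := h
      rw [← mu_smul ht μ, h', mu_smul ht ν]), Measure.restrict_univ]
  refine lintegral_congr fun μ ↦ ?_
  rw [det_smul_div_bracket, abs_of_nonneg (by positivity)]

theorem measurable_mu (t : ℝ) : Measurable (mu t) := by
  unfold mu; fun_prop

/-- The amplitude is determined only up to null sets in `μ`. Since the Jacobian is at most `t²`,
null sets in `μ` pull back to null sets in the disc. -/
theorem quasiMeasurePreserving_mu {t : ℝ} (ht : 0 < t) :
    Measure.QuasiMeasurePreserving (mu t) (volume.restrict (Metric.ball 0 t)) volume := by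
  refine ⟨measurable_mu t, Measure.AbsolutelyContinuous.mk fun s hs h0 ↦ ?_⟩
  rw [Measure.map_apply (measurable_mu t) hs, ← lintegral_indicator_one (measurable_mu t hs),
    lintegral_ball_eq ht]
  have : ∀ μ : Plane, ENNReal.ofReal (t ^ 2 / bracket μ ^ 4) *
      (mu t ⁻¹' s).indicator 1 ((t / bracket μ) • μ) ≤ ENNReal.ofReal (t ^ 2) * s.indicator 1 μ := by
    intro μ
    have hb := one_le_bracket μ
    gcongr
    · exact div_le_self (by positivity) (one_le_pow₀ hb)
    · by_cases hμ : μ ∈ s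
      · simp [hμ, Set.indicator_of_mem (s := mu t ⁻¹' s) (a := (t / bracket μ) • μ)
          (by rw [Set.mem_preimage, mu_smul ht]; exact hμ)]
      · simp [Set.indicator_of_notMem (s := mu t ⁻¹' s) (a := (t / bracket μ) • μ)
          (by rw [Set.mem_preimage, mu_smul ht]; exact hμ)]
  refine le_antisymm ((lintegral_mono this).trans ?_) zero_le
  rw [lintegral_const_mul _ (measurable_one.indicator hs), lintegral_indicator_one hs, h0, mul_zero]

/-! ### Measurability and continuity of the profile in the amplitude -/

theorem aemeasurable_har {α : Type*} [MeasurableSpace α] {ν : Measure α} (lam s : ℝ) {j : ℕ}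
    (hj : j ≤ 2) {ζ : α → ℂ} {r m : α → ℝ} (hζ : AEMeasurable ζ ν) (hr : AEMeasurable r ν)
    (hm : AEMeasurable m ν) (h : ∀ y, ‖ζ y‖ ≤ r y) :
    AEMeasurable (fun y ↦ har lam j s (ζ y) (r y) (m y)) ν := by
  classical
  have ho : AEMeasurable (fun y ↦ osc lam s (r y) (m y)) ν := by
    unfold osc phase; fun_prop
  have hw : AEMeasurable (fun y ↦ ζ y * osc lam s (r y) (m y) / (r y : ℂ)) ν := by fun_prop
  -- Continuity of the series is known on the closed disc only. Its extension by zero is measurable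
  -- and agrees with it at all arguments that occur.
  have hk : Measurable ((Metric.closedBall (0 : ℂ) 1).piecewise (kk j) 0) :=
    (continuousOn_kk hj).measurable_piecewise continuousOn_const measurableSet_closedBall
  refine (hk.comp_aemeasurable hw).congr (Eventually.of_forall fun y ↦ ?_)
  have : ζ y * osc lam s (r y) (m y) / (r y : ℂ) ∈ Metric.closedBall (0 : ℂ) 1 := by
    simpa using norm_mul_osc_div_le_one lam s (m y) (h y)
  simp only [Function.comp_apply, Set.piecewise_eq_of_mem _ _ _ this, har]

theorem aemeasurable_osc {α : Type*} [MeasurableSpace α] {ν : Measure α} (lam s : ℝ)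
    {r m : α → ℝ} (hr : AEMeasurable r ν) (hm : AEMeasurable m ν) :
    AEMeasurable (fun y ↦ osc lam s (r y) (m y)) ν := by
  unfold osc phase; fun_prop

section

variable {α : Type*} [MeasurableSpace α] {ν : Measure α} (lam s : ℝ) {ζ : α → ℂ} {r m : α → ℝ}

theorem aemeasurable_pro (hζ : AEMeasurable ζ ν) (hr : AEMeasurable r ν) (hm : AEMeasurable m ν)
    (h : ∀ y, ‖ζ y‖ ≤ r y) :
    AEMeasurable (fun y ↦ pro lam s (ζ y) (r y) (m y)) ν ∧
    AEMeasurable (fun y ↦ pro₁ lam s (ζ y) (r y) (m y)) ν ∧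
    AEMeasurable (fun y ↦ pro₂ lam s (ζ y) (r y) (m y)) ν ∧
    AEMeasurable (fun y ↦ lead lam s (ζ y) (r y) (m y)) ν := by
  have h0 := aemeasurable_har lam s (j := 0) (by norm_num) hζ hr hm h
  have h1 := aemeasurable_har lam s (j := 1) (by norm_num) hζ hr hm h
  have h2 := aemeasurable_har lam s (j := 2) (by norm_num) hζ hr hm h
  have ho := aemeasurable_osc lam s hr hm
  have p1 : AEMeasurable (fun y ↦ phase₁ lam s (r y) (m y)) ν := by unfold phase₁; fun_prop
  have p2 : AEMeasurable (fun y ↦ phase₂ lam s (r y) (m y)) ν := by unfold phase₂; fun_prop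
  have h0' : AEMeasurable (fun y ↦ kk 0 (ζ y * osc lam s (r y) (m y) / (r y : ℂ))) ν := h0
  refine ⟨?_, ?_, ?_, ?_⟩
  · unfold pro; fun_prop
  · unfold pro₁; fun_prop
  · unfold pro₂; fun_prop
  · unfold lead; fun_prop

end

/-- If the limiting modulus is positive, continuity on the closed disc applies. If it is zero, the
quotient `ζ/r` may have no limit, but the harmonics stay bounded and the factor `r²` tends to zero.
-/
theorem tendsto_har (lam s : ℝ) {j : ℕ} (hj : j ≤ 2) {ζ : ℕ → ℂ} {r : ℕ → ℝ} {ζ₀ : ℂ} {r₀ : ℝ}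
    (hζ : Tendsto ζ atTop (𝓝 ζ₀)) (hr : Tendsto r atTop (𝓝 r₀)) (h : ∀ k, ‖ζ k‖ ≤ r k) (m : ℝ) :
    Tendsto (fun k ↦ ((r k ^ 2 : ℝ) : ℂ) * har lam j s (ζ k) (r k) m) atTop
      (𝓝 (((r₀ ^ 2 : ℝ) : ℂ) * har lam j s ζ₀ r₀ m)) := by
  have h0 : ‖ζ₀‖ ≤ r₀ := le_of_tendsto_of_tendsto' hζ.norm hr h
  rcases ((norm_nonneg _).trans h0).eq_or_lt with hr0 | hr0
  · rw [← hr0] at hr ⊢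
    have e : (((0 : ℝ) ^ 2 : ℝ) : ℂ) * har lam j s ζ₀ 0 m = 0 := by simp
    rw [e]
    refine squeeze_zero_norm (a := fun k ↦ r k ^ 2 * coeffSum) (fun k ↦ ?_) ?_
    · rw [norm_mul, Complex.norm_real, Real.norm_eq_abs, abs_of_nonneg (sq_nonneg _)]
      gcongr
      exact norm_har_le lam hj s m (h k)
    · simpa using (hr.pow 2).mul_const coeffSum
  · refine ((Complex.continuous_ofReal.tendsto _).comp (hr.pow 2)).mul ?_
    have ho : Tendsto (fun k ↦ osc lam s (r k) m) atTop (𝓝 (osc lam s r₀ m)) := by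
      have : Continuous fun r ↦ osc lam s r m := by unfold osc phase; fun_prop
      exact (this.tendsto r₀).comp hr
    have hc : Tendsto (fun k ↦ ζ k * osc lam s (r k) m / (r k : ℂ)) atTop
        (𝓝 (ζ₀ * osc lam s r₀ m / (r₀ : ℂ))) :=
      (hζ.mul ho).div ((Complex.continuous_ofReal.tendsto _).comp hr) (by exact_mod_cast hr0.ne')
    have hmem := norm_mul_osc_div_le_one lam s m h0
    refine (continuousOn_kk hj _ (by simpa using hmem)).tendsto.comp
      (tendsto_nhdsWithin_iff.2 ⟨hc, Eventually.of_forall fun k ↦ ?_⟩)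
    simpa using norm_mul_osc_div_le_one lam s m (h k)

/-- Clears the division by `r`, so that the limit at a zero of the amplitude can be taken term by
term. -/
theorem lead_eq {s r : ℝ} (lam : ℝ) (ζ : ℂ) (m : ℝ) :
    lead lam s ζ r m = ((lam * (s ^ 2)⁻¹ : ℝ) : ℂ) * ((8 / (3 * Real.pi) : ℝ) *
      (r * (ζ * osc lam s r m)) + ((r ^ 2 : ℝ) : ℂ) * har lam 0 s ζ r m
        - ((r ^ 2 : ℝ) : ℂ) * har lam 2 s ζ r m) := by
  rw [lead]
  rcases eq_or_ne r 0 with h0 | h0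
  · simp [h0]
  · have : (r : ℂ) ≠ 0 := by exact_mod_cast h0
    push_cast
    field_simp

theorem tendsto_pro (lam s : ℝ) {ζ : ℕ → ℂ} {r : ℕ → ℝ} {ζ₀ : ℂ} {r₀ : ℝ}
    (hζ : Tendsto ζ atTop (𝓝 ζ₀)) (hr : Tendsto r atTop (𝓝 r₀)) (h : ∀ k, ‖ζ k‖ ≤ r k) (m : ℝ) :
    Tendsto (fun k ↦ pro lam s (ζ k) (r k) m) atTop (𝓝 (pro lam s ζ₀ r₀ m)) ∧
    Tendsto (fun k ↦ pro₁ lam s (ζ k) (r k) m) atTop (𝓝 (pro₁ lam s ζ₀ r₀ m)) ∧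
    Tendsto (fun k ↦ pro₂ lam s (ζ k) (r k) m) atTop (𝓝 (pro₂ lam s ζ₀ r₀ m)) ∧
    Tendsto (fun k ↦ lead lam s (ζ k) (r k) m) atTop (𝓝 (lead lam s ζ₀ r₀ m)) := by
  have hn : ‖ζ₀‖ ≤ r₀ := le_of_tendsto_of_tendsto' hζ.norm hr h
  have h0 := tendsto_har lam s (j := 0) (by norm_num) hζ hr h m
  have h1 := tendsto_har lam s (j := 1) (by norm_num) hζ hr h m
  have h2 := tendsto_har lam s (j := 2) (by norm_num) hζ hr h m
  have hrc : Tendsto (fun k ↦ (r k : ℂ)) atTop (𝓝 (r₀ : ℂ)) :=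
    (Complex.continuous_ofReal.tendsto _).comp hr
  have ho : Tendsto (fun k ↦ ζ k * osc lam s (r k) m) atTop (𝓝 (ζ₀ * osc lam s r₀ m)) := by
    have : Continuous fun r ↦ osc lam s r m := by unfold osc phase; fun_prop
    exact hζ.mul ((this.tendsto r₀).comp hr)
  have p1 : Tendsto (fun k ↦ (phase₁ lam s (r k) m : ℂ)) atTop (𝓝 (phase₁ lam s r₀ m : ℂ)) := by
    have : Continuous fun r ↦ (phase₁ lam s r m : ℂ) := by unfold phase₁; fun_prop
    exact (this.tendsto r₀).comp hr
  have p2 : Tendsto (fun k ↦ (phase₂ lam s (r k) m : ℂ)) atTop (𝓝 (phase₂ lam s r₀ m : ℂ)) := by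
    have : Continuous fun r ↦ (phase₂ lam s r m : ℂ) := by unfold phase₂; fun_prop
    exact (this.tendsto r₀).comp hr
  have e0 : ∀ ζ r, pro lam s ζ r m = ((s⁻¹ : ℝ) : ℂ) * (ζ * osc lam s r m)
      + ((lam * (s ^ 2)⁻¹ : ℝ) : ℂ) * (((r ^ 2 : ℝ) : ℂ) * har lam 0 s ζ r m) := fun ζ r ↦ by
    rw [pro, har]; push_cast; ring
  have e1 : ∀ ζ r, pro₁ lam s ζ r m = -((s ^ 2)⁻¹ : ℝ) * (ζ * osc lam s r m)
      - Complex.I * phase₁ lam s r m * (s⁻¹ : ℝ) * (ζ * osc lam s r m)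
      + lam * (-2 * ((s ^ 3)⁻¹ : ℝ) * (((r ^ 2 : ℝ) : ℂ) * har lam 0 s ζ r m)
        - Complex.I * phase₁ lam s r m * ((s ^ 2)⁻¹ : ℝ) *
          (((r ^ 2 : ℝ) : ℂ) * har lam 1 s ζ r m)) := fun ζ r ↦ by
    rw [pro₁]; push_cast; ring
  have e2 : ∀ ζ r, pro₂ lam s ζ r m = 2 * ((s ^ 3)⁻¹ : ℝ) * (ζ * osc lam s r m)
      + 2 * Complex.I * phase₁ lam s r m * ((s ^ 2)⁻¹ : ℝ) * (ζ * osc lam s r m)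
      - (Complex.I * phase₂ lam s r m + (phase₁ lam s r m : ℂ) ^ 2) * (s⁻¹ : ℝ)
        * (ζ * osc lam s r m)
      + lam * (6 * ((s ^ 4)⁻¹ : ℝ) * (((r ^ 2 : ℝ) : ℂ) * har lam 0 s ζ r m)
        + 4 * Complex.I * phase₁ lam s r m * ((s ^ 3)⁻¹ : ℝ) *
          (((r ^ 2 : ℝ) : ℂ) * har lam 1 s ζ r m)
        - Complex.I * phase₂ lam s r m * ((s ^ 2)⁻¹ : ℝ) * (((r ^ 2 : ℝ) : ℂ) * har lam 1 s ζ r m)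
        - (phase₁ lam s r m : ℂ) ^ 2 * ((s ^ 2)⁻¹ : ℝ) *
          (((r ^ 2 : ℝ) : ℂ) * har lam 2 s ζ r m)) := fun ζ r ↦ by
    rw [pro₂]; push_cast; ring
  refine ⟨?_, ?_, ?_, ?_⟩
  · simp only [e0]
    exact (ho.const_mul _).add (h0.const_mul _)
  · simp only [e1]
    exact ((ho.const_mul _).sub (((p1.const_mul _).mul_const _).mul ho)).add
      (((h0.const_mul _).sub (((p1.const_mul _).mul_const _).mul h1)).const_mul _)
  · simp only [e2]
    exact (((ho.const_mul _).add (((p1.const_mul _).mul_const _).mul ho)).sub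
      ((((p2.const_mul _).add (p1.pow 2)).mul_const _).mul ho)).add
      (((((h0.const_mul _).add (((p1.const_mul _).mul_const _).mul h1)).sub
        (((p2.const_mul _).mul_const _).mul h1)).sub (((p1.pow 2).mul_const _).mul h2)).const_mul _)
  · rw [lead_eq]
    simp only [lead_eq]
    exact ((((hrc.mul ho).const_mul _).add h0).sub h2).const_mul _

/-- The majorant for all dominated convergence arguments below. It depends on the sup bound of the
modulus only, not on derivatives of the amplitude or on the regularization. -/
theorem exists_pro_bound (lam : ℝ) {S : ℝ} (hS : 0 ≤ S) : ∃ B : ℝ, ∀ (s : ℝ) (ζ : ℂ) (r m : ℝ),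
    1 ≤ s → ‖ζ‖ ≤ r → r ≤ S → 1 ≤ m →
    ‖pro lam s ζ r m‖ ≤ B ∧ ‖pro₁ lam s ζ r m‖ ≤ B ∧ ‖pro₂ lam s ζ r m‖ ≤ B := by
  obtain ⟨A, hA⟩ : ∃ A, A = |phaseCoeff lam| * S := ⟨_, rfl⟩
  obtain ⟨K, hK⟩ : ∃ K, K = |lam| * S ^ 2 * coeffSum := ⟨_, rfl⟩
  have hC := coeffSum_nonneg
  have hA0 : 0 ≤ A := by rw [hA]; positivity
  have hK0 : 0 ≤ K := by rw [hK]; positivity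
  refine ⟨12 * (1 + A) ^ 2 * (S + K), fun s ζ r m hs hζ hr hm ↦ ?_⟩
  have hr0 : 0 ≤ r := (norm_nonneg _).trans hζ
  have hs0 : 0 < s := by linarith
  have hm0 : 0 < m := by linarith
  have hE : ‖ζ * osc lam s r m‖ ≤ S := by rw [norm_mul, norm_osc, mul_one]; exact hζ.trans hr
  have hsi : ∀ n : ℕ, ‖(((s ^ n)⁻¹ : ℝ) : ℂ)‖ ≤ 1 := fun n ↦ by
    rw [Complex.norm_real, Real.norm_eq_abs, abs_of_pos (by positivity)]
    exact inv_le_one_of_one_le₀ (one_le_pow₀ hs)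
  have hsi1 : ‖((s⁻¹ : ℝ) : ℂ)‖ ≤ 1 := by simpa using hsi 1
  have hcr : |phaseCoeff lam| * r ≤ A := by rw [hA]; gcongr
  have hdiv : |phaseCoeff lam * r / m / s| ≤ A := by
    rw [abs_div, abs_div, abs_mul, abs_of_nonneg hr0, abs_of_pos hm0, abs_of_pos hs0]
    exact (div_le_self (by positivity) hs).trans ((div_le_self (by positivity) hm).trans hcr)
  have hp1 : ‖(phase₁ lam s r m : ℂ)‖ ≤ 1 + A := by
    rw [Complex.norm_real, Real.norm_eq_abs, phase₁]
    refine (abs_add_le _ _).trans (add_le_add ?_ hdiv)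
    rw [abs_of_pos (by positivity)]
    exact div_le_one_of_le₀ hm hm0.le
  have hp2 : ‖(phase₂ lam s r m : ℂ)‖ ≤ A := by
    rw [Complex.norm_real, Real.norm_eq_abs, phase₂, abs_neg]
    rw [abs_div, abs_div, abs_mul, abs_of_nonneg hr0, abs_of_pos hm0,
      abs_of_pos (by positivity : 0 < s ^ 2)]
    exact (div_le_self (by positivity) (one_le_pow₀ hs)).trans
      ((div_le_self (by positivity) hm).trans hcr)
  have hm3 : ∀ (x y : ℂ) (a b : ℝ), ‖x‖ ≤ a → ‖y‖ ≤ b → ‖x * y‖ ≤ a * b :=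
    fun x y a b hx hy ↦ (norm_mul_le x y).trans
      (mul_le_mul hx hy (norm_nonneg _) ((norm_nonneg _).trans hx))
  have ha3 : ∀ (x y : ℂ) (a b : ℝ), ‖x‖ ≤ a → ‖y‖ ≤ b → ‖x + y‖ ≤ a + b :=
    fun x y a b hx hy ↦ (norm_add_le x y).trans (add_le_add hx hy)
  have hs3 : ∀ (x y : ℂ) (a b : ℝ), ‖x‖ ≤ a → ‖y‖ ≤ b → ‖x - y‖ ≤ a + b :=
    fun x y a b hx hy ↦ (norm_sub_le x y).trans (add_le_add hx hy)
  have hl : ‖((lam * r ^ 2 : ℝ) : ℂ)‖ ≤ |lam| * S ^ 2 := by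
    rw [Complex.norm_real, Real.norm_eq_abs, abs_mul, abs_of_nonneg (sq_nonneg r)]
    gcongr
  have k0 := norm_har_le lam (j := 0) (by norm_num) s m hζ
  have k1 := norm_har_le lam (j := 1) (by norm_num) s m hζ
  have k2 := norm_har_le lam (j := 2) (by norm_num) s m hζ
  have hI : ‖Complex.I‖ ≤ 1 := Complex.norm_I.le
  have n2 : ‖(2 : ℂ)‖ ≤ 2 := by simp
  have n2' : ‖(-2 : ℂ)‖ ≤ 2 := by simp
  have n4 : ‖(4 : ℂ)‖ ≤ 4 := by simp
  have n6 : ‖(6 : ℂ)‖ ≤ 6 := by simp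
  have e0 : pro lam s ζ r m = ((s⁻¹ : ℝ) : ℂ) * (ζ * osc lam s r m)
      + ((lam * r ^ 2 : ℝ) : ℂ) * (((s ^ 2)⁻¹ : ℝ) * har lam 0 s ζ r m) := by
    rw [pro, har]; push_cast; ring
  have hAA : 1 ≤ (1 + A) ^ 2 := by nlinarith
  have hSK : 0 ≤ S + K := by positivity
  have hpp : ‖(phase₁ lam s r m : ℂ) ^ 2‖ ≤ (1 + A) ^ 2 := by
    rw [norm_pow]; gcongr
  have hX := mul_nonneg hA0 hSK
  have hY := mul_nonneg (sq_nonneg A) hSK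
  refine ⟨?_, ?_, ?_⟩
  · rw [e0]
    refine (ha3 _ _ _ _ (hm3 _ _ _ _ hsi1 hE)
      (hm3 _ _ _ _ hl (hm3 _ _ _ _ (hsi 2) k0))).trans ?_
    have : 1 * S + |lam| * S ^ 2 * (1 * coeffSum) = S + K := by rw [hK]; ring
    rw [this]
    nlinarith
  · rw [pro₁]
    refine (ha3 _ _ _ _ (hs3 _ _ _ _ (hm3 _ _ _ _ ((norm_neg _).trans_le (hsi 2)) hE)
      (hm3 _ _ _ _ (hm3 _ _ _ _ (hm3 _ _ _ _ hI hp1) hsi1) hE))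
      (hm3 _ _ _ _ hl (hs3 _ _ _ _ (hm3 _ _ _ _ (hm3 _ _ _ _ n2' (hsi 3)) k0)
        (hm3 _ _ _ _ (hm3 _ _ _ _ (hm3 _ _ _ _ hI hp1) (hsi 2)) k1)))).trans ?_
    have : 1 * S + 1 * (1 + A) * 1 * S + |lam| * S ^ 2 *
        (2 * 1 * coeffSum + 1 * (1 + A) * 1 * coeffSum) = (2 + A) * S + (3 + A) * K := by
      rw [hK]; ring
    rw [this]
    nlinarith [mul_nonneg hA0 hS, mul_nonneg hA0 hK0]
  · rw [pro₂]
    refine (ha3 _ _ _ _ (hs3 _ _ _ _ (ha3 _ _ _ _ (hm3 _ _ _ _ (hm3 _ _ _ _ n2 (hsi 3)) hE)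
      (hm3 _ _ _ _ (hm3 _ _ _ _ (hm3 _ _ _ _ (hm3 _ _ _ _ n2 hI) hp1) (hsi 2)) hE))
      (hm3 _ _ _ _ (hm3 _ _ _ _ (ha3 _ _ _ _ (hm3 _ _ _ _ hI hp2) hpp) hsi1) hE))
      (hm3 _ _ _ _ hl (hs3 _ _ _ _ (hs3 _ _ _ _ (ha3 _ _ _ _
        (hm3 _ _ _ _ (hm3 _ _ _ _ n6 (hsi 4)) k0)
        (hm3 _ _ _ _ (hm3 _ _ _ _ (hm3 _ _ _ _ (hm3 _ _ _ _ n4 hI) hp1) (hsi 3)) k1))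
        (hm3 _ _ _ _ (hm3 _ _ _ _ (hm3 _ _ _ _ hI hp2) (hsi 2)) k1))
        (hm3 _ _ _ _ (hm3 _ _ _ _ hpp (hsi 2)) k2)))).trans ?_
    have : 2 * 1 * S + 2 * 1 * (1 + A) * 1 * S + (1 * A + (1 + A) ^ 2) * 1 * S + |lam| * S ^ 2 *
        (6 * 1 * coeffSum + 4 * 1 * (1 + A) * 1 * coeffSum + 1 * A * 1 * coeffSum +
          (1 + A) ^ 2 * 1 * coeffSum) =
        (5 + 5 * A + A ^ 2) * S + (11 + 7 * A + A ^ 2) * K := by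
      rw [hK]; ring
    rw [this]
    have a1 := mul_nonneg hA0 hS
    have a2 := mul_nonneg hA0 hK0
    have a3 := mul_nonneg (sq_nonneg A) hS
    have a4 := mul_nonneg (sq_nonneg A) hK0
    have e : 12 * (1 + A) ^ 2 * (S + K) = 12 * S + 24 * (A * S) + 12 * (A ^ 2 * S) + 12 * K +
      24 * (A * K) + 12 * (A ^ 2 * K) := by ring
    linarith

/-! ### Functions of `μ = x/√(t² - |x|²)` on the light cone -/

/-- The function `f(μ)` on `|x| < s`, extended by zero. -/
def spread (s : ℝ) (f : Plane → ℂ) : Plane → ℂ := (Metric.ball 0 s).indicator fun x ↦ f (mu s x)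

theorem mu_smul_eq {s : ℝ} (hs : 0 < s) (y : Plane) : mu s (s • y) = mu 1 y := by
  have e : s ^ 2 - ‖s • y‖ ^ 2 = s ^ 2 * (1 ^ 2 - ‖y‖ ^ 2) := by
    rw [norm_smul, Real.norm_eq_abs, abs_of_pos hs]; ring
  rw [mu, mu, e, Real.sqrt_mul (sq_nonneg s), Real.sqrt_sq hs.le, smul_smul, mul_inv, mul_assoc,
    mul_comm, mul_assoc, mul_inv_cancel₀ hs.ne', mul_one]

theorem ae_restrict_ball_mu {s : ℝ} (hs : 0 < s) {p : Plane → Prop} (h : ∀ᵐ μ, p μ) :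
    ∀ᵐ x ∂(volume.restrict (Metric.ball (0 : Plane) s)), p (mu s x) :=
  (quasiMeasurePreserving_mu hs).ae h

theorem ae_ball_mu {s : ℝ} (hs : 0 < s) {p : Plane → Prop} (h : ∀ᵐ μ, p μ) :
    ∀ᵐ x : Plane, x ∈ Metric.ball (0 : Plane) s → p (mu s x) :=
  (ae_restrict_iff' measurableSet_ball).1 (ae_restrict_ball_mu hs h)

theorem aemeasurable_spread {s : ℝ} (hs : 0 < s) {f : Plane → ℂ} (hf : AEMeasurable f volume) :
    AEMeasurable (spread s f) volume := by
  rw [spread, aemeasurable_indicator_iff measurableSet_ball]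
  exact hf.comp_quasiMeasurePreserving (quasiMeasurePreserving_mu hs)

theorem norm_spread_le {s : ℝ} (hs : 0 < s) {f : Plane → ℂ} {B : ℝ} (hB : 0 ≤ B)
    (h : ∀ᵐ μ, ‖f μ‖ ≤ B) : ∀ᵐ x, ‖spread s f x‖ ≤ B := by
  filter_upwards [ae_ball_mu hs h] with x hx
  by_cases hm : x ∈ Metric.ball (0 : Plane) s
  · rw [spread, Set.indicator_of_mem hm]; exact hx hm
  · rw [spread, Set.indicator_of_notMem hm]; simpa using hB

theorem tendsto_spread {s : ℝ} (hs : 0 < s) {f : ℕ → Plane → ℂ} {g : Plane → ℂ}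
    (h : ∀ᵐ μ, Tendsto (fun k ↦ f k μ) atTop (𝓝 (g μ))) :
    ∀ᵐ x, Tendsto (fun k ↦ spread s (f k) x) atTop (𝓝 (spread s g x)) := by
  filter_upwards [ae_ball_mu hs h] with x hx
  by_cases hm : x ∈ Metric.ball (0 : Plane) s
  · simp only [spread, Set.indicator_of_mem hm]; exact hx hm
  · simp only [spread, Set.indicator_of_notMem hm]; exact tendsto_const_nhds

theorem lintegral_spread_sq {s : ℝ} (hs : 0 < s) (f : Plane → ℂ) :
    ∫⁻ x, ‖spread s f x‖ₑ ^ 2 = ∫⁻ μ, ENNReal.ofReal (s ^ 2 / bracket μ ^ 4) * ‖f μ‖ₑ ^ 2 := by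
  have e : ∀ x, ‖spread s f x‖ₑ ^ 2 =
      (Metric.ball (0 : Plane) s).indicator (fun x ↦ ‖f (mu s x)‖ₑ ^ 2) x := fun x ↦ by
    by_cases hm : x ∈ Metric.ball (0 : Plane) s
    · simp only [spread, Set.indicator_of_mem hm]
    · simp only [spread, Set.indicator_of_notMem hm]; simp
  simp only [e]
  rw [lintegral_indicator measurableSet_ball, lintegral_ball_eq hs]
  simp only [mu_smul hs]

theorem locallyIntegrable_of_bound {f : Plane → ℂ} (hf : AEMeasurable f volume) {B : ℝ}
    (h : ∀ᵐ x, ‖f x‖ ≤ B) : LocallyIntegrable f volume :=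
  (memLp_top_of_bound hf.aestronglyMeasurable B h).locallyIntegrable le_top

theorem integrable_smul_of_bound {f : Plane → ℂ} (hf : AEMeasurable f volume) {B : ℝ}
    (h : ∀ᵐ x, ‖f x‖ ≤ B) {ψ : Plane → ℝ} (hψ : Continuous ψ) (hs : HasCompactSupport ψ) :
    Integrable (fun x ↦ ψ x • f x) volume :=
  (locallyIntegrable_of_bound hf h).integrable_smul_left_of_hasCompactSupport hψ hs

theorem tendsto_integral_smul_of_bound {f : ℕ → Plane → ℂ} {g : Plane → ℂ}
    (hf : ∀ k, AEMeasurable (f k) volume) {B : ℝ} (hB : ∀ k, ∀ᵐ x, ‖f k x‖ ≤ B)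
    (h : ∀ᵐ x, Tendsto (fun k ↦ f k x) atTop (𝓝 (g x))) {ψ : Plane → ℝ} (hψ : Continuous ψ)
    (hs : HasCompactSupport ψ) :
    Tendsto (fun k ↦ ∫ x, ψ x • f k x) atTop (𝓝 (∫ x, ψ x • g x)) := by
  refine tendsto_integral_of_dominated_convergence (fun x ↦ |ψ x| * B) (fun k ↦ ?_) ?_
    (fun k ↦ ?_) ?_
  · exact hψ.aestronglyMeasurable.smul (hf k).aestronglyMeasurable
  · exact (hψ.integrable_of_hasCompactSupport hs).abs.mul_const B
  · filter_upwards [hB k] with x hx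
    rw [norm_smul, Real.norm_eq_abs]
    gcongr
  · filter_upwards [h] with x hx using hx.const_smul (ψ x)

/-- The substitution `x = sy` maps the slice of the cone to the fixed unit disc, where `mu s (s y) =
mu 1 y` no longer depends on time. Time derivatives then fall on `s² ψ(sy)` and on the explicit time
dependence of the profile, never on the amplitude. -/
theorem integral_smul_spread {s : ℝ} (hs : 0 < s) (f : Plane → ℂ) (ψ : Plane → ℝ) :
    ∫ x, ψ x • spread s f x = ∫ y in Metric.ball (0 : Plane) 1, (s ^ 2 * ψ (s • y)) • f (mu 1 y) := by
  have h := Measure.integral_comp_smul (volume : Measure Plane) (fun x ↦ ψ x • spread s f x) s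
  rw [finrank_euclideanSpace_fin, abs_of_pos (by positivity)] at h
  have h2 : ∫ x, ψ x • spread s f x = s ^ 2 • ∫ y, ψ (s • y) • spread s f (s • y) := by
    rw [h, smul_smul, mul_inv_cancel₀ (by positivity), one_smul]
  rw [h2, ← integral_smul, ← integral_indicator measurableSet_ball]
  refine integral_congr_ae (Eventually.of_forall fun y ↦ ?_)
  have hm : s • y ∈ Metric.ball (0 : Plane) s ↔ y ∈ Metric.ball (0 : Plane) 1 := by
    rw [mem_ball_zero_iff, mem_ball_zero_iff, norm_smul, Real.norm_eq_abs, abs_of_pos hs,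
      mul_lt_iff_lt_one_right hs]
  by_cases hy : y ∈ Metric.ball (0 : Plane) 1
  · simp only [spread, Set.indicator_of_mem hy, Set.indicator_of_mem (hm.2 hy), smul_smul,
      mu_smul_eq hs]
  · simp only [spread, Set.indicator_of_notMem hy, Set.indicator_of_notMem (mt hm.1 hy), smul_zero]

/-! ### Time derivatives of the pairing with a test function -/

theorem hasDerivAt_integral_of_bound {α : Type*} [MeasurableSpace α] {ν : Measure α}
    [IsFiniteMeasure ν] {F F' : ℝ → α → ℂ} {U : Set ℝ} {s B : ℝ} (hU : U ∈ 𝓝 s)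
    (hm : ∀ s ∈ U, AEStronglyMeasurable (F s) ν) (hm' : AEStronglyMeasurable (F' s) ν)
    (hB : ∀ᵐ a ∂ν, ‖F s a‖ ≤ B) (hB' : ∀ᵐ a ∂ν, ∀ s ∈ U, ‖F' s a‖ ≤ B)
    (hd : ∀ᵐ a ∂ν, ∀ s ∈ U, HasDerivAt (fun s ↦ F s a) (F' s a) s) :
    HasDerivAt (fun s ↦ ∫ a, F s a ∂ν) (∫ a, F' s a ∂ν) s :=
  (hasDerivAt_integral_of_dominated_loc_of_deriv_le hU (eventually_of_mem hU hm)
    (Integrable.of_bound (hm s (mem_of_mem_nhds hU)) B hB) hm' hB' (integrable_const B) hd).2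

/-- The weight `s² ψ(sy)` and its two time derivatives. -/
def wt (ψ : Plane → ℝ) (s : ℝ) (y : Plane) : ℝ := s ^ 2 * ψ (s • y)

/-- The first time derivative of `wt`. -/
def wt₁ (ψ : Plane → ℝ) (s : ℝ) (y : Plane) : ℝ :=
  2 * s * ψ (s • y) + s ^ 2 * fderiv ℝ ψ (s • y) y

/-- The second time derivative of `wt`. -/
def wt₂ (ψ : Plane → ℝ) (s : ℝ) (y : Plane) : ℝ :=
  2 * ψ (s • y) + 2 * s * fderiv ℝ ψ (s • y) y +
    (2 * s * fderiv ℝ ψ (s • y) y + s ^ 2 * fderiv ℝ (fderiv ℝ ψ) (s • y) y y)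

section

variable {ψ : Plane → ℝ}

theorem hasDerivAt_smul_left (s : ℝ) (y : Plane) : HasDerivAt (fun s : ℝ ↦ s • y) y s := by
  simpa using (hasDerivAt_id s).smul_const y

theorem hasDerivAt_wt (hψ : ContDiff ℝ ∞ ψ) (s : ℝ) (y : Plane) :
    HasDerivAt (fun s ↦ wt ψ s y) (wt₁ ψ s y) s := by
  have h1 : HasDerivAt (fun s : ℝ ↦ ψ (s • y)) (fderiv ℝ ψ (s • y) y) s :=
    (hψ.differentiable (by simp) _).hasFDerivAt.comp_hasDerivAt s (hasDerivAt_smul_left s y)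
  have h := (hasDerivAt_pow 2 s).mul h1
  convert! h using 1
  rw [wt₁]; simp

theorem hasDerivAt_wt₁ (hψ : ContDiff ℝ ∞ ψ) (s : ℝ) (y : Plane) :
    HasDerivAt (fun s ↦ wt₁ ψ s y) (wt₂ ψ s y) s := by
  have h1 : HasDerivAt (fun s : ℝ ↦ ψ (s • y)) (fderiv ℝ ψ (s • y) y) s :=
    (hψ.differentiable (by simp) _).hasFDerivAt.comp_hasDerivAt s (hasDerivAt_smul_left s y)
  have h2 : HasDerivAt (fun s : ℝ ↦ fderiv ℝ ψ (s • y) y)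
      (fderiv ℝ (fderiv ℝ ψ) (s • y) y y) s := by
    have := (fderiv_fderiv_apply (hψ.of_le two_le_infty).contDiffAt y
      (x := s • y)).comp_hasDerivAt s (hasDerivAt_smul_left s y)
    exact this
  have h := (((hasDerivAt_id s).const_mul 2).mul h1).add ((hasDerivAt_pow 2 s).mul h2)
  convert! h using 1
  rw [wt₂]; simp

theorem continuous_wt (hψ : ContDiff ℝ ∞ ψ) (s : ℝ) :
    Continuous (wt ψ s) ∧ Continuous (wt₁ ψ s) ∧ Continuous (wt₂ ψ s) := by
  have c0 : Continuous fun y : Plane ↦ ψ (s • y) := hψ.continuous.comp (by fun_prop)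
  have c1 : Continuous fun y : Plane ↦ fderiv ℝ ψ (s • y) y :=
    ((hψ.continuous_fderiv (by simp)).comp (by fun_prop : Continuous fun y : Plane ↦ s • y)).clm_apply
      continuous_id
  have h1 : ContDiff ℝ 1 (fderiv ℝ ψ) := hψ.fderiv_right (by norm_cast)
  have c2 : Continuous fun y : Plane ↦ fderiv ℝ (fderiv ℝ ψ) (s • y) y y :=
    (((h1.continuous_fderiv (by simp)).comp
      (by fun_prop : Continuous fun y : Plane ↦ s • y)).clm_apply continuous_id).clm_apply
      continuous_id
  unfold wt wt₁ wt₂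
  exact ⟨by fun_prop, by fun_prop, by fun_prop⟩

theorem abs_wt_le {s T u v w b₀ b₁ b₂ : ℝ} (h0 : 0 ≤ s) (hT : s ≤ T) (q0 : |u| ≤ b₀)
    (q1 : |v| ≤ b₁) (q2 : |w| ≤ b₂) :
    |s ^ 2 * u| ≤ (2 + 4 * T + T ^ 2) * (b₀ + b₁ + b₂) ∧
    |2 * s * u + s ^ 2 * v| ≤ (2 + 4 * T + T ^ 2) * (b₀ + b₁ + b₂) ∧
    |2 * u + 2 * s * v + (2 * s * v + s ^ 2 * w)| ≤ (2 + 4 * T + T ^ 2) * (b₀ + b₁ + b₂) := by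
  have p0 := (abs_nonneg _).trans q0
  have p1 := (abs_nonneg _).trans q1
  have p2 := (abs_nonneg _).trans q2
  have hT0 := h0.trans hT
  have e1 : |2 * s * u| ≤ 2 * T * b₀ := by
    rw [abs_mul, abs_of_nonneg (by positivity)]; gcongr
  have e2 : |s ^ 2 * v| ≤ T ^ 2 * b₁ := by
    rw [abs_mul, abs_of_nonneg (by positivity)]; gcongr
  have e3 : |2 * s * v| ≤ 2 * T * b₁ := by
    rw [abs_mul, abs_of_nonneg (by positivity)]; gcongr
  have e4 : |s ^ 2 * w| ≤ T ^ 2 * b₂ := by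
    rw [abs_mul, abs_of_nonneg (by positivity)]; gcongr
  have e5 : |2 * u| ≤ 2 * b₀ := by
    rw [abs_mul, Nat.abs_ofNat]; gcongr
  have e6 : |s ^ 2 * u| ≤ T ^ 2 * b₀ := by
    rw [abs_mul, abs_of_nonneg (by positivity)]; gcongr
  have ee : (2 + 4 * T + T ^ 2) * (b₀ + b₁ + b₂) = 2 * b₀ + 4 * (T * b₀) + T ^ 2 * b₀ +
    2 * b₁ + 4 * (T * b₁) + T ^ 2 * b₁ + 2 * b₂ + 4 * (T * b₂) + T ^ 2 * b₂ := by ring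
  have r0 := mul_nonneg hT0 p0
  have r1 := mul_nonneg hT0 p1
  have r2 := mul_nonneg hT0 p2
  have r3 := mul_nonneg (sq_nonneg T) p0
  have r4 := mul_nonneg (sq_nonneg T) p1
  have r5 := mul_nonneg (sq_nonneg T) p2
  rw [ee]
  refine ⟨?_, ?_, ?_⟩
  · linarith
  · refine (abs_add_le _ _).trans ?_
    linarith
  · refine (abs_add_le _ _).trans ((add_le_add (abs_add_le _ _) (abs_add_le _ _)).trans ?_)
    linarith

theorem exists_norm2_bound (hψ : ContDiff ℝ ∞ ψ) (hs : HasCompactSupport ψ) :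
    ∃ b : ℝ, ∀ x, norm2 ψ x ≤ b := by
  have hc : HasCompactSupport (norm2 ψ) := HasCompactSupport.intro hs.isCompact fun x hx ↦ by
    have h : fderiv ℝ (fderiv ℝ ψ) x = 0 := image_eq_zero_of_notMem_tsupport fun h ↦
      hx (tsupport_fderiv_subset ℝ (tsupport_fderiv_subset ℝ h))
    rw [norm2, h]
    exact norm_zero (E := Plane →L[ℝ] Plane →L[ℝ] ℝ)
  obtain ⟨b, hb⟩ := hc.exists_bound_of_continuous (continuous_norm2 (hψ.of_le two_le_infty))
  exact ⟨b, fun x ↦ (le_abs_self _).trans (hb x)⟩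

theorem exists_wt_bound (hψ : ContDiff ℝ ∞ ψ) (hs : HasCompactSupport ψ) (T : ℝ) :
    ∃ B : ℝ, ∀ s y, 0 ≤ s → s ≤ T → ‖y‖ ≤ 1 → |wt ψ s y| ≤ B ∧ |wt₁ ψ s y| ≤ B ∧ |wt₂ ψ s y| ≤ B := by
  obtain ⟨b0, hb0⟩ := hs.exists_bound_of_continuous hψ.continuous
  obtain ⟨b1, hb1⟩ := (hs.fderiv ℝ).exists_bound_of_continuous (hψ.continuous_fderiv (by simp))
  obtain ⟨b2, hb2⟩ := exists_norm2_bound hψ hs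
  refine ⟨(2 + 4 * T + T ^ 2) * (b0 + b1 + b2), fun s y h0 hT hy ↦ ?_⟩
  have q1 : |fderiv ℝ ψ (s • y) y| ≤ b1 := by
    refine (norm_fderiv_apply_le ψ (s • y) y).trans ?_
    exact (mul_le_of_le_one_right (norm1_nonneg _ _) hy).trans (hb1 _)
  have q2 : |fderiv ℝ (fderiv ℝ ψ) (s • y) y y| ≤ b2 := by
    refine (norm_fderiv_fderiv_apply_le ψ (s • y) y y).trans ?_
    have n2 := norm2_nonneg ψ (s • y)
    exact (mul_le_of_le_one_right (mul_nonneg n2 (norm_nonneg y)) hy).trans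
      ((mul_le_of_le_one_right n2 hy).trans (hb2 _))
  exact abs_wt_le h0 hT (hb0 _) q1 q2

end

/-- The jet at one point provides some first derivative near it; by uniqueness this is `U₁`, since
jets are given at all nearby points. -/
theorem hasDerivAt_of_jets {F : Type*} [NormedAddCommGroup F] [NormedSpace ℝ F]
    {U U₁ U₂ : ℝ → F} {V : Set ℝ} (hV : IsOpen V)
    (h : ∀ s ∈ V, Jet (fun h ↦ U (s + h)) (U s) (U₁ s) (U₂ s)) {s : ℝ} (hs : s ∈ V) :
    HasDerivAt U (U₁ s) s ∧ HasDerivAt U₁ (U₂ s) s := by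
  have hd : ∀ s ∈ V, HasDerivAt U (U₁ s) s := fun s hs ↦ by
    have h1 : HasDerivAt (fun h ↦ U (s + h)) (U₁ s) (s - s) := by
      rw [sub_self]; exact (h s hs).hasDerivAt
    simpa using h1.comp_sub_const s s
  refine ⟨hd s hs, ?_⟩
  obtain ⟨f₁, h1, -, h2⟩ := (h s hs).ex
  have ht : Tendsto (fun h : ℝ ↦ s + h) (𝓝 0) (𝓝 s) := by
    simpa using (continuous_const_add s).tendsto 0
  have e : (fun h ↦ U₁ (s + h)) =ᶠ[𝓝 0] f₁ := by
    filter_upwards [h1, ht (hV.mem_nhds hs)] with x a b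
    exact ((hd _ b).comp_const_add s x).unique a
  have h3 : HasDerivAt (fun h ↦ U₁ (s + h)) (U₂ s) (s - s) := by
    rw [sub_self]; exact h2.congr_of_eventuallyEq e
  simpa using h3.comp_sub_const s s

/-- The approximate solution with amplitude `Z` and modulus `R`. -/
def app (lam : ℝ) (Z : Plane → ℂ) (R : Plane → ℝ) (s : ℝ) : Plane → ℂ :=
  spread s fun μ ↦ pro lam s (Z μ) (R μ) (bracket μ)

/-- The second time derivative of the pairing of `app` with a test function. -/
def pairing₂ (lam : ℝ) (Z : Plane → ℂ) (R : Plane → ℝ) (ψ : Plane → ℝ) (s : ℝ) : ℂ :=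
  ∫ y in Metric.ball (0 : Plane) 1,
    (wt ψ s y • pro₂ lam s (Z (mu 1 y)) (R (mu 1 y)) (bracket (mu 1 y))
      + wt₁ ψ s y • pro₁ lam s (Z (mu 1 y)) (R (mu 1 y)) (bracket (mu 1 y))
      + (wt₁ ψ s y • pro₁ lam s (Z (mu 1 y)) (R (mu 1 y)) (bracket (mu 1 y))
      + wt₂ ψ s y • pro lam s (Z (mu 1 y)) (R (mu 1 y)) (bracket (mu 1 y))))

/-- The amplitude `Z` and the modulus `R` are measurable, with `|Z| ≤ R ≤ S`. -/
structure IsAmplitude (Z : Plane → ℂ) (R : Plane → ℝ) (S : ℝ) : Prop where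
  nonneg : 0 ≤ S
  meas : AEMeasurable Z volume
  meas_modulus : AEMeasurable R volume
  norm_le : ∀ μ, ‖Z μ‖ ≤ R μ
  le : ∀ᵐ μ, R μ ≤ S

section

variable {lam S : ℝ} {Z : Plane → ℂ} {R : Plane → ℝ} {ψ : Plane → ℝ}

theorem IsAmplitude.comp_mu (h : IsAmplitude Z R S) :
    AEMeasurable (fun y ↦ Z (mu 1 y)) (volume.restrict (Metric.ball 0 1)) ∧
    AEMeasurable (fun y ↦ R (mu 1 y)) (volume.restrict (Metric.ball 0 1)) ∧
    AEMeasurable (fun y ↦ bracket (mu 1 y)) (volume.restrict (Metric.ball 0 1)) :=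
  ⟨h.meas.comp_quasiMeasurePreserving (quasiMeasurePreserving_mu one_pos),
    h.meas_modulus.comp_quasiMeasurePreserving (quasiMeasurePreserving_mu one_pos),
    (contDiff_bracket.continuous.measurable.comp (measurable_mu 1)).aemeasurable⟩

/-- After the substitution to the unit disc this is differentiation under the integral, twice, with
a bounded majorant; the amplitude need only be bounded and measurable. Times greater than 1 are
taken because the bounds on the profile hold there. -/
theorem hasDerivAt_pairing (lam : ℝ) (h : IsAmplitude Z R S) (hψ : ContDiff ℝ ∞ ψ)
    (hs : HasCompactSupport ψ) : ∃ D : ℝ → ℂ, ∀ s, 1 < s →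
      HasDerivAt (fun s ↦ ∫ x, ψ x • app lam Z R s x) (D s) s ∧
      HasDerivAt D (pairing₂ lam Z R ψ s) s := by
  set p : ℝ → Plane → ℂ := fun s y ↦ pro lam s (Z (mu 1 y)) (R (mu 1 y)) (bracket (mu 1 y)) with hp
  set p₁ : ℝ → Plane → ℂ := fun s y ↦ pro₁ lam s (Z (mu 1 y)) (R (mu 1 y)) (bracket (mu 1 y))
    with hp₁
  set p₂ : ℝ → Plane → ℂ := fun s y ↦ pro₂ lam s (Z (mu 1 y)) (R (mu 1 y)) (bracket (mu 1 y))
    with hp₂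
  have : IsFiniteMeasure (volume.restrict (Metric.ball (0 : Plane) 1)) :=
    ⟨by rw [Measure.restrict_apply_univ]; exact measure_ball_lt_top⟩
  obtain ⟨m1, m2, m3⟩ := h.comp_mu
  have hm : ∀ s, _ := fun s ↦ aemeasurable_pro lam s m1 m2 m3 (fun y ↦ h.norm_le (mu 1 y))
  obtain ⟨B, hB⟩ := exists_pro_bound lam h.nonneg
  have hR := ae_restrict_ball_mu one_pos h.le
  have hball : ∀ᵐ y ∂(volume.restrict (Metric.ball (0 : Plane) 1)), ‖y‖ ≤ 1 := by
    filter_upwards [ae_restrict_mem measurableSet_ball] with y hy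
    exact (mem_ball_zero_iff.1 hy).le
  have hder : ∀ y s, 0 < s → HasDerivAt (fun s ↦ p s y) (p₁ s y) s ∧
      HasDerivAt (fun s ↦ p₁ s y) (p₂ s y) s := fun y s hs ↦
    hasDerivAt_of_jets (U := fun s ↦ p s y) (U₁ := fun s ↦ p₁ s y) (U₂ := fun s ↦ p₂ s y)
      isOpen_Ioi (V := Set.Ioi 0)
      (fun s hs ↦ jet_pro_time lam hs (h.norm_le (mu 1 y)) (bracket (mu 1 y))) hs
  refine ⟨fun s ↦ ∫ y in Metric.ball (0 : Plane) 1, (wt ψ s y • p₁ s y + wt₁ ψ s y • p s y),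
    fun s hs1 ↦ ?_⟩
  obtain ⟨W, hW⟩ := exists_wt_bound hψ hs (s + 1)
  have hU : Set.Ioo 1 (s + 1) ∈ 𝓝 s := Ioo_mem_nhds hs1 (by linarith)
  have hW0 : 0 ≤ W := (abs_nonneg _).trans (hW s 0 (by linarith) (by linarith) (by simp)).1
  have hms : ∀ {c : Plane → ℝ} {f : Plane → ℂ}, Continuous c →
      AEMeasurable f (volume.restrict (Metric.ball 0 1)) →
      AEStronglyMeasurable (fun y ↦ c y • f y) (volume.restrict (Metric.ball 0 1)) :=
    fun hc hf ↦ hc.aestronglyMeasurable.smul hf.aestronglyMeasurable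
  have hbd : ∀ᵐ y ∂(volume.restrict (Metric.ball (0 : Plane) 1)), ∀ τ ∈ Set.Ioo 1 (s + 1),
      (|wt ψ τ y| ≤ W ∧ |wt₁ ψ τ y| ≤ W ∧ |wt₂ ψ τ y| ≤ W) ∧
      (‖p τ y‖ ≤ B ∧ ‖p₁ τ y‖ ≤ B ∧ ‖p₂ τ y‖ ≤ B) := by
    filter_upwards [hR, hball] with y h1 h2 τ hτ
    exact ⟨hW τ y (by linarith [hτ.1]) hτ.2.le h2,
      hB τ _ _ _ hτ.1.le (h.norm_le _) h1 (one_le_bracket _)⟩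
  have hsm : ∀ {a : ℝ} {z : ℂ}, |a| ≤ W → ‖z‖ ≤ B → ‖a • z‖ ≤ W * B := fun {a z} ha hz ↦ by
    rw [norm_smul, Real.norm_eq_abs]
    exact mul_le_mul ha hz (norm_nonneg _) hW0
  have hsin : s ∈ Set.Ioo 1 (s + 1) := ⟨hs1, by linarith⟩
  constructor
  · have e : (fun s ↦ ∫ x, ψ x • app lam Z R s x) =ᶠ[𝓝 s]
        fun s ↦ ∫ y in Metric.ball (0 : Plane) 1, wt ψ s y • p s y := by
      filter_upwards [hU] with τ hτ
      exact integral_smul_spread (by linarith [hτ.1]) _ ψ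
    refine HasDerivAt.congr_of_eventuallyEq ?_ e
    refine hasDerivAt_integral_of_bound (B := W * B + W * B)
      (F := fun s y ↦ wt ψ s y • p s y) (F' := fun s y ↦ wt ψ s y • p₁ s y + wt₁ ψ s y • p s y) hU
      (fun τ _ ↦ hms (continuous_wt hψ τ).1 (hm τ).1)
      ((hms (continuous_wt hψ s).1 (hm s).2.1).add (hms (continuous_wt hψ s).2.1 (hm s).1)) ?_ ?_ ?_
    · filter_upwards [hbd] with y hy
      obtain ⟨⟨a0, a1, a2⟩, b0, b1, b2⟩ := hy s hsin
      have := (norm_nonneg _).trans (hsm a0 b0)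
      linarith [hsm a0 b0]
    · filter_upwards [hbd] with y hy τ hτ
      obtain ⟨⟨a0, a1, a2⟩, b0, b1, b2⟩ := hy τ hτ
      exact (norm_add_le _ _).trans (add_le_add (hsm a0 b1) (hsm a1 b0))
    · refine Eventually.of_forall fun y τ hτ ↦ ?_
      exact (hasDerivAt_wt hψ τ y).smul (hder y τ (by linarith [hτ.1])).1
  · refine hasDerivAt_integral_of_bound (B := W * B + W * B + (W * B + W * B))
      (F := fun s y ↦ wt ψ s y • p₁ s y + wt₁ ψ s y • p s y)
      (F' := fun s y ↦ wt ψ s y • p₂ s y + wt₁ ψ s y • p₁ s y +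
        (wt₁ ψ s y • p₁ s y + wt₂ ψ s y • p s y)) hU
      (fun τ _ ↦ (hms (continuous_wt hψ τ).1 (hm τ).2.1).add (hms (continuous_wt hψ τ).2.1 (hm τ).1))
      (((hms (continuous_wt hψ s).1 (hm s).2.2.1).add (hms (continuous_wt hψ s).2.1 (hm s).2.1)).add
      ((hms (continuous_wt hψ s).2.1 (hm s).2.1).add (hms (continuous_wt hψ s).2.2 (hm s).1))) ?_ ?_ ?_
    · filter_upwards [hbd] with y hy
      obtain ⟨⟨a0, a1, a2⟩, b0, b1, b2⟩ := hy s hsin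
      have := (norm_nonneg _).trans (hsm a0 b0)
      refine (norm_add_le _ _).trans ?_
      linarith [hsm a0 b1, hsm a1 b0]
    · filter_upwards [hbd] with y hy τ hτ
      obtain ⟨⟨a0, a1, a2⟩, b0, b1, b2⟩ := hy τ hτ
      exact (norm_add_le _ _).trans (add_le_add
        ((norm_add_le _ _).trans (add_le_add (hsm a0 b2) (hsm a1 b1)))
        ((norm_add_le _ _).trans (add_le_add (hsm a1 b1) (hsm a2 b0))))
    · refine Eventually.of_forall fun y τ hτ ↦ ?_
      have hτ0 : 0 < τ := by linarith [hτ.1]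
      exact ((hasDerivAt_wt hψ τ y).smul (hder y τ hτ0).2).add
        ((hasDerivAt_wt₁ hψ τ y).smul (hder y τ hτ0).1)

theorem tendsto_pairing₂ (lam : ℝ) {Zs : ℕ → Plane → ℂ} {Rs : ℕ → Plane → ℝ}
    (hk : ∀ k, IsAmplitude (Zs k) (Rs k) S)
    (hZ : ∀ᵐ μ, Tendsto (fun k ↦ Zs k μ) atTop (𝓝 (Z μ)))
    (hR : ∀ᵐ μ, Tendsto (fun k ↦ Rs k μ) atTop (𝓝 (R μ))) (hψ : ContDiff ℝ ∞ ψ)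
    (hs : HasCompactSupport ψ) {s : ℝ} (hs1 : 1 ≤ s) :
    Tendsto (fun k ↦ pairing₂ lam (Zs k) (Rs k) ψ s) atTop (𝓝 (pairing₂ lam Z R ψ s)) := by
  obtain ⟨B, hB⟩ := exists_pro_bound lam (hk 0).nonneg
  obtain ⟨W, hW⟩ := exists_wt_bound hψ hs s
  have hW0 : 0 ≤ W := (abs_nonneg _).trans (hW s 0 (by linarith) (by linarith) (by simp)).1
  obtain ⟨c0, c1, c2⟩ := continuous_wt hψ s
  have hms : ∀ {c : Plane → ℝ} {f : Plane → ℂ}, Continuous c →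
      AEMeasurable f (volume.restrict (Metric.ball 0 1)) →
      AEStronglyMeasurable (fun y ↦ c y • f y) (volume.restrict (Metric.ball 0 1)) :=
    fun hc hf ↦ hc.aestronglyMeasurable.smul hf.aestronglyMeasurable
  have hsm : ∀ {a : ℝ} {z : ℂ}, |a| ≤ W → ‖z‖ ≤ B → ‖a • z‖ ≤ W * B := fun {a z} ha hz ↦ by
    rw [norm_smul, Real.norm_eq_abs]
    exact mul_le_mul ha hz (norm_nonneg _) hW0
  have : IsFiniteMeasure (volume.restrict (Metric.ball (0 : Plane) 1)) :=
    ⟨by rw [Measure.restrict_apply_univ]; exact measure_ball_lt_top⟩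
  refine tendsto_integral_of_dominated_convergence (fun _ ↦ W * B + W * B + (W * B + W * B))
    (fun k ↦ ?_) (integrable_const _) (fun k ↦ ?_) ?_
  · obtain ⟨m1, m2, m3⟩ := (hk k).comp_mu
    obtain ⟨q0, q1, q2, -⟩ := aemeasurable_pro lam s m1 m2 m3 (fun y ↦ (hk k).norm_le (mu 1 y))
    exact ((hms c0 q2).add (hms c1 q1)).add ((hms c1 q1).add (hms c2 q0))
  · filter_upwards [ae_restrict_ball_mu one_pos (hk k).le, ae_restrict_mem measurableSet_ball]
      with y h1 h2
    obtain ⟨a0, a1, a2⟩ := hW s y (by linarith) le_rfl (mem_ball_zero_iff.1 h2).le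
    obtain ⟨b0, b1, b2⟩ := hB s _ _ _ hs1 ((hk k).norm_le _) h1 (one_le_bracket _)
    exact (norm_add_le _ _).trans (add_le_add
      ((norm_add_le _ _).trans (add_le_add (hsm a0 b2) (hsm a1 b1)))
      ((norm_add_le _ _).trans (add_le_add (hsm a1 b1) (hsm a2 b0))))
  · filter_upwards [ae_restrict_ball_mu one_pos hZ, ae_restrict_ball_mu one_pos hR] with y h1 h2
    obtain ⟨t0, t1, t2, -⟩ := tendsto_pro lam s h1 h2 (fun k ↦ (hk k).norm_le _) (bracket (mu 1 y))
    exact ((t2.const_smul _).add (t1.const_smul _)).add ((t1.const_smul _).add (t0.const_smul _))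

end

/-! ### The approximate solution for a smooth, compactly supported amplitude -/

section

variable {lam ε : ℝ} {Z : Plane → ℂ}

theorem kk_zero_right (j : ℕ) (hj : j ≤ 2) : kk j 0 = 0 := by
  have h := norm_kk_le hj (z := 0) (by simp)
  simpa using h

theorem pro_zero (lam s r m : ℝ) : pro lam s 0 r m = 0 := by
  rw [pro, zero_mul, zero_div, kk_zero_right 0 (by norm_num)]; simp

theorem lead_zero (lam s r m : ℝ) : lead lam s 0 r m = 0 := by
  rw [lead, har, har, zero_mul, zero_div, kk_zero_right 0 (by norm_num),
    kk_zero_right 2 le_rfl]; simp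

/-- The approximate solution as a function on spacetime. -/
def appST (lam ε : ℝ) (Z : Plane → ℂ) (p : ℝ × Plane) : ℂ := app lam Z (rad ε Z) p.1 p.2

theorem appST_eq_prof {p : ℝ × Plane} (hp : ‖p.2‖ < p.1) :
    appST lam ε Z p = prof lam ε Z (hyp p) := by
  have e : p.2 ∈ Metric.ball (0 : Plane) p.1 := by simpa using hp
  rw [appST, app, spread, Set.indicator_of_mem e, prof, hyp, sqrt_mul_bracket_mu hp]

theorem appST_eventuallyEq_prof {p : ℝ × Plane} (hp : ‖p.2‖ < p.1) :
    appST lam ε Z =ᶠ[𝓝 p] fun p ↦ prof lam ε Z (hyp p) := by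
  filter_upwards [(isOpen_lt (by fun_prop : Continuous fun p : ℝ × Plane ↦ ‖p.2‖)
    (by fun_prop : Continuous fun p : ℝ × Plane ↦ p.1)).mem_nhds hp] with q hq
  exact appST_eq_prof hq

/-- If the support of `Z` lies in `|μ| ≤ r`, the approximate solution lives in the strictly smaller
cone `(1 + r²)|x|² ≤ r²t²`. It therefore vanishes in a neighbourhood of the light cone, and the
sharp cutoff at `|x| = t` creates no singularity. -/
theorem appST_eventuallyEq_zero (hs : HasCompactSupport Z) {p : ℝ × Plane} (h0 : 0 < p.1)
    (hp : p.1 ≤ ‖p.2‖) : appST lam ε Z =ᶠ[𝓝 p] fun _ ↦ 0 := by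
  obtain ⟨r, hr⟩ := hs.isCompact.isBounded.exists_norm_le
  have hmem : r ^ 2 * p.1 ^ 2 < (1 + r ^ 2) * ‖p.2‖ ^ 2 := by
    have : p.1 ^ 2 ≤ ‖p.2‖ ^ 2 := pow_le_pow_left₀ h0.le hp 2
    nlinarith [mul_le_mul_of_nonneg_left this (sq_nonneg r), sq_pos_of_pos h0]
  filter_upwards [(isOpen_lt (by fun_prop : Continuous fun p : ℝ × Plane ↦ r ^ 2 * p.1 ^ 2)
    (by fun_prop : Continuous fun p : ℝ × Plane ↦ (1 + r ^ 2) * ‖p.2‖ ^ 2)).mem_nhds hmem]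
    with q hq
  by_cases hb : q.2 ∈ Metric.ball (0 : Plane) q.1
  · rw [appST, app, spread, Set.indicator_of_mem hb]
    have hz : Z (mu q.1 q.2) = 0 := by
      by_contra hne
      have hn := hr _ (subset_tsupport Z hne)
      have hlt : ‖q.2‖ < q.1 := by simpa using hb
      have h1 : 0 < q.1 ^ 2 - ‖q.2‖ ^ 2 := by nlinarith [norm_nonneg q.2]
      have h2 := Real.sqrt_pos.2 h1
      have h3 : ‖mu q.1 q.2‖ ^ 2 = ‖q.2‖ ^ 2 / (q.1 ^ 2 - ‖q.2‖ ^ 2) := by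
        rw [mu, norm_smul, Real.norm_eq_abs, mul_pow, sq_abs, inv_pow, Real.sq_sqrt h1.le]
        field_simp
      have h4 : ‖mu q.1 q.2‖ ^ 2 ≤ r ^ 2 := pow_le_pow_left₀ (norm_nonneg _) hn 2
      rw [h3, div_le_iff₀ h1] at h4
      linarith
    rw [hz, pro_zero]
  · rw [appST, app, spread, Set.indicator_of_notMem hb]

theorem contDiffAt_appST (lam : ℝ) (hε : 0 < ε) (hZ : ContDiff ℝ ∞ Z) (hs : HasCompactSupport Z)
    {p : ℝ × Plane} (h0 : 0 < p.1) : ContDiffAt ℝ 2 (appST lam ε Z) p := by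
  rcases lt_or_ge ‖p.2‖ p.1 with hp | hp
  · refine ContDiffAt.congr_of_eventuallyEq ?_ (appST_eventuallyEq_prof hp)
    have h1 : 0 < p.1 ^ 2 - ‖p.2‖ ^ 2 := by nlinarith [norm_nonneg p.2]
    exact ContDiffAt.comp p (g := prof lam ε Z)
      (contDiffAt_prof lam hε hZ (p := hyp p) (Real.sqrt_pos.2 h1))
      (contDiffAt_hyp (by rwa [abs_of_pos h0]))
  · exact contDiffAt_const.congr_of_eventuallyEq (appST_eventuallyEq_zero hs h0 hp)

theorem box_congr {A B : ℝ × Plane → ℂ} {p : ℝ × Plane} (h : A =ᶠ[𝓝 p] B) : box A p = box B p := by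
  have h1 : fderiv ℝ (fderiv ℝ A) p = fderiv ℝ (fderiv ℝ B) p :=
    (h.fderiv (𝕜 := ℝ)).fderiv_eq
  rw [box, box, h1]

/-- The bound for the error before the factor `⟨μ⟩²`, cut off to the support of the amplitude. -/
def errFun (lam ε : ℝ) (Z : Plane → ℂ) (s : ℝ) (μ : Plane) : ℝ :=
  bracket μ ^ 2 * (errConst lam * Real.log s ^ 2 * (s ^ 3)⁻¹ * (tsupport Z).indicator (errBd ε Z) μ)

theorem errFun_nonneg (lam ε : ℝ) (Z : Plane → ℂ) {s : ℝ} (hs : 0 < s) (μ : Plane) :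
    0 ≤ errFun lam ε Z s μ := by
  have h1 := errConst_nonneg lam
  have h2 : 0 ≤ (tsupport Z).indicator (errBd ε Z) μ :=
    Set.indicator_nonneg (fun μ _ ↦ errBd_nonneg ε Z μ) μ
  rw [errFun]; positivity

/-- Off the support of `Z` the left side vanishes identically, which justifies the indicator in
`errFun`. The indicator is needed: the regularized modulus is at least `ε` everywhere, so `errBd`
alone would not be square integrable. -/
theorem norm_box_appST_le (lam : ℝ) (hε : 0 < ε) (hZ : ContDiff ℝ ∞ Z) (hs : HasCompactSupport Z)
    {t : ℝ} (ht : Real.exp 1 ≤ t) (x : Plane) :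
    ‖box (appST lam ε Z) (t, x) + app lam Z (rad ε Z) t x
      - spread t (fun μ ↦ lead lam t (Z μ) (rad ε Z μ) (bracket μ)) x‖ ≤
    ‖spread t (fun μ ↦ (errFun lam ε Z t μ : ℂ)) x‖ := by
  have ht0 : 0 < t := (Real.exp_pos 1).trans_le ht
  by_cases hx : ‖x‖ < t
  · have hb : x ∈ Metric.ball (0 : Plane) t := by simpa using hx
    have h1 : 0 < t ^ 2 - ‖x‖ ^ 2 := by nlinarith [norm_nonneg x]
    have hρ := Real.sqrt_pos.2 h1
    have e1 := sqrt_mul_bracket_mu hx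
    have e2 := sqrt_smul_mu hx
    have hA : app lam Z (rad ε Z) t x = prof lam ε Z (hyp (t, x)) := appST_eq_prof (p := (t, x)) hx
    rw [box_congr (appST_eventuallyEq_prof (p := (t, x)) hx)]
    rw [spread, Set.indicator_of_mem hb, spread, Set.indicator_of_mem hb, Complex.norm_real,
      Real.norm_eq_abs, abs_of_nonneg (errFun_nonneg lam ε Z ht0 _)]
    by_cases hsup : mu t x ∈ tsupport Z
    · rw [hA, errFun, Set.indicator_of_mem hsup]
      have h := norm_box_prof_sub_lead_le lam hε hZ hρ (μ := mu t x) (by rw [e1]; exact ht)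
      rw [e1, e2] at h
      exact h
    · rw [errFun, Set.indicator_of_notMem hsup, mul_zero, mul_zero]
      have hz : ∀ᶠ q in 𝓝 (t, x), prof lam ε Z (hyp q) = 0 := by
        have hc : ContinuousAt (fun q : ℝ × Plane ↦ (hyp q).2) (t, x) :=
          ((contDiffAt_hyp (n := 0) (p := (t, x)) (by rwa [abs_of_pos ht0])).continuousAt).snd
        have ho : (tsupport Z)ᶜ ∈ 𝓝 (hyp (t, x)).2 :=
          (isClosed_tsupport Z).isOpen_compl.mem_nhds hsup
        filter_upwards [hc ho] with q hq
        rw [prof, image_eq_zero_of_notMem_tsupport hq, pro_zero]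
      have hbz : box (fun q ↦ prof lam ε Z (hyp q)) (t, x) = 0 := by
        rw [box_congr (B := fun _ ↦ 0) hz, box]
        simp
      rw [hbz, hA, hz.self_of_nhds, image_eq_zero_of_notMem_tsupport hsup, lead_zero]
      simp
  · have hb : x ∉ Metric.ball (0 : Plane) t := by simpa using hx
    have hz := appST_eventuallyEq_zero (lam := lam) (ε := ε) hs (p := (t, x)) ht0 (not_lt.1 hx)
    have hbz : box (appST lam ε Z) (t, x) = 0 := by
      rw [box_congr hz, box]
      simp
    rw [hbz, spread, Set.indicator_of_notMem hb, spread, Set.indicator_of_notMem hb, app, spread,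
      Set.indicator_of_notMem hb]
    simp

end

/-! ### Integration by parts -/

theorem integral_smul_lapl {g : Plane → ℂ} (hg : ContDiff ℝ 2 g) {ψ : Plane → ℝ}
    (hψ : ContDiff ℝ ∞ ψ) (hs : HasCompactSupport ψ) :
    ∫ x, ψ x • lapl g x = ∫ x, lapl ψ x • g x := by
  have hg1 : ContDiff ℝ 1 (fderiv ℝ g) := hg.fderiv_right (by norm_num)
  have hψ1 : ContDiff ℝ ∞ (fderiv ℝ ψ) := hψ.fderiv_right (by simp)
  have cg : ∀ v, ContDiff ℝ 1 fun x ↦ fderiv ℝ g x v := fun v ↦ hg1.clm_apply contDiff_const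
  have cψ : ∀ v, ContDiff ℝ ∞ fun x ↦ fderiv ℝ ψ x v := fun v ↦ hψ1.clm_apply contDiff_const
  have sψ : ∀ v, HasCompactSupport fun x ↦ fderiv ℝ ψ x v := fun v ↦ hs.fderiv_apply (𝕜 := ℝ) v
  have int : ∀ {a : Plane → ℝ} {b : Plane → ℂ}, Continuous a → Continuous b → HasCompactSupport a →
      Integrable fun x ↦ a x • b x := fun ha hb hsa ↦
    (ha.smul hb).integrable_of_hasCompactSupport hsa.smul_right
  have dd : ∀ {F : Type} [NormedAddCommGroup F] [NormedSpace ℝ F] {f : Plane → F},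
      ContDiff ℝ 2 f → ∀ x v, fderiv ℝ (fderiv ℝ f) x v v = fderiv ℝ (fun y ↦ fderiv ℝ f y v) x v :=
    fun hf x v ↦ by
      rw [(fderiv_fderiv_apply hf.contDiffAt v).fderiv]; rfl
  have key : ∀ v, ∫ x, ψ x • fderiv ℝ (fderiv ℝ g) x v v =
      ∫ x, fderiv ℝ (fderiv ℝ ψ) x v v • g x := fun v ↦ by
    simp only [dd hg, dd (hψ.of_le two_le_infty)]
    rw [integral_smul_fderiv_eq_neg_fderiv_smul_of_integrable
      (int (cψ v).continuous (cg v).continuous (sψ v))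
      (int hψ.continuous (((cg v).continuous_fderiv (by simp)).clm_apply continuous_const) hs)
      (int hψ.continuous (cg v).continuous hs)
      (fun x _ ↦ hψ.differentiable (by simp) x) (fun x _ ↦ (cg v).differentiable (by simp) x),
      integral_smul_fderiv_eq_neg_fderiv_smul_of_integrable
      (int (((cψ v).continuous_fderiv (by simp)).clm_apply continuous_const) hg.continuous
        ((sψ v).fderiv_apply (𝕜 := ℝ) v))
      (int (cψ v).continuous (cg v).continuous (sψ v))
      (int (cψ v).continuous hg.continuous (sψ v))
      (fun x _ ↦ (cψ v).differentiable (by simp) x) (fun x _ ↦ hg.differentiable (by simp) x),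
      neg_neg]
  have c2 : ∀ v, Continuous fun x ↦ fderiv ℝ (fderiv ℝ g) x v v := fun v ↦
    ((hg1.continuous_fderiv (by simp)).clm_apply continuous_const).clm_apply continuous_const
  have c3 : ∀ v, Continuous fun x ↦ fderiv ℝ (fderiv ℝ ψ) x v v := fun v ↦
    ((hψ1.continuous_fderiv (by simp)).clm_apply continuous_const).clm_apply continuous_const
  have s3 : ∀ v, HasCompactSupport fun x ↦ fderiv ℝ (fderiv ℝ ψ) x v v := fun v ↦ by
    simp only [dd (hψ.of_le two_le_infty)]
    exact (sψ v).fderiv_apply (𝕜 := ℝ) v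
  simp only [lapl, Finset.smul_sum, Finset.sum_smul]
  rw [integral_finsetSum _ fun j _ ↦ int hψ.continuous (c2 _) hs,
    integral_finsetSum _ fun j _ ↦ int (c3 _) hg.continuous (s3 _)]
  exact Finset.sum_congr rfl fun j _ ↦ key _

theorem hasDerivAt_integral_smul {B B' : ℝ → Plane → ℂ} {ψ : Plane → ℝ} (hψ : Continuous ψ)
    (hs : HasCompactSupport ψ) (hB : ContinuousOn (fun p : ℝ × Plane ↦ B p.1 p.2) {p | 0 < p.1})
    (hB' : ContinuousOn (fun p : ℝ × Plane ↦ B' p.1 p.2) {p | 0 < p.1})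
    (hd : ∀ s x, 0 < s → HasDerivAt (fun s ↦ B s x) (B' s x) s) {t : ℝ} (ht : 0 < t) :
    HasDerivAt (fun s ↦ ∫ x, ψ x • B s x) (∫ x, ψ x • B' t x) t := by
  have hK : IsCompact (Set.Icc (t / 2) (2 * t) ×ˢ tsupport ψ) := isCompact_Icc.prod hs.isCompact
  have hsub : Set.Icc (t / 2) (2 * t) ×ˢ tsupport ψ ⊆ {p : ℝ × Plane | 0 < p.1} := by
    rintro ⟨s, x⟩ ⟨h1, -⟩
    exact lt_of_lt_of_le (half_pos ht) h1.1
  obtain ⟨b0, hb0⟩ := hK.exists_bound_of_continuousOn (hB.mono hsub)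
  obtain ⟨b1, hb1⟩ := hK.exists_bound_of_continuousOn (hB'.mono hsub)
  obtain ⟨w, hw⟩ := hs.exists_bound_of_continuous hψ
  have hU : Set.Ioo (t / 2) (2 * t) ∈ 𝓝 t := Ioo_mem_nhds (by linarith) (by linarith)
  have hfin : IsFiniteMeasure (volume.restrict (tsupport ψ)) :=
    ⟨by rw [Measure.restrict_apply_univ]; exact hs.isCompact.measure_lt_top⟩
  have hmem : ∀ᵐ x ∂(volume.restrict (tsupport ψ)), x ∈ tsupport ψ :=
    ae_restrict_mem (isClosed_tsupport ψ).measurableSet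
  have hc : ∀ {C : ℝ → Plane → ℂ}, ContinuousOn (fun p : ℝ × Plane ↦ C p.1 p.2) {p | 0 < p.1} →
      ∀ s, 0 < s → Continuous (C s) := fun {C} hC s hs0 ↦ by
    have := hC.comp_continuous (f := fun x : Plane ↦ (s, x)) (by fun_prop) (fun x ↦ hs0)
    exact this
  have hset : ∀ C : ℝ → Plane → ℂ, ∀ s,
      ∫ x in tsupport ψ, ψ x • C s x = ∫ x, ψ x • C s x := fun C s ↦
    setIntegral_eq_integral_of_forall_compl_eq_zero fun x hx ↦ by
      rw [image_eq_zero_of_notMem_tsupport hx, zero_smul]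
  have hw0 : 0 ≤ w := (norm_nonneg _).trans (hw 0)
  simp only [← hset]
  refine hasDerivAt_integral_of_bound (B := w * (|b0| + |b1|)) (F := fun s x ↦ ψ x • B s x)
    (F' := fun s x ↦ ψ x • B' s x) hU
    (fun s h ↦ (hψ.smul (hc hB s (by linarith [h.1]))).aestronglyMeasurable)
    (hψ.smul (hc hB' t ht)).aestronglyMeasurable ?_ ?_ ?_
  · filter_upwards [hmem] with x hx
    rw [norm_smul]
    gcongr
    · exact hw x
    · refine (hb0 (t, x) ⟨⟨by linarith, by linarith⟩, hx⟩).trans ?_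
      linarith [le_abs_self b0, abs_nonneg b1]
  · filter_upwards [hmem] with x hx s h
    rw [norm_smul]
    gcongr
    · exact hw x
    · refine (hb1 (s, x) ⟨⟨h.1.le, h.2.le⟩, hx⟩).trans ?_
      linarith [le_abs_self b1, abs_nonneg b0]
  · refine Eventually.of_forall fun x s h ↦ ?_
    exact (hd s x (by linarith [h.1])).const_smul (ψ x)

/-- The pairing of `(□ + 1)A` with a test function. -/
def weakBox (lam : ℝ) (Z : Plane → ℂ) (R : Plane → ℝ) (ψ : Plane → ℝ) (t : ℝ) : ℂ :=
  pairing₂ lam Z R ψ t - (∫ x, lapl ψ x • app lam Z R t x) + ∫ x, ψ x • app lam Z R t x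

section

variable {lam ε : ℝ} {Z : Plane → ℂ} {ψ : Plane → ℝ}

theorem isAmplitude_rad (hε : 0 < ε) (hZ : ContDiff ℝ ∞ Z) {S : ℝ} (hS : ∀ x, ‖Z x‖ + ε ≤ S) :
    IsAmplitude Z (rad ε Z) S where
  nonneg := (add_nonneg (norm_nonneg _) hε.le).trans (hS 0)
  meas := hZ.continuous.measurable.aemeasurable
  meas_modulus := (contDiff_rad hε hZ).continuous.measurable.aemeasurable
  norm_le := norm_le_rad ε Z
  le := ae_of_all _ fun x ↦ (rad_le hε.le Z x).trans (hS x)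

theorem fderiv_fderiv_slice {A : ℝ × Plane → ℂ} {t : ℝ} {x v : Plane}
    (hA : ContDiffAt ℝ 2 A (t, x)) :
    fderiv ℝ (fderiv ℝ fun y ↦ A (t, y)) x v v = fderiv ℝ (fderiv ℝ A) (t, x) (0, v) (0, v) := by
  have h1 : ContDiffAt ℝ 2 (fun y ↦ A (t, y)) x :=
    ContDiffAt.comp x (g := A) (f := fun y ↦ (t, y)) hA (contDiffAt_const.prodMk contDiffAt_id)
  have j1 := Jet.of_contDiffAt h1 (Jet.line x v)
  have j2 := Jet.of_contDiffAt hA ((Jet.const t).prodMk (Jet.line x v))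
  have h := (j1.unique j2).2
  have h0 : ((0 : ℝ), (0 : Plane)) = 0 := rfl
  rwa [map_zero, add_zero, h0, map_zero, add_zero] at h

/-- For smooth compactly supported `Z` the approximate solution is of class `C²` for positive times,
so the weak expression is the classical one after integrating by parts in space. -/
theorem weakBox_eq (lam : ℝ) (hε : 0 < ε) (hZ : ContDiff ℝ ∞ Z) (hsZ : HasCompactSupport Z)
    (hψ : ContDiff ℝ ∞ ψ) (hs : HasCompactSupport ψ) {t : ℝ} (ht : 1 < t) :
    weakBox lam Z (rad ε Z) ψ t =
      ∫ x, ψ x • (box (appST lam ε Z) (t, x) + app lam Z (rad ε Z) t x) ∧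
    Continuous (fun x ↦ box (appST lam ε Z) (t, x) + app lam Z (rad ε Z) t x) := by
  have ht0 : 0 < t := by linarith
  set A := appST lam ε Z with hA
  have hA2 : ∀ {s x}, 0 < s → ContDiffAt ℝ 2 A (s, x) := fun hs0 ↦
    contDiffAt_appST lam hε hZ hsZ (p := (_, _)) hs0
  have hO : IsOpen {p : ℝ × Plane | 0 < p.1} := isOpen_lt continuous_const continuous_fst
  have hA' : ContDiffOn ℝ 2 A {p : ℝ × Plane | 0 < p.1} := fun p hp ↦
    (hA2 (s := p.1) (x := p.2) hp).contDiffWithinAt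
  have c1 : ContDiffOn ℝ 1 (fderiv ℝ A) {p : ℝ × Plane | 0 < p.1} :=
    hA'.fderiv_of_isOpen hO (by norm_num)
  have c2 : ContinuousOn (fderiv ℝ (fderiv ℝ A)) {p : ℝ × Plane | 0 < p.1} :=
    c1.continuousOn_fderiv_of_isOpen hO (by simp)
  have hline : ∀ (s : ℝ) (x : Plane), HasDerivAt (fun s ↦ (s, x)) ((1 : ℝ), (0 : Plane)) s :=
    fun s x ↦ (hasDerivAt_id s).prodMk (hasDerivAt_const s x)
  have d1 : ∀ s x, 0 < s → HasDerivAt (fun s ↦ A (s, x)) (fderiv ℝ A (s, x) (1, 0)) s :=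
    fun s x hs0 ↦ by
      have := ((hA2 (x := x) hs0).differentiableAt (by simp)).hasFDerivAt.comp_hasDerivAt s
        (hline s x)
      exact this
  have d2 : ∀ s x, 0 < s → HasDerivAt (fun s ↦ fderiv ℝ A (s, x) (1, 0))
      (fderiv ℝ (fderiv ℝ A) (s, x) (1, 0) (1, 0)) s := fun s x hs0 ↦ by
    have := (fderiv_fderiv_apply (hA2 (x := x) hs0) ((1 : ℝ), (0 : Plane))).comp_hasDerivAt s
      (hline s x)
    exact this
  have k0 : ContinuousOn (fun p : ℝ × Plane ↦ A (p.1, p.2)) {p | 0 < p.1} := hA'.continuousOn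
  have k1 : ContinuousOn (fun p : ℝ × Plane ↦ fderiv ℝ A (p.1, p.2) (1, 0)) {p | 0 < p.1} :=
    c1.continuousOn.clm_apply continuousOn_const
  have k2 : ∀ v, ContinuousOn (fun p : ℝ × Plane ↦ fderiv ℝ (fderiv ℝ A) (p.1, p.2) v v)
      {p | 0 < p.1} := fun v ↦ (c2.clm_apply continuousOn_const).clm_apply continuousOn_const
  have e1 := fun s (hs0 : 0 < s) ↦ hasDerivAt_integral_smul (B := fun s x ↦ A (s, x))
    (B' := fun s x ↦ fderiv ℝ A (s, x) (1, 0)) hψ.continuous hs k0 k1 d1 hs0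
  have e2 := hasDerivAt_integral_smul (B := fun s x ↦ fderiv ℝ A (s, x) (1, 0))
    (B' := fun s x ↦ fderiv ℝ (fderiv ℝ A) (s, x) (1, 0) (1, 0)) hψ.continuous hs k1 (k2 _) d2 ht0
  obtain ⟨z, hz⟩ := hsZ.exists_bound_of_continuous hZ.continuous
  obtain ⟨D, hD⟩ := hasDerivAt_pairing lam (isAmplitude_rad hε hZ
    (fun x ↦ add_le_add_left (hz x) ε)) hψ hs
  -- Both sides are time derivatives of the same pairing, hence equal for `s > 1`, and so are their
  -- derivatives at `t`. The formula for `pairing₂` need not be compared with the classical one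
  -- directly.
  have hDe : D =ᶠ[𝓝 t] fun s ↦ ∫ x, ψ x • fderiv ℝ A (s, x) (1, 0) := by
    filter_upwards [Ioi_mem_nhds ht] with s hs1
    have hs1' : 1 < s := hs1
    exact (hD s hs1).1.unique (e1 s (by linarith))
  have hp2 : pairing₂ lam Z (rad ε Z) ψ t =
      ∫ x, ψ x • fderiv ℝ (fderiv ℝ A) (t, x) (1, 0) (1, 0) :=
    (hD t ht).2.unique (e2.congr_of_eventuallyEq hDe)
  have cs : ∀ {f : ℝ × Plane → ℂ}, ContinuousOn f {p | 0 < p.1} → Continuous fun x ↦ f (t, x) :=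
    fun hf ↦ hf.comp_continuous (by fun_prop) (fun x ↦ ht0)
  have hslice : ContDiff ℝ 2 fun x ↦ A (t, x) := contDiff_iff_contDiffAt.2 fun x ↦
    ContDiffAt.comp x (g := A) (f := fun y ↦ (t, y)) (hA2 ht0)
      (contDiffAt_const.prodMk contDiffAt_id)
  have hlap : ∀ x, lapl (fun x ↦ A (t, x)) x =
      ∑ j, fderiv ℝ (fderiv ℝ A) (t, x) (0, unitVec j) (0, unitVec j) := fun x ↦
    Finset.sum_congr rfl fun j _ ↦ fderiv_fderiv_slice (hA2 ht0)
  have hcl : Continuous (lapl fun x ↦ A (t, x)) := by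
    simp only [funext hlap]
    exact continuous_finsetSum _ fun j _ ↦ cs (k2 _)
  have int : ∀ {b : Plane → ℂ}, Continuous b → Integrable fun x ↦ ψ x • b x := fun hb ↦
    (hψ.continuous.smul hb).integrable_of_hasCompactSupport hs.smul_right
  have hbox : ∀ x, box A (t, x) = fderiv ℝ (fderiv ℝ A) (t, x) (1, 0) (1, 0) -
      lapl (fun x ↦ A (t, x)) x := fun x ↦ by rw [box, hlap]
  have happ : ∀ x, app lam Z (rad ε Z) t x = A (t, x) := fun x ↦ rfl
  refine ⟨?_, ?_⟩
  · rw [weakBox, hp2]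
    simp only [hbox, happ, smul_add, smul_sub]
    have hI : ∫ x, lapl ψ x • A (t, x) = ∫ x, ψ x • lapl (fun x ↦ A (t, x)) x :=
      (integral_smul_lapl hslice hψ hs).symm
    have i2 : Integrable fun x ↦ ψ x • fderiv ℝ (fderiv ℝ A) (t, x) (1, 0) (1, 0) :=
      int (cs (k2 _))
    have i0 : Integrable fun x ↦ ψ x • A (t, x) := int (cs k0)
    have i3 : Integrable fun x ↦ ψ x • fderiv ℝ (fderiv ℝ A) (t, x) (1, 0) (1, 0) -
        ψ x • lapl (fun x ↦ A (t, x)) x := i2.sub (int hcl)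
    rw [hI, integral_add i3 i0, integral_sub i2 (int hcl)]
  · simp only [hbox, happ]
    exact ((cs (k2 _)).sub hcl).add (cs k0)

end

/-! ### Bounded functionals on test functions -/

/-- The bound makes `ℓ` factor through the range of `J`. The induced functional extends to all of
`H` by Hahn-Banach, without closedness of the range, and is then represented by Riesz. -/
theorem exists_riesz {V H : Type*} [AddCommGroup V] [Module ℝ V] [NormedAddCommGroup H]
    [InnerProductSpace ℝ H] [CompleteSpace H] (J : V →ₗ[ℝ] H) (ℓ : V →ₗ[ℝ] ℝ) {B : ℝ}
    (hB : 0 ≤ B) (h : ∀ v, |ℓ v| ≤ B * ‖J v‖) : ∃ g : H, ‖g‖ ≤ B ∧ ∀ v, ℓ v = inner ℝ g (J v) := by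
  obtain ⟨r, hr⟩ := J.rangeRestrict.exists_rightInverse_of_surjective J.range_rangeRestrict
  have hr' : ∀ y : LinearMap.range J, J (r y) = y := fun y ↦ by
    have := congrArg (fun T ↦ ((T y : LinearMap.range J) : H)) hr
    simpa using this
  have hf : ∀ y : LinearMap.range J, ‖(ℓ ∘ₗ r) y‖ ≤ B * ‖y‖ := fun y ↦ by
    have := h (r y)
    rw [hr' y] at this
    exact this
  obtain ⟨F, hF, hn⟩ := exists_extension_norm_eq (LinearMap.range J)
    ((ℓ ∘ₗ r).mkContinuous B hf)
  refine ⟨(InnerProductSpace.toDual ℝ H).symm F, ?_, fun v ↦ ?_⟩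
  · rw [LinearIsometryEquiv.norm_map, hn]
    exact LinearMap.mkContinuous_norm_le _ hB _
  · rw [InnerProductSpace.toDual_symm_apply]
    have h1 := hF ⟨J v, LinearMap.mem_range_self J v⟩
    -- The two arguments differ by an element of the kernel of `J`, on which the bound forces `ℓ` to
    -- vanish.
    have h2 : ℓ (r ⟨J v, LinearMap.mem_range_self J v⟩) = ℓ v := by
      have h3 := h (r ⟨J v, LinearMap.mem_range_self J v⟩ - v)
      rw [map_sub, map_sub, hr', sub_self, norm_zero, mul_zero] at h3
      exact sub_eq_zero.1 (abs_nonpos_iff.1 h3)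
    rw [← h2]
    exact h1.symm

/-- The space of test functions. -/
def testSpace : Submodule ℝ (Plane → ℝ) where
  carrier := {ψ | ContDiff ℝ ∞ ψ ∧ HasCompactSupport ψ}
  add_mem' h k := ⟨h.1.add k.1, h.2.add k.2⟩
  zero_mem' := ⟨contDiff_const, HasCompactSupport.zero⟩
  smul_mem' c _ h := ⟨contDiff_const.smul h.1, h.2.smul_left (f := fun _ ↦ c)⟩

theorem L2Bd.abs_integral_mul_le {e ψ : Plane → ℝ} {b : ℝ} (he : L2Bd e b)
    (hψ : MemLp ψ 2 volume) : |∫ x, ψ x * e x| ≤ b * (eLpNorm ψ 2 volume).toReal := by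
  have h : inner ℝ (he.memLp.toLp e) (hψ.toLp ψ) = ∫ x, ψ x * e x := by
    rw [L2.inner_def]
    refine integral_congr_ae ?_
    filter_upwards [he.memLp.coeFn_toLp, hψ.coeFn_toLp] with x h1 h2
    rw [h1, h2]
    rfl
  rw [← h]
  refine (abs_real_inner_le_norm _ _).trans ?_
  rw [Lp.norm_toLp, Lp.norm_toLp]
  gcongr
  exact ENNReal.toReal_le_of_le_ofReal he.1 he.2.2

/-- A limit of functionals with `L²` densities inherits linearity and the limit of their bounds, so
Riesz gives a density. No weakly convergent subsequence is extracted. -/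
theorem exists_density {ℓ : (Plane → ℝ) → ℝ} {e : ℕ → Plane → ℝ} {b : ℕ → ℝ} {B : ℝ}
    (he : ∀ k, L2Bd (e k) (b k)) (hb : Tendsto b atTop (𝓝 B))
    (hℓ : ∀ ψ : Plane → ℝ, ContDiff ℝ ∞ ψ → HasCompactSupport ψ →
      Tendsto (fun k ↦ ∫ x, ψ x * e k x) atTop (𝓝 (ℓ ψ))) :
    ∃ g : Plane → ℝ, L2Bd g B ∧ ∀ ψ : Plane → ℝ, ContDiff ℝ ∞ ψ → HasCompactSupport ψ →
      ℓ ψ = ∫ x, g x * ψ x := by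
  have hB : 0 ≤ B := ge_of_tendsto' hb fun k ↦ (he k).1
  have hm : ∀ ψ : testSpace, MemLp (ψ : Plane → ℝ) 2 volume := fun ψ ↦
    ψ.2.1.continuous.memLp_of_hasCompactSupport ψ.2.2
  have hint : ∀ (ψ : testSpace) k, Integrable fun x ↦ (ψ : Plane → ℝ) x * e k x := fun ψ k ↦
    (hm ψ).integrable_mul (he k).memLp
  let J : testSpace →ₗ[ℝ] Lp ℝ 2 (volume : Measure Plane) :=
    { toFun := fun ψ ↦ (hm ψ).toLp (ψ : Plane → ℝ)
      map_add' := fun ψ φ ↦ MemLp.toLp_add (hm ψ) (hm φ)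
      map_smul' := fun c ψ ↦ MemLp.toLp_const_smul c (hm ψ) }
  let L : testSpace →ₗ[ℝ] ℝ :=
    { toFun := fun ψ ↦ ℓ ψ
      map_add' := fun ψ φ ↦ by
        have h1 := (hℓ ψ ψ.2.1 ψ.2.2).add (hℓ φ φ.2.1 φ.2.2)
        refine tendsto_nhds_unique (hℓ _ (ψ + φ).2.1 (ψ + φ).2.2) (h1.congr fun k ↦ ?_)
        rw [← integral_add (hint ψ k) (hint φ k)]
        exact integral_congr_ae (ae_of_all _ fun x ↦ (add_mul _ _ _).symm)
      map_smul' := fun c ψ ↦ by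
        have h1 := (hℓ ψ ψ.2.1 ψ.2.2).const_mul c
        refine tendsto_nhds_unique (hℓ _ (c • ψ).2.1 (c • ψ).2.2) (h1.congr fun k ↦ ?_)
        rw [← integral_const_mul]
        exact integral_congr_ae (ae_of_all _ fun x ↦ (mul_assoc _ _ _).symm) }
  have hJ : ∀ ψ : testSpace, ‖J ψ‖ = (eLpNorm (ψ : Plane → ℝ) 2 volume).toReal := fun ψ ↦
    Lp.norm_toLp _ (hm ψ)
  obtain ⟨g, hg, h⟩ := exists_riesz J L hB fun ψ ↦ by
    rw [hJ]
    exact le_of_tendsto_of_tendsto' (hℓ ψ ψ.2.1 ψ.2.2).abs (hb.mul_const _) fun k ↦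
      (he k).abs_integral_mul_le (hm ψ)
  refine ⟨g, ⟨hB, (Lp.memLp g).1, ?_⟩, fun ψ h1 h2 ↦ ?_⟩
  · rw [← ENNReal.ofReal_toReal (Lp.memLp g).2.ne]
    exact ENNReal.ofReal_le_ofReal hg
  · have h3 := h ⟨ψ, h1, h2⟩
    rw [L2.inner_def] at h3
    refine h3.trans (integral_congr_ae ?_)
    filter_upwards [(hm ⟨ψ, h1, h2⟩).coeFn_toLp] with x hx
    have e1 : (J ⟨ψ, h1, h2⟩ : Plane → ℝ) x = ψ x := hx
    rw [e1]
    exact mul_comm _ _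

/-! ### The limit of the errors -/

/-- The sup bound on `Z` linearizes the polynomial, except for the square of the gradient term. That
square is kept, since the gradient is not bounded but only in `L⁴`. -/
theorem errBd_le {ε : ℝ} (hε : 0 < ε) (hε1 : ε ≤ 1) {Z : Plane → ℂ} {S : ℝ} {μ : Plane}
    (hS : ‖Z μ‖ ≤ S) : errBd ε Z μ ≤ (2 + S) ^ 3 * (‖Z μ‖ + ε + bracket μ * norm1 Z μ +
      bracket μ ^ 2 * norm2 Z μ) + (2 + S) ^ 2 * (bracket μ * norm1 Z μ) ^ 2 := by
  have hb := bracket_pos μ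
  have n1 : 0 ≤ bracket μ * norm1 Z μ := mul_nonneg hb.le (norm1_nonneg Z μ)
  have n2 : 0 ≤ bracket μ ^ 2 * norm2 Z μ := mul_nonneg (by positivity) (norm2_nonneg Z μ)
  have hr := rad_le hε.le Z μ
  have hr0 := rad_nonneg ε Z μ
  have hz := norm_nonneg (Z μ)
  have hS0 : 0 ≤ S := hz.trans hS
  rw [errBd, proBd]
  generalize bracket μ * norm1 Z μ = a at *
  generalize bracket μ ^ 2 * norm2 Z μ = b at *
  generalize rad ε Z μ = r at *
  generalize ‖Z μ‖ = z at *
  have h1 : (1 + r) ^ 2 ≤ (2 + S) ^ 2 := pow_le_pow_left₀ (by linarith) (by linarith) 2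
  have h2 : r ≤ S + 1 := by linarith
  have e1 : (1 + r) ^ 2 * (r ^ 2 + a ^ 2 + r * b) ≤
      (2 + S) ^ 2 * ((S + 1) * (z + ε) + a ^ 2 + (S + 1) * b) := by
    have : r ^ 2 ≤ (S + 1) * (z + ε) := by
      rw [sq]; exact mul_le_mul h2 hr hr0 (by linarith)
    gcongr
  have hX : 0 ≤ z + ε + a + b := by linarith
  have e2 : 1 ≤ (2 + S) ^ 2 := one_le_pow₀ (by linarith)
  have e3 := mul_le_mul_of_nonneg_right e2 hX
  have e4 : 0 ≤ (2 + S) ^ 2 * ((S + 1) * a) := by positivity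
  have e5 : (2 + S) ^ 3 * (z + ε + a + b) = (2 + S) ^ 2 * (z + ε + a + b) +
    (2 + S) ^ 2 * ((S + 1) * (z + ε) + (S + 1) * b) + (2 + S) ^ 2 * ((S + 1) * a) := by ring
  rw [e5]
  have e6 : (2 + S) ^ 2 * ((S + 1) * (z + ε) + a ^ 2 + (S + 1) * b) =
    (2 + S) ^ 2 * ((S + 1) * (z + ε) + (S + 1) * b) + (2 + S) ^ 2 * a ^ 2 := by ring
  linarith

theorem l2Bd_indicator_const {K : Set Plane} (hK : MeasurableSet K) {v : ℝ} (hv : 0 ≤ v)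
    (h : volume K ≤ ENNReal.ofReal v) {c : ℝ} (hc : 0 ≤ c) :
    L2Bd (K.indicator fun _ ↦ c) (c * √v) := by
  refine L2Bd.of_sq_le (by positivity) (measurable_const.indicator hK).aestronglyMeasurable ?_
  have e : ∀ x, ‖K.indicator (fun _ ↦ c) x‖ₑ ^ 2 = K.indicator (fun _ ↦ ENNReal.ofReal (c ^ 2)) x :=
    fun x ↦ by
      by_cases hx : x ∈ K
      · rw [Set.indicator_of_mem hx, Set.indicator_of_mem hx, Real.enorm_eq_ofReal hc,
          ENNReal.ofReal_pow hc]
      · rw [Set.indicator_of_notMem hx, Set.indicator_of_notMem hx]; simp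
  simp only [e]
  rw [lintegral_indicator hK, lintegral_const, Measure.restrict_apply_univ, mul_pow,
    Real.sq_sqrt hv, ENNReal.ofReal_mul (sq_nonneg c)]
  gcongr

/-- The value, gradient and Hessian contribute `M + M + CM ≤ 3CM`, and the squared gradient
contributes at most one more `CM` after `M ≤ 2 + CM` is used. The regularization contributes `ε`
times the square root of the area of the support. -/
theorem l2Bd_indicator_errBd {ε : ℝ} (hε : 0 < ε) (hε1 : ε ≤ 1) {Z : Plane → ℂ}
    (hZ : ContDiff ℝ ∞ Z) {C M v : ℝ} (hM : 0 ≤ M) (hC : 1 ≤ C) (hW : WBd 0 Z M)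
    (hS : ∀ x, ‖Z x‖ ≤ C * M)
    (h2 : L2Bd (fun x ↦ bracket x ^ 2 * norm2 Z x) (C * M))
    (h1 : L2Bd (fun x ↦ (bracket x * norm1 Z x) ^ 2) (C * M ^ 2)) (hv : 0 ≤ v)
    (hvol : volume (tsupport Z) ≤ ENNReal.ofReal v) :
    L2Bd ((tsupport Z).indicator (errBd ε Z)) ((2 + C * M) ^ 3 * (4 * (C * M) + ε * √v)) := by
  have hS0 : 0 ≤ C * M := by positivity
  have hMS : M ≤ C * M := le_mul_of_one_le_left hM hC
  have hK : MeasurableSet (tsupport Z) := (isClosed_tsupport Z).measurableSet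
  have b0 : L2Bd (fun x ↦ ‖Z x‖) M := by simpa using hW.zero
  have b1 : L2Bd (fun x ↦ bracket x * norm1 Z x) M := by simpa using hW.one
  have bi := l2Bd_indicator_const hK hv hvol hε.le
  have hb := (((b0.add bi).add b1).add h2).const_mul (c := (2 + C * M) ^ 3) (by positivity)
  have hb' := hb.add (h1.const_mul (c := (2 + C * M) ^ 2) (by positivity))
  have hcont : Continuous (errBd ε Z) := by
    have c0 := (contDiff_rad hε hZ).continuous
    have c1 := continuous_norm1 (hZ.of_le (by norm_cast) : ContDiff ℝ 1 Z)
    have c2 := continuous_norm2 (hZ.of_le two_le_infty)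
    have c3 := contDiff_bracket.continuous
    unfold errBd proBd
    fun_prop
  refine (hb'.mono (hcont.measurable.indicator hK).aestronglyMeasurable fun x ↦ ?_).le ?_
  · have n1 := norm1_nonneg Z x
    have n2 := norm2_nonneg Z x
    have nb := bracket_pos x
    by_cases hx : x ∈ tsupport Z
    · rw [Set.indicator_of_mem hx, Set.indicator_of_mem hx, Real.norm_eq_abs,
        abs_of_nonneg (errBd_nonneg ε Z x)]
      exact errBd_le hε hε1 (hS x)
    · rw [Set.indicator_of_notMem hx, Set.indicator_of_notMem hx, norm_zero]
      positivity
  · have e1 : (2 + C * M) ^ 2 * (C * M ^ 2) ≤ (2 + C * M) ^ 2 * ((2 + C * M) * (C * M)) := by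
      refine mul_le_mul_of_nonneg_left ?_ (by positivity)
      calc C * M ^ 2 = M * (C * M) := by ring
        _ ≤ _ := mul_le_mul_of_nonneg_right (by linarith) hS0
    have e2 : (2 + C * M) ^ 2 * ((2 + C * M) * (C * M)) = (2 + C * M) ^ 3 * (C * M) := by ring
    have e3 : (2 + C * M) ^ 3 * (M + ε * √v + M + C * M) ≤
        (2 + C * M) ^ 3 * (3 * (C * M) + ε * √v) :=
      mul_le_mul_of_nonneg_left (by linarith) (by positivity)
    have e4 : (2 + C * M) ^ 3 * (4 * (C * M) + ε * √v) =
      (2 + C * M) ^ 3 * (3 * (C * M) + ε * √v) + (2 + C * M) ^ 3 * (C * M) := by ring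
    linarith

/-- The Jacobian `t²⟨μ⟩⁻⁴` cancels the square of the factor `⟨μ⟩²` in `errFun` exactly and improves
`t⁻³` to `t · t⁻³ = t⁻²`. -/
theorem l2Bd_spread_errFun (lam : ℝ) {ε : ℝ} {Z : Plane → ℂ} {t N : ℝ} (ht : 0 < t)
    (h : L2Bd ((tsupport Z).indicator (errBd ε Z)) N) :
    L2Bd (spread t fun μ ↦ (errFun lam ε Z t μ : ℂ))
      (errConst lam * Real.log t ^ 2 * (t ^ 2)⁻¹ * N) := by
  have hc : 0 ≤ errConst lam * Real.log t ^ 2 * (t ^ 3)⁻¹ := by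
    have := errConst_nonneg lam
    positivity
  have hc2 : errConst lam * Real.log t ^ 2 * (t ^ 2)⁻¹ =
      t * (errConst lam * Real.log t ^ 2 * (t ^ 3)⁻¹) := by field_simp
  have hm : AEMeasurable (fun μ ↦ (errFun lam ε Z t μ : ℂ)) volume := by
    have h1 := h.2.1.aemeasurable
    have h2 : Measurable bracket := contDiff_bracket.continuous.measurable
    unfold errFun
    fun_prop
  have hg := (h.const_mul hc).const_mul ht.le
  rw [hc2, mul_assoc t]
  refine L2Bd.of_sq_le hg.1 (aemeasurable_spread ht hm).aestronglyMeasurable ?_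
  rw [lintegral_spread_sq ht]
  refine le_trans (lintegral_mono fun μ ↦ le_of_eq ?_) hg.lintegral_sq_le
  have hb := bracket_pos μ
  have hi : 0 ≤ (tsupport Z).indicator (errBd ε Z) μ :=
    Set.indicator_nonneg (fun μ _ ↦ errBd_nonneg ε Z μ) μ
  have e1 : ‖(errFun lam ε Z t μ : ℂ)‖ₑ = ENNReal.ofReal (errFun lam ε Z t μ) := by
    rw [← Real.enorm_eq_ofReal (errFun_nonneg lam ε Z ht μ)]
    exact enorm_eq_iff_norm_eq.2 (by rw [Complex.norm_real])
  rw [e1, Real.enorm_eq_ofReal (by positivity), ← ENNReal.ofReal_pow (errFun_nonneg lam ε Z ht μ),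
    ← ENNReal.ofReal_pow (by positivity), ← ENNReal.ofReal_mul (by positivity), errFun]
  congr 1
  field_simp

/-! ### Passage to the limit -/

theorem norm_lead_le (lam s m : ℝ) {ζ : ℂ} {r : ℝ} (h : ‖ζ‖ ≤ r) :
    ‖lead lam s ζ r m‖ ≤ |lam| * r ^ 2 * (s ^ 2)⁻¹ * (8 / (3 * Real.pi) + 2 * coeffSum) := by
  have hπ := Real.pi_pos
  have k0 := norm_har_le lam (j := 0) (by norm_num) s m h
  have k2 := norm_har_le lam (j := 2) le_rfl s m h
  have k := norm_mul_osc_div_le_one lam s m h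
  rw [lead, norm_mul, Complex.norm_real, Real.norm_eq_abs, abs_mul, abs_mul,
    abs_of_nonneg (sq_nonneg r), abs_of_nonneg (by positivity : 0 ≤ (s ^ 2)⁻¹)]
  refine mul_le_mul_of_nonneg_left ?_ (by positivity)
  refine (norm_sub_le _ _).trans ((add_le_add ((norm_add_le _ _).trans (add_le_add
    (le_of_eq (norm_mul _ _)) k0)) k2).trans ?_)
  rw [Complex.norm_real, Real.norm_eq_abs, abs_of_pos (by positivity)]
  have := mul_le_mul_of_nonneg_left k (by positivity : 0 ≤ 8 / (3 * Real.pi))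
  linarith

section

variable {lam S t : ℝ} {Z : Plane → ℂ} {R : Plane → ℝ} {ψ : Plane → ℝ}

theorem IsAmplitude.aemeasurable (h : IsAmplitude Z R S) (lam s : ℝ) :
    AEMeasurable (fun μ ↦ pro lam s (Z μ) (R μ) (bracket μ)) volume ∧
    AEMeasurable (fun μ ↦ lead lam s (Z μ) (R μ) (bracket μ)) volume := by
  have := aemeasurable_pro lam s h.meas h.meas_modulus
    contDiff_bracket.continuous.measurable.aemeasurable h.norm_le
  exact ⟨this.1, this.2.2.2⟩

theorem exists_app_bound (lam : ℝ) (hS : 0 ≤ S) : ∃ B : ℝ, 0 ≤ B ∧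
    ∀ {Z : Plane → ℂ} {R : Plane → ℝ} {t : ℝ}, IsAmplitude Z R S → 1 ≤ t →
      (∀ᵐ x, ‖app lam Z R t x‖ ≤ B) ∧
      ∀ᵐ x, ‖spread t (fun μ ↦ lead lam t (Z μ) (R μ) (bracket μ)) x‖ ≤ B := by
  obtain ⟨B, hB⟩ := exists_pro_bound lam hS
  have hπ := Real.pi_pos
  have hC := coeffSum_nonneg
  have h0 : 0 ≤ |lam| * S ^ 2 * (8 / (3 * Real.pi) + 2 * coeffSum) := by positivity
  refine ⟨|B| + |lam| * S ^ 2 * (8 / (3 * Real.pi) + 2 * coeffSum), by positivity,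
    fun {Z R t} h ht ↦ ⟨?_, ?_⟩⟩
  · refine norm_spread_le (by linarith) (by positivity) ?_
    filter_upwards [h.le] with μ hμ
    have := (hB t _ _ _ ht (h.norm_le μ) hμ (one_le_bracket μ)).1
    linarith [le_abs_self B]
  · refine norm_spread_le (by linarith) (by positivity) ?_
    filter_upwards [h.le] with μ hμ
    refine (norm_lead_le lam t _ (h.norm_le μ)).trans ?_
    have hr := (norm_nonneg _).trans (h.norm_le μ)
    have hti : (t ^ 2)⁻¹ ≤ 1 := inv_le_one_of_one_le₀ (one_le_pow₀ ht)
    calc _ ≤ |lam| * S ^ 2 * 1 * (8 / (3 * Real.pi) + 2 * coeffSum) := by gcongr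
      _ ≤ _ := by rw [mul_one]; linarith [abs_nonneg B]

theorem hasCompactSupport_lapl {ψ : Plane → ℝ} (hs : HasCompactSupport ψ) :
    HasCompactSupport (lapl ψ) := HasCompactSupport.intro hs.isCompact fun x hx ↦ by
  have h : fderiv ℝ (fderiv ℝ ψ) x = 0 := image_eq_zero_of_notMem_tsupport fun h ↦
    hx (tsupport_fderiv_subset ℝ (tsupport_fderiv_subset ℝ h))
  simp [lapl, h]

theorem tendsto_weakBox (lam : ℝ) {Zs : ℕ → Plane → ℂ} {Rs : ℕ → Plane → ℝ}
    (hk : ∀ k, IsAmplitude (Zs k) (Rs k) S)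
    (hZ : ∀ᵐ μ, Tendsto (fun k ↦ Zs k μ) atTop (𝓝 (Z μ)))
    (hR : ∀ᵐ μ, Tendsto (fun k ↦ Rs k μ) atTop (𝓝 (R μ))) (hψ : ContDiff ℝ ∞ ψ)
    (hs : HasCompactSupport ψ) (ht : 1 ≤ t) :
    Tendsto (fun k ↦ weakBox lam (Zs k) (Rs k) ψ t -
      ∫ x, ψ x • spread t (fun μ ↦ lead lam t (Zs k μ) (Rs k μ) (bracket μ)) x) atTop
      (𝓝 (weakBox lam Z R ψ t -
        ∫ x, ψ x • spread t (fun μ ↦ lead lam t (Z μ) (R μ) (bracket μ)) x)) := by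
  have ht0 : 0 < t := by linarith
  obtain ⟨B, -, hB⟩ := exists_app_bound lam (hk 0).nonneg
  have hlap := hasCompactSupport_lapl hs
  have hpro : ∀ᵐ μ, Tendsto (fun k ↦ pro lam t (Zs k μ) (Rs k μ) (bracket μ)) atTop
      (𝓝 (pro lam t (Z μ) (R μ) (bracket μ))) := by
    filter_upwards [hZ, hR] with μ h1 h2
    exact (tendsto_pro lam t h1 h2 (fun k ↦ (hk k).norm_le μ) _).1
  have hlead : ∀ᵐ μ, Tendsto (fun k ↦ lead lam t (Zs k μ) (Rs k μ) (bracket μ)) atTop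
      (𝓝 (lead lam t (Z μ) (R μ) (bracket μ))) := by
    filter_upwards [hZ, hR] with μ h1 h2
    exact (tendsto_pro lam t h1 h2 (fun k ↦ (hk k).norm_le μ) _).2.2.2
  have ha : ∀ {φ : Plane → ℝ}, Continuous φ → HasCompactSupport φ →
      Tendsto (fun k ↦ ∫ x, φ x • app lam (Zs k) (Rs k) t x) atTop
        (𝓝 (∫ x, φ x • app lam Z R t x)) := fun hφ hsφ ↦
    tendsto_integral_smul_of_bound
      (fun k ↦ aemeasurable_spread ht0 ((hk k).aemeasurable lam t).1)
      (fun k ↦ (hB (hk k) ht).1) (tendsto_spread ht0 hpro) hφ hsφ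
  exact (((tendsto_pairing₂ lam hk hZ hR hψ hs ht).sub (ha (continuous_lapl hψ) hlap)).add
    (ha hψ.continuous hs)).sub (tendsto_integral_smul_of_bound
      (fun k ↦ aemeasurable_spread ht0 ((hk k).aemeasurable lam t).2)
      (fun k ↦ (hB (hk k) ht).2) (tendsto_spread ht0 hlead) hψ.continuous hs)

end

theorem tendsto_rad {F : ℕ → Plane → ℂ} {Z : Plane → ℂ} {ε : ℕ → ℝ} (hε : Tendsto ε atTop (𝓝 0))
    {μ : Plane} (h : Tendsto (fun k ↦ F k μ) atTop (𝓝 (Z μ))) :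
    Tendsto (fun k ↦ rad (ε k) (F k) μ) atTop (𝓝 ‖Z μ‖) := by
  have h1 := (((h.norm.pow 2).add (hε.pow 2))).sqrt
  simpa [rad] using h1

/-- The supports of the approximations may grow without control, so `ε k` is chosen small against
their area: `((k + 1)(1 + v k))⁻¹` works. -/
theorem exists_regularization (v : ℕ → ℝ) (hv : ∀ k, 0 ≤ v k) : ∃ ε : ℕ → ℝ, (∀ k, 0 < ε k) ∧
    (∀ k, ε k ≤ 1) ∧ Tendsto ε atTop (𝓝 0) ∧ Tendsto (fun k ↦ ε k * √(v k)) atTop (𝓝 0) := by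
  have h0 : Tendsto (fun k : ℕ ↦ ((k : ℝ) + 1)⁻¹) atTop (𝓝 0) := by
    simpa using tendsto_one_div_add_atTop_nhds_zero_nat (𝕜 := ℝ)
  have hp : ∀ k, 0 < 1 + v k := fun k ↦ by linarith [hv k]
  have hp1 : ∀ k, (1 + v k)⁻¹ ≤ 1 := fun k ↦ inv_le_one_of_one_le₀ (by linarith [hv k])
  have hsq : ∀ k, (1 + v k)⁻¹ * √(v k) ≤ 1 := fun k ↦ by
    rw [inv_mul_le_iff₀ (hp k), mul_one, Real.sqrt_le_left (hp k).le]
    nlinarith [hv k]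
  refine ⟨fun k ↦ ((k : ℝ) + 1)⁻¹ * (1 + v k)⁻¹, fun k ↦ by have := hp k; positivity, fun k ↦ ?_,
    ?_, ?_⟩
  · have : ((k : ℝ) + 1)⁻¹ ≤ 1 := inv_le_one_of_one_le₀ (by linarith [k.cast_nonneg (α := ℝ)])
    exact mul_le_one₀ this (inv_nonneg.2 (hp k).le) (hp1 k)
  · refine squeeze_zero (fun k ↦ by have := hp k; positivity) (fun k ↦ ?_) h0
    exact mul_le_of_le_one_right (by positivity) (hp1 k)
  · refine squeeze_zero (fun k ↦ by have := hp k; positivity) (fun k ↦ ?_) h0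
    rw [mul_assoc]
    exact mul_le_of_le_one_right (by positivity) (hsq k)

/-- For each approximation the error is classical and bounded in `L²`. The weak expression converges
as the approximation and `ε` go to their limits, and the contribution of `ε` disappears from the
bound. -/
theorem exists_error_density (lam : ℝ) {C M : ℝ} (hC : 1 ≤ C) (hM : 0 ≤ M) {F : ℕ → Plane → ℂ}
    {Z : Plane → ℂ} (hF : ∀ k, ContDiff ℝ ∞ (F k)) (hs : ∀ k, HasCompactSupport (F k))
    (hW : ∀ k, WBd 0 (F k) M) (hsup : ∀ k x, ‖F k x‖ ≤ C * M)
    (h2 : ∀ k, L2Bd (fun x ↦ bracket x ^ 2 * norm2 (F k) x) (C * M))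
    (h1 : ∀ k, L2Bd (fun x ↦ (bracket x * norm1 (F k) x) ^ 2) (C * M ^ 2))
    (hlim : ∀ᵐ μ, Tendsto (fun k ↦ F k μ) atTop (𝓝 (Z μ))) {t : ℝ} (ht : Real.exp 1 ≤ t) :
    ∃ g : Plane → ℝ, L2Bd g (errConst lam * Real.log t ^ 2 * (t ^ 2)⁻¹ *
        ((2 + C * M) ^ 3 * (4 * (C * M)))) ∧
      ∀ ψ : Plane → ℝ, ContDiff ℝ ∞ ψ → HasCompactSupport ψ →
        (weakBox lam Z (fun μ ↦ ‖Z μ‖) ψ t -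
          ∫ x, ψ x • spread t (fun μ ↦ lead lam t (Z μ) ‖Z μ‖ (bracket μ)) x).re =
          ∫ x, g x * ψ x := by
  have ht1 : 1 < t := by
    have := Real.add_one_le_exp (1 : ℝ); linarith
  have ht0 : 0 < t := by linarith
  have hfin : ∀ k, volume (tsupport (F k)) ≠ ⊤ := fun k ↦ (hs k).isCompact.measure_lt_top.ne
  obtain ⟨ε, e0, e1, e2, e3⟩ := exists_regularization
    (fun k ↦ (volume (tsupport (F k))).toReal) fun k ↦ ENNReal.toReal_nonneg
  have hamp : ∀ k, IsAmplitude (F k) (rad (ε k) (F k)) (C * M + 1) := fun k ↦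
    isAmplitude_rad (e0 k) (hF k) fun x ↦ add_le_add (hsup k x) (e1 k)
  have hind := fun k ↦ l2Bd_indicator_errBd (e0 k) (e1 k) (hF k) hM hC (hW k) (hsup k) (h2 k) (h1 k)
    ENNReal.toReal_nonneg (ENNReal.ofReal_toReal (hfin k)).ge
  set E : ℕ → Plane → ℂ := fun k x ↦ box (appST lam (ε k) (F k)) (t, x) +
    app lam (F k) (rad (ε k) (F k)) t x -
    spread t (fun μ ↦ lead lam t (F k μ) (rad (ε k) (F k) μ) (bracket μ)) x with hE
  -- Only the continuity statement of `weakBox_eq` is wanted, so the zero test function serves.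
  have hcont : ∀ k, Continuous fun x ↦ box (appST lam (ε k) (F k)) (t, x) +
      app lam (F k) (rad (ε k) (F k)) t x := fun k ↦
    (weakBox_eq (ψ := fun _ ↦ 0) lam (e0 k) (hF k) (hs k) contDiff_const
      HasCompactSupport.zero ht1).2
  have hEm : ∀ k, AEStronglyMeasurable (E k) volume := fun k ↦
    (hcont k).aestronglyMeasurable.sub
      (aemeasurable_spread ht0 ((hamp k).aemeasurable lam t).2).aestronglyMeasurable
  have hre : ∀ k, L2Bd (fun x ↦ (E k x).re) (errConst lam * Real.log t ^ 2 * (t ^ 2)⁻¹ *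
      ((2 + C * M) ^ 3 * (4 * (C * M) + ε k * √((volume (tsupport (F k))).toReal)))) := fun k ↦ by
    refine (l2Bd_spread_errFun lam ht0 (hind k)).mono_ae
      (Complex.continuous_re.comp_aestronglyMeasurable (hEm k)) (ae_of_all _ fun x ↦ ?_)
    exact (Complex.abs_re_le_norm _).trans (norm_box_appST_le lam (e0 k) (hF k) (hs k) ht x)
  have hlimB : Tendsto (fun k ↦ errConst lam * Real.log t ^ 2 * (t ^ 2)⁻¹ *
      ((2 + C * M) ^ 3 * (4 * (C * M) + ε k * √((volume (tsupport (F k))).toReal)))) atTop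
      (𝓝 (errConst lam * Real.log t ^ 2 * (t ^ 2)⁻¹ * ((2 + C * M) ^ 3 * (4 * (C * M))))) := by
    have := ((e3.const_add (4 * (C * M))).const_mul ((2 + C * M) ^ 3)).const_mul
      (errConst lam * Real.log t ^ 2 * (t ^ 2)⁻¹)
    simpa using this
  have hR : ∀ᵐ μ, Tendsto (fun k ↦ rad (ε k) (F k) μ) atTop (𝓝 ‖Z μ‖) := by
    filter_upwards [hlim] with μ hμ using tendsto_rad e2 hμ
  refine exists_density hre hlimB fun ψ hψ hsψ ↦ ?_
  have h := (Complex.continuous_re.tendsto _).comp (tendsto_weakBox lam hamp hlim hR hψ hsψ ht1.le)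
  refine h.congr fun k ↦ ?_
  obtain ⟨B, -, hB⟩ := exists_app_bound lam (hamp k).nonneg
  have i1 : Integrable fun x ↦ ψ x • (box (appST lam (ε k) (F k)) (t, x) +
      app lam (F k) (rad (ε k) (F k)) t x) :=
    (hψ.continuous.smul (hcont k)).integrable_of_hasCompactSupport hsψ.smul_right
  have i2 := integrable_smul_of_bound
    (aemeasurable_spread ht0 ((hamp k).aemeasurable lam t).2) (hB (hamp k) ht1.le).2
    hψ.continuous hsψ
  rw [Function.comp_apply, (weakBox_eq lam (e0 k) (hF k) (hs k) hψ hsψ ht1).1,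
    ← integral_sub i1 i2]
  have hi : Integrable fun x ↦ ψ x • E k x := by
    refine (i1.sub i2).congr (ae_of_all _ fun x ↦ ?_)
    simp only [hE, Pi.sub_apply, smul_sub]
  have hre2 : (∫ x, (ψ x • E k x).re) = (∫ x, ψ x • E k x).re := integral_re hi
  refine Eq.trans ?_ (hre2.symm.trans (integral_congr_ae (ae_of_all _ fun x ↦ ?_)))
  · simp only [hE, smul_sub]
  · simp only [Complex.smul_re, smul_eq_mul]

/-! ### The approximate solution as a real part -/

theorem norm_amp (φ₀ φ₁ : 𝓢'(Plane, ℂ)) (μ : Plane) : ‖amp φ₀ φ₁ μ‖ =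
    bracket μ ^ 2 * ‖hat φ₀ μ + Complex.I * ((bracket μ : ℝ) : ℂ)⁻¹ * hat φ₁ μ‖ := by
  have hb : (bracket μ : ℂ) ≠ 0 := by exact_mod_cast (bracket_pos μ).ne'
  have e : amp φ₀ φ₁ μ = Complex.I * ((bracket μ ^ 2 : ℝ) : ℂ) *
      (hat φ₀ μ + Complex.I * ((bracket μ : ℝ) : ℂ)⁻¹ * hat φ₁ μ) := by
    rw [amp_eq, Complex.real_smul, Complex.real_smul]
    push_cast
    linear_combination (norm := (field_simp; ring)) -((bracket μ : ℂ) * hat φ₁ μ) * Complex.I_sq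
  rw [e, norm_mul, norm_mul, Complex.norm_I, one_mul, Complex.norm_real,
    Real.norm_of_nonneg (sq_nonneg _)]

/-- By `norm_amp`, `Ψ = c |Z|/⟨μ⟩`: the phase depends on the data through the modulus of the
amplitude only. -/
theorem alpha_eq_phase (lam : ℝ) (φ₀ φ₁ : 𝓢'(Plane, ℂ)) (t : ℝ) (μ : Plane) :
    alpha lam φ₀ φ₁ t μ = phase lam t ‖amp φ₀ φ₁ μ‖ (bracket μ) := by
  have hb := (bracket_pos μ).ne'
  rw [alpha, phase, Psi, norm_amp, phaseCoeff]
  generalize ‖hat φ₀ μ + Complex.I * ((bracket μ : ℝ) : ℂ)⁻¹ * hat φ₁ μ‖ = n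
  generalize -(4 * lam / (3 * Real.pi)) = c
  field_simp

theorem re_mul_exp_neg_I (ζ : ℂ) (θ : ℝ) :
    (ζ * Complex.exp (-Complex.I * θ)).re = ζ.re * Real.cos θ + ζ.im * Real.sin θ := by
  have e : Complex.exp (-Complex.I * θ) = Complex.exp (((-θ : ℝ) : ℂ) * Complex.I) := by
    congr 1; push_cast; ring
  rw [Complex.mul_re, e, Complex.exp_ofReal_mul_I_re, Complex.exp_ofReal_mul_I_im, Real.cos_neg,
    Real.sin_neg]
  ring

theorem summable_abs_coeff : Summable fun n : ℕ ↦ |coeff n| :=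
  Summable.of_nonneg_of_le (fun n ↦ abs_nonneg _)
    (fun n ↦ by simpa using pow_mul_coeff_le (j := 0) (by norm_num) n) summable_sq_mul_coeff

theorem re_kk_exp (θ : ℝ) :
    (kk 0 (Complex.exp (-Complex.I * θ))).re = ∑' n : ℕ, coeff n * Real.cos (n * θ) := by
  have hs := summable_kk (j := 0) (by norm_num) (norm_exp_neg_I_mul θ).le
  rw [kk, Complex.re_tsum hs]
  refine tsum_congr fun n ↦ ?_
  rw [← Complex.exp_nat_mul, Complex.re_ofReal_mul]
  have e : (n : ℂ) * (-Complex.I * θ) = ((-(n * θ) : ℝ) : ℂ) * Complex.I := by push_cast; ring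
  rw [e, Complex.exp_ofReal_mul_I_re, Real.cos_neg, pow_zero, one_mul]

/-- Addition theorem `cos nβ cos nα + sin nβ sin nα = cos n(α - β)`. The terms `n = 0, 1` missing on
the left have zero coefficients. -/
theorem tsum_harmonics (A α β : ℝ) :
    (∑' k : ℕ, coeff (k + 2) * A * Real.cos ((k + 2 : ℕ) * β) * Real.cos ((k + 2 : ℕ) * α)) +
      (∑' k : ℕ, coeff (k + 2) * A * Real.sin ((k + 2 : ℕ) * β) * Real.sin ((k + 2 : ℕ) * α)) =
      A * (kk 0 (Complex.exp (-Complex.I * (α - β : ℝ)))).re := by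
  have hs := summable_abs_coeff
  have hsum : ∀ f : ℕ → ℝ, (∀ n, |f n| ≤ 1) → Summable fun n ↦ coeff n * A * f n := fun f hf ↦ by
    refine Summable.of_norm_bounded (hs.mul_right |A|) fun n ↦ ?_
    rw [Real.norm_eq_abs, abs_mul, abs_mul]
    exact mul_le_of_le_one_right (by positivity) (hf n)
  have hc := (summable_nat_add_iff 2).2 (hsum
    (fun n ↦ Real.cos (n * β) * Real.cos (n * α)) fun n ↦ by
      rw [abs_mul]
      exact mul_le_one₀ (Real.abs_cos_le_one _) (abs_nonneg _) (Real.abs_cos_le_one _))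
  have hd := (summable_nat_add_iff 2).2 (hsum
    (fun n ↦ Real.sin (n * β) * Real.sin (n * α)) fun n ↦ by
      rw [abs_mul]
      exact mul_le_one₀ (Real.abs_sin_le_one _) (abs_nonneg _) (Real.abs_sin_le_one _))
  have he := hsum (fun n ↦ Real.cos (n * (α - β))) fun n ↦ Real.abs_cos_le_one _
  have e : A * (kk 0 (Complex.exp (-Complex.I * (α - β : ℝ)))).re =
      ∑' n : ℕ, coeff n * A * Real.cos (n * (α - β)) := by
    rw [re_kk_exp, ← tsum_mul_left]
    exact tsum_congr fun n ↦ by ring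
  rw [e, ← he.sum_add_tsum_nat_add 2, Finset.sum_range_succ, Finset.sum_range_succ,
    Finset.sum_range_zero, coeff_zero, coeff_one]
  simp only [mul_assoc] at hc hd ⊢
  rw [← hc.tsum_add hd]
  simp only [zero_mul, add_zero, zero_add]
  refine tsum_congr fun k ↦ ?_
  rw [mul_sub, Real.cos_sub]
  ring

/-- `β` and the argument of the amplitude differ by a multiple of `2π`, so the choice of the branch
is immaterial. -/
theorem norm_mul_exp_beta (φ₀ φ₁ : 𝓢'(Plane, ℂ)) (μ : Plane) :
    (‖amp φ₀ φ₁ μ‖ : ℂ) * Complex.exp (beta φ₀ φ₁ μ * Complex.I) = amp φ₀ φ₁ μ := by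
  have e : Complex.exp (beta φ₀ φ₁ μ * Complex.I) =
      Complex.exp (Complex.arg (amp φ₀ φ₁ μ) * Complex.I) := by
    refine Complex.exp_eq_exp_iff_exists_int.2
      ⟨-toIocDiv Real.two_pi_pos 0 (Complex.arg (amp φ₀ φ₁ μ)), ?_⟩
    have : beta φ₀ φ₁ μ = Complex.arg (amp φ₀ φ₁ μ) -
      toIocDiv Real.two_pi_pos 0 (Complex.arg (amp φ₀ φ₁ μ)) • (2 * Real.pi) := rfl
    rw [this, zsmul_eq_mul]
    push_cast
    ring
  rw [e, Complex.norm_mul_exp_arg_mul_I]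

theorem uap_eq (lam : ℝ) (φ₀ φ₁ : 𝓢'(Plane, ℂ)) (t : ℝ) (x : Plane) : uap lam φ₀ φ₁ t x =
    (spread t (fun μ ↦ ((t⁻¹ : ℝ) : ℂ) *
      (amp φ₀ φ₁ μ * osc lam t ‖amp φ₀ φ₁ μ‖ (bracket μ))) x).re := by
  by_cases hx : x ∈ Metric.ball (0 : Plane) t
  · rw [uap, spread, Set.indicator_of_mem hx, Set.indicator_of_mem hx, Complex.re_ofReal_mul, osc,
      re_mul_exp_neg_I, ← alpha_eq_phase, amp]
    ring
  · rw [uap, spread, Set.indicator_of_notMem hx, Set.indicator_of_notMem hx, Complex.zero_re]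

theorem vap_eq (lam : ℝ) (φ₀ φ₁ : 𝓢'(Plane, ℂ)) (t : ℝ) (x : Plane) : vap lam φ₀ φ₁ t x =
    (spread t (fun μ ↦ ((lam * (t ^ 2)⁻¹ * ‖amp φ₀ φ₁ μ‖ ^ 2 : ℝ) : ℂ) *
      kk 0 (amp φ₀ φ₁ μ * osc lam t ‖amp φ₀ φ₁ μ‖ (bracket μ) / ‖amp φ₀ φ₁ μ‖)) x).re := by
  by_cases hx : x ∈ Metric.ball (0 : Plane) t
  · rw [vap, spread, Set.indicator_of_mem hx, Set.indicator_of_mem hx]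
    generalize mu t x = μ
    have hsq : P₁ φ₀ φ₁ μ ^ 2 + Q₁ φ₀ φ₁ μ ^ 2 = ‖amp φ₀ φ₁ μ‖ ^ 2 := by
      rw [← Complex.normSq_eq_norm_sq, Complex.normSq_apply, amp]; ring
    have hP : ∀ n, P lam φ₀ φ₁ n μ = coeff n * (lam * ‖amp φ₀ φ₁ μ‖ ^ 2) *
        Real.cos (n * beta φ₀ φ₁ μ) := fun n ↦ by rw [P, hsq, mul_assoc (coeff n)]
    have hQ : ∀ n, Q lam φ₀ φ₁ n μ = coeff n * (lam * ‖amp φ₀ φ₁ μ‖ ^ 2) *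
        Real.sin (n * beta φ₀ φ₁ μ) := fun n ↦ by rw [Q, hsq, mul_assoc (coeff n)]
    simp only [hP, hQ]
    rw [← mul_add, tsum_harmonics, Complex.re_ofReal_mul]
    -- Where the amplitude vanishes, `β` has no meaning, but the factor `|Z|²` makes both sides
    -- zero. Elsewhere `Z e^{-iα}/|Z| = e^{-i(α - β)}`.
    rcases eq_or_ne (amp φ₀ φ₁ μ) 0 with h0 | h0
    · simp [h0]
    · have h1 : (‖amp φ₀ φ₁ μ‖ : ℂ) ≠ 0 := by exact_mod_cast norm_ne_zero_iff.2 h0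
      have e : amp φ₀ φ₁ μ * osc lam t ‖amp φ₀ φ₁ μ‖ (bracket μ) / ‖amp φ₀ φ₁ μ‖ =
          Complex.exp (-Complex.I * (alpha lam φ₀ φ₁ t μ - beta φ₀ φ₁ μ : ℝ)) := by
        have e1 : Complex.exp (-Complex.I * (alpha lam φ₀ φ₁ t μ - beta φ₀ φ₁ μ : ℝ)) =
            Complex.exp (beta φ₀ φ₁ μ * Complex.I) * osc lam t ‖amp φ₀ φ₁ μ‖ (bracket μ) := by
          rw [osc, ← alpha_eq_phase, ← Complex.exp_add]
          congr 1
          push_cast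
          ring
        rw [e1, div_eq_iff h1]
        nth_rewrite 1 [← norm_mul_exp_beta φ₀ φ₁ μ]
        ring
      rw [e]
      ring
  · rw [vap, spread, Set.indicator_of_notMem hx, Set.indicator_of_notMem hx, Complex.zero_re]

theorem spread_add (s : ℝ) (f g : Plane → ℂ) (x : Plane) :
    spread s (fun μ ↦ f μ + g μ) x = spread s f x + spread s g x := by
  by_cases hx : x ∈ Metric.ball (0 : Plane) s
  · simp only [spread, Set.indicator_of_mem hx]
  · simp only [spread, Set.indicator_of_notMem hx, add_zero]

theorem approx_eq (lam : ℝ) (φ₀ φ₁ : 𝓢'(Plane, ℂ)) (t : ℝ) (x : Plane) : approx lam φ₀ φ₁ t x =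
    (app lam (amp φ₀ φ₁) (fun μ ↦ ‖amp φ₀ φ₁ μ‖) t x).re := by
  rw [approx, uap_eq, vap_eq, ← Complex.add_re, ← spread_add]
  rfl

/-! ### The nonlinearity -/

/-- With the true modulus the argument of the series has modulus one, say `e^{-iθ}`, and `lead`
becomes the complete Fourier series of `|cos θ| cos θ`. So the resonant part is exactly `N(u_ap)`,
with no remainder. -/
theorem re_lead (lam : ℝ) {s : ℝ} (hs : 0 < s) (ζ : ℂ) (m : ℝ) :
    (lead lam s ζ ‖ζ‖ m).re = nonlin lam (s⁻¹ * (ζ * osc lam s ‖ζ‖ m).re) := by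
  rcases eq_or_ne ζ 0 with h0 | h0
  · rw [h0, lead_zero]; simp [nonlin]
  · have h1 : (‖ζ‖ : ℂ) ≠ 0 := by exact_mod_cast norm_ne_zero_iff.2 h0
    have hn : 0 < ‖ζ‖ := norm_pos_iff.2 h0
    have hw : ‖ζ * osc lam s ‖ζ‖ m / ‖ζ‖‖ = 1 := by
      rw [norm_div, norm_mul, norm_osc, Complex.norm_real, norm_norm, mul_one, div_self hn.ne']
    obtain ⟨θ, hθ⟩ : ∃ θ : ℝ, ζ * osc lam s ‖ζ‖ m / ‖ζ‖ = Complex.exp (-Complex.I * θ) := by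
      refine ⟨-Complex.arg (ζ * osc lam s ‖ζ‖ m / ‖ζ‖), ?_⟩
      have := Complex.norm_mul_exp_arg_mul_I (ζ * osc lam s ‖ζ‖ m / ‖ζ‖)
      rw [hw, Complex.ofReal_one, one_mul] at this
      rw [← this]
      congr 1
      rw [this]
      push_cast
      ring
    have hz : (ζ * osc lam s ‖ζ‖ m).re = ‖ζ‖ * Real.cos θ := by
      have : ζ * osc lam s ‖ζ‖ m = (‖ζ‖ : ℂ) * Complex.exp (-Complex.I * θ) := by
        rw [← hθ, mul_div_cancel₀ _ h1]
      have h2 := re_mul_exp_neg_I 1 θ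
      rw [one_mul] at h2
      rw [this, Complex.re_ofReal_mul, h2]
      simp
    have h2 := re_mul_exp_neg_I 1 θ
    rw [one_mul, Complex.one_re, Complex.one_im, zero_mul, add_zero, one_mul] at h2
    rw [hz, lead, har, har, hθ, Complex.re_ofReal_mul, add_sub_assoc, Complex.add_re,
      Complex.re_ofReal_mul, h2, re_kk_sub_kk, nonlin, abs_mul, abs_mul,
      abs_of_pos (inv_pos.2 hs), abs_of_pos hn]
    field_simp

theorem re_spread_lead (lam : ℝ) {t : ℝ} (ht : 0 < t) (φ₀ φ₁ : 𝓢'(Plane, ℂ)) (x : Plane) :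
    (spread t (fun μ ↦ lead lam t (amp φ₀ φ₁ μ) ‖amp φ₀ φ₁ μ‖ (bracket μ)) x).re =
      nonlin lam (uap lam φ₀ φ₁ t x) := by
  by_cases hx : x ∈ Metric.ball (0 : Plane) t
  · rw [uap_eq, spread, spread, Set.indicator_of_mem hx, Set.indicator_of_mem hx, re_lead lam ht,
      Complex.re_ofReal_mul]
  · rw [uap_eq, spread, spread, Set.indicator_of_notMem hx, Set.indicator_of_notMem hx]
    simp [nonlin]

theorem abs_nonlin_sub_le (lam u v : ℝ) :
    |nonlin lam u - nonlin lam (u + v)| ≤ |lam| * ( |v| * (2 * |u| + |v|)) := by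
  have e : nonlin lam u - nonlin lam (u + v) =
      lam * (( |u| - |u + v|) * u - |u + v| * v) := by rw [nonlin, nonlin]; ring
  have h1 : |( |u| - |u + v|)| ≤ |v| := by
    have := abs_abs_sub_abs_le_abs_sub u (u + v)
    rwa [sub_add_cancel_left, abs_neg] at this
  have h2 : |u + v| ≤ |u| + |v| := abs_add_le u v
  rw [e, abs_mul]
  refine mul_le_mul_of_nonneg_left ?_ (abs_nonneg lam)
  refine (abs_sub _ _).trans ?_
  rw [abs_mul, abs_mul, abs_abs]
  have h3 := mul_le_mul_of_nonneg_right h1 (abs_nonneg u)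
  have h4 := mul_le_mul_of_nonneg_right h2 (abs_nonneg v)
  linarith

/-! ### Bounds for the approximate solution -/

section

variable {lam S t : ℝ} {φ₀ φ₁ : 𝓢'(Plane, ℂ)}

theorem isAmplitude_amp (hm : AEStronglyMeasurable (amp φ₀ φ₁) volume) (hS : 0 ≤ S)
    (h : ∀ᵐ μ, ‖amp φ₀ φ₁ μ‖ ≤ S) : IsAmplitude (amp φ₀ φ₁) (fun μ ↦ ‖amp φ₀ φ₁ μ‖) S where
  nonneg := hS
  meas := hm.aemeasurable
  meas_modulus := hm.aemeasurable.norm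
  norm_le _ := le_rfl
  le := h

theorem aemeasurable_uap (lam : ℝ) (ht : 0 < t) (h : IsAmplitude (amp φ₀ φ₁) (fun μ ↦ ‖amp φ₀ φ₁ μ‖) S) :
    AEMeasurable (uap lam φ₀ φ₁ t) volume := by
  have e : uap lam φ₀ φ₁ t = fun x ↦ (spread t (fun μ ↦ ((t⁻¹ : ℝ) : ℂ) *
      (amp φ₀ φ₁ μ * osc lam t ‖amp φ₀ φ₁ μ‖ (bracket μ))) x).re := funext (uap_eq lam φ₀ φ₁ t)
  rw [e]
  exact Complex.measurable_re.comp_aemeasurable (aemeasurable_spread ht ((h.meas.mul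
    (aemeasurable_osc lam t h.meas_modulus contDiff_bracket.continuous.aemeasurable)).const_mul _))

theorem aemeasurable_approx (lam : ℝ) (ht : 0 < t)
    (h : IsAmplitude (amp φ₀ φ₁) (fun μ ↦ ‖amp φ₀ φ₁ μ‖) S) :
    AEMeasurable (approx lam φ₀ φ₁ t) volume := by
  rw [funext (approx_eq lam φ₀ φ₁ t)]
  exact Complex.measurable_re.comp_aemeasurable (aemeasurable_spread ht (h.aemeasurable lam t).1)

theorem abs_uap_le (lam : ℝ) (ht : 0 < t)
    (h : IsAmplitude (amp φ₀ φ₁) (fun μ ↦ ‖amp φ₀ φ₁ μ‖) S) :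
    ∀ᵐ x, |uap lam φ₀ φ₁ t x| ≤ t⁻¹ * S := by
  have hS := h.nonneg
  filter_upwards [norm_spread_le ht (B := t⁻¹ * S) (by positivity) (f := fun μ ↦ ((t⁻¹ : ℝ) : ℂ) *
      (amp φ₀ φ₁ μ * osc lam t ‖amp φ₀ φ₁ μ‖ (bracket μ))) (by
    filter_upwards [h.le] with μ hμ
    rw [norm_mul, norm_mul, norm_osc, mul_one, Complex.norm_real,
      Real.norm_of_nonneg (inv_pos.2 ht).le]
    exact mul_le_mul_of_nonneg_left hμ (inv_pos.2 ht).le)] with x hx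
  rw [uap_eq]
  exact (Complex.abs_re_le_norm _).trans hx

theorem abs_vap_le (lam : ℝ) (ht : 0 < t)
    (h : IsAmplitude (amp φ₀ φ₁) (fun μ ↦ ‖amp φ₀ φ₁ μ‖) S) :
    ∀ᵐ x, |vap lam φ₀ φ₁ t x| ≤ (t ^ 2)⁻¹ * ( |lam| * coeffSum * S ^ 2) := by
  have hS := h.nonneg
  have hc := coeffSum_nonneg
  filter_upwards [norm_spread_le ht (B := (t ^ 2)⁻¹ * ( |lam| * coeffSum * S ^ 2)) (by positivity)
      (f := fun μ ↦ ((lam * (t ^ 2)⁻¹ * ‖amp φ₀ φ₁ μ‖ ^ 2 : ℝ) : ℂ) *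
      kk 0 (amp φ₀ φ₁ μ * osc lam t ‖amp φ₀ φ₁ μ‖ (bracket μ) / ‖amp φ₀ φ₁ μ‖)) (by
    filter_upwards [h.le] with μ hμ
    have h1 := norm_har_le lam (j := 0) (by norm_num) t (bracket μ) (le_refl ‖amp φ₀ φ₁ μ‖)
    have h2 := pow_le_pow_left₀ (norm_nonneg _) hμ 2
    rw [har] at h1
    rw [norm_mul, Complex.norm_real, Real.norm_eq_abs, abs_mul, abs_mul,
      abs_of_pos (by positivity : 0 < (t ^ 2)⁻¹), abs_of_nonneg (sq_nonneg ‖amp φ₀ φ₁ μ‖)]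
    calc |lam| * (t ^ 2)⁻¹ * ‖amp φ₀ φ₁ μ‖ ^ 2 * _
        ≤ |lam| * (t ^ 2)⁻¹ * S ^ 2 * coeffSum := by gcongr
      _ = _ := by ring)] with x hx
  rw [vap_eq]
  exact (Complex.abs_re_le_norm _).trans hx

theorem abs_approx_le (lam : ℝ) (ht : 1 ≤ t)
    (h : IsAmplitude (amp φ₀ φ₁) (fun μ ↦ ‖amp φ₀ φ₁ μ‖) S) :
    ∀ᵐ x, |approx lam φ₀ φ₁ t x| ≤ t⁻¹ * (S + |lam| * coeffSum * S ^ 2) := by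
  have ht0 : 0 < t := by linarith
  have hc := coeffSum_nonneg
  have hle : (t ^ 2)⁻¹ ≤ t⁻¹ := inv_anti₀ ht0 (le_self_pow₀ ht (by norm_num))
  filter_upwards [abs_uap_le lam ht0 h, abs_vap_le lam ht0 h] with x h1 h2
  have h3 : (t ^ 2)⁻¹ * ( |lam| * coeffSum * S ^ 2) ≤ t⁻¹ * ( |lam| * coeffSum * S ^ 2) := by
    gcongr
  rw [approx, mul_add]
  exact (abs_add_le _ _).trans (by linarith)

/-- The difference is at most `|λ||v|(2|u| + |v|)` with `u = O(t⁻¹)`, `v = O(t⁻²)`, hence `O(t⁻³)`.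
It vanishes outside the disc of area `πt² ≤ (2t)²`, so taking the `L²` norm costs one factor `2t`.
-/
theorem l2Bd_nonlin_sub (ht : 1 ≤ t)
    (h : IsAmplitude (amp φ₀ φ₁) (fun μ ↦ ‖amp φ₀ φ₁ μ‖) S) :
    L2Bd (fun x ↦ nonlin lam (uap lam φ₀ φ₁ t x) - nonlin lam (approx lam φ₀ φ₁ t x))
      ((t ^ 2)⁻¹ * (2 * (|lam| ^ 2 * coeffSum) * S ^ 3 * (2 + |lam| * coeffSum * S))) := by
  have ht0 : 0 < t := by linarith
  have hS := h.nonneg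
  have hc := coeffSum_nonneg
  set κ := |lam| * coeffSum with hκ
  have hκ0 : 0 ≤ κ := by positivity
  set c := |lam| * ((t ^ 2)⁻¹ * (κ * S ^ 2) * (2 * (t⁻¹ * S) + t⁻¹ * (κ * S ^ 2))) with hcdef
  have hc0 : 0 ≤ c := by positivity
  have hvol : volume (Metric.ball (0 : Plane) t) ≤ ENNReal.ofReal ((2 * t) ^ 2) := by
    rw [EuclideanSpace.volume_ball_fin_two, ← ENNReal.ofReal_pow ht0.le,
      ← ENNReal.ofReal_mul (by positivity)]
    exact ENNReal.ofReal_le_ofReal (by nlinarith [Real.pi_lt_four, sq_nonneg t])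
  have hb := l2Bd_indicator_const measurableSet_ball (by positivity) hvol hc0
  rw [Real.sqrt_sq (by linarith)] at hb
  have hmeas : Measurable (nonlin lam) := by unfold nonlin; fun_prop
  refine (hb.mono_ae (f := fun x ↦ nonlin lam (uap lam φ₀ φ₁ t x) -
    nonlin lam (approx lam φ₀ φ₁ t x)) ?_ ?_).le (le_of_eq ?_)
  · exact ((hmeas.comp_aemeasurable (aemeasurable_uap lam ht0 h)).sub
      (hmeas.comp_aemeasurable (aemeasurable_approx lam ht0 h))).aestronglyMeasurable
  · have hle : (t ^ 2)⁻¹ ≤ t⁻¹ := inv_anti₀ ht0 (le_self_pow₀ ht (by norm_num))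
    filter_upwards [abs_uap_le lam ht0 h, abs_vap_le lam ht0 h] with x h1 h2
    by_cases hx : x ∈ Metric.ball (0 : Plane) t
    · rw [Set.indicator_of_mem hx, Real.norm_of_nonneg hc0, Real.norm_eq_abs, approx]
      refine (abs_nonlin_sub_le lam _ _).trans ?_
      have h3 : |vap lam φ₀ φ₁ t x| ≤ t⁻¹ * (κ * S ^ 2) :=
        h2.trans (mul_le_mul_of_nonneg_right hle (by positivity))
      rw [hcdef]
      gcongr
    · rw [Set.indicator_of_notMem hx, approx, uap, vap, Set.indicator_of_notMem hx,
        Set.indicator_of_notMem hx, add_zero, sub_self]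
  · rw [hcdef, hκ]
    field_simp

/-! ### The equation -/

/-- Taking real parts in the complex weak formulation: the error density `g` plus the resonant part,
which is `N(u_ap)`, is the value of the Klein-Gordon operator on `A`. -/
theorem isKleinGordonAt_approx (ht : 1 < t)
    (h : IsAmplitude (amp φ₀ φ₁) (fun μ ↦ ‖amp φ₀ φ₁ μ‖) S) {g : Plane → ℝ}
    (hg : MemLp g 2 volume)
    (hgψ : ∀ ψ : Plane → ℝ, ContDiff ℝ ∞ ψ → HasCompactSupport ψ →
      (weakBox lam (amp φ₀ φ₁) (fun μ ↦ ‖amp φ₀ φ₁ μ‖) ψ t - ∫ x, ψ x •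
        spread t (fun μ ↦ lead lam t (amp φ₀ φ₁ μ) ‖amp φ₀ φ₁ μ‖ (bracket μ)) x).re =
        ∫ x, g x * ψ x) :
    IsKleinGordonAt (approx lam φ₀ φ₁) t fun x ↦ g x + nonlin lam (uap lam φ₀ φ₁ t x) := by
  have ht0 : 0 < t := by linarith
  obtain ⟨B, -, hB⟩ := exists_app_bound lam h.nonneg
  have happ : ∀ s, 1 < s → AEMeasurable (app lam (amp φ₀ φ₁) (fun μ ↦ ‖amp φ₀ φ₁ μ‖) s) volume :=
    fun s hs ↦ aemeasurable_spread (by linarith) (h.aemeasurable lam s).1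
  have hlead := aemeasurable_spread ht0 (h.aemeasurable lam t).2
  have hre : ∀ s, 1 < s → ∀ ψ : Plane → ℝ, Continuous ψ → HasCompactSupport ψ →
      ∫ x, approx lam φ₀ φ₁ s x * ψ x =
        (∫ x, ψ x • app lam (amp φ₀ φ₁) (fun μ ↦ ‖amp φ₀ φ₁ μ‖) s x).re := fun s hs ψ hψ hsψ ↦ by
    have i := integrable_smul_of_bound (happ s hs) (hB h hs.le).1 hψ hsψ
    refine Eq.trans (integral_congr_ae (ae_of_all _ fun x ↦ ?_)) (integral_re i)
    simp only [approx_eq, RCLike.re_to_complex, Complex.smul_re, smul_eq_mul, mul_comm]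
  have hev : ∀ᶠ s in 𝓝 t, 1 < s := eventually_gt_nhds ht
  have hN : MemLp (fun x ↦ nonlin lam (uap lam φ₀ φ₁ t x)) ⊤ volume := by
    refine memLp_top_of_bound (C := B) ?_ ?_
    · simp only [← re_spread_lead lam ht0]
      exact (Complex.measurable_re.comp_aemeasurable hlead).aestronglyMeasurable
    · filter_upwards [(hB h ht.le).2] with x hx
      rw [← re_spread_lead lam ht0]
      exact (Complex.abs_re_le_norm _).trans hx
  refine ⟨?_, (hg.locallyIntegrable (by norm_num)).add (hN.locallyIntegrable le_top),
    fun ψ hψ hsψ ↦ ?_⟩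
  · filter_upwards [hev] with s hs
    refine (memLp_top_of_bound (C := B)
      (aemeasurable_approx lam (by linarith) h).aestronglyMeasurable ?_).locallyIntegrable le_top
    filter_upwards [(hB h hs.le).1] with x hx
    rw [approx_eq]
    exact (Complex.abs_re_le_norm _).trans hx
  · obtain ⟨D, hD⟩ := hasDerivAt_pairing lam h hψ hsψ
    have dre : ∀ {f : ℝ → ℂ} {f' : ℂ} {s : ℝ}, HasDerivAt f f' s →
        HasDerivAt (fun s ↦ (f s).re) f'.re s := fun hf ↦ by
      have := Complex.reCLM.hasFDerivAt.comp_hasDerivAt _ hf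
      exact this
    refine ⟨fun s ↦ (D s).re, _, ?_, dre (hD t ht).2, ?_⟩
    · filter_upwards [hev] with s hs
      refine (dre (hD s hs).1).congr_of_eventuallyEq ?_
      filter_upwards [eventually_gt_nhds hs] with τ hτ
      exact hre τ hτ ψ hψ.continuous hsψ
    · have hlapl : Continuous (Δ ψ) := by
        rw [← lapl_eq_laplacian]; exact continuous_lapl hψ
      have hsl : HasCompactSupport (Δ ψ) := by
        rw [← lapl_eq_laplacian]; exact hasCompactSupport_lapl hsψ
      have i1 : Integrable fun x ↦ g x * ψ x :=
        (hg.locallyIntegrable (by norm_num)).integrable_smul_right_of_hasCompactSupport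
          hψ.continuous hsψ
      have i2 : Integrable fun x ↦ nonlin lam (uap lam φ₀ φ₁ t x) * ψ x :=
        (hN.locallyIntegrable le_top).integrable_smul_right_of_hasCompactSupport hψ.continuous hsψ
      have hNψ : ∫ x, nonlin lam (uap lam φ₀ φ₁ t x) * ψ x = (∫ x, ψ x •
          spread t (fun μ ↦ lead lam t (amp φ₀ φ₁ μ) ‖amp φ₀ φ₁ μ‖ (bracket μ)) x).re := by
        have i := integrable_smul_of_bound hlead (hB h ht.le).2 hψ.continuous hsψ
        refine Eq.trans (integral_congr_ae (ae_of_all _ fun x ↦ ?_)) (integral_re i)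
        simp only [← re_spread_lead lam ht0, RCLike.re_to_complex, Complex.smul_re, smul_eq_mul,
          mul_comm]
      have e := hgψ ψ hψ hsψ
      rw [Complex.sub_re, ← hNψ, weakBox, Complex.add_re, Complex.sub_re,
        ← hre t ht ψ hψ.continuous hsψ, lapl_eq_laplacian, ← hre t ht _ hlapl hsl] at e
      simp only [add_mul]
      rw [integral_add i1 i2, ← e]
      ring

end

/-! ### The constants -/

/-- Here `κY` is the sup bound on the amplitude. Both error terms have a factor `Y`; what is left
grows at most like `(1 + Y)³` in the first and `Y²(1 + Y)` in the second, which gives the power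
`Y³`. -/
theorem exists_final_const (lam : ℝ) {κ : ℝ} (hκ : 0 ≤ κ) : ∃ C : ℝ, 0 < C ∧ ∀ Y : ℝ, 0 ≤ Y →
    κ * Y + |lam| * coeffSum * (κ * Y) ^ 2 ≤ C * Y * (1 + Y) ∧
    errConst lam * ((2 + κ * Y) ^ 3 * (4 * (κ * Y))) + 2 * (|lam| ^ 2 * coeffSum) * (κ * Y) ^ 3 *
      (2 + |lam| * coeffSum * (κ * Y)) ≤ C * Y * (1 + Y ^ 3) := by
  have hc := coeffSum_nonneg
  have he := errConst_nonneg lam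
  set a := |lam| * coeffSum with ha
  have ha0 : 0 ≤ a := by positivity
  set b := 2 * (|lam| ^ 2 * coeffSum) with hb
  have hb0 : 0 ≤ b := by positivity
  set E := errConst lam
  refine ⟨1 + κ + a * κ ^ 2 + E * ((2 + κ) ^ 3 * (16 * κ)) + b * κ ^ 3 * (2 + a * κ) * 2,
    by positivity, fun Y hY ↦ ⟨?_, ?_⟩⟩
  · have h1 : κ * Y + a * (κ * Y) ^ 2 ≤ (κ + a * κ ^ 2) * Y * (1 + Y) := by
      have : 0 ≤ κ * Y ^ 2 + a * κ ^ 2 * Y := by positivity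
      linarith
    refine h1.trans ?_
    rw [mul_assoc, mul_assoc _ Y]
    refine mul_le_mul_of_nonneg_right ?_ (by positivity)
    have : 0 ≤ E * ((2 + κ) ^ 3 * (16 * κ)) + b * κ ^ 3 * (2 + a * κ) * 2 := by positivity
    linarith
  -- Both inequalities follow from `(1 + Y)(1 - Y)² ≥ 0`.
  · have h3 : (1 + Y) ^ 3 ≤ 4 * (1 + Y ^ 3) := by
      nlinarith [mul_nonneg (by linarith : 0 ≤ 1 + Y) (sq_nonneg (1 - Y))]
    have h2 : Y ^ 2 * (1 + Y) ≤ 2 * (1 + Y ^ 3) := by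
      nlinarith [mul_nonneg (by linarith : 0 ≤ 1 + Y) (sq_nonneg (1 - Y))]
    have h4 : (2 + κ * Y) ^ 3 ≤ (2 + κ) ^ 3 * (4 * (1 + Y ^ 3)) := by
      refine le_trans ?_ (mul_le_mul_of_nonneg_left h3 (by positivity))
      rw [← mul_pow]
      exact pow_le_pow_left₀ (by positivity) (by nlinarith) 3
    have h5 : E * ((2 + κ * Y) ^ 3 * (4 * (κ * Y))) ≤
        E * ((2 + κ) ^ 3 * (4 * (1 + Y ^ 3)) * (4 * (κ * Y))) := by gcongr
    have h6 : b * (κ * Y) ^ 3 * (2 + a * (κ * Y)) ≤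
        b * κ ^ 3 * (2 + a * κ) * Y * (2 * (1 + Y ^ 3)) := by
      have : 2 + a * (κ * Y) ≤ (2 + a * κ) * (1 + Y) := by
        have : 0 ≤ 2 * Y + a * κ := by positivity
        linarith
      calc b * (κ * Y) ^ 3 * (2 + a * (κ * Y)) ≤ b * (κ * Y) ^ 3 * ((2 + a * κ) * (1 + Y)) := by
            gcongr
        _ = b * κ ^ 3 * (2 + a * κ) * Y * (Y ^ 2 * (1 + Y)) := by ring
        _ ≤ _ := mul_le_mul_of_nonneg_left h2 (by positivity)
    have h7 : 0 ≤ (1 + κ + a * κ ^ 2) * Y * (1 + Y ^ 3) := by positivity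
    linarith

end NLKG

end

theorem proposition4p1 (lam : ℝ) (hlam : lam ≠ 0) :
    ∃ C : ℝ, 0 < C ∧ ∀ φ₀ φ₁ : 𝓢'(NLKG.Plane, ℂ), NLKG.MemY φ₀ φ₁ →
      ∀ t : ℝ, Real.exp 1 ≤ t →
        (MemLp (NLKG.approx lam φ₀ φ₁ t) ⊤ volume ∧
          eLpNorm (NLKG.approx lam φ₀ φ₁ t) ⊤ volume ≤
            ENNReal.ofReal (C * t⁻¹ * (NLKG.normY φ₀ φ₁).toReal *
              (1 + (NLKG.normY φ₀ φ₁).toReal))) ∧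
        ∃ G : NLKG.Plane → ℝ, NLKG.IsKleinGordonAt (NLKG.approx lam φ₀ φ₁) t G ∧
          MemLp (fun x ↦ G x - NLKG.nonlin lam (NLKG.approx lam φ₀ φ₁ t x)) 2 volume ∧
          eLpNorm (fun x ↦ G x - NLKG.nonlin lam (NLKG.approx lam φ₀ φ₁ t x)) 2 volume ≤
            ENNReal.ofReal (C * (t ^ 2)⁻¹ * Real.log t ^ 2 * (NLKG.normY φ₀ φ₁).toReal *
              (1 + (NLKG.normY φ₀ φ₁).toReal ^ 3)) := by
  obtain ⟨c, hc, happrox⟩ := NLKG.exists_amp_approx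
  obtain ⟨k, hk, hbounds⟩ := NLKG.WBd.exists_bounds
  obtain ⟨C, hC, hconst⟩ := NLKG.exists_final_const lam (κ := k * c) (by positivity)
  refine ⟨C, hC, fun φ₀ φ₁ hY t ht ↦ ?_⟩
  obtain ⟨hm, F, hF, hs, hW, hlim⟩ := happrox φ₀ φ₁ hY
  set Y := (NLKG.normY φ₀ φ₁).toReal
  have hY0 : 0 ≤ Y := ENNReal.toReal_nonneg
  have hM : 0 ≤ c * Y := mul_nonneg hc hY0
  have hb := fun n ↦ hbounds (F n) (c * Y) (hF n) (hs n) (hW n)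
  obtain ⟨hC1, hC2⟩ := hconst Y hY0
  -- The approximations satisfy the sup bound everywhere, uniformly; it passes to the amplitude at
  -- almost every point.
  have hamp : NLKG.IsAmplitude (NLKG.amp φ₀ φ₁) (fun μ ↦ ‖NLKG.amp φ₀ φ₁ μ‖) (k * (c * Y)) := by
    refine NLKG.isAmplitude_amp hm (by positivity) ?_
    filter_upwards [hlim] with μ hμ
    exact le_of_tendsto' hμ.norm fun n ↦ (hb n).1 μ
  have ht1 : 1 < t := by linarith [Real.add_one_le_exp (1 : ℝ)]
  have ht0 : 0 < t := by linarith
  rw [mul_assoc k] at hC1 hC2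
  have hA := NLKG.abs_approx_le lam ht1.le hamp
  have hAm := (NLKG.aemeasurable_approx lam ht0 hamp).aestronglyMeasurable
  refine ⟨⟨memLp_top_of_bound hAm _ hA, (eLpNormEssSup_le_of_ae_bound hA).trans
    (ENNReal.ofReal_le_ofReal ?_)⟩, ?_⟩
  · refine (mul_le_mul_of_nonneg_left hC1 (inv_pos.2 ht0).le).trans_eq ?_
    ring
  · obtain ⟨g, hg, hgψ⟩ := NLKG.exists_error_density lam hk hM hF hs hW (fun n ↦ (hb n).1)
      (fun n ↦ (hb n).2.1) (fun n ↦ (hb n).2.2) hlim ht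
    have hsum := hg.add (NLKG.l2Bd_nonlin_sub (lam := lam) ht1.le hamp)
    simp only [← add_sub_assoc] at hsum
    refine ⟨_, NLKG.isKleinGordonAt_approx ht1 hamp hg.memLp hgψ, hsum.memLp,
      hsum.2.2.trans (ENNReal.ofReal_le_ofReal ?_)⟩
    -- The contribution of the nonlinearity has no logarithm; for `t ≥ e` it is absorbed into the
    -- term with `(log t)²`.
    have hlog : 1 ≤ Real.log t ^ 2 :=
      one_le_pow₀ ((Real.le_log_iff_exp_le ht0).2 ht)
    have hcs := NLKG.coeffSum_nonneg
    set b := 2 * (|lam| ^ 2 * NLKG.coeffSum) * (k * (c * Y)) ^ 3 *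
      (2 + |lam| * NLKG.coeffSum * (k * (c * Y)))
    have hb0 : 0 ≤ b := by positivity
    have h1 : (t ^ 2)⁻¹ * b ≤ Real.log t ^ 2 * (t ^ 2)⁻¹ * b := by
      rw [mul_assoc]
      exact le_mul_of_one_le_left (by positivity) hlog
    have h2 := mul_le_mul_of_nonneg_left hC2
      (by positivity : 0 ≤ Real.log t ^ 2 * (t ^ 2)⁻¹)
    linarith
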